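/- **Setting.** Let $\hat f(\xi,\mu,\tau)=\int_{\mathbb R^3}e^{-i(x\xi+y\mu+t\tau)}f(x,y,t)\,dx\,dy\,dt$, and let $\omega(\xi,\mu)=\xi^3+\mu^2/\xi$ be the dispersion relation of the KP-I equation. Functions are complex valued. Fix an even smooth $\eta_0:\mathbb R\to[0,1]$ supported in $[-8/5,8/5]$ and equal to $1$ on $[-5/4,5/4]$, and put $\eta_j(r)=\eta_0(r/2^j)-\eta_0(r/2^{j-1})$ for $j\ge1$. For $k\ge1$ let $I_k=\{\xi:\tfrac34 2^k\le|\xi|<\tfrac32 2^k\}$ and $\tilde I_k=\{\xi:2^{k-1}\le|\xi|\le2^{k+1}\}$. For $k=0$ let $I_0=\{|\xi|<\tfrac32\}$ and $\tilde I_0=\{|\xi|\le2\}$. For $k\ge0$ let $P_k$ be the Fourier multiplier in $x$ with symbol $1_{I_k}(\xi)$. For $g$ on $\mathbb R^3$ let $$\|g\|_{X}=\sum_{j\ge0}2^{j/2}\|\eta_j(\tau-\omega(\xi,\mu))\,g(\xi,\mu,\tau)\|_{L^2_{\xi,\mu,\tau}} .$$ For $f\in L^2(\mathbb R^3)$ with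 $\hat f$ supported in $\tilde I_k\times\mathbb R^2$ let $$\|f\|_{F_k}=\sup_{t_0\in\mathbb R}\big\|\widehat{f\,\eta_0(2^k(t-t_0))}\big\|_{X},\qquad \|f\|_{N_k}=\sup_{t_0\in\mathbb R}\big\|(\tau-\omega(\xi,\mu)+i2^k)^{-1}\,\widehat{f\,\eta_0(2^k(t-t_0))}\big\|_{X}.$$ For $T\in(0,1]$ let $\|P_kw\|_{F_k(T)}$, respectively $\|P_kw\|_{N_k(T)}$, be the infimum of $\|f\|_{F_k}$, respectively $\|f\|_{N_k}$, over all such $f$ with $f=P_kw$ on $\mathbb R^2\times[-T,T]$ (and $\infty$ if there is none). For $s\ge0$ let $$\|u\|_{F^s(T)}^2=\sum_{k\ge0}2^{2sk}\|P_ku\|_{F_k(T)}^2,\qquad \|w\|_{N^s(T)}^2=\sum_{k\ge0}2^{2sk}\|P_kw\|_{N_k(T)}^2,$$ and let $F^s(T)$ be the space of $u\in C([-T,T];L^2(\mathbb R^2))$ with $\|u\|_{F^s(T)}<\infty$. For $u,v\in C([-T,T];L^2(\mathbb R^2))$ the product $uv(t)\in L^1(\mathbb R^2)$ is taken pointwise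 at each time $t$, and $\partial_x(uv)(t)$ is its distributional derivative. **Proposition.** (a) For every $s\ge1$ there is a constant $C>0$ (depending only on $s$ and $\eta_0$) such that for all $T\in(0,1]$ and all $u,v\in F^s(T)$, $$\|\partial_x(uv)\|_{N^s(T)}\le C\big(\|u\|_{F^s(T)}\|v\|_{F^1(T)}+\|u\|_{F^1(T)}\|v\|_{F^s(T)}\big).$$ (b) There is a constant $C>0$ (depending only on $\eta_0$) such that for all $T\in(0,1]$, $u\in F^0(T)$ and $v\in F^1(T)$, $$\|\partial_x(uv)\|_{N^0(T)}\le C\,\|u\|_{F^0(T)}\|v\|_{F^1(T)}.$$ -/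

import Mathlib

open MeasureTheory Set
open scoped ENNReal ContDiff SchwartzMap FourierTransform LineDeriv

noncomputable section

namespace KPI

/-! ### Physical space and Lebesgue spaces -/

/-- The plane, with coordinates `x = p 0`, `y = p 1` (frequencies `ξ = p 0`, `μ = p 1`). -/
abbrev Plane := EuclideanSpace ℝ (Fin 2)

/-- Space-time, with coordinates `x, y, t` (frequencies `ξ, μ, τ`). -/
abbrev SpaceTime := EuclideanSpace ℝ (Fin 3)

/-- `L²(ℝ²)`, complex valued. -/
abbrev L2Plane := Lp ℂ 2 (volume : Measure Plane)

/-- `L²(ℝ³)`, complex valued. -/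
abbrev L2SpaceTime := Lp ℂ 2 (volume : Measure SpaceTime)

/-! ### The smooth cutoff and the dyadic decomposition -/

/-- An even smooth function `η₀ : ℝ → [0, 1]`, supported in `[-8/5, 8/5]` and equal to `1` on
`[-5/4, 5/4]`. -/
structure Cutoff where
  toFun : ℝ → ℝ
  smooth : ContDiff ℝ ∞ toFun
  even : ∀ x, toFun (-x) = toFun x
  mem_Icc : ∀ x, toFun x ∈ Icc (0 : ℝ) 1
  support_subset : Function.support toFun ⊆ Icc (-(8 / 5)) (8 / 5)
  eq_one : ∀ x ∈ Icc (-(5 / 4) : ℝ) (5 / 4), toFun x = 1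

/-- The inhomogeneous dyadic functions: `η_0`, and `η_j(r) = η₀(r / 2^j) - η₀(r / 2^(j-1))` for
`j ≥ 1`. -/
def Cutoff.dyadic (η : Cutoff) (j : ℕ) (r : ℝ) : ℝ :=
  if j = 0 then η.toFun r
  else η.toFun (r / 2 ^ j) - η.toFun (r / 2 ^ ((j : ℤ) - 1))

/-- The sharp frequency sets: `{|ξ| < 3/2}` for `k = 0` (the symbol of `P_{≤ 0}`), and
`{(3/4) 2^k ≤ |ξ| < (3/2) 2^k}` for `k ≥ 1` (the symbol of `P_k`). -/
def freqSet (k : ℕ) : Set ℝ :=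
  if k = 0 then {ξ | |ξ| < 3 / 2}
  else {ξ | |ξ| ∈ Ico (3 / 4 * 2 ^ k : ℝ) (3 / 2 * 2 ^ k)}

/-- The enlarged frequency sets: `{|ξ| ≤ 2}` for `k = 0`, and `{2^(k-1) ≤ |ξ| ≤ 2^(k+1)}` for
`k ≥ 1`. -/
def wideFreqSet (k : ℕ) : Set ℝ :=
  if k = 0 then {ξ | |ξ| ≤ 2}
  else {ξ | |ξ| ∈ Icc (2 ^ ((k : ℤ) - 1) : ℝ) (2 ^ ((k : ℤ) + 1))}

/-- The dispersion relation of KP-I (the value at `ξ = 0`, a null set, is irrelevant). -/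
def omega (ξ μ : ℝ) : ℝ := ξ ^ 3 + μ ^ 2 / ξ

/-! ### The spaces `X_k`, `F_k`, `N_k` -/

/-- The space-time Fourier transform with the normalization
`f̂(ξ, μ, τ) = ∫ e^{-i x ξ} e^{-i y μ} e^{-i t τ} f(x, y, t) dx dy dt`, on `L²(ℝ³)`. Mathlib's `𝓕`
has the phase `e^{-2 π i ⟨x, ζ⟩}`, hence the dilation. -/
def fourierST (f : L2SpaceTime) (ζ : SpaceTime) : ℂ :=
  (𝓕 f : L2SpaceTime) ((2 * Real.pi)⁻¹ • ζ)

/-- The modulation `τ - ω(ξ, μ)`. -/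
def modulation (ζ : SpaceTime) : ℝ := ζ 2 - omega (ζ 0) (ζ 1)

/-- The norm of `X_k`: `∑_{j ≥ 0} 2^{j/2} ‖η_j(τ - ω(ξ, μ)) g(ξ, μ, τ)‖_{L²}`. (The formula does
not depend on `k`, which only enters through the support condition.) -/
def xNorm (η : Cutoff) (g : SpaceTime → ℂ) : ℝ≥0∞ :=
  ∑' j : ℕ, ENNReal.ofReal ((2 : ℝ) ^ ((j : ℝ) / 2)) *
    eLpNorm (fun ζ => (η.dyadic j (modulation ζ) : ℂ) * g ζ) 2 volume

/-- Multiplication of an `L²(ℝ³)` function by a time cutoff stays in `L²(ℝ³)`. -/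
theorem memLp_timeCut (η : Cutoff) (k : ℕ) (t₀ : ℝ) (f : L2SpaceTime) :
    MemLp (fun z : SpaceTime => (η.toFun (2 ^ k * (z 2 - t₀)) : ℂ) * f z) 2 volume := by
  have hc : Continuous fun z : SpaceTime => (η.toFun (2 ^ k * (z 2 - t₀)) : ℂ) := by
    have := η.smooth.continuous
    fun_prop
  refine MemLp.of_le (Lp.memLp f) (hc.aestronglyMeasurable.mul (Lp.aestronglyMeasurable f)) ?_
  refine Filter.Eventually.of_forall fun z => ?_
  have h := η.mem_Icc (2 ^ k * (z 2 - t₀))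
  rw [norm_mul, Complex.norm_real, Real.norm_eq_abs, abs_of_nonneg h.1]
  exact mul_le_of_le_one_left (norm_nonneg _) h.2

/-- The localization `f · η₀(2^k (t - t₀))` in time. -/
def timeCut (η : Cutoff) (k : ℕ) (t₀ : ℝ) (f : L2SpaceTime) : L2SpaceTime :=
  (memLp_timeCut η k t₀ f).toLp _

/-- `f̂` is supported in `{ξ ∈ wideFreqSet k}`. -/
def FreqSupported (k : ℕ) (f : L2SpaceTime) : Prop :=
  ∀ᵐ ζ : SpaceTime, ζ 0 ∉ wideFreqSet k → fourierST f ζ = 0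

/-- The norm of `F_k`; the space `F_k` consists of the `f ∈ L²(ℝ³)` with `FreqSupported k f` and
`fkNorm η k f < ∞`. (Multiplication by functions of time does not change the support in `ξ`.) -/
def fkNorm (η : Cutoff) (k : ℕ) (f : L2SpaceTime) : ℝ≥0∞ :=
  ⨆ t₀ : ℝ, xNorm η (fourierST (timeCut η k t₀ f))

/-- The norm of `N_k`; the space `N_k` consists of the `f ∈ L²(ℝ³)` with `FreqSupported k f` and
`nkNorm η k f < ∞`. -/
def nkNorm (η : Cutoff) (k : ℕ) (f : L2SpaceTime) : ℝ≥0∞ :=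
  ⨆ t₀ : ℝ, xNorm η fun ζ =>
    ((modulation ζ : ℂ) + Complex.I * 2 ^ k)⁻¹ * fourierST (timeCut η k t₀ f) ζ

/-! ### Frequency projections and extensions -/

/-- `h ∈ L²(ℝ²)` is the Littlewood-Paley piece of the tempered distribution `w` on the plane with
symbol `1_{freqSet k}(ξ)`: the Fourier transform of `w` is a locally integrable function `g`, and
`ĥ(ξ, μ) = 1_{freqSet k}(ξ) g(ξ, μ)`. Here `q` is the frequency variable of Mathlib's transform,
so that `(ξ, μ) = 2 π q`. -/
def IsPiece (k : ℕ) (w : 𝓢'(Plane, ℂ)) (h : L2Plane) : Prop :=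
  ∃ g : Plane → ℂ, LocallyIntegrable g volume ∧
    (∀ φ : 𝓢(Plane, ℂ), Integrable (fun q => φ q * g q) volume ∧
      (𝓕 w) φ = ∫ q, φ q * g q) ∧
    ∀ᵐ q : Plane, (𝓕 h : L2Plane) q =
      indicator {q : Plane | 2 * Real.pi * q 0 ∈ freqSet k} g q

/-- `f ∈ L²(ℝ³)` coincides on `ℝ² × [-T, T]` with the `k`-th Littlewood-Paley piece of the
time-dependent tempered distribution `w`. -/
def ExtendsPiece (T : ℝ) (k : ℕ) (w : ℝ → 𝓢'(Plane, ℂ)) (f : L2SpaceTime) : Prop :=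
  ∀ᵐ t ∂(volume.restrict (Icc (-T) T)), ∃ h : L2Plane,
    (∀ᵐ p : Plane, h p = f !₂[p 0, p 1, t]) ∧ IsPiece k (w t) h

/-! ### The norms of `F_k(T)`, `N_k(T)`, `F^s(T)`, `N^s(T)` -/

/-- `‖P_k w‖_{F_k(T)}` (`‖P_{≤ 0} w‖_{F_0(T)}` if `k = 0`): the infimum of `‖f‖_{F_k}` over the
extensions `f` of `P_k w`; it is `∞` if there is none. -/
def fkTNorm (η : Cutoff) (T : ℝ) (k : ℕ) (w : ℝ → 𝓢'(Plane, ℂ)) : ℝ≥0∞ :=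
  ⨅ (f : L2SpaceTime) (_ : FreqSupported k f) (_ : ExtendsPiece T k w f), fkNorm η k f

/-- `‖P_k w‖_{N_k(T)}` (`‖P_{≤ 0} w‖_{N_0(T)}` if `k = 0`): the infimum of `‖f‖_{N_k}` over the
extensions `f` of `P_k w`; it is `∞` if there is none. -/
def nkTNorm (η : Cutoff) (T : ℝ) (k : ℕ) (w : ℝ → 𝓢'(Plane, ℂ)) : ℝ≥0∞ :=
  ⨅ (f : L2SpaceTime) (_ : FreqSupported k f) (_ : ExtendsPiece T k w f), nkNorm η k f

/-- The norm of `N^s(T)`: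
`(∑_{k ≥ 1} 2^{2sk} ‖P_k w‖²_{N_k(T)} + ‖P_{≤ 0} w‖²_{N_0(T)})^{1/2}`; the last summand is the
term `k = 0` of the series below. -/
def nNorm (η : Cutoff) (s T : ℝ) (w : ℝ → 𝓢'(Plane, ℂ)) : ℝ≥0∞ :=
  (∑' k : ℕ, ENNReal.ofReal ((2 : ℝ) ^ (2 * s * k)) * nkTNorm η T k w ^ 2) ^ (1 / 2 : ℝ)

/-- The norm of `F^s(T)`:
`(∑_{k ≥ 1} 2^{2sk} ‖P_k u‖²_{F_k(T)} + ‖P_{≤ 0} u‖²_{F_0(T)})^{1/2}`. -/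
def fNorm (η : Cutoff) (s T : ℝ) (u : ℝ → L2Plane) : ℝ≥0∞ :=
  (∑' k : ℕ, ENNReal.ofReal ((2 : ℝ) ^ (2 * s * k)) *
    fkTNorm η T k (fun t => (u t : 𝓢'(Plane, ℂ))) ^ 2) ^ (1 / 2 : ℝ)

/-- The space `F^s(T)`: the `u ∈ C([-T, T] : L²(ℝ²))` with finite norm. Only the values of `u`
on `[-T, T]` matter. -/
def FSpace (η : Cutoff) (s T : ℝ) : Set (ℝ → L2Plane) :=
  {u | ContinuousOn u (Icc (-T) T) ∧ fNorm η s T u < ⊤}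

/-- `∂_x (u v)`: at each time the product of the two `L²` functions is an `L¹` function, and the
derivative in the direction `x` is taken in the sense of distributions. -/
def dxMul (u v : ℝ → L2Plane) (t : ℝ) : 𝓢'(Plane, ℂ) :=
  ∂_{(EuclideanSpace.single 0 1 : Plane)}
    (((u t • v t : Lp ℂ 1 (volume : Measure Plane))) : 𝓢'(Plane, ℂ))

end KPI

end

open MeasureTheory Set
open scoped ENNReal ContDiff SchwartzMap FourierTransform LineDeriv

noncomputable section

namespace KPI

/-! The estimate is reduced to dyadic pieces. Choose nearly optimal extensions f_i of P_i u and g_j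
of P_j v, and estimate P_k ∂_x (f_i g_j) in N_k. The N_k norm sees time intervals of length 2^{-k},
the F_i and F_j norms see lengths 2^{-i} and 2^{-j}; everything is cut into intervals of length
about 2^{-l} with l = max i j + 2. Multiplication by a bump at that scale is a convolution in τ with
a kernel dominated by a Cauchy profile of width 2^l, so modulations below 2^l become
indistinguishable. The norm `yNorm l`, in which they form a single shell, is therefore controlled by
the F norm (`yNorm_timeMul_le`). Dually, the factor (τ - ω + i2^k)^{-1} turns the N_k norm into
`zNorm k`, with weight 2^{-1/2} per dyadic step of modulation (`xNorm_inv_modulation_le`). The price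
is that about 2^{l-k} short intervals meet one interval of length 2^{-k} (`exists_piece`).

What remains is an L² bound for convolutions of functions with prescribed modulations.
Cauchy-Schwarz reduces it to the measure of the set of ζ' for which ζ' and ζ - ζ' both have small
modulation. For fixed ξ, ξ' the sum of these modulations is a quadratic polynomial in μ'; let 2D be,
up to sign, its derivative. The resonance identity says ω(ζ) - ω(ζ') - ω(ζ-ζ') = ξ'(ξ-ξ')(3ξ -
D²/ξ). Either |D| ≥ |ξ| and the polynomial is steep, or the resonance function has size at least 2|ξ
ξ'(ξ-ξ')| and some modulation must pay for it. For a high frequency i ~ k and a low frequency j this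
yields the factor 2^{j/2-k} (`zNorm_conv_high_low_le`). For comparable inputs the measure is taken
with one input fixed, and the vertex bound for quadratic sublevel sets alone yields 2^{(k-l)/2}
(`zNorm_conv_low_le`).

Multiplying by 2^k for the derivative and by 2^{l-k} for the number of intervals gives the
interaction weights: 2^{j/2} for high-low interactions and 2^{(max i j + k)/2} for comparable
inputs. One derivative on one factor absorbs either weight with geometric room to spare, and Schur's
test sums the pieces. In part (b) the derivative is always on v. If v is the high factor, 2^{i/2} is
compared with 2^j where i < j and j ~ k, which still leaves decay in k - i.

It must also be shown that the sum of the pieces is an L²(ℝ³) extension of P_k ∂_x (uv). A cruder L²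
bound (`l2_mul_conv_le_yNorm`) gives absolute convergence for each fixed k. The Fourier identity
defining a piece descends to almost every fixed time (`IsDx.ae_slice`). At such a time the
Littlewood-Paley series of u and v converge in L², and the product is continuous from L² × L² to L¹
(`isPiece_dx_mul_tsum`). -/

/-! ### Coordinates -/

/-- The point of space-time with plane coordinates `p` and time coordinate `t`. -/
def stMk (z : Plane × ℝ) : SpaceTime := !₂[z.1 0, z.1 1, z.2]

@[simp] theorem stMk_zero (z : Plane × ℝ) : stMk z 0 = z.1 0 := rfl
@[simp] theorem stMk_one (z : Plane × ℝ) : stMk z 1 = z.1 1 := rfl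
@[simp] theorem stMk_two (z : Plane × ℝ) : stMk z 2 = z.2 := rfl

/-- Space-time as the product of the plane and the time axis. -/
def stEquiv : Plane × ℝ ≃ᵐ SpaceTime where
  toFun := stMk
  invFun ζ := (!₂[ζ 0, ζ 1], ζ 2)
  left_inv z := by
    refine Prod.ext ?_ rfl
    ext i; fin_cases i <;> rfl
  right_inv ζ := by
    ext i; fin_cases i <;> rfl
  measurable_toFun := by
    have : Continuous stMk := by
      unfold stMk
      refine (PiLp.continuous_toLp 2 _).comp (continuous_pi fun i => ?_)
      fin_cases i <;> simp <;> fun_prop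
    exact this.measurable
  measurable_invFun := by
    have : Continuous fun ζ : SpaceTime => ((!₂[ζ 0, ζ 1] : Plane), ζ 2) := by
      refine Continuous.prodMk ?_ (by fun_prop)
      refine (PiLp.continuous_toLp 2 _).comp (continuous_pi fun i => ?_)
      fin_cases i <;> simp <;> fun_prop
    exact this.measurable

theorem measurePreserving_stEquiv : MeasurePreserving stEquiv := by
  have h1 : MeasurePreserving (fun z : (Fin 2 → ℝ) × ℝ => z.swap) (volume.prod volume)
      (volume.prod volume) := Measure.measurePreserving_swap
  have h2 := (volume_preserving_piFinSuccAbove (fun _ : Fin 3 => ℝ) (Fin.last 2)).symm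
  have h3 := PiLp.volume_preserving_toLp (Fin 3)
  have h4 := ((EuclideanSpace.volume_preserving_symm_measurableEquiv_toLp (Fin 2)).prod
    (MeasurePreserving.id (volume : Measure ℝ)))
  have h5 := h3.comp (h2.comp (h1.comp h4))
  have e : (stEquiv : Plane × ℝ → SpaceTime) = WithLp.toLp 2 ∘
      (MeasurableEquiv.piFinSuccAbove (fun _ : Fin 3 => ℝ) (Fin.last 2)).symm ∘
      (fun z => z.swap) ∘ Prod.map (MeasurableEquiv.toLp 2 (Fin 2 → ℝ)).symm id := by
    funext z
    ext i
    fin_cases i <;> rfl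
  rw [e]
  exact h5

/-- The plane as a product of two lines. -/
def planeEquiv : ℝ × ℝ ≃ᵐ Plane where
  toFun z := !₂[z.1, z.2]
  invFun p := (p 0, p 1)
  left_inv z := rfl
  right_inv p := by ext i; fin_cases i <;> rfl
  measurable_toFun := by
    have : Continuous fun z : ℝ × ℝ => (!₂[z.1, z.2] : Plane) := by
      refine (PiLp.continuous_toLp 2 _).comp (continuous_pi fun i => ?_)
      fin_cases i <;> simp <;> fun_prop
    exact this.measurable
  measurable_invFun := by
    have : Continuous fun p : Plane => (p 0, p 1) := by fun_prop
    exact this.measurable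

theorem measurePreserving_planeEquiv : MeasurePreserving planeEquiv := by
  have h2 := (volume_preserving_finTwoArrow ℝ).symm
  have h3 := PiLp.volume_preserving_toLp (Fin 2)
  have h5 := h3.comp h2
  have e : (planeEquiv : ℝ × ℝ → Plane) =
      WithLp.toLp 2 ∘ (MeasurableEquiv.finTwoArrow (α := ℝ)).symm := by
    funext z
    ext i
    fin_cases i <;> rfl
  rw [e]
  exact h5

theorem lintegral_spaceTime (f : SpaceTime → ℝ≥0∞) (hf : Measurable f) :
    ∫⁻ ζ, f ζ = ∫⁻ p : Plane, ∫⁻ t : ℝ, f (stMk (p, t)) := by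
  rw [← measurePreserving_stEquiv.lintegral_comp hf, Measure.volume_eq_prod,
    lintegral_prod _ (by exact (hf.comp stEquiv.measurable).aemeasurable)]
  rfl

theorem lintegral_plane (f : Plane → ℝ≥0∞) (hf : Measurable f) :
    ∫⁻ p, f p = ∫⁻ x : ℝ, ∫⁻ y : ℝ, f !₂[x, y] := by
  rw [← measurePreserving_planeEquiv.lintegral_comp hf, Measure.volume_eq_prod,
    lintegral_prod _ (by exact (hf.comp planeEquiv.measurable).aemeasurable)]
  rfl

/-- Fubini in the order τ, μ, ξ. The bound on the μ-sections is only asked for almost every ξ,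
because ω degenerates on the lines where a frequency ξ' or ξ - ξ' vanishes. -/
theorem volume_le_of_sections {S : Set SpaceTime} (hS : MeasurableSet S) (I : Set ℝ)
    (E : ℝ → Set ℝ) (a b : ℝ≥0∞) (hE : ∀ ζ ∈ S, ζ 0 ∈ I ∧ ζ 1 ∈ E (ζ 0))
    (ha : ∀ᵐ ξ, volume (E ξ) ≤ a)
    (hb : ∀ ξ μ, volume {τ | stMk (!₂[ξ, μ], τ) ∈ S} ≤ b) :
    volume S ≤ volume I * a * b := by
  have h1 : volume S = ∫⁻ ζ, S.indicator 1 ζ := (lintegral_indicator_one hS).symm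
  have hm : Measurable (S.indicator (1 : SpaceTime → ℝ≥0∞)) := measurable_one.indicator hS
  rw [h1, lintegral_spaceTime _ hm, lintegral_plane]
  · have key : ∀ᵐ ξ, (∫⁻ μ, ∫⁻ τ, S.indicator (1 : SpaceTime → ℝ≥0∞) (stMk (!₂[ξ, μ], τ)))
        ≤ I.indicator (fun _ => a * b) ξ := by
      filter_upwards [ha] with ξ hξ
      have h2 : ∀ μ, (∫⁻ τ, S.indicator (1 : SpaceTime → ℝ≥0∞) (stMk (!₂[ξ, μ], τ)))
          = volume {τ | stMk (!₂[ξ, μ], τ) ∈ S} := by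
        intro μ
        rw [← lintegral_indicator_one]
        · rfl
        · exact hS.preimage (stEquiv.measurable.comp (measurable_const.prodMk measurable_id))
      simp_rw [h2]
      by_cases hI : ξ ∈ I
      · rw [indicator_of_mem hI]
        calc ∫⁻ μ, volume {τ | stMk (!₂[ξ, μ], τ) ∈ S}
            ≤ ∫⁻ μ, (E ξ).indicator (fun _ => b) μ := by
              refine lintegral_mono fun μ => ?_
              by_cases hμ : μ ∈ E ξ
              · rw [indicator_of_mem hμ]; exact hb ξ μ
              · have : {τ | stMk (!₂[ξ, μ], τ) ∈ S} = ∅ := by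
                  ext τ
                  simp only [mem_ofPred_eq, mem_empty_iff_false, iff_false]
                  exact fun h => hμ (hE _ h).2
                simp [this]
          _ ≤ b * volume (E ξ) := lintegral_indicator_const_le _ _
          _ ≤ a * b := by rw [mul_comm]; gcongr
      · have : ∀ μ, {τ | stMk (!₂[ξ, μ], τ) ∈ S} = ∅ := by
          intro μ
          ext τ
          simp only [mem_ofPred_eq, mem_empty_iff_false, iff_false]
          exact fun h => hI (hE _ h).1
        simp [this]
    refine (lintegral_mono_ae key).trans ((lintegral_indicator_const_le _ _).trans ?_)
    rw [mul_comm, mul_assoc]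
  · exact Measurable.lintegral_prod_right' (hm.comp stEquiv.measurable)

/-! ### Sublevel sets of quadratic polynomials -/

theorem volume_le_of_abs_sub_le {s : Set ℝ} {d : ℝ} (hd : ∀ x ∈ s, ∀ y ∈ s, x ≤ y → y - x ≤ d) :
    volume s ≤ ENNReal.ofReal d := by
  refine (Real.volume_le_diam s).trans (Metric.ediam_le fun x hx y hy => ?_)
  rw [edist_dist, Real.dist_eq]
  refine ENNReal.ofReal_le_ofReal ?_
  rcases le_total x y with h | h
  · rw [abs_sub_comm, abs_of_nonneg (sub_nonneg.2 h)]; exact hd x hx y hy h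
  · rw [abs_of_nonneg (sub_nonneg.2 h)]; exact hd y hy x hx h

/-- Halving a set that is symmetric around a point. -/
theorem volume_le_of_abs_dist {s : Set ℝ} {c d : ℝ} (hd0 : 0 ≤ d)
    (hd : ∀ x ∈ s, ∀ y ∈ s, |x - c| ≤ |y - c| → |y - c| - |x - c| ≤ d) :
    volume s ≤ ENNReal.ofReal (2 * d) := by
  have h : s ⊆ (s ∩ Ici c) ∪ (s ∩ Iic c) := by
    intro x hx
    rcases le_total c x with h | h
    · exact Or.inl ⟨hx, h⟩
    · exact Or.inr ⟨hx, h⟩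
  refine (measure_mono h).trans ((measure_union_le _ _).trans ?_)
  rw [two_mul, ENNReal.ofReal_add hd0 hd0]
  refine add_le_add (volume_le_of_abs_sub_le ?_) (volume_le_of_abs_sub_le ?_)
  · rintro x ⟨hx, hxc⟩ y ⟨hy, hyc⟩ hxy
    simp only [mem_Ici] at hxc hyc
    have := hd x hx y hy
    rw [abs_of_nonneg (by linarith), abs_of_nonneg (by linarith)] at this
    linarith [this (by linarith)]
  · rintro x ⟨hx, hxc⟩ y ⟨hy, hyc⟩ hxy
    simp only [mem_Iic] at hxc hyc
    have := hd y hy x hx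
    rw [abs_of_nonpos (by linarith), abs_of_nonpos (by linarith)] at this
    linarith [this (by linarith)]

/-- Two values in [-M, M] differ by at most 2M, and the constant A cancels in the difference. Both
sublevel set bounds below start from this. -/
theorem sq_sub_sq_le_of_quadratic {A b c M x y : ℝ} (hb : b ≠ 0)
    (hx : |A + b * (x - c) ^ 2| ≤ M) (hy : |A + b * (y - c) ^ 2| ≤ M) :
    |b| * (|y - c| ^ 2 - |x - c| ^ 2) ≤ 2 * M := by
  rw [sq_abs, sq_abs]
  rw [abs_le] at hx hy
  rcases lt_or_gt_of_ne hb with h | h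
  · rw [abs_of_neg h]; linarith
  · rw [abs_of_pos h]; linarith

/-- The bound that includes the vertex c: with X = |x - c| ≤ Y = |y - c| one has (Y - X)² ≤ Y² - X²
≤ 2M/|b|, so each half of the set has diameter at most 2√(M/|b|). -/
theorem volume_quadratic_le {A b c M : ℝ} (hb : b ≠ 0) (hM : 0 ≤ M) :
    volume {x : ℝ | |A + b * (x - c) ^ 2| ≤ M} ≤ ENNReal.ofReal (4 * √(M / |b|)) := by
  have hb' : 0 < |b| := abs_pos.2 hb
  have h0 := Real.sqrt_nonneg (M / |b|)
  have := volume_le_of_abs_dist (s := {x : ℝ | |A + b * (x - c) ^ 2| ≤ M}) (c := c)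
    (d := 2 * √(M / |b|)) (by positivity) ?_
  · rwa [← mul_assoc, show (2 : ℝ) * 2 = 4 by norm_num] at this
  intro x hx y hy hxy
  have h := sq_sub_sq_le_of_quadratic hb hx hy
  have h2 : |y - c| ^ 2 - |x - c| ^ 2 ≤ 2 * (M / |b|) := by
    rw [← mul_div_assoc, le_div_iff₀ hb']; linarith
  have hs : √(M / |b|) ^ 2 = M / |b| := Real.sq_sqrt (by positivity)
  refine abs_le_of_sq_le_sq' (?_ : _ ≤ _) (by positivity) |>.2
  nlinarith [abs_nonneg (x - c), abs_nonneg (y - c)]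

/-- Away from the vertex Y² - X² = (Y - X)(Y + X), and |b|(Y + X) ≥ 2K by the lower bound on the
half-derivative b(x - c). Hence Y - X ≤ M/K on each half. -/
theorem volume_quadratic_le_of_le_deriv {A b c M K : ℝ} (hb : b ≠ 0) (hM : 0 ≤ M) (hK : 0 < K) :
    volume {x : ℝ | |A + b * (x - c) ^ 2| ≤ M ∧ K ≤ |b * (x - c)|} ≤
      ENNReal.ofReal (2 * (M / K)) := by
  have hb' : 0 < |b| := abs_pos.2 hb
  refine volume_le_of_abs_dist (c := c) (by positivity) ?_
  rintro x ⟨hx, hx'⟩ y ⟨hy, hy'⟩ hxy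
  have h := sq_sub_sq_le_of_quadratic hb hx hy
  rw [abs_mul] at hx' hy'
  rw [le_div_iff₀ hK]
  nlinarith [abs_nonneg (x - c), abs_nonneg (y - c)]

/-! ### The resonance identity and measures of resonant sets -/

theorem measurable_omega : Measurable fun z : ℝ × ℝ => omega z.1 z.2 := by
  unfold omega; fun_prop

theorem measurable_modulation : Measurable modulation := by
  have h : Measurable fun ζ : SpaceTime => (ζ 0, ζ 1) := by fun_prop
  exact Measurable.sub (by fun_prop) (measurable_omega.comp h)

theorem omega_neg (ξ μ : ℝ) : omega (-ξ) (-μ) = -omega ξ μ := by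
  unfold omega; rw [div_neg]; ring

theorem modulation_neg (ζ : SpaceTime) : modulation (-ζ) = -modulation ζ := by
  simp only [modulation, PiLp.neg_apply, omega_neg]; ring

/-- Completing the square in μ': the vertex μξ'/ξ is the point where the slopes μ'/ξ' and (μ -
μ')/(ξ - ξ') agree. -/
theorem omega_add_omega {ξ μ ξ' μ' : ℝ} (h : ξ ≠ 0) (h1 : ξ' ≠ 0) (h2 : ξ - ξ' ≠ 0) :
    omega ξ' μ' + omega (ξ - ξ') (μ - μ') =
      ξ' ^ 3 + (ξ - ξ') ^ 3 + μ ^ 2 / ξ +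
        ξ / (ξ' * (ξ - ξ')) * (μ' - μ * ξ' / ξ) ^ 2 := by
  unfold omega
  field_simp
  ring

/-- The squared quantity is the slope difference μ'/ξ' - (μ - μ')/(ξ - ξ'), which is also half the
μ'-derivative of the quadratic in `omega_add_omega`. A vanishing resonance function therefore forces
a derivative of size comparable to |ξ|; this link drives the high-low estimate. -/
theorem resonance {ξ μ ξ' μ' : ℝ} (h : ξ ≠ 0) (h1 : ξ' ≠ 0) (h2 : ξ - ξ' ≠ 0) :
    omega ξ μ - (omega ξ' μ' + omega (ξ - ξ') (μ - μ')) =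
      ξ' * (ξ - ξ') *
        (3 * ξ - (ξ / (ξ' * (ξ - ξ')) * (μ' - μ * ξ' / ξ)) ^ 2 / ξ) := by
  unfold omega
  field_simp
  ring

/-- Pairs `ζ' + (ζ - ζ')` with bounded modulations. -/
def pairSet (ζ : SpaceTime) (M M' : ℝ) : Set SpaceTime :=
  {ζ' | |modulation ζ'| ≤ M ∧ |modulation (ζ - ζ')| ≤ M'}

theorem measurableSet_pairSet (ζ : SpaceTime) (M M' : ℝ) : MeasurableSet (pairSet ζ M M') := by
  have h1 : Measurable fun ζ' : SpaceTime => |modulation ζ'| :=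
    measurable_modulation.abs
  have h2 : Measurable fun ζ' : SpaceTime => |modulation (ζ - ζ')| :=
    (measurable_modulation.comp (measurable_const.sub measurable_id)).abs
  exact (measurableSet_le h1 measurable_const).inter (measurableSet_le h2 measurable_const)

theorem modulation_add_modulation_sub (ζ ζ' : SpaceTime) :
    modulation ζ' + modulation (ζ - ζ') =
      ζ 2 - (omega (ζ' 0) (ζ' 1) + omega (ζ 0 - ζ' 0) (ζ 1 - ζ' 1)) := by
  simp only [modulation, PiLp.sub_apply]; ring

/-- For fixed (ξ', μ') the two modulation constraints confine τ' to intervals of lengths 2M and 2M',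
hence the factor 2 min(M, M'). Only the μ'-sections remain to be estimated, away from ξ' = 0 and ξ'
= ζ 0. -/
theorem volume_le_of_subset_pairSet {ζ : SpaceTime} {M M' : ℝ} {S : Set SpaceTime}
    (hS : MeasurableSet S) (hSp : S ⊆ pairSet ζ M M') (I : Set ℝ) (hI : ∀ ζ' ∈ S, ζ' 0 ∈ I)
    (a : ℝ≥0∞) (ha : ∀ ξ', ξ' ≠ 0 → ζ 0 - ξ' ≠ 0 →
      volume {μ' | ∃ τ', stMk (!₂[ξ', μ'], τ') ∈ S} ≤ a) :
    volume S ≤ volume I * a * ENNReal.ofReal (2 * min M M') := by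
  refine volume_le_of_sections hS I (fun ξ' => {μ' | ∃ τ', stMk (!₂[ξ', μ'], τ') ∈ S}) a _ ?_ ?_ ?_
  · intro ζ' h
    refine ⟨hI _ h, ζ' 2, ?_⟩
    convert h
    ext i; fin_cases i <;> rfl
  · have : ∀ᵐ ξ' : ℝ, ξ' ≠ 0 ∧ ξ' ≠ ζ 0 := by
      filter_upwards [compl_mem_ae_iff.2 (measure_singleton (0 : ℝ)),
        compl_mem_ae_iff.2 (measure_singleton (ζ 0))] with ξ' h1 h2 using ⟨h1, h2⟩
    filter_upwards [this] with ξ' h using ha ξ' h.1 (sub_ne_zero.2 h.2.symm)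
  · intro ξ μ
    refine volume_le_of_abs_sub_le fun x hx y hy hxy => ?_
    have h1 := hSp hx
    have h2 := hSp hy
    simp only [pairSet, mem_ofPred_eq, modulation, stMk_zero, stMk_one, stMk_two,
      PiLp.sub_apply, abs_le] at h1 h2
    rcases min_cases M M' with h | h <;> rw [h.1] <;> linarith

theorem volume_abs_le (R : ℝ) : volume {ξ : ℝ | |ξ| ≤ R} = ENNReal.ofReal (2 * R) := by
  have : {ξ : ℝ | |ξ| ≤ R} = Icc (-R) R := by ext; simp [abs_le]
  rw [this, Real.volume_Icc]; congr 1; ring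

theorem volume_abs_sub_le (a R : ℝ) :
    volume {ξ : ℝ | |a - ξ| ≤ R} = ENNReal.ofReal (2 * R) := by
  have : {ξ : ℝ | |a - ξ| ≤ R} = Icc (a - R) (a + R) := by
    ext; simp only [abs_le, mem_ofPred_eq, mem_Icc]; constructor <;> intro h <;> constructor <;>
      linarith [h.1, h.2]
  rw [this, Real.volume_Icc]; congr 1; ring

theorem abs_sub_omega_le {ζ ζ' : SpaceTime} {M M' : ℝ} (h : ζ' ∈ pairSet ζ M M') :
    |ζ 2 - (omega (ζ' 0) (ζ' 1) + omega (ζ 0 - ζ' 0) (ζ 1 - ζ' 1))| ≤ M + M' := by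
  rw [← modulation_add_modulation_sub]
  exact (abs_add_le _ _).trans (add_le_add h.1 h.2)

theorem measurableSet_abs_coord_le (i : Fin 3) (R : ℝ) :
    MeasurableSet {ζ' : SpaceTime | |ζ' i| ≤ R} :=
  (isClosed_le (by fun_prop) (by fun_prop)).measurableSet

theorem measurableSet_abs_sub_coord_le (i : Fin 3) (a R : ℝ) :
    MeasurableSet {ζ' : SpaceTime | |a - ζ' i| ≤ R} :=
  (isClosed_le (by fun_prop) (by fun_prop)).measurableSet

/-- The part of `pairSet` used for high × high interactions. -/
theorem volume_pairSet_low_le {ζ : SpaceTime} {M M' R : ℝ} (hM : 0 ≤ M) (hM' : 0 ≤ M')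
    (hR : 0 ≤ R) (hζ : ζ 0 ≠ 0) :
    volume {ζ' ∈ pairSet ζ M M' | |ζ' 0| ≤ R ∧ |ζ 0 - ζ' 0| ≤ |ζ 0|} ≤
      ENNReal.ofReal (2 * R * (4 * √((M + M') * R)) * (2 * min M M')) := by
  rw [ENNReal.ofReal_mul (by positivity), ENNReal.ofReal_mul (by positivity), ← volume_abs_le]
  have hm : MeasurableSet {ζ' ∈ pairSet ζ M M' | |ζ' 0| ≤ R ∧ |ζ 0 - ζ' 0| ≤ |ζ 0|} :=
    (measurableSet_pairSet _ _ _).inter ((measurableSet_abs_coord_le _ _).inter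
      (measurableSet_abs_sub_coord_le _ _ _))
  refine volume_le_of_subset_pairSet hm (fun _ h => h.1) _ (fun _ h => h.2.1) _ ?_
  intro ξ' h1 h2
  by_cases hc : |ξ'| ≤ R ∧ |ζ 0 - ξ'| ≤ |ζ 0|
  swap
  · have : {μ' | ∃ τ', stMk (!₂[ξ', μ'], τ') ∈
        {ζ' ∈ pairSet ζ M M' | |ζ' 0| ≤ R ∧ |ζ 0 - ζ' 0| ≤ |ζ 0|}} = ∅ := by
      ext μ'
      simp only [mem_ofPred_eq, mem_empty_iff_false, iff_false]
      rintro ⟨τ', h⟩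
      exact hc h.2
    rw [this, measure_empty]; exact zero_le
  have hb : ζ 0 / (ξ' * (ζ 0 - ξ')) ≠ 0 := div_ne_zero hζ (mul_ne_zero h1 h2)
  refine le_trans (measure_mono ?_) ((volume_quadratic_le (M := M + M')
    (A := -(ζ 2 - (ξ' ^ 3 + (ζ 0 - ξ') ^ 3 + ζ 1 ^ 2 / ζ 0))) (c := ζ 1 * ξ' / ζ 0) hb
    (by positivity)).trans (ENNReal.ofReal_le_ofReal ?_))
  · rintro μ' ⟨τ', h⟩
    have := abs_sub_omega_le h.1
    simp only [stMk_zero, stMk_one] at this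
    have e := omega_add_omega (μ := ζ 1) (μ' := μ') hζ h1 h2
    simp only [mem_ofPred_eq]
    rw [abs_sub_comm] at this
    convert this using 2
    change _ = omega ξ' μ' + omega (ζ 0 - ξ') (ζ 1 - μ') - ζ 2
    rw [e]; ring
  -- The inverse of the leading coefficient is |ξ'||ζ 0 - ξ'|/|ζ 0|, at most R because |ζ 0 - ξ'| ≤
  -- |ζ 0| and |ξ'| ≤ R.
  · gcongr
    rw [abs_div, abs_mul, div_div_eq_mul_div, mul_div_assoc]
    gcongr
    rw [div_le_iff₀ (abs_pos.2 hζ)]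
    exact mul_le_mul hc.1 hc.2 (abs_nonneg _) hR

/-- The part of `pairSet` used for high × low interactions. -/
theorem volume_pairSet_resonant_le {ζ : SpaceTime} {M M' M₃ R : ℝ} (hM : 0 ≤ M) (hM' : 0 ≤ M')
    (hM₃ : |modulation ζ| ≤ M₃) (hR : 0 ≤ R) (hζ : ζ 0 ≠ 0) :
    volume {ζ' ∈ pairSet ζ M M' | |ζ 0 - ζ' 0| ≤ R} ≤
      ENNReal.ofReal (2 * R * (6 * √((M + M') * (M + M' + M₃)) / |ζ 0|) * (2 * min M M')) := by
  have hM₃0 : 0 ≤ M₃ := (abs_nonneg _).trans hM₃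
  have hζ' : 0 < |ζ 0| := abs_pos.2 hζ
  rw [ENNReal.ofReal_mul (by positivity), ENNReal.ofReal_mul (by positivity),
    ← volume_abs_sub_le (ζ 0)]
  have hm : MeasurableSet {ζ' ∈ pairSet ζ M M' | |ζ 0 - ζ' 0| ≤ R} :=
    (measurableSet_pairSet _ _ _).inter (measurableSet_abs_sub_coord_le _ _ _)
  refine volume_le_of_subset_pairSet hm (fun _ h => h.1) _ (fun _ h => h.2) _ ?_
  intro ξ' h1 h2
  set N := M + M' with hN
  have hN0 : 0 ≤ N := by positivity
  have hb : ζ 0 / (ξ' * (ζ 0 - ξ')) ≠ 0 := div_ne_zero hζ (mul_ne_zero h1 h2)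
  set b := ζ 0 / (ξ' * (ζ 0 - ξ')) with hbdef
  set A := -(ζ 2 - (ξ' ^ 3 + (ζ 0 - ξ') ^ 3 + ζ 1 ^ 2 / ζ 0)) with hA
  set c := ζ 1 * ξ' / ζ 0 with hc
  -- The dichotomy: either the half-derivative b(μ' - c) has size at least |ζ 0|, or |3ζ 0 - D²/ζ 0|
  -- ≥ 2|ζ 0|. In the second case the resonance function is at least 2|ζ 0||ξ'(ζ 0 - ξ')|, and it is
  -- bounded by the three modulations, that is by N + M₃.
  have key : {μ' | ∃ τ', stMk (!₂[ξ', μ'], τ') ∈ {ζ' ∈ pairSet ζ M M' | |ζ 0 - ζ' 0| ≤ R}} ⊆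
      {x | |A + b * (x - c) ^ 2| ≤ N ∧ |ζ 0| ≤ |b * (x - c)|} ∪
      {x | |A + b * (x - c) ^ 2| ≤ N ∧ 2 * |ζ 0| * |ξ' * (ζ 0 - ξ')| ≤ N + M₃} := by
    rintro μ' ⟨τ', h⟩
    have h3 := abs_sub_omega_le h.1
    simp only [stMk_zero, stMk_one] at h3
    change |ζ 2 - (omega ξ' μ' + omega (ζ 0 - ξ') (ζ 1 - μ'))| ≤ N at h3
    have e := omega_add_omega (μ := ζ 1) (μ' := μ') hζ h1 h2
    have h4 : |A + b * (μ' - c) ^ 2| ≤ N := by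
      rw [abs_sub_comm] at h3
      convert h3 using 2
      rw [e]; ring
    rcases le_or_gt |ζ 0| |b * (μ' - c)| with h5 | h5
    · exact Or.inl ⟨h4, h5⟩
    refine Or.inr ⟨h4, ?_⟩
    have e2 := resonance (μ := ζ 1) (μ' := μ') hζ h1 h2
    have h6 : |ξ' * (ζ 0 - ξ') * (3 * ζ 0 - (b * (μ' - c)) ^ 2 / ζ 0)| ≤ N + M₃ := by
      rw [← e2]
      have : omega (ζ 0) (ζ 1) - (omega ξ' μ' + omega (ζ 0 - ξ') (ζ 1 - μ')) =
          (ζ 2 - (omega ξ' μ' + omega (ζ 0 - ξ') (ζ 1 - μ'))) - modulation ζ := by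
        simp only [modulation]; ring
      rw [this]
      exact (abs_sub _ _).trans (add_le_add h3 hM₃)
    rw [abs_mul] at h6
    have h7 : |(b * (μ' - c)) ^ 2 / ζ 0| ≤ |ζ 0| := by
      rw [abs_div, div_le_iff₀ hζ', abs_pow]
      nlinarith [abs_nonneg (b * (μ' - c))]
    have h8 : 2 * |ζ 0| ≤ |3 * ζ 0 - (b * (μ' - c)) ^ 2 / ζ 0| := by
      have := abs_sub_abs_le_abs_sub (3 * ζ 0) ((b * (μ' - c)) ^ 2 / ζ 0)
      rw [abs_mul, abs_of_pos (by norm_num : (0 : ℝ) < 3)] at this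
      linarith
    calc 2 * |ζ 0| * |ξ' * (ζ 0 - ξ')| = |ξ' * (ζ 0 - ξ')| * (2 * |ζ 0|) := by ring
      _ ≤ _ := (mul_le_mul_of_nonneg_left h8 (abs_nonneg _)).trans h6
  have hle : N ≤ √(N * (N + M₃)) := Real.le_sqrt_of_sq_le (by nlinarith)
  refine (measure_mono key).trans ((measure_union_le _ _).trans ?_)
  -- The share 2 goes to the steep part, of measure at most 2N/|ζ 0|. The share 4 goes to the
  -- resonant part, where 1/|b| ≤ (N + M₃)/(2|ζ 0|²) is inserted into the vertex bound.
  have e6 : 6 * √(N * (N + M₃)) / |ζ 0| =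
      2 * (√(N * (N + M₃)) / |ζ 0|) + 4 * (√(N * (N + M₃)) / |ζ 0|) := by ring
  rw [e6, ENNReal.ofReal_add (by positivity) (by positivity)]
  refine add_le_add ?_ ?_
  · refine (volume_quadratic_le_of_le_deriv hb hN0 hζ').trans (ENNReal.ofReal_le_ofReal ?_)
    gcongr
  · by_cases hx : 2 * |ζ 0| * |ξ' * (ζ 0 - ξ')| ≤ N + M₃
    · refine (measure_mono (fun x h => h.1)).trans ((volume_quadratic_le hb hN0).trans
        (ENNReal.ofReal_le_ofReal ?_))
      gcongr
      rw [hbdef, abs_div, div_div_eq_mul_div,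
        Real.sqrt_le_left (by positivity), div_pow, Real.sq_sqrt (by positivity), mul_div_assoc,
        mul_div_assoc]
      refine mul_le_mul_of_nonneg_left ?_ hN0
      rw [div_le_div_iff₀ hζ' (by positivity)]
      have := mul_nonneg (abs_nonneg (ξ' * (ζ 0 - ξ'))) hζ'.le
      nlinarith
    · have : {x | |A + b * (x - c) ^ 2| ≤ N ∧ 2 * |ζ 0| * |ξ' * (ζ 0 - ξ')| ≤ N + M₃} = ∅ := by
        ext x
        simp only [mem_ofPred_eq, mem_empty_iff_false, iff_false]
        exact fun h => hx h.2
      rw [this, measure_empty]; exact zero_le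

/-- The part of `pairSet` used far away from the characteristic surface. -/
theorem volume_pairSet_far_le {ζ : SpaceTime} {M M' B : ℝ} (hM : 0 ≤ M) (hM' : 0 ≤ M')
    (hB : 2 ≤ B) (hmod : 8 * B ^ 4 ≤ |modulation ζ|) (hζ : ζ 0 ≠ 0) :
    volume {ζ' ∈ pairSet ζ M M' | |ζ' 0| ≤ B ∧ |ζ 0 - ζ' 0| ≤ B} ≤
      ENNReal.ofReal (8 * (M + M') * min M M' / √|ζ 0|) := by
  have hζ' : 0 < |ζ 0| := abs_pos.2 hζ
  have hs : 0 < √|ζ 0| := Real.sqrt_pos.2 hζ'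
  have hss : √|ζ 0| ^ 2 = |ζ 0| := Real.sq_sqrt hζ'.le
  have hB0 : 0 < B := by linarith
  -- The ξ'-interval has length 2B and the μ'-sections will be bounded by 2N/(B√|ζ 0|), N = M + M',
  -- so that B disappears from the result.
  have e0 : 8 * (M + M') * min M M' / √|ζ 0| =
      2 * B * (2 * ((M + M') / (B * √|ζ 0|))) * (2 * min M M') := by
    field_simp
    ring
  rw [e0, ENNReal.ofReal_mul (by positivity), ENNReal.ofReal_mul (by positivity), ← volume_abs_le]
  have hm : MeasurableSet {ζ' ∈ pairSet ζ M M' | |ζ' 0| ≤ B ∧ |ζ 0 - ζ' 0| ≤ B} :=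
    (measurableSet_pairSet _ _ _).inter ((measurableSet_abs_coord_le _ _).inter
      (measurableSet_abs_sub_coord_le _ _ _))
  refine volume_le_of_subset_pairSet hm (fun _ h => h.1) _ (fun _ h => h.2.1) _ ?_
  intro ξ' h1 h2
  by_cases hc0 : |ξ'| ≤ B ∧ |ζ 0 - ξ'| ≤ B
  swap
  · have : {μ' | ∃ τ', stMk (!₂[ξ', μ'], τ') ∈
        {ζ' ∈ pairSet ζ M M' | |ζ' 0| ≤ B ∧ |ζ 0 - ζ' 0| ≤ B}} = ∅ := by
      ext μ'
      simp only [mem_ofPred_eq, mem_empty_iff_false, iff_false]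
      rintro ⟨τ', h⟩
      exact hc0 h.2
    rw [this, measure_empty]; exact zero_le
  have hprod : |ξ' * (ζ 0 - ξ')| ≤ B ^ 2 := by
    rw [abs_mul, sq]; exact mul_le_mul hc0.1 hc0.2 (abs_nonneg _) hB0.le
  set N := M + M' with hN
  have hN0 : 0 ≤ N := by positivity
  have hb : ζ 0 / (ξ' * (ζ 0 - ξ')) ≠ 0 := div_ne_zero hζ (mul_ne_zero h1 h2)
  set b := ζ 0 / (ξ' * (ζ 0 - ξ')) with hbdef
  set A := -(ζ 2 - (ξ' ^ 3 + (ζ 0 - ξ') ^ 3 + ζ 1 ^ 2 / ζ 0)) with hA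
  set c := ζ 1 * ξ' / ζ 0 with hc
  have hpt : ∀ μ', (∃ τ', stMk (!₂[ξ', μ'], τ') ∈
      {ζ' ∈ pairSet ζ M M' | |ζ' 0| ≤ B ∧ |ζ 0 - ζ' 0| ≤ B}) →
      |ζ 2 - (omega ξ' μ' + omega (ζ 0 - ξ') (ζ 1 - μ'))| ≤ N ∧ |A + b * (μ' - c) ^ 2| ≤ N := by
    rintro μ' ⟨τ', h⟩
    have h3 := abs_sub_omega_le h.1
    simp only [stMk_zero, stMk_one] at h3
    change |ζ 2 - (omega ξ' μ' + omega (ζ 0 - ξ') (ζ 1 - μ'))| ≤ N at h3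
    have e := omega_add_omega (μ := ζ 1) (μ' := μ') hζ h1 h2
    refine ⟨h3, ?_⟩
    rw [abs_sub_comm] at h3
    convert h3 using 2
    rw [e]; ring
  -- If N ≥ 4B⁴, then |ξ'(ζ 0 - ξ')| ≤ B² ≤ N/(4B²) and the vertex bound suffices. If N < 4B⁴, the
  -- output modulation 8B⁴ can only come from the resonance function, which is then at least 4B⁴.
  -- Hence |3ζ 0 - D²/ζ 0| ≥ 4B², and since 3|ζ 0| ≤ 6B ≤ 3B² the half-derivative satisfies D² ≥
  -- B²|ζ 0|.
  rcases le_or_gt (4 * B ^ 4) N with hcase | hcase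
  · refine (measure_mono (fun x h => (hpt x h).2)).trans ((volume_quadratic_le hb hN0).trans
      (ENNReal.ofReal_le_ofReal ?_))
    have h5 : √(N / |b|) ≤ N / (2 * (B * √|ζ 0|)) := by
      rw [hbdef, abs_div, div_div_eq_mul_div, Real.sqrt_le_left (by positivity), div_pow, mul_pow,
        mul_pow, hss, div_le_div_iff₀ hζ' (by positivity)]
      have : |ξ' * (ζ 0 - ξ')| * (4 * B ^ 2) ≤ N := by nlinarith
      calc N * |ξ' * (ζ 0 - ξ')| * (2 ^ 2 * (B ^ 2 * |ζ 0|))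
          = N * |ζ 0| * (|ξ' * (ζ 0 - ξ')| * (4 * B ^ 2)) := by ring
        _ ≤ N * |ζ 0| * N := by gcongr
        _ = N ^ 2 * |ζ 0| := by ring
    calc 4 * √(N / |b|) ≤ 4 * (N / (2 * (B * √|ζ 0|))) := by gcongr
      _ = 2 * (N / (B * √|ζ 0|)) := by field_simp; ring
  · refine le_trans (measure_mono ?_) (volume_quadratic_le_of_le_deriv (A := A) (c := c) hb hN0
      (by positivity : 0 < B * √|ζ 0|))
    intro μ' hμ'
    obtain ⟨h3, h4⟩ := hpt μ' hμ'
    refine ⟨h4, ?_⟩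
    have e2 := resonance (μ := ζ 1) (μ' := μ') hζ h1 h2
    have h6 : 4 * B ^ 4 ≤ |ξ' * (ζ 0 - ξ') * (3 * ζ 0 - (b * (μ' - c)) ^ 2 / ζ 0)| := by
      rw [← e2]
      have : omega (ζ 0) (ζ 1) - (omega ξ' μ' + omega (ζ 0 - ξ') (ζ 1 - μ')) =
          (ζ 2 - (omega ξ' μ' + omega (ζ 0 - ξ') (ζ 1 - μ'))) - modulation ζ := by
        simp only [modulation]; ring
      rw [this]
      have := abs_sub_abs_le_abs_sub (modulation ζ)
        (ζ 2 - (omega ξ' μ' + omega (ζ 0 - ξ') (ζ 1 - μ')))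
      rw [abs_sub_comm (modulation ζ)] at this
      linarith
    rw [abs_mul] at h6
    have h7 : 4 * B ^ 2 ≤ |3 * ζ 0 - (b * (μ' - c)) ^ 2 / ζ 0| := by
      by_contra hcon
      push Not at hcon
      have : |ξ' * (ζ 0 - ξ')| * |3 * ζ 0 - (b * (μ' - c)) ^ 2 / ζ 0| < B ^ 2 * (4 * B ^ 2) :=
        mul_lt_mul' hprod hcon (abs_nonneg _) (by positivity)
      nlinarith
    have h8 : |ζ 0| ≤ 2 * B := by
      have := abs_add_le ξ' (ζ 0 - ξ')
      rw [add_sub_cancel] at this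
      linarith [hc0.1, hc0.2]
    have h9 : |3 * ζ 0 - (b * (μ' - c)) ^ 2 / ζ 0| ≤ 3 * |ζ 0| + |b * (μ' - c)| ^ 2 / |ζ 0| := by
      refine (abs_sub _ _).trans (le_of_eq ?_)
      rw [abs_mul, abs_div, abs_pow, abs_of_pos (by norm_num : (0 : ℝ) < 3)]
    have h10 : B ^ 2 ≤ |b * (μ' - c)| ^ 2 / |ζ 0| := by nlinarith
    rw [le_div_iff₀ hζ'] at h10
    refine abs_le_of_sq_le_sq' ?_ (abs_nonneg _) |>.2
    rw [mul_pow, hss]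
    exact h10

/-! ### `L²` norms of nonnegative functions -/

/-- The `L²` norm of a function with values in `[0, ∞]`. -/
def l2 {α : Type*} [MeasureSpace α] (F : α → ℝ≥0∞) : ℝ≥0∞ := (∫⁻ z, F z ^ 2) ^ (1 / 2 : ℝ)

section l2

variable {α : Type*} [MeasureSpace α]

theorem sq_rpow_half (x : ℝ≥0∞) : (x ^ 2) ^ (1 / 2 : ℝ) = x := by
  rw [← ENNReal.rpow_natCast, ← ENNReal.rpow_mul]; norm_num

theorem rpow_half_sq (x : ℝ≥0∞) : (x ^ (1 / 2 : ℝ)) ^ 2 = x := by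
  rw [← ENNReal.rpow_natCast, ← ENNReal.rpow_mul]; norm_num

theorem l2_sq (F : α → ℝ≥0∞) : l2 F ^ 2 = ∫⁻ z, F z ^ 2 := rpow_half_sq _

theorem le_of_sq_le_sq {x y : ℝ≥0∞} (h : x ^ 2 ≤ y ^ 2) : x ≤ y := by
  rw [← sq_rpow_half x, ← sq_rpow_half y]
  exact ENNReal.rpow_le_rpow h (by norm_num)

theorem l2_mono_ae {F G : α → ℝ≥0∞} (h : ∀ᵐ z, F z ≤ G z) : l2 F ≤ l2 G :=
  ENNReal.rpow_le_rpow (lintegral_mono_ae (h.mono fun z hz => by gcongr)) (by norm_num)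

theorem l2_mono {F G : α → ℝ≥0∞} (h : ∀ z, F z ≤ G z) : l2 F ≤ l2 G :=
  l2_mono_ae (Filter.Eventually.of_forall h)

theorem l2_eq_eLpNorm {E : Type*} [NormedAddCommGroup E] (f : α → E) :
    eLpNorm f 2 volume = l2 fun z => ‖f z‖ₑ := by
  rw [eLpNorm_eq_lintegral_rpow_enorm_toReal (by norm_num) (by norm_num), l2]
  norm_num

theorem l2_const_mul (c : ℝ≥0∞) {F : α → ℝ≥0∞} (hF : Measurable F) :
    l2 (fun z => c * F z) = c * l2 F := by
  unfold l2
  simp_rw [mul_pow]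
  rw [lintegral_const_mul _ (hF.pow_const 2), ENNReal.mul_rpow_of_nonneg _ _ (by norm_num),
    sq_rpow_half]

theorem l2_zero : l2 (fun _ : α => (0 : ℝ≥0∞)) = 0 := by
  simp [l2]

theorem l2_add_le {F G : α → ℝ≥0∞} (hF : Measurable F) (hG : Measurable G) :
    l2 (fun z => F z + G z) ≤ l2 F + l2 G := by
  have := ENNReal.lintegral_Lp_add_le (p := 2) (μ := (volume : Measure α)) hF.aemeasurable
    hG.aemeasurable (by norm_num)
  simpa [l2] using this

theorem l2_sum_le {ι : Type*} (s : Finset ι) {F : ι → α → ℝ≥0∞} (hF : ∀ i, Measurable (F i)) :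
    l2 (fun z => ∑ i ∈ s, F i z) ≤ ∑ i ∈ s, l2 (F i) := by
  classical
  induction s using Finset.induction_on with
  | empty => simp [l2_zero]
  | insert i s hi ih =>
    simp_rw [Finset.sum_insert hi]
    exact (l2_add_le (hF i) (Finset.measurable_sum _ fun i _ => hF i)).trans (by gcongr)

/-- Minkowski's inequality for finite sums passes to the limit by monotone convergence along the
directed family of finite subsets. -/
theorem l2_tsum_le {ι : Type*} [Countable ι] {F : ι → α → ℝ≥0∞} (hF : ∀ i, Measurable (F i)) :
    l2 (fun z => ∑' i, F i z) ≤ ∑' i, l2 (F i) := by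
  apply le_of_sq_le_sq
  rw [l2_sq]
  have h1 : ∀ z, (∑' i, F i z) ^ 2 = ⨆ s : Finset ι, (∑ i ∈ s, F i z) ^ 2 := by
    intro z
    have hm : Monotone fun s : Finset ι => ∑ i ∈ s, F i z := fun s t h =>
      Finset.sum_le_sum_of_subset h
    exact tendsto_nhds_unique ((ENNReal.continuous_pow 2).continuousAt.tendsto.comp
      (ENNReal.summable.hasSum : HasSum (fun i => F i z) _))
      (tendsto_atTop_iSup fun s t h => pow_le_pow_left' (hm h) 2)
  simp_rw [h1]
  rw [lintegral_iSup_directed (fun s => ((Finset.measurable_sum _ fun i _ =>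
    hF i).pow_const 2).aemeasurable)]
  · refine iSup_le fun s => ?_
    rw [← l2_sq]
    gcongr
    exact (l2_sum_le s hF).trans (ENNReal.sum_le_tsum s)
  · intro s t
    classical
    refine ⟨s ∪ t, fun z => ?_, fun z => ?_⟩ <;> dsimp only <;> gcongr
    · exact Finset.subset_union_left
    · exact Finset.subset_union_right

theorem lintegral_mul_le_l2 {F G : α → ℝ≥0∞} (hF : Measurable F) (hG : Measurable G) :
    ∫⁻ z, F z * G z ≤ l2 F * l2 G := by
  have h : Real.HolderConjugate 2 2 := by
    rw [Real.holderConjugate_iff]; norm_num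
  have := ENNReal.lintegral_mul_le_Lp_mul_Lq (volume : Measure α) h hF.aemeasurable
    hG.aemeasurable
  simpa [l2] using this

/-- Duality for the `L²` norm. -/
theorem l2_le_of_forall_lintegral_mul_le [SigmaFinite (volume : Measure α)] {H : α → ℝ≥0∞}
    (hH : Measurable H) {B : ℝ≥0∞}
    (h : ∀ G : α → ℝ≥0∞, Measurable G → ∫⁻ z, H z * G z ≤ B * l2 G) : l2 H ≤ B := by
  let S := spanningSets (volume : Measure α)
  -- Truncations of finite L² norm. Testing against the truncation itself gives l2² ≤ B · l2, and
  -- finiteness allows the cancellation.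
  let Hn : ℕ → α → ℝ≥0∞ := fun n => (S n).indicator fun z => min (H z) n
  have hHn : ∀ n, Measurable (Hn n) := fun n =>
    (hH.min measurable_const).indicator (measurableSet_spanningSets _ n)
  have hle : ∀ n z, Hn n z ≤ H z := by
    intro n z
    by_cases hz : z ∈ S n
    · simp only [Hn, indicator_of_mem hz]; exact min_le_left _ _
    · simp [Hn, indicator_of_notMem hz]
  have h1 : ∀ n, l2 (Hn n) ≤ B := by
    intro n
    have hfin : l2 (Hn n) ≠ ⊤ := by
      have : ∫⁻ z, Hn n z ^ 2 ≤ (n : ℝ≥0∞) ^ 2 * volume (S n) := by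
        refine le_trans (lintegral_mono fun z => ?_) (lintegral_indicator_const_le (S n) _)
        by_cases hz : z ∈ S n
        · simp only [Hn, indicator_of_mem hz]; gcongr; exact min_le_right _ _
        · simp [Hn, indicator_of_notMem hz]
      refine (ENNReal.rpow_lt_top_of_nonneg (by norm_num) (ne_top_of_le_ne_top ?_ this)).ne
      exact ENNReal.mul_ne_top (by simp) (measure_spanningSets_lt_top _ n).ne
    rcases eq_or_ne (l2 (Hn n)) 0 with h0 | h0
    · rw [h0]; exact zero_le
    have h2 : l2 (Hn n) * l2 (Hn n) ≤ B * l2 (Hn n) := by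
      rw [← sq, l2_sq]
      refine le_trans (lintegral_mono fun z => ?_) (h _ (hHn n))
      rw [sq]
      gcongr
      exact hle n z
    exact (ENNReal.mul_le_mul_iff_left h0 hfin).1 h2
  have hmono : Monotone Hn := by
    intro m n hmn z
    by_cases hz : z ∈ S m
    · have hz' : z ∈ S n := monotone_spanningSets _ hmn hz
      simp only [Hn, indicator_of_mem hz, indicator_of_mem hz']
      gcongr
    · simp [Hn, indicator_of_notMem hz]
  have hsup : ∀ z, H z ^ 2 = ⨆ n, Hn n z ^ 2 := by
    intro z
    have ht : Filter.Tendsto (fun n => Hn n z) Filter.atTop (nhds (H z)) := by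
      obtain ⟨m, hm⟩ : ∃ m, z ∈ S m := by
        have : z ∈ ⋃ i, S i := by rw [iUnion_spanningSets]; trivial
        simpa using this
      have : Filter.Tendsto (fun n : ℕ => min (H z) n) Filter.atTop (nhds (min (H z) ⊤)) :=
        Filter.Tendsto.min tendsto_const_nhds ENNReal.tendsto_nat_nhds_top
      rw [min_top_right] at this
      refine this.congr' ?_
      filter_upwards [Filter.eventually_ge_atTop m] with n hn
      have hz' : z ∈ S n := monotone_spanningSets _ hn hm
      simp only [Hn, indicator_of_mem hz']
    exact tendsto_nhds_unique ((ENNReal.continuous_pow 2).continuousAt.tendsto.comp ht)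
      (tendsto_atTop_iSup fun m n hmn => pow_le_pow_left' (hmono hmn z) 2)
  apply le_of_sq_le_sq
  rw [l2_sq]
  simp_rw [hsup]
  rw [lintegral_iSup (fun n => (hHn n).pow_const 2) fun m n hmn z =>
    pow_le_pow_left' (hmono hmn z) 2]
  refine iSup_le fun n => ?_
  rw [← l2_sq]
  gcongr
  exact h1 n

end l2

/-! ### Convolution -/

/-- The convolution of nonnegative functions on frequency space. -/
def conv (F₁ F₂ : SpaceTime → ℝ≥0∞) (ζ : SpaceTime) : ℝ≥0∞ := ∫⁻ ζ', F₁ ζ' * F₂ (ζ - ζ')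

theorem conv_comm (F₁ F₂ : SpaceTime → ℝ≥0∞) : conv F₁ F₂ = conv F₂ F₁ := by
  funext ζ
  unfold conv
  rw [← lintegral_sub_left_eq_self _ ζ]
  simp [mul_comm]

theorem measurable_conv {F₁ F₂ : SpaceTime → ℝ≥0∞} (h₁ : Measurable F₁) (h₂ : Measurable F₂) :
    Measurable (conv F₁ F₂) := by
  have : Measurable fun z : SpaceTime × SpaceTime => F₁ z.2 * F₂ (z.1 - z.2) := by fun_prop
  exact this.lintegral_prod_right'

theorem conv_congr_ae {F₁ F₂ G₁ G₂ : SpaceTime → ℝ≥0∞} (h₁ : F₁ =ᵐ[volume] G₁)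
    (h₂ : F₂ =ᵐ[volume] G₂) : conv F₁ F₂ = conv G₁ G₂ := by
  funext ζ
  refine lintegral_congr_ae ?_
  have h3 := (quasiMeasurePreserving_sub_left volume ζ).ae_eq_comp h₂
  filter_upwards [h₁, h3] with z hz hz'
  simp only [Function.comp_apply] at hz'
  rw [hz, hz']

theorem l2_prod_sub {F G : SpaceTime → ℝ≥0∞} (hF : Measurable F) (hG : Measurable G) :
    ∫⁻ ζ : SpaceTime, ∫⁻ ζ', (F ζ' * G (ζ - ζ')) ^ 2 = (l2 F * l2 G) ^ 2 := by
  rw [lintegral_lintegral_swap]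
  · simp_rw [mul_pow, l2_sq]
    have : ∀ ζ' : SpaceTime, ∫⁻ ζ, F ζ' ^ 2 * G (ζ - ζ') ^ 2 = F ζ' ^ 2 * ∫⁻ ζ, G ζ ^ 2 := by
      intro ζ'
      rw [lintegral_const_mul _ (by fun_prop), lintegral_sub_right_eq_self (fun ζ => G ζ ^ 2)]
    simp_rw [this]
    rw [lintegral_mul_const _ (by fun_prop)]
  · have : Measurable fun z : SpaceTime × SpaceTime => (F z.2 * G (z.1 - z.2)) ^ 2 := by fun_prop
    exact this.aemeasurable

/-- Cauchy-Schwarz in ζ' for each fixed output ζ: the cost is the measure of the set of contributing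
pairs, which the weight w may compensate. -/
theorem l2_mul_conv_le {w F₁ F₂ : SpaceTime → ℝ≥0∞} (h₁ : Measurable F₁)
    (h₂ : Measurable F₂) {N : ℝ≥0∞} (hN : ∀ ζ, w ζ ^ 2 *
      volume {ζ' | F₁ ζ' ≠ 0 ∧ F₂ (ζ - ζ') ≠ 0} ≤ N) :
    l2 (fun ζ => w ζ * conv F₁ F₂ ζ) ≤ N ^ (1 / 2 : ℝ) * (l2 F₁ * l2 F₂) := by
  apply le_of_sq_le_sq
  rw [l2_sq, mul_pow, rpow_half_sq, ← l2_prod_sub h₁ h₂, ← lintegral_const_mul]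
  swap
  · have : Measurable fun z : SpaceTime × SpaceTime => (F₁ z.2 * F₂ (z.1 - z.2)) ^ 2 := by fun_prop
    exact this.lintegral_prod_right'
  refine lintegral_mono fun ζ => ?_
  set S := {ζ' | F₁ ζ' ≠ 0 ∧ F₂ (ζ - ζ') ≠ 0} with hS
  have hSm : MeasurableSet S := by
    have e1 : MeasurableSet {ζ' | F₁ ζ' ≠ 0} := h₁ (measurableSet_singleton 0).compl
    have e2 : MeasurableSet {ζ' | F₂ (ζ - ζ') ≠ 0} :=
      (h₂.comp (measurable_const.sub measurable_id)) (measurableSet_singleton 0).compl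
    exact e1.inter e2
  have h3 : conv F₁ F₂ ζ = ∫⁻ ζ', (F₁ ζ' * F₂ (ζ - ζ')) * S.indicator 1 ζ' := by
    refine lintegral_congr fun ζ' => ?_
    by_cases h : ζ' ∈ S
    · simp [h]
    · rw [indicator_of_notMem h, mul_zero]
      simp only [hS, mem_ofPred_eq, not_and_or, not_not] at h
      rcases h with h | h <;> simp [h]
  have h4 : conv F₁ F₂ ζ ^ 2 ≤ (∫⁻ ζ', (F₁ ζ' * F₂ (ζ - ζ')) ^ 2) * volume S := by
    rw [h3]
    have := lintegral_mul_le_l2 (F := fun ζ' => F₁ ζ' * F₂ (ζ - ζ')) (G := S.indicator 1)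
      (by fun_prop) (measurable_one.indicator hSm)
    refine (pow_le_pow_left' this 2).trans ?_
    rw [mul_pow, l2_sq, l2_sq]
    gcongr
    rw [← lintegral_indicator_one hSm]
    refine lintegral_mono fun z => ?_
    by_cases h : z ∈ S <;> simp [h]
  calc (w ζ * conv F₁ F₂ ζ) ^ 2 ≤ w ζ ^ 2 * ((∫⁻ ζ', (F₁ ζ' * F₂ (ζ - ζ')) ^ 2) * volume S) := by
        rw [mul_pow]; gcongr
    _ = (w ζ ^ 2 * volume S) * ∫⁻ ζ', (F₁ ζ' * F₂ (ζ - ζ')) ^ 2 := by ring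
    _ ≤ N * ∫⁻ ζ', (F₁ ζ' * F₂ (ζ - ζ')) ^ 2 := by gcongr; exact hN ζ

/-- After pairing with G, Cauchy-Schwarz is applied on the product space to F₂(ζ - ζ')G(ζ) against
1_K F₁(ζ'). The cost is the measure of the outputs ζ for a fixed input ζ', which is the smaller set
when the output frequency is low. -/
theorem l2_restricted_conv_le {F₁ F₂ : SpaceTime → ℝ≥0∞} (h₁ : Measurable F₁)
    (h₂ : Measurable F₂) {K : Set (SpaceTime × SpaceTime)} (hK : MeasurableSet K) {N : ℝ≥0∞}
    (hN : ∀ ζ', volume {ζ | (ζ', ζ) ∈ K} ≤ N) :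
    l2 (fun ζ => ∫⁻ ζ', K.indicator 1 (ζ', ζ) * (F₁ ζ' * F₂ (ζ - ζ'))) ≤
      N ^ (1 / 2 : ℝ) * (l2 F₁ * l2 F₂) := by
  have hKm : Measurable (K.indicator (1 : SpaceTime × SpaceTime → ℝ≥0∞)) :=
    measurable_one.indicator hK
  have hjoint : Measurable fun z : SpaceTime × SpaceTime =>
      K.indicator (1 : SpaceTime × SpaceTime → ℝ≥0∞) (z.2, z.1) * (F₁ z.2 * F₂ (z.1 - z.2)) := by
    fun_prop
  refine l2_le_of_forall_lintegral_mul_le hjoint.lintegral_prod_right' fun G hG => ?_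
  have e1 : ∀ ζ, (∫⁻ ζ', K.indicator (1 : SpaceTime × SpaceTime → ℝ≥0∞) (ζ', ζ) *
      (F₁ ζ' * F₂ (ζ - ζ'))) * G ζ =
      ∫⁻ ζ', (F₂ (ζ - ζ') * G ζ) * (K.indicator 1 (ζ', ζ) * F₁ ζ') := by
    intro ζ
    rw [← lintegral_mul_const _ (by fun_prop)]
    refine lintegral_congr fun ζ' => ?_
    ring
  simp_rw [e1]
  have hP : Measurable fun z : SpaceTime × SpaceTime => F₂ (z.1 - z.2) * G z.1 := by fun_prop
  have hQ : Measurable fun z : SpaceTime × SpaceTime =>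
      K.indicator (1 : SpaceTime × SpaceTime → ℝ≥0∞) (z.2, z.1) * F₁ z.2 := by fun_prop
  have e2 := lintegral_mul_le_l2 hP hQ
  rw [Measure.volume_eq_prod, lintegral_prod _ (by exact (hP.mul hQ).aemeasurable)] at e2
  refine e2.trans ?_
  have e3 : l2 (fun z : SpaceTime × SpaceTime => F₂ (z.1 - z.2) * G z.1) = l2 F₂ * l2 G := by
    have : l2 (fun z : SpaceTime × SpaceTime => F₂ (z.1 - z.2) * G z.1) ^ 2 =
        (l2 F₂ * l2 G) ^ 2 := by
      rw [l2_sq, Measure.volume_eq_prod, lintegral_prod _ (by exact (hP.pow_const 2).aemeasurable),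
        mul_pow, l2_sq, l2_sq]
      have : ∀ ζ : SpaceTime, ∫⁻ ζ', (F₂ (ζ - ζ') * G ζ) ^ 2 = (∫⁻ ζ', F₂ ζ' ^ 2) * G ζ ^ 2 := by
        intro ζ
        simp_rw [mul_pow]
        rw [lintegral_mul_const _ (by fun_prop), lintegral_sub_left_eq_self (fun ζ' => F₂ ζ' ^ 2)]
      simp_rw [this]
      rw [lintegral_const_mul _ (by fun_prop)]
    exact le_antisymm (le_of_sq_le_sq this.le) (le_of_sq_le_sq this.ge)
  have e4 : l2 (fun z : SpaceTime × SpaceTime =>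
      K.indicator (1 : SpaceTime × SpaceTime → ℝ≥0∞) (z.2, z.1) * F₁ z.2) ≤
      N ^ (1 / 2 : ℝ) * l2 F₁ := by
    apply le_of_sq_le_sq
    rw [l2_sq, mul_pow, rpow_half_sq, l2_sq, Measure.volume_eq_prod,
      lintegral_prod_symm _ (by exact (hQ.pow_const 2).aemeasurable),
      ← lintegral_const_mul _ (by fun_prop)]
    refine lintegral_mono fun ζ' => ?_
    simp_rw [mul_pow]
    rw [lintegral_mul_const _ (by fun_prop)]
    gcongr
    refine le_trans (le_of_eq ?_) (hN ζ')
    have hs : MeasurableSet {ζ | (ζ', ζ) ∈ K} := measurable_prodMk_left hK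
    rw [← lintegral_indicator_one hs]
    refine lintegral_congr fun ζ => ?_
    by_cases h : (ζ', ζ) ∈ K
    · rw [indicator_of_mem h, indicator_of_mem (by exact h)]; simp
    · rw [indicator_of_notMem h, indicator_of_notMem (by exact h)]; simp
  calc _ ≤ l2 F₂ * l2 G * (N ^ (1 / 2 : ℝ) * l2 F₁) := by rw [e3]; gcongr
    _ = _ := by ring

/-! ### `L²` estimates for convolutions of functions with bounded modulation -/

theorem ae_coord_ne_zero : ∀ᵐ ζ : SpaceTime, ζ 0 ≠ 0 := by
  have hm : MeasurableSet {ζ : SpaceTime | ¬ ζ 0 ≠ 0} := by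
    have : {ζ : SpaceTime | ¬ ζ 0 ≠ 0} = {ζ | ζ 0 = 0} := by ext; simp
    rw [this]
    exact (isClosed_eq (by fun_prop) (by fun_prop)).measurableSet
  refine le_antisymm ((volume_le_of_sections hm {0} (fun _ => univ) ⊤ ⊤ ?_ ?_ ?_).trans ?_)
    zero_le
  · intro ζ h
    simp only [mem_ofPred_eq, not_not] at h
    exact ⟨h, trivial⟩
  · exact Filter.Eventually.of_forall fun _ => le_top
  · exact fun _ _ => le_top
  · simp

theorem ofReal_rpow_half {x : ℝ} (hx : 0 ≤ x) :
    ENNReal.ofReal x ^ (1 / 2 : ℝ) = ENNReal.ofReal √x := by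
  rw [ENNReal.ofReal_rpow_of_nonneg hx (by norm_num), Real.sqrt_eq_rpow]

/-- Low output frequency, pairs with `|ξ₂| ≤ |ξ₁|`. -/
theorem l2_restricted_conv_low_le {F₁ F₂ : SpaceTime → ℝ≥0∞} (h₁ : Measurable F₁)
    (h₂ : Measurable F₂) {M₂ M₃ R : ℝ} (hM₂ : 0 ≤ M₂) (hM₃ : 0 ≤ M₃) (hR : 0 ≤ R)
    (hF₂ : ∀ ζ, F₂ ζ ≠ 0 → |modulation ζ| ≤ M₂) :
    l2 ({ζ : SpaceTime | |modulation ζ| ≤ M₃ ∧ |ζ 0| ≤ R}.indicator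
      fun ζ => ∫⁻ ζ', {ζ' : SpaceTime | |ζ 0 - ζ' 0| ≤ |ζ' 0|}.indicator 1 ζ' *
        (F₁ ζ' * F₂ (ζ - ζ'))) ≤
      ENNReal.ofReal √(32 * (R * √R) * √M₃ * M₂) * (l2 F₁ * l2 F₂) := by
  -- With the input ζ' fixed, ζ and ζ' - ζ form a pair with sum ζ'. The modulation is odd, so the
  -- bound for F₂ at ζ - ζ' also controls ζ' - ζ.
  set K : Set (SpaceTime × SpaceTime) := {z | z.1 0 ≠ 0 ∧ z.2 ∈ {ζ' ∈ pairSet z.1 M₃ M₂ |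
    |ζ' 0| ≤ R ∧ |z.1 0 - ζ' 0| ≤ |z.1 0|}} with hKdef
  have hK : MeasurableSet K := by
    have m1 : MeasurableSet {z : SpaceTime × SpaceTime | z.1 0 ≠ 0} :=
      (isOpen_ne_fun (by fun_prop) (by fun_prop)).measurableSet
    have m2 : MeasurableSet {z : SpaceTime × SpaceTime | |z.2 0| ≤ R} :=
      (isClosed_le (by fun_prop) (by fun_prop)).measurableSet
    have m3 : MeasurableSet {z : SpaceTime × SpaceTime | |z.1 0 - z.2 0| ≤ |z.1 0|} :=
      (isClosed_le (by fun_prop) (by fun_prop)).measurableSet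
    have m4 : MeasurableSet {z : SpaceTime × SpaceTime | |modulation z.2| ≤ M₃} :=
      measurableSet_le (measurable_modulation.comp measurable_snd).abs measurable_const
    have m5 : MeasurableSet {z : SpaceTime × SpaceTime | |modulation (z.1 - z.2)| ≤ M₂} :=
      measurableSet_le (measurable_modulation.comp
        (measurable_fst.sub measurable_snd)).abs measurable_const
    exact m1.inter ((m4.inter m5).inter (m2.inter m3))
  have hvol : ∀ ζ', volume {ζ | (ζ', ζ) ∈ K} ≤ ENNReal.ofReal (32 * (R * √R) * √M₃ * M₂) := by
    intro ζ'
    by_cases h0 : ζ' 0 = 0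
    · have : {ζ | (ζ', ζ) ∈ K} = ∅ := by
        ext ζ; simp [hKdef, h0]
      rw [this, measure_empty]; exact zero_le
    have e : {ζ | (ζ', ζ) ∈ K} = {ζ'' ∈ pairSet ζ' M₃ M₂ | |ζ'' 0| ≤ R ∧
        |ζ' 0 - ζ'' 0| ≤ |ζ' 0|} := by
      ext ζ; simp [hKdef, h0]
    rw [e]
    refine (volume_pairSet_low_le hM₃ hM₂ hR h0).trans (ENNReal.ofReal_le_ofReal ?_)
    -- Only the power 1/2 of the output modulation is spent. After the final square root this is
    -- M₃^{1/4}, which the weight M₃^{-1/2} of `zNorm` turns into a convergent sum.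
    have key : √(M₃ + M₂) * min M₃ M₂ ≤ 2 * (√M₃ * M₂) := by
      rcases le_total M₃ M₂ with h | h
      · rw [min_eq_left h]
        have h1 : √(M₃ + M₂) ≤ 2 * √M₂ := by
          rw [Real.sqrt_le_left (by positivity), mul_pow, Real.sq_sqrt hM₂]; linarith
        have h2 : √M₃ ≤ √M₂ := Real.sqrt_le_sqrt h
        calc √(M₃ + M₂) * M₃ ≤ 2 * √M₂ * M₃ := by gcongr
          _ = 2 * √M₂ * (√M₃ * √M₃) := by rw [Real.mul_self_sqrt hM₃]
          _ ≤ 2 * √M₂ * (√M₃ * √M₂) := by gcongr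
          _ = 2 * (√M₃ * (√M₂ * √M₂)) := by ring
          _ = _ := by rw [Real.mul_self_sqrt hM₂]
      · rw [min_eq_right h]
        have h1 : √(M₃ + M₂) ≤ 2 * √M₃ := by
          rw [Real.sqrt_le_left (by positivity), mul_pow, Real.sq_sqrt hM₃]; linarith
        calc √(M₃ + M₂) * M₂ ≤ 2 * √M₃ * M₂ := by gcongr
          _ = _ := by ring
    rw [Real.sqrt_mul (by positivity)]
    calc 2 * R * (4 * (√(M₃ + M₂) * √R)) * (2 * min M₃ M₂)
        = 16 * (R * √R) * (√(M₃ + M₂) * min M₃ M₂) := by ring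
      _ ≤ 16 * (R * √R) * (2 * (√M₃ * M₂)) := by gcongr
      _ = _ := by ring
  rw [← ofReal_rpow_half (by positivity)]
  refine le_trans (l2_mono_ae ?_) (l2_restricted_conv_le h₁ h₂ hK hvol)
  filter_upwards with ζ
  by_cases hζ : ζ ∈ {ζ : SpaceTime | |modulation ζ| ≤ M₃ ∧ |ζ 0| ≤ R}
  swap
  · rw [indicator_of_notMem hζ]; exact zero_le
  rw [indicator_of_mem hζ]
  refine lintegral_mono_ae ?_
  filter_upwards [ae_coord_ne_zero] with ζ' hζ'
  by_cases hF : F₂ (ζ - ζ') = 0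
  · simp [hF]
  gcongr
  by_cases h : |ζ 0 - ζ' 0| ≤ |ζ' 0|
  · have hmem : (ζ', ζ) ∈ K := by
      refine ⟨hζ', ⟨hζ.1, ?_⟩, hζ.2, ?_⟩
      · have := hF₂ _ hF
        rwa [← neg_sub, modulation_neg, abs_neg] at this
      · rw [abs_sub_comm]; exact h
    rw [indicator_of_mem hmem]
    exact indicator_le_self' (fun _ _ => zero_le) _
  · rw [indicator_of_notMem (by exact h)]; exact zero_le

/-- Low output frequency. -/
theorem l2_conv_low_le {F₁ F₂ : SpaceTime → ℝ≥0∞} (h₁ : Measurable F₁)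
    (h₂ : Measurable F₂) {M₁ M₂ M₃ R L : ℝ} (hL : 0 < L) (hM₁ : L ≤ M₁) (hM₂ : L ≤ M₂)
    (hM₃ : 0 ≤ M₃) (hR : 0 ≤ R)
    (hF₁ : ∀ ζ, F₁ ζ ≠ 0 → |modulation ζ| ≤ M₁) (hF₂ : ∀ ζ, F₂ ζ ≠ 0 → |modulation ζ| ≤ M₂) :
    l2 ({ζ : SpaceTime | |modulation ζ| ≤ M₃ ∧ |ζ 0| ≤ R}.indicator (conv F₁ F₂)) ≤
      ENNReal.ofReal (2 * √(32 * (R * √R) * √M₃ * (M₁ * M₂ / L))) * (l2 F₁ * l2 F₂) := by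
  set D := {ζ : SpaceTime | |modulation ζ| ≤ M₃ ∧ |ζ 0| ≤ R} with hD
  have hDm : MeasurableSet D :=
    (measurableSet_le measurable_modulation.abs measurable_const).inter
      (measurableSet_abs_coord_le 0 R)
  let P : (SpaceTime → ℝ≥0∞) → (SpaceTime → ℝ≥0∞) → SpaceTime → ℝ≥0∞ := fun F G => D.indicator
    fun ζ => ∫⁻ ζ', {ζ' : SpaceTime | |ζ 0 - ζ' 0| ≤ |ζ' 0|}.indicator 1 ζ' * (F ζ' * G (ζ - ζ'))
  have hset : MeasurableSet {z : SpaceTime × SpaceTime | |z.1 0 - z.2 0| ≤ |z.2 0|} :=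
    (isClosed_le (by fun_prop) (by fun_prop)).measurableSet
  have hind : Measurable fun z : SpaceTime × SpaceTime =>
      {ζ' : SpaceTime | |z.1 0 - ζ' 0| ≤ |ζ' 0|}.indicator (1 : SpaceTime → ℝ≥0∞) z.2 :=
    measurable_one.indicator hset
  have hPm : ∀ F G : SpaceTime → ℝ≥0∞, Measurable F → Measurable G → Measurable (P F G) := by
    intro F G hF hG
    refine Measurable.indicator ?_ hDm
    have : Measurable fun z : SpaceTime × SpaceTime =>
        {ζ' : SpaceTime | |z.1 0 - ζ' 0| ≤ |ζ' 0|}.indicator (1 : SpaceTime → ℝ≥0∞) z.2 *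
          (F z.2 * G (z.1 - z.2)) := hind.mul (by fun_prop)
    exact this.lintegral_prod_right'
  -- In every pair one of the inputs has the larger |ξ|; the reflection ζ' ↦ ζ - ζ' exchanges the
  -- two cases.
  have hle : ∀ ζ, D.indicator (conv F₁ F₂) ζ ≤ P F₁ F₂ ζ + P F₂ F₁ ζ := by
    intro ζ
    by_cases hζ : ζ ∈ D
    swap
    · simp [P, indicator_of_notMem hζ]
    simp only [P, indicator_of_mem hζ]
    have hswap : (∫⁻ ζ', {ζ' : SpaceTime | |ζ 0 - ζ' 0| ≤ |ζ' 0|}.indicator 1 ζ' *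
        (F₂ ζ' * F₁ (ζ - ζ'))) = ∫⁻ ζ', {ζ' : SpaceTime | |ζ 0 - ζ' 0| ≤ |ζ' 0|}.indicator 1
          (ζ - ζ') * (F₁ ζ' * F₂ (ζ - ζ')) := by
      rw [← lintegral_sub_left_eq_self _ ζ]
      simp [mul_comm]
    have hi : ∀ ζ : SpaceTime, Measurable fun ζ' : SpaceTime =>
        {ζ' : SpaceTime | |ζ 0 - ζ' 0| ≤ |ζ' 0|}.indicator (1 : SpaceTime → ℝ≥0∞) ζ' :=
      fun ζ => hind.comp (measurable_const.prodMk measurable_id)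
    have hm : Measurable fun ζ' : SpaceTime =>
        {ζ' : SpaceTime | |ζ 0 - ζ' 0| ≤ |ζ' 0|}.indicator (1 : SpaceTime → ℝ≥0∞) ζ' *
          (F₁ ζ' * F₂ (ζ - ζ')) := (hi ζ).mul (by fun_prop)
    rw [hswap]
    refine le_of_le_of_eq ?_ (lintegral_add_left hm _)
    refine lintegral_mono fun ζ' => ?_
    rw [← add_mul]
    refine le_mul_of_one_le_left zero_le ?_
    rcases le_total |ζ 0 - ζ' 0| |ζ' 0| with h | h
    · rw [indicator_of_mem (by exact h)]; exact le_self_add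
    · rw [indicator_of_mem (a := ζ - ζ')
        (by simpa only [mem_ofPred_eq, PiLp.sub_apply, sub_sub_cancel] using h)]
      exact le_add_self
  refine (l2_mono hle).trans ((l2_add_le (hPm _ _ h₁ h₂) (hPm _ _ h₂ h₁)).trans ?_)
  have b1 := l2_restricted_conv_low_le h₁ h₂ (hL.le.trans hM₂) hM₃ hR hF₂
  have b2 := l2_restricted_conv_low_le h₂ h₁ (hL.le.trans hM₁) hM₃ hR hF₁
  -- Since M₁ ≥ L, the absent modulation can be inserted at the cost of 1/L, which makes the bound
  -- symmetric in M₁ and M₂.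
  have c1 : √(32 * (R * √R) * √M₃ * M₂) ≤ √(32 * (R * √R) * √M₃ * (M₁ * M₂ / L)) := by
    gcongr
    rw [le_div_iff₀ hL, mul_comm]
    exact mul_le_mul_of_nonneg_right hM₁ (hL.le.trans hM₂)
  have c2 : √(32 * (R * √R) * √M₃ * M₁) ≤ √(32 * (R * √R) * √M₃ * (M₁ * M₂ / L)) := by
    gcongr
    rw [le_div_iff₀ hL]
    exact mul_le_mul_of_nonneg_left hM₂ (hL.le.trans hM₁)
  rw [mul_comm (l2 F₂)] at b2
  rw [two_mul, ENNReal.ofReal_add (by positivity) (by positivity), add_mul]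
  refine add_le_add (b1.trans ?_) (b2.trans ?_) <;> gcongr

/-- Interaction of a high frequency with a low frequency. -/
theorem l2_conv_high_low_le {F₁ F₂ : SpaceTime → ℝ≥0∞} (h₁ : Measurable F₁)
    (h₂ : Measurable F₂) {M₁ M₂ M₃ R L X : ℝ} (hL : 0 < L) (hM₁ : L ≤ M₁) (hM₂ : L ≤ M₂)
    (hM₃ : L ≤ M₃) (hR : 0 ≤ R) (hX : 0 < X)
    (hF₁ : ∀ ζ, F₁ ζ ≠ 0 → |modulation ζ| ≤ M₁) (hF₂ : ∀ ζ, F₂ ζ ≠ 0 → |modulation ζ| ≤ M₂)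
    (hF₂R : ∀ ζ, F₂ ζ ≠ 0 → |ζ 0| ≤ R) :
    l2 ({ζ : SpaceTime | |modulation ζ| ≤ M₃ ∧ X ≤ |ζ 0|}.indicator (conv F₁ F₂)) ≤
      ENNReal.ofReal √(60 * (R * (M₁ * M₂) * √(M₃ / L) / X)) * (l2 F₁ * l2 F₂) := by
  set D := {ζ : SpaceTime | |modulation ζ| ≤ M₃ ∧ X ≤ |ζ 0|} with hD
  have hM₁0 : 0 < M₁ := hL.trans_le hM₁
  have hM₂0 : 0 < M₂ := hL.trans_le hM₂
  have hM₃0 : 0 < M₃ := hL.trans_le hM₃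
  have e : D.indicator (conv F₁ F₂) = fun ζ => D.indicator 1 ζ * conv F₁ F₂ ζ := by
    funext ζ
    by_cases h : ζ ∈ D <;> simp [h]
  rw [e, ← ofReal_rpow_half (by positivity)]
  refine l2_mul_conv_le h₁ h₂ fun ζ => ?_
  by_cases hζ : ζ ∈ D
  swap
  · simp [hζ]
  rw [indicator_of_mem hζ, Pi.one_apply, one_pow, one_mul]
  have hζ0 : 0 < |ζ 0| := hX.trans_le hζ.2
  refine (measure_mono ?_).trans ((volume_pairSet_resonant_le hM₁0.le hM₂0.le hζ.1 hR
    (abs_pos.1 hζ0)).trans (ENNReal.ofReal_le_ofReal ?_))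
  · rintro ζ' ⟨h1, h2⟩
    refine ⟨⟨hF₁ _ h1, hF₂ _ h2⟩, ?_⟩
    simpa using hF₂R _ h2
  · have hP : 0 ≤ max M₁ M₂ := le_max_of_le_left hM₁0.le
    have k1 : M₁ + M₂ ≤ 2 * max M₁ M₂ := by linarith [le_max_left M₁ M₂, le_max_right M₁ M₂]
    have hq : 1 ≤ M₃ / L := by rwa [one_le_div hL]
    -- Both max(M₁, M₂) and M₃ are at least L, so each is at most the product max(M₁, M₂)·M₃/L.
    have k2 : M₁ + M₂ + M₃ ≤ 3 * max M₁ M₂ * (M₃ / L) := by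
      have a1 : max M₁ M₂ ≤ max M₁ M₂ * (M₃ / L) := le_mul_of_one_le_right hP hq
      have a2 : M₃ ≤ max M₁ M₂ * (M₃ / L) := by
        rw [mul_div_assoc', le_div_iff₀ hL]
        nlinarith [le_max_left M₁ M₂]
      nlinarith
    have k3 : √((M₁ + M₂) * (M₁ + M₂ + M₃)) ≤ 5 / 2 * max M₁ M₂ * √(M₃ / L) := by
      rw [Real.sqrt_le_left (by positivity), mul_pow, Real.sq_sqrt (by positivity)]
      calc (M₁ + M₂) * (M₁ + M₂ + M₃) ≤ (2 * max M₁ M₂) * (3 * max M₁ M₂ * (M₃ / L)) := by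
            gcongr
        _ = 6 * ((max M₁ M₂) ^ 2 * (M₃ / L)) := by ring
        _ ≤ 25 / 4 * ((max M₁ M₂) ^ 2 * (M₃ / L)) := by gcongr; norm_num
        _ = _ := by ring
    calc 2 * R * (6 * √((M₁ + M₂) * (M₁ + M₂ + M₃)) / |ζ 0|) * (2 * min M₁ M₂)
        ≤ 2 * R * (6 * (5 / 2 * max M₁ M₂ * √(M₃ / L)) / X) * (2 * min M₁ M₂) := by
          have : 0 ≤ min M₁ M₂ := le_min hM₁0.le hM₂0.le
          gcongr
          exact hζ.2
      _ = 60 * (R * (max M₁ M₂ * min M₁ M₂) * √(M₃ / L) / X) := by ring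
      _ = _ := by rw [max_mul_min]

/-- Output far from the characteristic surface. -/
theorem l2_conv_far_le {F₁ F₂ : SpaceTime → ℝ≥0∞} (h₁ : Measurable F₁)
    (h₂ : Measurable F₂) {M₁ M₂ R B : ℝ} (hM₁ : 0 ≤ M₁) (hM₂ : 0 ≤ M₂) (hB : 2 ≤ B)
    (hR : 0 ≤ R)
    (hF₁ : ∀ ζ, F₁ ζ ≠ 0 → |modulation ζ| ≤ M₁) (hF₂ : ∀ ζ, F₂ ζ ≠ 0 → |modulation ζ| ≤ M₂)
    (hF₁B : ∀ ζ, F₁ ζ ≠ 0 → |ζ 0| ≤ B) (hF₂B : ∀ ζ, F₂ ζ ≠ 0 → |ζ 0| ≤ B) :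
    l2 ({ζ : SpaceTime | 8 * B ^ 4 ≤ |modulation ζ| ∧ |ζ 0| ≤ R}.indicator
      fun ζ => ENNReal.ofReal |ζ 0| * conv F₁ F₂ ζ) ≤
      ENNReal.ofReal √(16 * (R * √R * (M₁ * M₂))) * (l2 F₁ * l2 F₂) := by
  set D := {ζ : SpaceTime | 8 * B ^ 4 ≤ |modulation ζ| ∧ |ζ 0| ≤ R} with hD
  have e : D.indicator (fun ζ => ENNReal.ofReal |ζ 0| * conv F₁ F₂ ζ) =
      fun ζ => D.indicator (fun ζ => ENNReal.ofReal |ζ 0|) ζ * conv F₁ F₂ ζ := by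
    funext ζ
    by_cases h : ζ ∈ D <;> simp [h]
  rw [e, ← ofReal_rpow_half (by positivity)]
  refine l2_mul_conv_le h₁ h₂ fun ζ => ?_
  by_cases hζ : ζ ∈ D
  swap
  · simp [hζ]
  rw [indicator_of_mem hζ]
  rcases eq_or_ne (ζ 0) 0 with h0 | h0
  · simp [h0]
  have hζ0 : 0 < |ζ 0| := abs_pos.2 h0
  have hmin : 0 ≤ min M₁ M₂ := le_min hM₁ hM₂
  calc ENNReal.ofReal |ζ 0| ^ 2 * volume {ζ' | F₁ ζ' ≠ 0 ∧ F₂ (ζ - ζ') ≠ 0}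
      ≤ ENNReal.ofReal |ζ 0| ^ 2 * ENNReal.ofReal (8 * (M₁ + M₂) * min M₁ M₂ / √|ζ 0|) := by
        gcongr
        refine (measure_mono ?_).trans (volume_pairSet_far_le hM₁ hM₂ hB hζ.1 h0)
        rintro ζ' ⟨h1, h2⟩
        exact ⟨⟨hF₁ _ h1, hF₂ _ h2⟩, hF₁B _ h1, by simpa using hF₂B _ h2⟩
    _ = ENNReal.ofReal (|ζ 0| ^ 2 * (8 * (M₁ + M₂) * min M₁ M₂ / √|ζ 0|)) := by
        rw [ENNReal.ofReal_mul (by positivity), ENNReal.ofReal_pow (abs_nonneg _)]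
    _ ≤ _ := by
        refine ENNReal.ofReal_le_ofReal ?_
        have hs : 0 < √|ζ 0| := Real.sqrt_pos.2 hζ0
        have k1 : M₁ + M₂ ≤ 2 * max M₁ M₂ := by linarith [le_max_left M₁ M₂, le_max_right M₁ M₂]
        have k2 : |ζ 0| ^ 2 / √|ζ 0| = |ζ 0| * √|ζ 0| := by
          rw [div_eq_iff hs.ne', mul_assoc, Real.mul_self_sqrt hζ0.le, sq]
        calc |ζ 0| ^ 2 * (8 * (M₁ + M₂) * min M₁ M₂ / √|ζ 0|)
            = 8 * (|ζ 0| ^ 2 / √|ζ 0|) * (M₁ + M₂) * min M₁ M₂ := by ring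
          _ = 8 * (|ζ 0| * √|ζ 0|) * (M₁ + M₂) * min M₁ M₂ := by rw [k2]
          _ ≤ 8 * (R * √R) * (2 * max M₁ M₂) * min M₁ M₂ := by
              gcongr
              · exact hζ.2
              · exact hζ.2
          _ = 16 * (R * √R * (max M₁ M₂ * min M₁ M₂)) := by ring
          _ = _ := by rw [max_mul_min]

/-! ### Sharp modulation shells -/

/-- Real powers of two as elements of `[0, ∞]`. -/
def W (x : ℝ) : ℝ≥0∞ := ENNReal.ofReal ((2 : ℝ) ^ x)

theorem W_add (x y : ℝ) : W (x + y) = W x * W y := by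
  rw [W, W, W, ← ENNReal.ofReal_mul (by positivity), Real.rpow_add (by norm_num)]

theorem W_mono {x y : ℝ} (h : x ≤ y) : W x ≤ W y :=
  ENNReal.ofReal_le_ofReal (Real.rpow_le_rpow_of_exponent_le (by norm_num) h)

theorem W_ne_top (x : ℝ) : W x ≠ ⊤ := ENNReal.ofReal_ne_top

theorem W_pos (x : ℝ) : 0 < W x := ENNReal.ofReal_pos.2 (by positivity)

theorem W_zero : W 0 = 1 := by simp [W]

theorem W_one : W 1 = 2 := by simp [W]

theorem W_mul_nat (x : ℝ) (n : ℕ) : W (x * n) = W x ^ n := by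
  rw [W, W, ← ENNReal.ofReal_pow (by positivity), Real.rpow_mul (by norm_num), Real.rpow_natCast]

/-- The sum of a geometric series of powers of two. -/
def geomConst (x : ℝ) : ℝ≥0∞ := ∑' n : ℕ, W (-x * n)

theorem geomConst_ne_top {x : ℝ} (hx : 0 < x) : geomConst x ≠ ⊤ := by
  unfold geomConst
  simp_rw [W_mul_nat]
  rw [ENNReal.tsum_geometric]
  refine ENNReal.inv_ne_top.2 (tsub_pos_of_lt ?_).ne'
  rw [← W_zero, W, W]
  refine (ENNReal.ofReal_lt_ofReal_iff (by positivity)).2 ?_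
  exact Real.rpow_lt_rpow_of_exponent_lt (by norm_num) (by linarith)

/-- Read from the top term downwards, the sum is part of a geometric series with ratio 2^{-x}. -/
theorem sum_range_W_le {x : ℝ} (N : ℕ) :
    ∑ n ∈ Finset.range (N + 1), W (x * n) ≤ W (x * N) * geomConst x := by
  rw [← Finset.sum_range_reflect]
  calc ∑ j ∈ Finset.range (N + 1), W (x * ((N + 1 - 1 - j : ℕ) : ℝ))
      = ∑ j ∈ Finset.range (N + 1), W (x * N) * W (-x * j) := by
        refine Finset.sum_congr rfl fun j hj => ?_
        rw [← W_add]
        have : j ≤ N := Nat.lt_succ_iff.1 (Finset.mem_range.1 hj)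
        congr 1
        push_cast [Nat.add_sub_cancel, Nat.cast_sub this]
        ring
    _ = W (x * N) * ∑ j ∈ Finset.range (N + 1), W (-x * j) := by rw [Finset.mul_sum]
    _ ≤ _ := by gcongr; exact ENNReal.sum_le_tsum _

/-- The sharp dyadic shells of modulation above the scale `2^l`. -/
def shell (l : ℕ) : ℕ → Set SpaceTime
  | 0 => {ζ | |modulation ζ| ≤ 2 ^ l}
  | n + 1 => {ζ | 2 ^ (l + n) < |modulation ζ| ∧ |modulation ζ| ≤ 2 ^ (l + n + 1)}

theorem measurableSet_shell (l n : ℕ) : MeasurableSet (shell l n) := by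
  have h := measurable_modulation.abs
  cases n with
  | zero => exact measurableSet_le h measurable_const
  | succ n => exact (measurableSet_lt measurable_const h).inter (measurableSet_le h measurable_const)

theorem abs_modulation_le_of_mem_shell {l n : ℕ} {ζ : SpaceTime} (h : ζ ∈ shell l n) :
    |modulation ζ| ≤ 2 ^ (l + n) := by
  cases n with
  | zero => exact h
  | succ n => exact h.2

theorem exists_mem_shell (l : ℕ) (ζ : SpaceTime) : ∃ n, ζ ∈ shell l n := by
  have hex : ∃ n : ℕ, |modulation ζ| ≤ 2 ^ (l + n) := by
    obtain ⟨n, hn⟩ := pow_unbounded_of_one_lt |modulation ζ| (one_lt_two (α := ℝ))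
    refine ⟨n, hn.le.trans (pow_le_pow_right₀ (by norm_num) (by omega))⟩
  classical
  refine ⟨Nat.find hex, ?_⟩
  rcases h : Nat.find hex with _ | n
  · have := Nat.find_spec hex
    rw [h] at this
    exact this
  · refine ⟨?_, by have := Nat.find_spec hex; rw [h] at this; exact this⟩
    have := Nat.find_min hex (m := n) (by omega)
    exact not_le.1 this

theorem mem_shell_unique {l m n : ℕ} {ζ : SpaceTime} (hm : ζ ∈ shell l m) (hn : ζ ∈ shell l n) :
    m = n := by
  have key : ∀ m n, m < n → ζ ∈ shell l m → ζ ∈ shell l n → False := by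
    intro m n hmn hm hn
    obtain ⟨n, rfl⟩ : ∃ k, n = k + 1 := ⟨n - 1, by omega⟩
    have h1 := abs_modulation_le_of_mem_shell hm
    have h2 := hn.1
    have h3 : (2 : ℝ) ^ (l + m) ≤ 2 ^ (l + n) := pow_le_pow_right₀ (by norm_num) (by omega)
    linarith
  rcases lt_trichotomy m n with h | h | h
  · exact (key _ _ h hm hn).elim
  · exact h
  · exact (key _ _ h hn hm).elim

theorem tsum_indicator_shell (l : ℕ) (F : SpaceTime → ℝ≥0∞) (ζ : SpaceTime) :
    ∑' n, (shell l n).indicator F ζ = F ζ := by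
  obtain ⟨n, hn⟩ := exists_mem_shell l ζ
  rw [tsum_eq_single n, indicator_of_mem hn]
  intro m hm
  exact indicator_of_notMem (fun h => hm (mem_shell_unique h hn)) _

/-- The `X`-type norm above the modulation scale `2^l`, with sharp cutoffs. -/
def yNorm (l : ℕ) (F : SpaceTime → ℝ≥0∞) : ℝ≥0∞ :=
  ∑' n : ℕ, W ((l + n : ℝ) / 2) * l2 ((shell l n).indicator F)

/-- The dual-type norm above the modulation scale `2^l`, with sharp cutoffs. -/
def zNorm (l : ℕ) (F : SpaceTime → ℝ≥0∞) : ℝ≥0∞ :=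
  ∑' n : ℕ, W (-(l + n : ℝ) / 2) * l2 ((shell l n).indicator F)

theorem yNorm_mono_ae {l : ℕ} {F G : SpaceTime → ℝ≥0∞} (h : ∀ᵐ ζ, F ζ ≤ G ζ) :
    yNorm l F ≤ yNorm l G := by
  refine ENNReal.tsum_le_tsum fun n => ?_
  gcongr
  refine l2_mono_ae (h.mono fun ζ hζ => ?_)
  by_cases h : ζ ∈ shell l n <;> simp [h, hζ]

theorem zNorm_mono_ae {l : ℕ} {F G : SpaceTime → ℝ≥0∞} (h : ∀ᵐ ζ, F ζ ≤ G ζ) :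
    zNorm l F ≤ zNorm l G := by
  refine ENNReal.tsum_le_tsum fun n => ?_
  gcongr
  refine l2_mono_ae (h.mono fun ζ hζ => ?_)
  by_cases h : ζ ∈ shell l n <;> simp [h, hζ]

theorem weighted_tsum_le (a : ℕ → ℝ≥0∞) (l : ℕ) {ι : Type*} [Countable ι]
    {F : ι → SpaceTime → ℝ≥0∞} (hF : ∀ i, Measurable (F i)) :
    ∑' n : ℕ, a n * l2 ((shell l n).indicator fun ζ => ∑' i, F i ζ) ≤
      ∑' i, ∑' n : ℕ, a n * l2 ((shell l n).indicator (F i)) := by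
  rw [ENNReal.tsum_comm]
  refine ENNReal.tsum_le_tsum fun n => ?_
  rw [ENNReal.tsum_mul_left]
  gcongr
  refine le_trans (le_of_eq ?_) (l2_tsum_le fun i => (hF i).indicator (measurableSet_shell l n))
  congr 1
  funext ζ
  by_cases h : ζ ∈ shell l n <;> simp [h]

theorem yNorm_tsum_le (l : ℕ) {ι : Type*} [Countable ι] {F : ι → SpaceTime → ℝ≥0∞}
    (hF : ∀ i, Measurable (F i)) : yNorm l (fun ζ => ∑' i, F i ζ) ≤ ∑' i, yNorm l (F i) :=
  weighted_tsum_le _ l hF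

theorem zNorm_tsum_le (l : ℕ) {ι : Type*} [Countable ι] {F : ι → SpaceTime → ℝ≥0∞}
    (hF : ∀ i, Measurable (F i)) : zNorm l (fun ζ => ∑' i, F i ζ) ≤ ∑' i, zNorm l (F i) :=
  weighted_tsum_le _ l hF

theorem indicator_const_mul (S : Set SpaceTime) (c : ℝ≥0∞) (F : SpaceTime → ℝ≥0∞) :
    (S.indicator fun ζ => c * F ζ) = fun ζ => c * S.indicator F ζ := by
  funext ζ
  by_cases h : ζ ∈ S <;> simp [h]

theorem yNorm_const_mul (l : ℕ) (c : ℝ≥0∞) {F : SpaceTime → ℝ≥0∞} (hF : Measurable F) :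
    yNorm l (fun ζ => c * F ζ) = c * yNorm l F := by
  unfold yNorm
  rw [← ENNReal.tsum_mul_left]
  refine tsum_congr fun n => ?_
  rw [indicator_const_mul, l2_const_mul c (hF.indicator (measurableSet_shell l n))]
  ring

theorem zNorm_const_mul (l : ℕ) (c : ℝ≥0∞) {F : SpaceTime → ℝ≥0∞} (hF : Measurable F) :
    zNorm l (fun ζ => c * F ζ) = c * zNorm l F := by
  unfold zNorm
  rw [← ENNReal.tsum_mul_left]
  refine tsum_congr fun n => ?_
  rw [indicator_const_mul, l2_const_mul c (hF.indicator (measurableSet_shell l n))]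
  ring

theorem l2_indicator_le {α : Type*} [MeasureSpace α] (S : Set α) (F : α → ℝ≥0∞) :
    l2 (S.indicator F) ≤ l2 F :=
  l2_mono fun _ => indicator_le_self' (fun _ _ => zero_le) _

/-- The weights grow geometrically, so the top shell 2^m dominates the shells between 2^l and 2^m.
-/
theorem yNorm_le_of_modulation_le {l m : ℕ} (hlm : l ≤ m) {F : SpaceTime → ℝ≥0∞}
    (hF : ∀ ζ, F ζ ≠ 0 → |modulation ζ| ≤ 2 ^ m) :
    yNorm l F ≤ geomConst (1 / 2) * (W (m / 2) * l2 F) := by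
  obtain ⟨d, rfl⟩ := Nat.exists_eq_add_of_le hlm
  have h0 : ∀ n ∉ Finset.range (d + 1), W ((l + n : ℝ) / 2) * l2 ((shell l n).indicator F) = 0 := by
    intro n hn
    rw [Finset.mem_range, not_lt] at hn
    have : (shell l n).indicator F = fun _ => 0 := by
      funext ζ
      by_cases hζ : ζ ∈ shell l n
      · rw [indicator_of_mem hζ]
        by_contra hne
        have h1 := hF ζ hne
        obtain ⟨n, rfl⟩ : ∃ k, n = k + 1 := ⟨n - 1, by omega⟩
        have h2 := hζ.1
        have h3 : (2 : ℝ) ^ (l + d) ≤ 2 ^ (l + n) := pow_le_pow_right₀ (by norm_num) (by omega)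
        linarith
      · exact indicator_of_notMem hζ _
    rw [this, l2_zero, mul_zero]
  rw [yNorm, tsum_eq_sum h0]
  calc ∑ n ∈ Finset.range (d + 1), W ((l + n : ℝ) / 2) * l2 ((shell l n).indicator F)
      ≤ ∑ n ∈ Finset.range (d + 1), W (l / 2) * W (1 / 2 * n) * l2 F := by
        refine Finset.sum_le_sum fun n _ => ?_
        rw [← W_add]
        gcongr
        · exact W_mono (by ring_nf; rfl)
        · exact l2_indicator_le _ _
    _ = W (l / 2) * (∑ n ∈ Finset.range (d + 1), W (1 / 2 * n)) * l2 F := by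
        rw [Finset.mul_sum, Finset.sum_mul]
    _ ≤ W (l / 2) * (W (1 / 2 * d) * geomConst (1 / 2)) * l2 F := by
        gcongr; exact sum_range_W_le d
    _ = geomConst (1 / 2) * (W (l / 2) * W (1 / 2 * d) * l2 F) := by ring
    _ = _ := by
        rw [← W_add]; congr 3; push_cast; ring_nf

/-! ### Bilinear estimates in the sharp norms -/

theorem conv_eq_tsum (l : ℕ) {F₁ F₂ : SpaceTime → ℝ≥0∞} (h₁ : Measurable F₁)
    (h₂ : Measurable F₂) (ζ : SpaceTime) : conv F₁ F₂ ζ =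
      ∑' i : ℕ × ℕ, conv ((shell l i.1).indicator F₁) ((shell l i.2).indicator F₂) ζ := by
  unfold conv
  rw [← lintegral_tsum]
  · refine lintegral_congr fun ζ' => ?_
    rw [ENNReal.tsum_prod (f := fun m n => (shell l m).indicator F₁ ζ' *
      (shell l n).indicator F₂ (ζ - ζ'))]
    simp_rw [ENNReal.tsum_mul_left, ENNReal.tsum_mul_right, tsum_indicator_shell]
  · intro i
    exact ((h₁.indicator (measurableSet_shell l _)).mul ((h₂.indicator
      (measurableSet_shell l _)).comp (measurable_const.sub measurable_id))).aemeasurable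

/-- A countably subadditive functional is bounded on convolutions if it is so on pieces of fixed
modulation. -/
theorem bilinear_of_shell (Z : (SpaceTime → ℝ≥0∞) → ℝ≥0∞)
    (hZ : ∀ H : ℕ × ℕ → SpaceTime → ℝ≥0∞, (∀ i, Measurable (H i)) →
      Z (fun ζ => ∑' i, H i ζ) ≤ ∑' i, Z (H i)) (l : ℕ) (B : ℝ≥0∞)
    {F₁ F₂ : SpaceTime → ℝ≥0∞} (h₁ : Measurable F₁) (h₂ : Measurable F₂)
    (h : ∀ m n : ℕ, Z (conv ((shell l m).indicator F₁) ((shell l n).indicator F₂)) ≤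
      B * (W ((l + m : ℝ) / 2) * l2 ((shell l m).indicator F₁)) *
        (W ((l + n : ℝ) / 2) * l2 ((shell l n).indicator F₂))) :
    Z (conv F₁ F₂) ≤ B * yNorm l F₁ * yNorm l F₂ := by
  have e : conv F₁ F₂ = fun ζ => ∑' i : ℕ × ℕ,
      conv ((shell l i.1).indicator F₁) ((shell l i.2).indicator F₂) ζ :=
    funext (conv_eq_tsum l h₁ h₂)
  rw [e]
  refine (hZ _ fun i => measurable_conv (h₁.indicator (measurableSet_shell l _))
    (h₂.indicator (measurableSet_shell l _))).trans ?_
  have e2 : (∑' i : ℕ × ℕ, B * (W ((l + i.1 : ℝ) / 2) * l2 ((shell l i.1).indicator F₁)) *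
      (W ((l + i.2 : ℝ) / 2) * l2 ((shell l i.2).indicator F₂))) =
      B * yNorm l F₁ * yNorm l F₂ := by
    rw [ENNReal.tsum_prod (f := fun m n : ℕ =>
      B * (W ((l + m : ℝ) / 2) * l2 ((shell l m).indicator F₁)) *
        (W ((l + n : ℝ) / 2) * l2 ((shell l n).indicator F₂)))]
    simp_rw [ENNReal.tsum_mul_left, ENNReal.tsum_mul_right]
    rw [ENNReal.tsum_mul_left, yNorm, yNorm]
  rw [← e2]
  exact ENNReal.tsum_le_tsum fun i => h i.1 i.2

theorem sqrt_two_rpow (x : ℝ) : √((2 : ℝ) ^ x) = 2 ^ (x / 2) := by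
  rw [Real.sqrt_eq_rpow, ← Real.rpow_mul (by norm_num)]; ring_nf

theorem two_pow_eq_rpow (n : ℕ) : (2 : ℝ) ^ n = (2 : ℝ) ^ (n : ℝ) := (Real.rpow_natCast _ _).symm

theorem modulation_le_of_indicator_shell_ne_zero {l n : ℕ} {F : SpaceTime → ℝ≥0∞}
    (ζ : SpaceTime) (h : (shell l n).indicator F ζ ≠ 0) : |modulation ζ| ≤ 2 ^ (l + n) :=
  abs_modulation_le_of_mem_shell (mem_of_indicator_ne_zero h)

theorem ne_zero_of_indicator_ne_zero {S : Set SpaceTime} {F : SpaceTime → ℝ≥0∞}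
    {ζ : SpaceTime} (h : S.indicator F ζ ≠ 0) : F ζ ≠ 0 := by
  intro h0
  exact h (by by_cases hS : ζ ∈ S <;> simp [hS, h0])

theorem zNorm_indicator_tsum_le (l : ℕ) {D : Set SpaceTime} (hD : MeasurableSet D)
    (H : ℕ × ℕ → SpaceTime → ℝ≥0∞) (hH : ∀ i, Measurable (H i)) :
    zNorm l (D.indicator fun ζ => ∑' i, H i ζ) ≤ ∑' i, zNorm l (D.indicator (H i)) := by
  refine le_trans (le_of_eq ?_) (zNorm_tsum_le l fun i => (hH i).indicator hD)
  congr 1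
  funext ζ
  by_cases h : ζ ∈ D <;> simp [h]

/-- Estimate for outputs of low frequency. -/
theorem zNorm_conv_low_le (k l : ℕ) {F₁ F₂ : SpaceTime → ℝ≥0∞} (h₁ : Measurable F₁)
    (h₂ : Measurable F₂) :
    zNorm k ({ζ : SpaceTime | |ζ 0| ≤ 2 ^ (k + 1)}.indicator (conv F₁ F₂)) ≤
      geomConst (1 / 4) * W ((k - l : ℝ) / 2 + 17 / 4) * yNorm l F₁ * yNorm l F₂ := by
  refine bilinear_of_shell (fun H => zNorm k ({ζ : SpaceTime | |ζ 0| ≤ 2 ^ (k + 1)}.indicator H))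
    (zNorm_indicator_tsum_le k (measurableSet_abs_coord_le 0 _)) l _ h₁ h₂ fun m n => ?_
  set G₁ := (shell l m).indicator F₁
  set G₂ := (shell l n).indicator F₂
  have hG₁ : Measurable G₁ := h₁.indicator (measurableSet_shell l m)
  have hG₂ : Measurable G₂ := h₂.indicator (measurableSet_shell l n)
  have key : ∀ p : ℕ, W (-(k + p : ℝ) / 2) * l2 ((shell k p).indicator
      ({ζ : SpaceTime | |ζ 0| ≤ 2 ^ (k + 1)}.indicator (conv G₁ G₂))) ≤
      W (-(1 / 4) * p) * (W ((k - l : ℝ) / 2 + 17 / 4) * (W ((l + m : ℝ) / 2) * l2 G₁) *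
        (W ((l + n : ℝ) / 2) * l2 G₂)) := by
    intro p
    have e := l2_conv_low_le hG₁ hG₂ (M₁ := 2 ^ (l + m)) (M₂ := 2 ^ (l + n))
      (M₃ := 2 ^ (k + p)) (R := 2 ^ (k + 1)) (L := 2 ^ l) (by positivity)
      (pow_le_pow_right₀ (by norm_num) (by omega)) (pow_le_pow_right₀ (by norm_num) (by omega))
      (by positivity) (by positivity)
      modulation_le_of_indicator_shell_ne_zero modulation_le_of_indicator_shell_ne_zero
    -- Everything is a power of 2. Combined with the weight -(k + p)/2, the exponents add up to (k -
    -- l)/2 + 17/4 - p/4 besides the input weights, and the -p/4 is summed over the output shells.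
    have hx : 2 * √(32 * ((2 : ℝ) ^ (k + 1) * √(2 ^ (k + 1))) * √(2 ^ (k + p)) *
        (2 ^ (l + m) * 2 ^ (l + n) / 2 ^ l)) =
        2 ^ ((7 / 2 : ℝ) + 3 / 4 * (k + 1) + (k + p) / 4 + (l + m) / 2 + (l + n) / 2 - l / 2) := by
      rw [show (32 : ℝ) = 2 ^ (5 : ℝ) by norm_num]
      simp_rw [two_pow_eq_rpow, sqrt_two_rpow]
      rw [← Real.rpow_add (by norm_num), ← Real.rpow_add (by norm_num),
        ← Real.rpow_add (by norm_num), ← Real.rpow_add (by norm_num),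
        ← Real.rpow_sub (by norm_num), ← Real.rpow_add (by norm_num), sqrt_two_rpow]
      nth_rewrite 1 [← Real.rpow_one 2]
      rw [← Real.rpow_add (by norm_num)]
      congr 1
      push_cast
      ring
    rw [hx] at e
    change _ ≤ W _ * _ at e
    calc W (-(k + p : ℝ) / 2) * l2 ((shell k p).indicator
          ({ζ : SpaceTime | |ζ 0| ≤ 2 ^ (k + 1)}.indicator (conv G₁ G₂)))
        ≤ W (-(k + p : ℝ) / 2) * (W ((7 / 2 : ℝ) + 3 / 4 * (k + 1) + (k + p) / 4 + (l + m) / 2 +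
            (l + n) / 2 - l / 2) * (l2 G₁ * l2 G₂)) := by
          gcongr
          refine (l2_mono fun ζ => ?_).trans e
          rw [indicator_indicator]
          refine indicator_le_indicator_of_subset (fun ζ h => ?_) (fun _ => zero_le) ζ
          exact ⟨abs_modulation_le_of_mem_shell h.1, h.2⟩
      _ = W (-(1 / 4) * p) * W ((k - l : ℝ) / 2 + 17 / 4) * W ((l + m : ℝ) / 2) *
            W ((l + n : ℝ) / 2) * (l2 G₁ * l2 G₂) := by
          rw [← mul_assoc]
          simp_rw [← W_add]
          congr 2
          ring
      _ = _ := by ring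
  refine (ENNReal.tsum_le_tsum key).trans (le_of_eq ?_)
  rw [ENNReal.tsum_mul_right, geomConst]
  ring

/-- Estimate for interactions of high and low frequencies. -/
theorem zNorm_conv_high_low_le {k k₂ l : ℕ} (hkl : k ≤ l) {F₁ F₂ : SpaceTime → ℝ≥0∞}
    (h₁ : Measurable F₁) (h₂ : Measurable F₂) (hF₂ : ∀ ζ, F₂ ζ ≠ 0 → |ζ 0| ≤ 2 ^ (k₂ + 1)) :
    zNorm k ({ζ : SpaceTime | (2 : ℝ) ^ k / 2 ≤ |ζ 0|}.indicator (conv F₁ F₂)) ≤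
      geomConst (1 / 4) * W (k₂ / 2 - k + 4) * yNorm l F₁ * yNorm l F₂ := by
  have hD : MeasurableSet {ζ : SpaceTime | (2 : ℝ) ^ k / 2 ≤ |ζ 0|} :=
    (isClosed_le (by fun_prop) (by fun_prop)).measurableSet
  refine bilinear_of_shell (fun H => zNorm k ({ζ : SpaceTime | (2 : ℝ) ^ k / 2 ≤ |ζ 0|}.indicator H))
    (zNorm_indicator_tsum_le k hD) l _ h₁ h₂ fun m n => ?_
  set G₁ := (shell l m).indicator F₁
  set G₂ := (shell l n).indicator F₂ with hG₂def
  have hG₁ : Measurable G₁ := h₁.indicator (measurableSet_shell l m)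
  have hG₂ : Measurable G₂ := h₂.indicator (measurableSet_shell l n)
  have key : ∀ p : ℕ, W (-(k + p : ℝ) / 2) * l2 ((shell k p).indicator
      ({ζ : SpaceTime | (2 : ℝ) ^ k / 2 ≤ |ζ 0|}.indicator (conv G₁ G₂))) ≤
      W (-(1 / 4) * p) * (W (k₂ / 2 - k + 4) * (W ((l + m : ℝ) / 2) * l2 G₁) *
        (W ((l + n : ℝ) / 2) * l2 G₂)) := by
    intro p
    -- The common lower bound L is 2^k and not 2^l: the output shells start at 2^k, while the inputs
    -- have modulation bounds at least 2^l ≥ 2^k.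
    have e := l2_conv_high_low_le hG₁ hG₂ (M₁ := 2 ^ (l + m)) (M₂ := 2 ^ (l + n))
      (M₃ := 2 ^ (k + p)) (R := 2 ^ (k₂ + 1)) (L := 2 ^ k) (X := 2 ^ k / 2) (by positivity)
      (pow_le_pow_right₀ (by norm_num) (by omega)) (pow_le_pow_right₀ (by norm_num) (by omega))
      (pow_le_pow_right₀ (by norm_num) (by omega)) (by positivity) (by positivity)
      modulation_le_of_indicator_shell_ne_zero modulation_le_of_indicator_shell_ne_zero
      (fun ζ h => hF₂ ζ (ne_zero_of_indicator_ne_zero h))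
    have hx : √(60 * ((2 : ℝ) ^ (k₂ + 1) * (2 ^ (l + m) * 2 ^ (l + n)) *
        √(2 ^ (k + p) / 2 ^ k) / (2 ^ k / 2))) ≤
        2 ^ ((4 : ℝ) + k₂ / 2 + p / 4 + (l + m) / 2 + (l + n) / 2 - k / 2) := by
      have : √(64 * ((2 : ℝ) ^ (k₂ + 1) * (2 ^ (l + m) * 2 ^ (l + n)) *
          √(2 ^ (k + p) / 2 ^ k) / (2 ^ k / 2))) =
          2 ^ ((4 : ℝ) + k₂ / 2 + p / 4 + (l + m) / 2 + (l + n) / 2 - k / 2) := by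
        rw [show (2 : ℝ) ^ k / 2 = 2 ^ ((k : ℝ) - 1) by
          rw [Real.rpow_sub (by norm_num), Real.rpow_natCast, Real.rpow_one],
          show (64 : ℝ) = 2 ^ (6 : ℝ) by norm_num]
        simp_rw [two_pow_eq_rpow]
        rw [← Real.rpow_sub (by norm_num), sqrt_two_rpow, ← Real.rpow_add (by norm_num),
          ← Real.rpow_add (by norm_num), ← Real.rpow_add (by norm_num),
          ← Real.rpow_sub (by norm_num), ← Real.rpow_add (by norm_num), sqrt_two_rpow]
        congr 1
        push_cast
        ring
      rw [← this]
      gcongr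
      norm_num
    replace e := e.trans (mul_le_mul_left (ENNReal.ofReal_le_ofReal hx) _)
    change _ ≤ W _ * _ at e
    calc W (-(k + p : ℝ) / 2) * l2 ((shell k p).indicator
          ({ζ : SpaceTime | (2 : ℝ) ^ k / 2 ≤ |ζ 0|}.indicator (conv G₁ G₂)))
        ≤ W (-(k + p : ℝ) / 2) * (W ((4 : ℝ) + k₂ / 2 + p / 4 + (l + m) / 2 + (l + n) / 2 - k / 2)
            * (l2 G₁ * l2 G₂)) := by
          gcongr
          refine (l2_mono fun ζ => ?_).trans e
          rw [indicator_indicator]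
          refine indicator_le_indicator_of_subset (fun ζ h => ?_) (fun _ => zero_le) ζ
          exact ⟨abs_modulation_le_of_mem_shell h.1, h.2⟩
      _ = W (-(1 / 4) * p) * W (k₂ / 2 - k + 4) * W ((l + m : ℝ) / 2) *
            W ((l + n : ℝ) / 2) * (l2 G₁ * l2 G₂) := by
          rw [← mul_assoc]
          simp_rw [← W_add]
          congr 2
          ring
      _ = _ := by ring
  refine (ENNReal.tsum_le_tsum key).trans (le_of_eq ?_)
  rw [ENNReal.tsum_mul_right, geomConst]
  ring

/-- Unweighted `L²` estimate for the output. -/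
theorem l2_mul_conv_le_yNorm (k₃ k : ℕ) {F₁ F₂ : SpaceTime → ℝ≥0∞}
    (h₁ : Measurable F₁) (h₂ : Measurable F₂) (hF₁ : ∀ ζ, F₁ ζ ≠ 0 → |ζ 0| ≤ 2 ^ (k + 1))
    (hF₂ : ∀ ζ, F₂ ζ ≠ 0 → |ζ 0| ≤ 2 ^ (k + 1)) :
    l2 ({ζ : SpaceTime | |ζ 0| ≤ 2 ^ (k₃ + 1)}.indicator
      fun ζ => ENNReal.ofReal |ζ 0| * conv F₁ F₂ ζ) ≤
      W (2 * k₃ + k / 2 + 7) * yNorm (k + 2) F₁ * yNorm (k + 2) F₂ := by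
  set l := k + 2 with hl
  set D := {ζ : SpaceTime | |ζ 0| ≤ 2 ^ (k₃ + 1)} with hDdef
  have hD : MeasurableSet D := measurableSet_abs_coord_le 0 _
  have hw : Measurable fun ζ : SpaceTime => ENNReal.ofReal |ζ 0| := by
    have : Continuous fun ζ : SpaceTime => |ζ 0| := by fun_prop
    exact this.measurable.ennreal_ofReal
  refine bilinear_of_shell (fun H => l2 (D.indicator fun ζ => ENNReal.ofReal |ζ 0| * H ζ))
    (fun H hH => ?_) l _ h₁ h₂ fun m n => ?_
  · refine le_trans (le_of_eq ?_) (l2_tsum_le fun i => (hw.mul (hH i)).indicator hD)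
    congr 1
    funext ζ
    by_cases h : ζ ∈ D <;> simp [h, ENNReal.tsum_mul_left]
  set G₁ := (shell l m).indicator F₁
  set G₂ := (shell l n).indicator F₂ with hG₂def
  have hG₁ : Measurable G₁ := h₁.indicator (measurableSet_shell l m)
  have hG₂ : Measurable G₂ := h₂.indicator (measurableSet_shell l n)
  -- No decay in the output modulation is available here, so the output is split at 8B⁴, B =
  -- 2^{k+1}. Below this threshold the low output bound is used with M₃ = 8B⁴; above it
  -- `l2_conv_far_le` does not see the output modulation at all.
  have e₁ := l2_conv_low_le hG₁ hG₂ (M₁ := 2 ^ (l + m)) (M₂ := 2 ^ (l + n))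
    (M₃ := 8 * (2 ^ (k + 1)) ^ 4) (R := 2 ^ (k₃ + 1)) (L := 2 ^ l) (by positivity)
    (pow_le_pow_right₀ (by norm_num) (by omega)) (pow_le_pow_right₀ (by norm_num) (by omega))
    (by positivity) (by positivity)
    modulation_le_of_indicator_shell_ne_zero modulation_le_of_indicator_shell_ne_zero
  have e₂ := l2_conv_far_le hG₁ hG₂ (M₁ := 2 ^ (l + m)) (M₂ := 2 ^ (l + n))
    (R := 2 ^ (k₃ + 1)) (B := 2 ^ (k + 1)) (by positivity) (by positivity)
    (by rw [pow_succ]; nlinarith [one_le_pow₀ (one_le_two (α := ℝ)) (n := k)]) (by positivity)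
    modulation_le_of_indicator_shell_ne_zero modulation_le_of_indicator_shell_ne_zero
    (fun ζ h => hF₁ ζ (ne_zero_of_indicator_ne_zero h))
    (fun ζ h => hF₂ ζ (ne_zero_of_indicator_ne_zero h))
  have hx₁ : 2 * √(32 * ((2 : ℝ) ^ (k₃ + 1) * √(2 ^ (k₃ + 1))) * √(8 * (2 ^ (k + 1)) ^ 4) *
      (2 ^ (l + m) * 2 ^ (l + n) / 2 ^ l)) =
      2 ^ ((7 / 2 : ℝ) + 3 / 4 * (k₃ + 1) + (4 * k + 7) / 4 + (l + m) / 2 + (l + n) / 2 - l / 2) := by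
    rw [show (32 : ℝ) = 2 ^ (5 : ℝ) by norm_num, ← pow_mul,
      show (8 : ℝ) * 2 ^ ((k + 1) * 4) = 2 ^ (4 * k + 7) by ring]
    simp_rw [two_pow_eq_rpow, sqrt_two_rpow]
    rw [← Real.rpow_add (by norm_num), ← Real.rpow_add (by norm_num),
      ← Real.rpow_add (by norm_num), ← Real.rpow_add (by norm_num),
      ← Real.rpow_sub (by norm_num), ← Real.rpow_add (by norm_num), sqrt_two_rpow]
    nth_rewrite 1 [← Real.rpow_one 2]
    rw [← Real.rpow_add (by norm_num)]
    congr 1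
    push_cast
    ring
  have hx₂ : √(16 * ((2 : ℝ) ^ (k₃ + 1) * √(2 ^ (k₃ + 1)) * (2 ^ (l + m) * 2 ^ (l + n)))) =
      2 ^ ((2 : ℝ) + 3 / 4 * (k₃ + 1) + (l + m) / 2 + (l + n) / 2) := by
    rw [show (16 : ℝ) = 2 ^ (4 : ℝ) by norm_num]
    simp_rw [two_pow_eq_rpow, sqrt_two_rpow]
    rw [← Real.rpow_add (by norm_num), ← Real.rpow_add (by norm_num),
      ← Real.rpow_add (by norm_num), ← Real.rpow_add (by norm_num), sqrt_two_rpow]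
    congr 1
    push_cast
    ring
  rw [hx₁] at e₁
  rw [hx₂] at e₂
  change _ ≤ W _ * _ at e₁
  change _ ≤ W _ * _ at e₂
  set N := {ζ : SpaceTime | |modulation ζ| ≤ 8 * (2 ^ (k + 1)) ^ 4 ∧ |ζ 0| ≤ 2 ^ (k₃ + 1)} with hN
  set F := {ζ : SpaceTime | 8 * (2 ^ (k + 1)) ^ 4 ≤ |modulation ζ| ∧ |ζ 0| ≤ 2 ^ (k₃ + 1)} with hF
  have hNm : MeasurableSet N :=
    (measurableSet_le measurable_modulation.abs measurable_const).inter hD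
  have hFm : MeasurableSet F :=
    (measurableSet_le measurable_const measurable_modulation.abs).inter hD
  have hconv : Measurable (conv G₁ G₂) := measurable_conv hG₁ hG₂
  have hR : ENNReal.ofReal (2 ^ (k₃ + 1)) = W (k₃ + 1) := by
    rw [W, two_pow_eq_rpow]; push_cast; rfl
  calc l2 (D.indicator fun ζ => ENNReal.ofReal |ζ 0| * conv G₁ G₂ ζ)
      ≤ l2 (fun ζ => W (k₃ + 1) * N.indicator (conv G₁ G₂) ζ +
          F.indicator (fun ζ => ENNReal.ofReal |ζ 0| * conv G₁ G₂ ζ) ζ) := by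
        refine l2_mono fun ζ => ?_
        by_cases h : ζ ∈ D
        swap
        · rw [indicator_of_notMem h]; exact zero_le
        rw [indicator_of_mem h]
        rcases le_total |modulation ζ| (8 * (2 ^ (k + 1)) ^ 4) with h' | h'
        · rw [indicator_of_mem (show ζ ∈ N from ⟨h', h⟩)]
          refine le_add_right ?_
          rw [← hR]
          gcongr
          exact h
        · rw [indicator_of_mem (show ζ ∈ F from ⟨h', h⟩)]
          exact le_add_self
    _ ≤ W (k₃ + 1) * l2 (N.indicator (conv G₁ G₂)) +
          l2 (F.indicator fun ζ => ENNReal.ofReal |ζ 0| * conv G₁ G₂ ζ) := by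
        refine (l2_add_le ((hconv.indicator hNm).const_mul _)
          ((hw.mul hconv).indicator hFm)).trans ?_
        rw [l2_const_mul _ (hconv.indicator hNm)]
        rfl
    _ ≤ W (k₃ + 1) * (W ((7 / 2 : ℝ) + 3 / 4 * (k₃ + 1) + (4 * k + 7) / 4 + (l + m) / 2 +
          (l + n) / 2 - l / 2) * (l2 G₁ * l2 G₂)) +
        W ((2 : ℝ) + 3 / 4 * (k₃ + 1) + (l + m) / 2 + (l + n) / 2) * (l2 G₁ * l2 G₂) := by
        gcongr
    _ ≤ W (2 * k₃ + k / 2 + 6 + (l + m) / 2 + (l + n) / 2) * (l2 G₁ * l2 G₂) +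
        W (2 * k₃ + k / 2 + 6 + (l + m) / 2 + (l + n) / 2) * (l2 G₁ * l2 G₂) := by
        rw [← mul_assoc, ← W_add]
        have hl' : (l : ℝ) = k + 2 := by rw [hl]; push_cast; rfl
        have hk₃ : (0 : ℝ) ≤ k₃ := Nat.cast_nonneg _
        have hk : (0 : ℝ) ≤ k := Nat.cast_nonneg _
        gcongr <;> refine W_mono ?_
        · rw [hl']; linarith
        · linarith
    _ = W 1 * W (2 * k₃ + k / 2 + 6 + (l + m) / 2 + (l + n) / 2) * (l2 G₁ * l2 G₂) := by
        rw [W_one]; ring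
    _ = W (2 * k₃ + k / 2 + 7) * W ((l + m : ℝ) / 2) * W ((l + n : ℝ) / 2) * (l2 G₁ * l2 G₂) := by
        simp_rw [← W_add]
        congr 2
        ring
    _ = _ := by ring

/-! ### Averages in the time frequency -/

/-- The unit vector in the direction of time. -/
def eTime : SpaceTime := EuclideanSpace.single 2 1

@[simp] theorem sub_smul_eTime_zero (ζ : SpaceTime) (s : ℝ) : (ζ - s • eTime) 0 = ζ 0 := by
  simp [eTime]

@[simp] theorem sub_smul_eTime_one (ζ : SpaceTime) (s : ℝ) : (ζ - s • eTime) 1 = ζ 1 := by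
  simp [eTime]

@[simp] theorem sub_smul_eTime_two (ζ : SpaceTime) (s : ℝ) : (ζ - s • eTime) 2 = ζ 2 - s := by
  simp [eTime]

@[simp] theorem modulation_sub_smul_eTime (ζ : SpaceTime) (s : ℝ) :
    modulation (ζ - s • eTime) = modulation ζ - s := by
  simp only [modulation, sub_smul_eTime_zero, sub_smul_eTime_one, sub_smul_eTime_two]; ring

theorem measurable_comp_sub_smul_eTime {F : SpaceTime → ℝ≥0∞} (hF : Measurable F) :
    Measurable fun z : SpaceTime × ℝ => F (z.1 - z.2 • eTime) := by
  have : Continuous fun z : SpaceTime × ℝ => z.1 - z.2 • eTime := by fun_prop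
  exact hF.comp this.measurable

theorem measurable_comp_sub_smul_eTime_right {F : SpaceTime → ℝ≥0∞} (hF : Measurable F)
    (ζ : SpaceTime) : Measurable fun s : ℝ => F (ζ - s • eTime) :=
  (measurable_comp_sub_smul_eTime hF).comp (measurable_const.prodMk measurable_id)

/-- The average of `F` over time frequencies at distance at most `2^r`. -/
def boxAvg (r : ℕ) (F : SpaceTime → ℝ≥0∞) (ζ : SpaceTime) : ℝ≥0∞ :=
  W (-r) * ∫⁻ s in {s : ℝ | |s| ≤ 2 ^ r}, F (ζ - s • eTime)

theorem measurable_boxAvg (r : ℕ) {F : SpaceTime → ℝ≥0∞} (hF : Measurable F) :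
    Measurable (boxAvg r F) :=
  ((measurable_comp_sub_smul_eTime hF).lintegral_prod_right').const_mul _

theorem W_natCast (n : ℕ) : W n = ENNReal.ofReal (2 ^ n) := by
  rw [W, Real.rpow_natCast]

/-- At a given ζ only shifts s with |s| ≤ 2^r and |modulation ζ - s| ≤ 2^j contribute, a set of
measure at most 2^{1 + min(j, r)}. Cauchy-Schwarz then gains over the trivial bound when j < r. -/
theorem l2_boxAvg_le (r j : ℕ) {F : SpaceTime → ℝ≥0∞} (hF : Measurable F)
    (hFj : ∀ ζ, F ζ ≠ 0 → |modulation ζ| ≤ 2 ^ j) :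
    l2 (boxAvg r F) ≤ W (1 + (min (j : ℝ) r - r) / 2) * l2 F := by
  set I := {s : ℝ | |s| ≤ 2 ^ r} with hI
  have hIm : MeasurableSet I := (isClosed_le (by fun_prop) (by fun_prop)).measurableSet
  have hIv : volume I = W (1 + r) := by
    rw [hI, volume_abs_le, W_add, W_one, W_natCast, ENNReal.ofReal_mul (by norm_num)]
    simp
  have hF2 : ∀ ζ : SpaceTime, Measurable fun s : ℝ => F (ζ - s • eTime) :=
    measurable_comp_sub_smul_eTime_right hF
  have key : ∀ ζ, boxAvg r F ζ ^ 2 ≤ W (1 + min (j : ℝ) r - 2 * r) *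
      ∫⁻ s in I, F (ζ - s • eTime) ^ 2 := by
    intro ζ
    set S := {s : ℝ | |modulation ζ - s| ≤ 2 ^ j} with hS
    have hSm : MeasurableSet S := (isClosed_le (by fun_prop) (by fun_prop)).measurableSet
    have hSv : volume (I ∩ S) ≤ W (1 + min (j : ℝ) r) := by
      have hSv' : volume S = W (1 + j) := by
        rw [hS, volume_abs_sub_le, W_add, W_one, W_natCast, ENNReal.ofReal_mul (by norm_num)]
        simp
      rcases le_total (j : ℝ) r with h | h
      · rw [min_eq_left h, ← hSv']; exact measure_mono inter_subset_right
      · rw [min_eq_right h, ← hIv]; exact measure_mono inter_subset_left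
    have e1 : ∫⁻ s in I, F (ζ - s • eTime) =
        ∫⁻ s, (I.indicator (fun s => F (ζ - s • eTime)) s) * (I ∩ S).indicator 1 s := by
      rw [← lintegral_indicator hIm]
      refine lintegral_congr fun s => ?_
      by_cases hs : s ∈ I
      · by_cases hs' : s ∈ S
        · rw [indicator_of_mem (show s ∈ I ∩ S from ⟨hs, hs'⟩)]; simp
        · have h0 : F (ζ - s • eTime) = 0 := by
            by_contra hne
            have := hFj _ hne
            rw [modulation_sub_smul_eTime] at this
            exact hs' this
          simp [hs, h0]
      · simp [hs]
    have e2 := lintegral_mul_le_l2 ((hF2 ζ).indicator hIm)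
      (measurable_one.indicator (hIm.inter hSm) : Measurable ((I ∩ S).indicator
        (1 : ℝ → ℝ≥0∞)))
    have e3 : (∫⁻ s in I, F (ζ - s • eTime)) ^ 2 ≤
        (∫⁻ s in I, F (ζ - s • eTime) ^ 2) * W (1 + min (j : ℝ) r) := by
      rw [e1]
      refine (pow_le_pow_left' e2 2).trans ?_
      rw [mul_pow, l2_sq, l2_sq]
      refine mul_le_mul' (le_of_eq ?_) (le_trans (le_of_eq ?_) hSv)
      · rw [← lintegral_indicator hIm]
        refine lintegral_congr fun s => ?_
        by_cases hs : s ∈ I <;> simp [hs]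
      · rw [← lintegral_indicator_one (hIm.inter hSm)]
        refine lintegral_congr fun s => ?_
        by_cases hs : s ∈ I ∩ S
        · simp only [indicator_of_mem hs, Pi.one_apply, one_pow]
        · simp only [indicator_of_notMem hs]; norm_num
    calc boxAvg r F ζ ^ 2 = W (-r) ^ 2 * (∫⁻ s in I, F (ζ - s • eTime)) ^ 2 := by
          rw [boxAvg, mul_pow]
      _ ≤ W (-r) ^ 2 * ((∫⁻ s in I, F (ζ - s • eTime) ^ 2) * W (1 + min (j : ℝ) r)) := by gcongr
      _ = W (-r) * W (-r) * W (1 + min (j : ℝ) r) * ∫⁻ s in I, F (ζ - s • eTime) ^ 2 := by ring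
      _ = _ := by
          simp_rw [← W_add]; congr 2; ring
  apply le_of_sq_le_sq
  rw [l2_sq, mul_pow, l2_sq]
  have hm : Measurable fun z : SpaceTime × ℝ => F (z.1 - z.2 • eTime) ^ 2 :=
    (measurable_comp_sub_smul_eTime hF).pow_const 2
  calc ∫⁻ ζ, boxAvg r F ζ ^ 2
      ≤ ∫⁻ ζ, W (1 + min (j : ℝ) r - 2 * r) * ∫⁻ s in I, F (ζ - s • eTime) ^ 2 :=
        lintegral_mono key
    _ = W (1 + min (j : ℝ) r - 2 * r) * ∫⁻ s in I, ∫⁻ ζ, F (ζ - s • eTime) ^ 2 := by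
        rw [lintegral_const_mul _ hm.lintegral_prod_right', lintegral_lintegral_swap hm.aemeasurable]
    _ = W (1 + min (j : ℝ) r - 2 * r) * ((∫⁻ ζ, F ζ ^ 2) * W (1 + r)) := by
        congr 1
        have : ∀ s : ℝ, ∫⁻ ζ, F (ζ - s • eTime) ^ 2 = ∫⁻ ζ, F ζ ^ 2 := fun s =>
          lintegral_sub_right_eq_self (fun ζ => F ζ ^ 2) (s • eTime)
        simp_rw [this]
        rw [setLIntegral_const, hIv]
    _ = W (1 + min (j : ℝ) r - 2 * r) * W (1 + r) * ∫⁻ ζ, F ζ ^ 2 := by ring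
    _ = _ := by
        rw [← W_add, sq (W _), ← W_add]; congr 2; ring

theorem boxAvg_tsum (r : ℕ) {F : ℕ → SpaceTime → ℝ≥0∞} (hF : ∀ i, Measurable (F i))
    (ζ : SpaceTime) : boxAvg r (fun ζ => ∑' i, F i ζ) ζ = ∑' i, boxAvg r (F i) ζ := by
  unfold boxAvg
  rw [lintegral_tsum fun i => (measurable_comp_sub_smul_eTime_right (hF i) ζ).aemeasurable,
    ENNReal.tsum_mul_left]

/-- A piece at modulation 2^j spreads out to 2^{max(j, r)}, raising the weight by 2^{(max(j,r) -
j)/2}. The L² gain 2^{(min(j,r) - r)/2} compensates this exactly, because max + min = j + r. -/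
theorem yNorm_boxAvg_le {l r : ℕ} (hlr : l ≤ r) {F : SpaceTime → ℝ≥0∞} (hF : Measurable F) :
    yNorm l (boxAvg r F) ≤ 4 * geomConst (1 / 2) * yNorm 0 F := by
  have key : ∀ j : ℕ, yNorm l (boxAvg r ((shell 0 j).indicator F)) ≤
      4 * geomConst (1 / 2) * (W (((0 : ℕ) + j : ℝ) / 2) * l2 ((shell 0 j).indicator F)) := by
    intro j
    set G := (shell 0 j).indicator F with hG
    have hGj : ∀ ζ, G ζ ≠ 0 → |modulation ζ| ≤ 2 ^ j := by
      intro ζ h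
      have := modulation_le_of_indicator_shell_ne_zero ζ h
      rwa [zero_add] at this
    have hsupp : ∀ ζ, boxAvg r G ζ ≠ 0 → |modulation ζ| ≤ 2 ^ (max j r + 1) := by
      intro ζ h
      by_contra hcon
      push Not at hcon
      apply h
      rw [boxAvg, setLIntegral_congr_fun (g := fun _ => 0), lintegral_zero, mul_zero]
      · exact (isClosed_le (by fun_prop) (by fun_prop)).measurableSet
      intro s hs
      by_contra hne
      have h1 := hGj _ hne
      rw [modulation_sub_smul_eTime] at h1
      have h2 : |modulation ζ| ≤ |modulation ζ - s| + |s| := by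
        have := abs_add_le (modulation ζ - s) s
        rwa [sub_add_cancel] at this
      have h3 : (2 : ℝ) ^ j ≤ 2 ^ (max j r) := pow_le_pow_right₀ (by norm_num) (le_max_left _ _)
      have h4 : (2 : ℝ) ^ r ≤ 2 ^ (max j r) := pow_le_pow_right₀ (by norm_num) (le_max_right _ _)
      have h5 : |s| ≤ 2 ^ r := hs
      rw [pow_succ] at hcon
      linarith
    have hl : l ≤ max j r + 1 := hlr.trans ((le_max_right _ _).trans (Nat.le_succ _))
    refine (yNorm_le_of_modulation_le hl hsupp).trans ?_
    have e := l2_boxAvg_le r j (hF.indicator (measurableSet_shell 0 j)) hGj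
    calc geomConst (1 / 2) * (W (((max j r + 1 : ℕ) : ℝ) / 2) * l2 (boxAvg r G))
        ≤ geomConst (1 / 2) * (W (((max j r + 1 : ℕ) : ℝ) / 2) *
            (W (1 + (min (j : ℝ) r - r) / 2) * l2 G)) := by gcongr
      _ = geomConst (1 / 2) * (W (j / 2 + 3 / 2) * l2 G) := by
          rw [← mul_assoc (W _), ← W_add]
          congr 3
          push_cast
          have := max_add_min (j : ℝ) r
          linarith
      _ ≤ geomConst (1 / 2) * (W (j / 2 + 2) * l2 G) := by
          gcongr; exact W_mono (by linarith)
      _ = _ := by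
          have : W 2 = 4 := by
            rw [W]; norm_num
          rw [W_add, this]; push_cast; rw [zero_add]; ring
  have e : boxAvg r F = fun ζ => ∑' j, boxAvg r ((shell 0 j).indicator F) ζ := by
    funext ζ
    rw [← boxAvg_tsum r fun j => hF.indicator (measurableSet_shell 0 j)]
    simp_rw [tsum_indicator_shell]
  rw [e]
  refine (yNorm_tsum_le l fun j => measurable_boxAvg r
    (hF.indicator (measurableSet_shell 0 j))).trans ((ENNReal.tsum_le_tsum key).trans ?_)
  rw [ENNReal.tsum_mul_left, yNorm]

/-- The average of `F` in the time frequency against a Cauchy kernel of width `2^l`. -/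
def cauchyAvg (l : ℕ) (F : SpaceTime → ℝ≥0∞) (ζ : SpaceTime) : ℝ≥0∞ :=
  ∫⁻ s : ℝ, ENNReal.ofReal ((2 ^ l)⁻¹ / (1 + (s / 2 ^ l) ^ 2)) * F (ζ - s • eTime)

/-- For |s| comparable to 2^{l+n} the kernel is at most 4·2^{-l-2n} = 4·2^{-n}·2^{-(l+n)}, so it is
dominated by box averages with summable coefficients 2^{-n}. -/
theorem cauchyAvg_le (l : ℕ) {F : SpaceTime → ℝ≥0∞} (hF : Measurable F) (ζ : SpaceTime) :
    cauchyAvg l F ζ ≤ 4 * ∑' n : ℕ, W (-n) * boxAvg (l + n) F ζ := by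
  have hset : ∀ n : ℕ, MeasurableSet {s : ℝ | |s| ≤ 2 ^ (l + n)} := fun n =>
    (isClosed_le (by fun_prop) (by fun_prop)).measurableSet
  have hF2 := measurable_comp_sub_smul_eTime_right hF ζ
  have e : 4 * ∑' n : ℕ, W (-n) * boxAvg (l + n) F ζ = ∫⁻ s : ℝ, ∑' n : ℕ,
      4 * (W (-n) * (W (-(l + n : ℕ)) *
        {s : ℝ | |s| ≤ 2 ^ (l + n)}.indicator (fun s => F (ζ - s • eTime)) s)) := by
    rw [lintegral_tsum fun n => (((hF2.indicator (hset n)).const_mul _).const_mul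
      _ |>.const_mul _).aemeasurable, ← ENNReal.tsum_mul_left]
    refine tsum_congr fun n => ?_
    rw [boxAvg, lintegral_const_mul _ (((hF2.indicator (hset n)).const_mul _).const_mul _),
      lintegral_const_mul _ ((hF2.indicator (hset n)).const_mul _),
      lintegral_const_mul _ (hF2.indicator (hset n)), lintegral_indicator (hset n)]
  rw [e, cauchyAvg]
  refine lintegral_mono fun s => ?_
  obtain ⟨n, hn, hn'⟩ : ∃ n : ℕ, |s| ≤ 2 ^ (l + n) ∧
      ((2 : ℝ) ^ l)⁻¹ / (1 + (s / 2 ^ l) ^ 2) ≤ 4 * (2 ^ (-(n : ℝ)) * 2 ^ (-((l + n : ℕ) : ℝ))) := by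
    have hex : ∃ n : ℕ, |s| ≤ 2 ^ (l + n) := by
      obtain ⟨n, hn⟩ := pow_unbounded_of_one_lt |s| (one_lt_two (α := ℝ))
      exact ⟨n, hn.le.trans (pow_le_pow_right₀ (by norm_num) (by omega))⟩
    classical
    refine ⟨Nat.find hex, Nat.find_spec hex, ?_⟩
    have e1 : ∀ n : ℕ, (4 : ℝ) * (2 ^ (-(n : ℝ)) * 2 ^ (-((l + n : ℕ) : ℝ))) =
        (2 ^ l)⁻¹ * (4 / (2 ^ n) ^ 2) := by
      intro n
      rw [Real.rpow_neg (by norm_num), Real.rpow_neg (by norm_num), Real.rpow_natCast,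
        Real.rpow_natCast, pow_add]
      field_simp
    rw [e1, div_eq_mul_inv]
    gcongr
    -- With n minimal, either n = 0 and the denominator 1 + (s/2^l)² ≥ 1 is enough, or |s| > 2^{l+m}
    -- with n = m + 1, which accounts for the factor 4.
    rcases h : Nat.find hex with _ | m
    · rw [pow_zero]
      refine (inv_le_one_of_one_le₀ (by nlinarith [sq_nonneg (s / 2 ^ l)])).trans (by norm_num)
    · have := Nat.find_min hex (m := m) (by omega)
      push Not at this
      have h2 : (2 : ℝ) ^ m ≤ |s / 2 ^ l| := by
        rw [abs_div, abs_of_pos (by positivity : (0 : ℝ) < 2 ^ l), le_div_iff₀ (by positivity),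
          ← pow_add, add_comm]
        exact this.le
      have h3 : ((2 : ℝ) ^ m) ^ 2 ≤ (s / 2 ^ l) ^ 2 := by
        rw [← sq_abs (s / 2 ^ l)]; gcongr
      rw [inv_eq_one_div, div_le_div_iff₀ (by positivity) (by positivity),
        show (2 : ℝ) ^ (m + 1) = 2 ^ m * 2 from pow_succ _ _]
      nlinarith
  refine le_trans ?_ (ENNReal.le_tsum n)
  rw [indicator_of_mem (by exact hn), ← mul_assoc, ← mul_assoc, mul_assoc 4]
  gcongr
  refine (ENNReal.ofReal_le_ofReal hn').trans (le_of_eq ?_)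
  rw [ENNReal.ofReal_mul (by norm_num), ENNReal.ofReal_mul (by positivity), W, W]
  simp

theorem measurable_cauchyAvg (l : ℕ) {F : SpaceTime → ℝ≥0∞} (hF : Measurable F) :
    Measurable (cauchyAvg l F) := by
  have h1 : Measurable fun z : SpaceTime × ℝ =>
      ENNReal.ofReal (((2 : ℝ) ^ l)⁻¹ / (1 + (z.2 / 2 ^ l) ^ 2)) := by fun_prop
  exact (h1.mul (measurable_comp_sub_smul_eTime hF)).lintegral_prod_right'

theorem yNorm_cauchyAvg_le (l : ℕ) {F : SpaceTime → ℝ≥0∞} (hF : Measurable F) :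
    yNorm l (cauchyAvg l F) ≤ 16 * geomConst (1 / 2) * geomConst 1 * yNorm 0 F := by
  have hm : ∀ n, Measurable fun ζ => W (-(n : ℕ)) * boxAvg (l + n) F ζ := fun n =>
    (measurable_boxAvg _ hF).const_mul _
  calc yNorm l (cauchyAvg l F)
      ≤ yNorm l fun ζ => 4 * ∑' n : ℕ, W (-n) * boxAvg (l + n) F ζ :=
        yNorm_mono_ae (Filter.Eventually.of_forall (cauchyAvg_le l hF))
    _ = 4 * yNorm l fun ζ => ∑' n : ℕ, W (-n) * boxAvg (l + n) F ζ :=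
        yNorm_const_mul l 4 (Measurable.tsum hm)
    _ ≤ 4 * ∑' n : ℕ, yNorm l fun ζ => W (-n) * boxAvg (l + n) F ζ := by
        gcongr; exact yNorm_tsum_le l hm
    _ ≤ 4 * ∑' n : ℕ, W (-1 * n) * (4 * geomConst (1 / 2) * yNorm 0 F) := by
        gcongr with n
        rw [yNorm_const_mul l _ (measurable_boxAvg _ hF), neg_one_mul]
        gcongr
        exact yNorm_boxAvg_le (by omega) hF
    _ = geomConst 1 * (4 * geomConst (1 / 2) * yNorm 0 F) * 4 := by
        rw [ENNReal.tsum_mul_right, mul_comm 4]; rfl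
    _ = _ := by ring

/-! ### Comparison of smooth and sharp cutoffs -/

theorem Cutoff.eq_zero (η : Cutoff) {r : ℝ} (h : 8 / 5 < |r|) : η.toFun r = 0 := by
  by_contra hne
  have := η.support_subset hne
  have h2 : |r| ≤ 8 / 5 := abs_le.2 ⟨this.1, this.2⟩
  linarith

theorem Cutoff.eq_one' (η : Cutoff) {r : ℝ} (h : |r| ≤ 5 / 4) : η.toFun r = 1 :=
  η.eq_one r (abs_le.1 h)

theorem Cutoff.dyadic_zero (η : Cutoff) (r : ℝ) : η.dyadic 0 r = η.toFun r := by
  simp [Cutoff.dyadic]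

theorem Cutoff.dyadic_succ (η : Cutoff) (j : ℕ) (r : ℝ) :
    η.dyadic (j + 1) r = η.toFun (r / 2 ^ (j + 1)) - η.toFun (r / 2 ^ j) := by
  simp [Cutoff.dyadic]

theorem abs_div_two_pow (r : ℝ) (j : ℕ) : |r / 2 ^ j| = |r| / 2 ^ j := by
  rw [abs_div, abs_of_pos (by positivity : (0 : ℝ) < 2 ^ j)]

theorem Cutoff.abs_dyadic_le_one (η : Cutoff) (j : ℕ) (r : ℝ) : |η.dyadic j r| ≤ 1 := by
  cases j with
  | zero =>
    rw [η.dyadic_zero, abs_of_nonneg (η.mem_Icc r).1]; exact (η.mem_Icc r).2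
  | succ j =>
    rw [η.dyadic_succ, abs_le]
    have h1 := η.mem_Icc (r / 2 ^ (j + 1))
    have h2 := η.mem_Icc (r / 2 ^ j)
    constructor <;> linarith [h1.1, h1.2, h2.1, h2.2]

theorem Cutoff.abs_le_of_dyadic_ne_zero (η : Cutoff) {j : ℕ} {r : ℝ} (h : η.dyadic j r ≠ 0) :
    |r| ≤ 2 ^ (j + 1) := by
  by_contra hcon
  push Not at hcon
  apply h
  have h1 : η.toFun (r / 2 ^ j) = 0 := by
    apply η.eq_zero
    rw [abs_div_two_pow, lt_div_iff₀ (by positivity)]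
    rw [pow_succ] at hcon
    have : (0 : ℝ) < 2 ^ j := by positivity
    linarith
  cases j with
  | zero => rw [η.dyadic_zero]; simpa using h1
  | succ j =>
    rw [η.dyadic_succ, h1, zero_sub, neg_eq_zero]
    apply η.eq_zero
    rw [abs_div_two_pow, lt_div_iff₀ (by positivity)]
    have : (0 : ℝ) < 2 ^ j := by positivity
    rw [pow_succ, pow_succ] at hcon
    linarith

theorem Cutoff.lt_abs_of_dyadic_succ_ne_zero (η : Cutoff) {j : ℕ} {r : ℝ}
    (h : η.dyadic (j + 1) r ≠ 0) : 2 ^ j < |r| := by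
  by_contra hcon
  push Not at hcon
  apply h
  have : (0 : ℝ) < 2 ^ j := by positivity
  rw [η.dyadic_succ, η.eq_one', η.eq_one', sub_self]
  · rw [abs_div_two_pow, div_le_iff₀ (by positivity)]; linarith
  · rw [abs_div_two_pow, div_le_iff₀ (by positivity), pow_succ]; linarith

theorem Cutoff.dyadic_zero_eq_one (η : Cutoff) {r : ℝ} (h : |r| ≤ 1) : η.dyadic 0 r = 1 := by
  rw [η.dyadic_zero]; exact η.eq_one' (by linarith)

/-- The sum telescopes: only the outermost cutoff, equal to 1 there, and an inner one, equal to 0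
there, survive. -/
theorem Cutoff.dyadic_add_dyadic_succ (η : Cutoff) {j : ℕ} {r : ℝ} (h1 : 2 ^ j < |r|)
    (h2 : |r| ≤ 2 ^ (j + 1)) : η.dyadic j r + η.dyadic (j + 1) r = 1 := by
  have hp : (0 : ℝ) < 2 ^ j := by positivity
  have e1 : η.toFun (r / 2 ^ (j + 1)) = 1 := by
    apply η.eq_one'
    rw [abs_div_two_pow, div_le_iff₀ (by positivity)]
    have : (0 : ℝ) < 2 ^ (j + 1) := by positivity
    linarith
  rw [η.dyadic_succ, e1]
  cases j with
  | zero => rw [η.dyadic_zero]; simp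
  | succ j =>
    rw [η.dyadic_succ]
    have : η.toFun (r / 2 ^ j) = 0 := by
      apply η.eq_zero
      rw [abs_div_two_pow, lt_div_iff₀ (by positivity)]
      rw [pow_succ] at h1
      have : (0 : ℝ) < 2 ^ j := by positivity
      linarith
    rw [this]; ring

theorem Cutoff.measurable_dyadic_modulation (η : Cutoff) (j : ℕ) :
    Measurable fun ζ => (η.dyadic j (modulation ζ) : ℂ) := by
  have h : Measurable η.toFun := η.smooth.continuous.measurable
  have : Measurable (η.dyadic j) := by
    cases j with
    | zero => simp_rw [funext η.dyadic_zero]; exact h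
    | succ j => simp_rw [funext (η.dyadic_succ j)]; fun_prop
  exact (Complex.measurable_ofReal.comp (this.comp measurable_modulation))

/-- On each sharp shell two consecutive smooth cutoffs add up to 1. The factor 4 is 1 for the lowest
shell, 2 for η_n carried under the weight of shell n + 1, and 1 for η_{n+1}. -/
theorem yNorm_zero_le_xNorm (η : Cutoff) {g : SpaceTime → ℂ} (hg : Measurable g) :
    yNorm 0 (fun ζ => ‖g ζ‖ₑ) ≤ 4 * xNorm η g := by
  set a : ℕ → ℝ≥0∞ := fun j => l2 fun ζ => ‖(η.dyadic j (modulation ζ) : ℂ) * g ζ‖ₑ with ha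
  have hm : ∀ j, Measurable fun ζ => ‖(η.dyadic j (modulation ζ) : ℂ) * g ζ‖ₑ := fun j =>
    ((η.measurable_dyadic_modulation j).mul hg).enorm
  have hx : xNorm η g = ∑' j : ℕ, W (j / 2) * a j := by
    unfold xNorm
    simp_rw [l2_eq_eLpNorm]
    rfl
  have h0 : l2 ((shell 0 0).indicator fun ζ => ‖g ζ‖ₑ) ≤ a 0 := by
    refine l2_mono fun ζ => ?_
    by_cases h : ζ ∈ shell 0 0
    · have : |modulation ζ| ≤ 1 := by simpa [shell] using h
      rw [indicator_of_mem h, η.dyadic_zero_eq_one this]; simp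
    · rw [indicator_of_notMem h]; exact zero_le
  have h1 : ∀ n : ℕ, l2 ((shell 0 (n + 1)).indicator fun ζ => ‖g ζ‖ₑ) ≤ a n + a (n + 1) := by
    intro n
    refine le_trans (l2_mono fun ζ => ?_) (l2_add_le (hm n) (hm (n + 1)))
    by_cases h : ζ ∈ shell 0 (n + 1)
    · have h' : 2 ^ n < |modulation ζ| ∧ |modulation ζ| ≤ 2 ^ (n + 1) := by
        simpa [shell] using h
      rw [indicator_of_mem h]
      have e : g ζ = (η.dyadic n (modulation ζ) : ℂ) * g ζ +
          (η.dyadic (n + 1) (modulation ζ) : ℂ) * g ζ := by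
        rw [← add_mul, ← Complex.ofReal_add, η.dyadic_add_dyadic_succ h'.1 h'.2]; simp
      conv_lhs => rw [e]
      exact enorm_add_le _ _
    · rw [indicator_of_notMem h]; exact zero_le
  rw [hx, yNorm, tsum_eq_zero_add' ENNReal.summable]
  have hA : ∑' n : ℕ, W ((n + 1 : ℝ) / 2) * a (n + 1) ≤ ∑' j : ℕ, W (j / 2) * a j := by
    rw [tsum_eq_zero_add' (f := fun j : ℕ => W ((j : ℝ) / 2) * a j) ENNReal.summable]
    push_cast
    exact le_add_self
  have hB : ∑' n : ℕ, W ((n + 1 : ℝ) / 2) * a n ≤ 2 * ∑' j : ℕ, W (j / 2) * a j := by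
    rw [← ENNReal.tsum_mul_left]
    refine ENNReal.tsum_le_tsum fun n => ?_
    rw [← mul_assoc, ← W_one, ← W_add]
    gcongr
    exact W_mono (by linarith)
  calc _ ≤ W ((0 : ℝ) / 2) * a 0 + ∑' n : ℕ, W ((n + 1 : ℝ) / 2) * (a n + a (n + 1)) := by
        refine add_le_add ?_ (ENNReal.tsum_le_tsum fun n => ?_)
        · push_cast
          rw [add_zero]
          gcongr
        · push_cast
          rw [zero_add]
          gcongr
          exact h1 n
    _ ≤ ∑' j : ℕ, W (j / 2) * a j + (2 * ∑' j : ℕ, W (j / 2) * a j + ∑' j : ℕ, W (j / 2) * a j) := by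
        refine add_le_add ?_ ?_
        · have := ENNReal.le_tsum (f := fun j : ℕ => W ((j : ℝ) / 2) * a j) 0
          simpa using this
        · simp_rw [mul_add]
          rw [ENNReal.tsum_add]
          exact add_le_add hB hA
    _ = _ := by ring

theorem enorm_inv_modulation_le (k : ℕ) (ζ : SpaceTime) :
    ‖((modulation ζ : ℂ) + Complex.I * 2 ^ k)⁻¹‖ₑ ≤ W (-k) := by
  have h : (2 : ℝ) ^ k ≤ ‖(modulation ζ : ℂ) + Complex.I * 2 ^ k‖ := by
    have := Complex.abs_im_le_norm ((modulation ζ : ℂ) + Complex.I * 2 ^ k)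
    have e : ((modulation ζ : ℂ) + Complex.I * 2 ^ k).im = 2 ^ k := by
      have : (2 : ℂ) ^ k = ((2 ^ k : ℝ) : ℂ) := by push_cast; rfl
      rw [this, Complex.add_im, Complex.mul_im, Complex.ofReal_im, Complex.ofReal_im,
        Complex.ofReal_re, Complex.I_re, Complex.I_im]
      ring
    rw [e, abs_of_pos (by positivity)] at this
    exact this
  rw [← ofReal_norm, norm_inv, W, Real.rpow_neg (by norm_num), Real.rpow_natCast]
  refine ENNReal.ofReal_le_ofReal ?_
  gcongr

theorem enorm_inv_modulation_le' (k j : ℕ) {ζ : SpaceTime} (hζ : 2 ^ j < |modulation ζ|) :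
    ‖((modulation ζ : ℂ) + Complex.I * 2 ^ k)⁻¹‖ₑ ≤ W (-j) := by
  have h : (2 : ℝ) ^ j ≤ ‖(modulation ζ : ℂ) + Complex.I * 2 ^ k‖ := by
    have := Complex.abs_re_le_norm ((modulation ζ : ℂ) + Complex.I * 2 ^ k)
    have e : ((modulation ζ : ℂ) + Complex.I * 2 ^ k).re = modulation ζ := by
      have : (2 : ℂ) ^ k = ((2 ^ k : ℝ) : ℂ) := by push_cast; rfl
      rw [this, Complex.add_re, Complex.mul_re, Complex.ofReal_im, Complex.ofReal_re,
        Complex.ofReal_re, Complex.I_re, Complex.I_im]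
      ring
    rw [e] at this
    linarith
  rw [← ofReal_norm, norm_inv, W, Real.rpow_neg (by norm_num), Real.rpow_natCast]
  refine ENNReal.ofReal_le_ofReal ?_
  gcongr

/-- For j ≤ k the imaginary part i2^k dominates: all these pieces lie in the shells 0 and 1 above
2^k, and the geometric sum over j is governed by j = k. For j > k the modulation itself dominates,
and 2^{j/2}·2^{-j} is the weight of `zNorm` up to a constant. Each smooth piece meets two sharp
shells, at the cost 1 + 2 in the first range and 2 + 4 in the second. -/
theorem xNorm_inv_modulation_le (η : Cutoff) (k : ℕ) {g : SpaceTime → ℂ} (hg : Measurable g) :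
    xNorm η (fun ζ => ((modulation ζ : ℂ) + Complex.I * 2 ^ k)⁻¹ * g ζ) ≤
      (3 * geomConst (1 / 2) + 6) * zNorm k (fun ζ => ‖g ζ‖ₑ) := by
  set a : ℕ → ℝ≥0∞ := fun n => l2 ((shell k n).indicator fun ζ => ‖g ζ‖ₑ) with ha
  set Z := zNorm k (fun ζ => ‖g ζ‖ₑ) with hZ
  have hZe : Z = ∑' n : ℕ, W (-(k + n : ℝ) / 2) * a n := rfl
  have hm : ∀ n, Measurable ((shell k n).indicator fun ζ => ‖g ζ‖ₑ) := fun n =>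
    hg.enorm.indicator (measurableSet_shell k n)
  set b : ℕ → ℝ≥0∞ := fun j => l2 fun ζ => ‖(η.dyadic j (modulation ζ) : ℂ) *
    (((modulation ζ : ℂ) + Complex.I * 2 ^ k)⁻¹ * g ζ)‖ₑ with hb
  have hx : xNorm η (fun ζ => ((modulation ζ : ℂ) + Complex.I * 2 ^ k)⁻¹ * g ζ) =
      ∑' j : ℕ, W (j / 2) * b j := by
    unfold xNorm
    simp_rw [l2_eq_eLpNorm]
    rfl
  have hη : ∀ j ζ, ‖(η.dyadic j (modulation ζ) : ℂ)‖ₑ ≤ 1 := by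
    intro j ζ
    rw [← ofReal_norm, Complex.norm_real, Real.norm_eq_abs]
    exact ENNReal.ofReal_le_one.2 (η.abs_dyadic_le_one j _)
  have hlow : ∀ j ≤ k, b j ≤ W (-k) * (a 0 + a 1) := by
    intro j hj
    have : W (-k) * (a 0 + a 1) ≥ W (-k) * l2 (fun ζ => (shell k 0).indicator (fun ζ => ‖g ζ‖ₑ) ζ +
        (shell k 1).indicator (fun ζ => ‖g ζ‖ₑ) ζ) := by
      gcongr; exact l2_add_le (hm 0) (hm 1)
    refine le_trans ?_ this
    have hm2 : Measurable fun ζ => (shell k 0).indicator (fun ζ => ‖g ζ‖ₑ) ζ +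
        (shell k 1).indicator (fun ζ => ‖g ζ‖ₑ) ζ := (hm 0).add (hm 1)
    rw [← l2_const_mul _ hm2]
    refine l2_mono fun ζ => ?_
    rw [enorm_mul, enorm_mul]
    by_cases h0 : η.dyadic j (modulation ζ) = 0
    · simp [h0]
    have h1 := η.abs_le_of_dyadic_ne_zero h0
    calc _ ≤ 1 * (W (-k) * ‖g ζ‖ₑ) := by
          gcongr
          · exact hη j ζ
          · exact enorm_inv_modulation_le k ζ
      _ = W (-k) * ‖g ζ‖ₑ := one_mul _
      _ ≤ _ := by
          gcongr
          rcases le_or_gt |modulation ζ| (2 ^ k) with h | h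
          · rw [indicator_of_mem (show ζ ∈ shell k 0 from h)]; exact le_self_add
          · rw [indicator_of_mem (show ζ ∈ shell k 1 from ⟨h, h1.trans
              (pow_le_pow_right₀ (by norm_num) (by omega))⟩)]
            exact le_add_self
  have hhigh : ∀ i, b (k + 1 + i) ≤ W (-(k + i : ℕ)) * (a (i + 1) + a (i + 2)) := by
    intro i
    have : W (-(k + i : ℕ)) * (a (i + 1) + a (i + 2)) ≥
        W (-(k + i : ℕ)) * l2 (fun ζ => (shell k (i + 1)).indicator (fun ζ => ‖g ζ‖ₑ) ζ +
        (shell k (i + 2)).indicator (fun ζ => ‖g ζ‖ₑ) ζ) := by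
      gcongr; exact l2_add_le (hm _) (hm _)
    refine le_trans ?_ this
    have hm2 : Measurable fun ζ => (shell k (i + 1)).indicator (fun ζ => ‖g ζ‖ₑ) ζ +
        (shell k (i + 2)).indicator (fun ζ => ‖g ζ‖ₑ) ζ := (hm _).add (hm _)
    rw [← l2_const_mul _ hm2]
    refine l2_mono fun ζ => ?_
    rw [enorm_mul, enorm_mul]
    by_cases h0 : η.dyadic (k + 1 + i) (modulation ζ) = 0
    · simp [h0]
    have h1 := η.abs_le_of_dyadic_ne_zero h0
    have h2 : 2 ^ (k + i) < |modulation ζ| := by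
      rw [show k + 1 + i = (k + i) + 1 by ring] at h0
      exact η.lt_abs_of_dyadic_succ_ne_zero h0
    calc _ ≤ 1 * (W (-(k + i : ℕ)) * ‖g ζ‖ₑ) := by
          gcongr
          · exact hη _ ζ
          · exact enorm_inv_modulation_le' k _ h2
      _ = W (-(k + i : ℕ)) * ‖g ζ‖ₑ := one_mul _
      _ ≤ _ := by
          gcongr
          rcases le_or_gt |modulation ζ| (2 ^ (k + i + 1)) with h | h
          · rw [indicator_of_mem (show ζ ∈ shell k (i + 1) from ⟨h2, h⟩)]; exact le_self_add
          · rw [indicator_of_mem (show ζ ∈ shell k (i + 2) from ⟨h, h1.trans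
              (pow_le_pow_right₀ (by norm_num) (by omega))⟩)]
            exact le_add_self
  have hterm : ∀ n : ℕ, W (-(k + n : ℝ) / 2) * a n ≤ Z := fun n => by
    rw [hZe]; exact ENNReal.le_tsum n
  rw [hx, ← ENNReal.summable.sum_add_tsum_nat_add' (k := k + 1), add_mul]
  refine add_le_add ?_ ?_
  · calc ∑ j ∈ Finset.range (k + 1), W (j / 2) * b j
        ≤ ∑ j ∈ Finset.range (k + 1), W (1 / 2 * j) * (W (-k) * (a 0 + a 1)) := by
          refine Finset.sum_le_sum fun j hj => ?_
          rw [show (j : ℝ) / 2 = 1 / 2 * j by ring]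
          gcongr
          exact hlow j (Nat.lt_succ_iff.1 (Finset.mem_range.1 hj))
      _ ≤ W (1 / 2 * k) * geomConst (1 / 2) * (W (-k) * (a 0 + a 1)) := by
          rw [← Finset.sum_mul]
          gcongr
          exact sum_range_W_le k
      _ = geomConst (1 / 2) * ((W (1 / 2 * k) * W (-k)) * a 0 + (W (1 / 2 * k) * W (-k)) * a 1) := by
          ring
      _ ≤ geomConst (1 / 2) * (Z + 2 * Z) := by
          rw [← W_add]
          refine mul_le_mul' le_rfl (add_le_add ?_ ?_)
          · refine le_trans ?_ (hterm 0)
            gcongr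
            exact W_mono (by push_cast; linarith)
          · calc W (1 / 2 * k + -k) * a 1 ≤ 2 * (W (-(k + (1 : ℕ) : ℝ) / 2) * a 1) := by
                  rw [← mul_assoc, ← W_one, ← W_add]
                  gcongr
                  exact W_mono (by push_cast; linarith)
              _ ≤ _ := by gcongr; exact hterm 1
      _ = _ := by ring
  · calc ∑' i : ℕ, W (((i + (k + 1) : ℕ) : ℝ) / 2) * b (i + (k + 1))
        ≤ ∑' i : ℕ, (2 * (W (-(k + (i + 1 : ℕ) : ℝ) / 2) * a (i + 1)) +
            4 * (W (-(k + (i + 2 : ℕ) : ℝ) / 2) * a (i + 2))) := by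
          refine ENNReal.tsum_le_tsum fun i => ?_
          rw [show i + (k + 1) = k + 1 + i by ring]
          have hW2 : W 2 = 4 := by rw [W]; norm_num
          calc _ ≤ W (((k + 1 + i : ℕ) : ℝ) / 2) * (W (-(k + i : ℕ)) * (a (i + 1) + a (i + 2))) := by
                gcongr; exact hhigh i
            _ = (W (((k + 1 + i : ℕ) : ℝ) / 2) * W (-(k + i : ℕ))) * a (i + 1) +
                (W (((k + 1 + i : ℕ) : ℝ) / 2) * W (-(k + i : ℕ))) * a (i + 2) := by ring
            _ ≤ _ := by
                rw [← W_add, ← mul_assoc, ← mul_assoc, ← hW2, ← W_one, ← W_add, ← W_add]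
                gcongr <;> refine W_mono ?_ <;> push_cast <;> linarith
      _ = 2 * (∑' i : ℕ, W (-(k + (i + 1 : ℕ) : ℝ) / 2) * a (i + 1)) +
            4 * ∑' i : ℕ, W (-(k + (i + 2 : ℕ) : ℝ) / 2) * a (i + 2) := by
          rw [ENNReal.tsum_add, ENNReal.tsum_mul_left, ENNReal.tsum_mul_left]
      _ ≤ 2 * Z + 4 * Z := by
          gcongr
          · rw [hZe]
            exact ENNReal.tsum_comp_le_tsum_of_injective (add_left_injective 1)
              (fun n : ℕ => W (-(k + n : ℝ) / 2) * a n)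
          · rw [hZe]
            exact ENNReal.tsum_comp_le_tsum_of_injective (add_left_injective 2)
              (fun n : ℕ => W (-(k + n : ℝ) / 2) * a n)
      _ = _ := by ring

/-! ### Fourier transforms of integrable and square integrable functions -/

section Fourier

variable {V : Type*} [NormedAddCommGroup V] [InnerProductSpace ℝ V] [FiniteDimensional ℝ V]
  [MeasurableSpace V] [BorelSpace V]

theorem integral_fourier_mul_eq {f g : V → ℂ} (hf : Integrable f) (hg : Integrable g) :
    ∫ ξ, 𝓕 f ξ * g ξ = ∫ x, f x * 𝓕 g x := by
  have := VectorFourier.integral_fourierIntegral_smul_eq_flip (L := innerₗ V) (μ := volume)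
    (ν := volume) Real.continuous_fourierChar continuous_inner hf hg
  simpa using! this

/-- The duality pairing `(f, g) ↦ ∫ f g` on `L²`. -/
def pairing₂ : Lp ℂ 2 (volume : Measure V) →L[ℂ] Lp ℂ 2 (volume : Measure V) →L[ℂ] ℂ :=
  (ContinuousLinearMap.mul ℂ ℂ).lpPairing volume 2 2

theorem pairing₂_apply (f g : Lp ℂ 2 (volume : Measure V)) :
    pairing₂ f g = ∫ x, f x * g x := by
  simp [pairing₂, ContinuousLinearMap.lpPairing_eq_integral]

theorem denseRange_toLp :
    DenseRange fun φ : 𝓢(V, ℂ) => (φ.toLp 2 : Lp ℂ 2 (volume : Measure V)) :=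
  SchwartzMap.denseRange_toLpCLM (by simp)

theorem integral_fourier_mul_eq_L2 (f g : Lp ℂ 2 (volume : Measure V)) :
    ∫ x, (𝓕 f : Lp ℂ 2 (volume : Measure V)) x * g x =
      ∫ x, f x * (𝓕 g : Lp ℂ 2 (volume : Measure V)) x := by
  rw [← pairing₂_apply, ← pairing₂_apply]
  refine DenseRange.induction_on₂ (p := fun f g : Lp ℂ 2 (volume : Measure V) =>
    pairing₂ (𝓕 f) g = pairing₂ f (𝓕 g)) denseRange_toLp ?_ ?_ f g
  · have h1 : Continuous fun f : Lp ℂ 2 (volume : Measure V) =>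
      (𝓕 f : Lp ℂ 2 (volume : Measure V)) := FourierTransform.continuous_fourier
    refine isClosed_eq ?_ ?_
    · fun_prop
    · fun_prop
  · intro φ ψ
    rw [SchwartzMap.toLp_fourier_eq, SchwartzMap.toLp_fourier_eq, pairing₂_apply, pairing₂_apply]
    have e (φ ψ : 𝓢(V, ℂ)) : ∫ x, (φ.toLp 2 : Lp ℂ 2 (volume : Measure V)) x *
        (ψ.toLp 2 : Lp ℂ 2 (volume : Measure V)) x = ∫ x, φ x * ψ x := by
      refine integral_congr_ae ?_
      filter_upwards [φ.coeFn_toLp 2 volume, ψ.coeFn_toLp 2 volume] with x h1 h2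
      rw [h1, h2]
    rw [e, e, SchwartzMap.integral_fourier_mul_eq]

theorem ae_eq_of_integral_schwartz_mul_eq {f g : V → ℂ} (hf : LocallyIntegrable f)
    (hg : LocallyIntegrable g)
    (h : ∀ φ : 𝓢(V, ℂ), ∫ x, φ x * f x = ∫ x, φ x * g x) : f =ᵐ[volume] g := by
  refine ae_eq_of_integral_contDiff_smul_eq hf hg fun θ hθ hθc => ?_
  have h1 : HasCompactSupport (Complex.ofRealCLM ∘ θ) := hθc.comp_left rfl
  have h2 : ContDiff ℝ ∞ (Complex.ofRealCLM ∘ θ) := by fun_prop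
  simpa using h (h1.toSchwartzMap h2)

theorem integrable_schwartz_mul (φ : 𝓢(V, ℂ)) {f : V → ℂ} (hf : MemLp f 2) :
    Integrable fun x => φ x * f x :=
  (φ.memLp 2 volume).integrable_mul hf

/-- Both transforms satisfy the same exchange formula against Schwartz functions, and locally
integrable functions are determined by such pairings. -/
theorem coeFn_fourier_toLp {f : V → ℂ} (hf : Integrable f) (hf₂ : MemLp f 2) :
    ((𝓕 (hf₂.toLp f) : Lp ℂ 2 (volume : Measure V)) : V → ℂ) =ᵐ[volume] 𝓕 f := by
  have hc : Continuous (𝓕 f) :=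
    VectorFourier.fourierIntegral_continuous Real.continuous_fourierChar continuous_inner hf
  refine ae_eq_of_integral_schwartz_mul_eq ((Lp.memLp _).locallyIntegrable (by norm_num))
    hc.locallyIntegrable fun φ => ?_
  have h1 := integral_fourier_mul_eq_L2 (φ.toLp 2) (hf₂.toLp f)
  rw [SchwartzMap.toLp_fourier_eq] at h1
  have h2 := integral_fourier_mul_eq φ.integrable hf
  calc ∫ x, φ x * (𝓕 (hf₂.toLp f) : Lp ℂ 2 (volume : Measure V)) x
      = ∫ x, (φ.toLp 2 : Lp ℂ 2 (volume : Measure V)) x *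
          (𝓕 (hf₂.toLp f) : Lp ℂ 2 (volume : Measure V)) x := by
        refine integral_congr_ae ?_
        filter_upwards [φ.coeFn_toLp 2 volume] with x h1
        rw [h1]
    _ = ∫ x, 𝓕 φ x * f x := by
        rw [← h1]
        refine integral_congr_ae ?_
        filter_upwards [(𝓕 φ).coeFn_toLp 2 volume, hf₂.coeFn_toLp] with x h1 h2
        rw [h1, h2]
    _ = _ := by rw [← h2]; rfl

theorem integral_schwartz_mul_fourier (φ : 𝓢(V, ℂ)) (f : Lp ℂ 2 (volume : Measure V)) :
    ∫ x, φ x * (𝓕 f : Lp ℂ 2 (volume : Measure V)) x = ∫ x, 𝓕 φ x * f x := by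
  have h1 := integral_fourier_mul_eq_L2 (φ.toLp 2) f
  rw [SchwartzMap.toLp_fourier_eq] at h1
  calc _ = ∫ x, (φ.toLp 2 : Lp ℂ 2 (volume : Measure V)) x *
          (𝓕 f : Lp ℂ 2 (volume : Measure V)) x := by
        refine integral_congr_ae ?_
        filter_upwards [φ.coeFn_toLp 2 volume] with x h1
        rw [h1]
    _ = _ := by
        rw [← h1]
        refine integral_congr_ae ?_
        filter_upwards [(𝓕 φ).coeFn_toLp 2 volume] with x h1
        rw [h1]

/-- Writing φ as the transform of its inverse transform, the exchange formula moves 𝓕 onto ψ times a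
character, whose transform is a translate of 𝓕 ψ. -/
theorem fourier_schwartz_mul (φ ψ : 𝓢(V, ℂ)) (η : V) :
    𝓕 (fun z => φ z * ψ z) η = ∫ σ, 𝓕 φ σ * 𝓕 ψ (η - σ) := by
  set g : V → ℂ := fun z => Real.fourierChar (-inner ℝ z η) • ψ z with hg
  have hgi : Integrable g := (Real.fourierIntegral_convergent_iff η).2 ψ.integrable
  have hFg (σ : V) : 𝓕 g σ = 𝓕 ψ (σ + η) := by
    rw [SchwartzMap.fourier_coe, Real.fourier_eq, Real.fourier_eq]
    refine integral_congr_ae (Filter.Eventually.of_forall fun z => ?_)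
    simp only [hg, smul_smul, inner_add_right, neg_add, AddChar.map_add_eq_mul]
  have h1 := integral_fourier_mul_eq (𝓕⁻ φ).integrable hgi
  have h2 : 𝓕 ((𝓕⁻ φ : 𝓢(V, ℂ)) : V → ℂ) = φ := by
    rw [← SchwartzMap.fourier_coe, FourierTransform.fourier_fourierInv_eq]
  rw [h2] at h1
  calc 𝓕 (fun z => φ z * ψ z) η = ∫ ξ, φ ξ * g ξ := by
        rw [Real.fourier_eq]
        refine integral_congr_ae (Filter.Eventually.of_forall fun z => ?_)
        simp only [hg, Circle.smul_def, smul_eq_mul]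
        ring
    _ = ∫ σ, 𝓕 φ (-σ) * 𝓕 ψ (η + σ) := by
        rw [h1]
        refine integral_congr_ae (Filter.Eventually.of_forall fun z => ?_)
        simp only [hFg, SchwartzMap.fourierInv_coe, SchwartzMap.fourier_coe,
          Real.fourierInv_eq_fourier_neg, add_comm]
    _ = _ := by
        rw [← integral_neg_eq_self]
        simp [sub_eq_add_neg]

/-- For fixed η both sides are continuous in (f, g) ∈ L² × L²: on the left because the product lies
in L¹, on the right by Cauchy-Schwarz and Plancherel. Density of Schwartz functions then gives the
identity at every η, not merely almost everywhere. -/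
theorem fourier_mul_L2 (f g : Lp ℂ 2 (volume : Measure V)) (η : V) :
    𝓕 (fun z => f z * g z) η =
      ∫ σ, (𝓕 f : Lp ℂ 2 (volume : Measure V)) σ *
        (𝓕 g : Lp ℂ 2 (volume : Measure V)) (η - σ) := by
  have hmp : MeasurePreserving (fun σ : V => η - σ) volume volume :=
    Measure.measurePreserving_sub_left volume η
  set R := Lp.compMeasurePreserving (E := ℂ) (p := 2) (fun σ : V => η - σ) hmp with hR
  have hRc : Continuous R := (Lp.isometry_compMeasurePreserving hmp).continuous
  have hL (f g : Lp ℂ 2 (volume : Measure V)) : 𝓕 (fun z => f z * g z) η =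
      Real.Lp.fourierTransformCLM V ℂ
        ((ContinuousLinearMap.mul ℂ ℂ).holderL volume 2 2 1 f g) η := by
    rw [Real.Lp.fourierTransformCLM_apply, Real.Lp.fourierTransform_apply]
    refine Real.fourier_congr_ae ?_ _
    filter_upwards [(ContinuousLinearMap.mul ℂ ℂ).coeFn_holder (r := 1) f g] with x hx
    exact hx.symm
  have hG (f g : Lp ℂ 2 (volume : Measure V)) :
      ∫ σ, f σ * g (η - σ) = pairing₂ f (R g) := by
    rw [pairing₂_apply]
    refine integral_congr_ae ?_
    filter_upwards [Lp.coeFn_compMeasurePreserving g hmp] with x hx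
    rw [hR, hx]; rfl
  rw [hL, hG]
  have hF : Continuous fun f : Lp ℂ 2 (volume : Measure V) =>
      (𝓕 f : Lp ℂ 2 (volume : Measure V)) := FourierTransform.continuous_fourier
  refine DenseRange.induction_on₂ (p := fun f g : Lp ℂ 2 (volume : Measure V) =>
    Real.Lp.fourierTransformCLM V ℂ
        ((ContinuousLinearMap.mul ℂ ℂ).holderL volume 2 2 1 f g) η =
      pairing₂ (𝓕 f) (R (𝓕 g))) denseRange_toLp ?_ ?_ f g
  · refine isClosed_eq ?_ ?_
    · have hev : Continuous fun h : BoundedContinuousFunction V ℂ => h η := continuous_eval_const η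
      exact hev.comp (by fun_prop)
    · fun_prop
  · intro φ ψ
    rw [← hL, ← hG, SchwartzMap.toLp_fourier_eq, SchwartzMap.toLp_fourier_eq]
    have h1 : (fun z => (φ.toLp 2 : Lp ℂ 2 (volume : Measure V)) z *
        (ψ.toLp 2 : Lp ℂ 2 (volume : Measure V)) z) =ᵐ[volume] fun z => φ z * ψ z := by
      filter_upwards [φ.coeFn_toLp 2 volume, ψ.coeFn_toLp 2 volume] with x h1 h2
      rw [h1, h2]
    rw [Real.fourier_congr_ae h1, fourier_schwartz_mul]
    refine integral_congr_ae ?_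
    filter_upwards [(𝓕 φ).coeFn_toLp 2 volume,
      hmp.quasiMeasurePreserving.ae ((𝓕 ψ).coeFn_toLp 2 volume)] with x h1 h2
    rw [h1, h2]

end Fourier

/-! ### Multiplication by functions of time -/

theorem inner_eTime (z : SpaceTime) : inner ℝ z eTime = z 2 := by
  simp [eTime, EuclideanSpace.inner_single_right]

theorem fourier_timeMul {p : SpaceTime → ℂ} (hp : Integrable p) {K : ℝ → ℂ} (hK : Integrable K)
    (ζ : SpaceTime) :
    𝓕 (fun z => 𝓕⁻ K (z 2) * p z) ζ = ∫ σ, K σ * 𝓕 p (ζ - σ • eTime) := by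
  have hc : Continuous fun w : SpaceTime × ℝ =>
      ((Real.fourierChar (w.2 * w.1 2 - inner ℝ w.1 ζ) : Circle) : ℂ) :=
    continuous_subtype_val.comp (Real.continuous_fourierChar.comp (by fun_prop))
  have hint : Integrable (fun w : SpaceTime × ℝ =>
      ((Real.fourierChar (w.2 * w.1 2 - inner ℝ w.1 ζ) : Circle) : ℂ) * (p w.1 * K w.2))
      (volume.prod volume) := by
    refine (hp.mul_prod hK).mono (hc.aestronglyMeasurable.mul (hp.mul_prod hK).1) ?_
    exact Filter.Eventually.of_forall fun w => by simp [Circle.norm_coe]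
  calc 𝓕 (fun z => 𝓕⁻ K (z 2) * p z) ζ
      = ∫ z, ∫ σ, ((Real.fourierChar (σ * z 2 - inner ℝ z ζ) : Circle) : ℂ) * (p z * K σ) := by
        rw [Real.fourier_eq]
        refine integral_congr_ae (Filter.Eventually.of_forall fun z => ?_)
        simp only [Real.fourierInv_eq, Circle.smul_def, smul_eq_mul]
        rw [mul_left_comm, ← integral_mul_const]
        refine integral_congr_ae (Filter.Eventually.of_forall fun σ => ?_)
        simp only [sub_eq_add_neg, AddChar.map_add_eq_mul, Circle.coe_mul]
        have : inner ℝ σ (z 2) = σ * z 2 := by simp [mul_comm]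
        rw [this]; ring
    _ = ∫ σ, ∫ z, ((Real.fourierChar (σ * z 2 - inner ℝ z ζ) : Circle) : ℂ) * (p z * K σ) :=
        integral_integral_swap hint
    _ = _ := by
        refine integral_congr_ae (Filter.Eventually.of_forall fun σ => ?_)
        simp only [Real.fourier_eq]
        rw [← integral_const_mul]
        refine integral_congr_ae (Filter.Eventually.of_forall fun z => ?_)
        simp only [inner_sub_right, inner_smul_right, inner_eTime, Circle.smul_def, smul_eq_mul,
          neg_sub]
        ring

theorem lintegral_mul_le_l2_of_aemeasurable {α : Type*} [MeasureSpace α] {F G : α → ℝ≥0∞}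
    (hF : AEMeasurable F) (hG : AEMeasurable G) : ∫⁻ z, F z * G z ≤ l2 F * l2 G := by
  have h := ENNReal.lintegral_mul_le_Lp_mul_Lq volume Real.HolderConjugate.two_two hF hG
  simpa [l2] using h

/-- The Fubini hypothesis for the next lemma: for each σ Cauchy-Schwarz and translation invariance
give ‖φ‖‖F‖, which is then integrated against |K|. -/
theorem integrable_mul_timeConv {φ F : SpaceTime → ℂ} (hφ : MemLp φ 2) (hF : MemLp F 2)
    (hFm : StronglyMeasurable F) {K : ℝ → ℂ} (hK : Integrable K) :
    Integrable (fun w : SpaceTime × ℝ => φ w.1 * (K w.2 * F (w.1 - w.2 • eTime)))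
      (volume.prod volume) := by
  have hm : AEStronglyMeasurable
      (fun w : SpaceTime × ℝ => φ w.1 * (K w.2 * F (w.1 - w.2 • eTime))) (volume.prod volume) := by
    refine hφ.1.comp_fst.mul (hK.1.comp_snd.mul ?_)
    exact (hFm.comp_measurable (by fun_prop)).aestronglyMeasurable
  have hsh (σ : ℝ) : MemLp (fun ζ => F (ζ - σ • eTime)) 2 :=
    hF.comp_measurePreserving (measurePreserving_sub_right volume (σ • eTime))
  rw [integrable_prod_iff' hm]
  constructor
  · refine Filter.Eventually.of_forall fun σ => ?_
    have := (hφ.integrable_mul (hsh σ)).const_mul (K σ)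
    refine this.congr (Filter.Eventually.of_forall fun ζ => ?_)
    simp only [Pi.mul_apply]; ring
  · refine (hK.norm.mul_const ((eLpNorm φ 2 volume).toReal * (eLpNorm F 2 volume).toReal)).mono'
      hm.norm.prod_swap.integral_prod_right' ?_
    refine Filter.Eventually.of_forall fun σ => ?_
    have e1 : ∫ ζ, ‖φ ζ * (K σ * F (ζ - σ • eTime))‖ =
        ‖K σ‖ * ∫ ζ, ‖φ ζ‖ * ‖F (ζ - σ • eTime)‖ := by
      rw [← integral_const_mul]
      refine integral_congr_ae (Filter.Eventually.of_forall fun ζ => ?_)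
      simp only [norm_mul]; ring
    simp only [] at e1 ⊢
    rw [e1, Real.norm_of_nonneg (by positivity)]
    refine mul_le_mul_of_nonneg_left ?_ (norm_nonneg _)
    have hmm : AEStronglyMeasurable (fun ζ => ‖φ ζ‖ * ‖F (ζ - σ • eTime)‖) volume :=
      hφ.1.norm.mul (hsh σ).1.norm
    rw [integral_eq_lintegral_of_nonneg_ae (Filter.Eventually.of_forall fun ζ =>
      mul_nonneg (norm_nonneg (φ ζ)) (norm_nonneg (F (ζ - σ • eTime)))) hmm, ← ENNReal.toReal_mul]
    refine ENNReal.toReal_mono (ENNReal.mul_ne_top hφ.2.ne hF.2.ne) ?_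
    have e2 : eLpNorm (fun ζ => F (ζ - σ • eTime)) 2 volume = eLpNorm F 2 volume :=
      eLpNorm_comp_measurePreserving hF.1 (measurePreserving_sub_right volume (σ • eTime))
    rw [← e2, l2_eq_eLpNorm, l2_eq_eLpNorm]
    refine le_trans (le_of_eq ?_) (lintegral_mul_le_l2_of_aemeasurable hφ.1.enorm
      (hsh σ).1.enorm)
    refine lintegral_congr fun ζ => ?_
    rw [ENNReal.ofReal_mul (norm_nonneg _), ofReal_norm, ofReal_norm]

/-- The convolution in τ is tested against Schwartz functions. Translating the test function by σ in
τ multiplies its transform by a character of time, and integrating these characters against K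
rebuilds the multiplier 𝓕⁻ K. -/
theorem fourier_timeMul_L2 {f g : L2SpaceTime} {K : ℝ → ℂ} (hK : Integrable K)
    (hg : ∀ᵐ z : SpaceTime, g z = 𝓕⁻ K (z 2) * f z) :
    ((𝓕 g : L2SpaceTime) : SpaceTime → ℂ) =ᵐ[volume]
      fun ζ => ∫ σ, K σ * (𝓕 f : L2SpaceTime) (ζ - σ • eTime) := by
  set F : SpaceTime → ℂ := ⇑(𝓕 f : L2SpaceTime) with hF
  have hFL : MemLp F 2 := Lp.memLp _
  have hFm : StronglyMeasurable F := Lp.stronglyMeasurable _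
  have hcI (ζ : SpaceTime) (φ : SpaceTime → ℂ) : φ ζ * ∫ σ, K σ * F (ζ - σ • eTime) =
      ∫ σ, φ ζ * (K σ * F (ζ - σ • eTime)) := (integral_const_mul _ _).symm
  refine ae_eq_of_integral_schwartz_mul_eq ((Lp.memLp _).locallyIntegrable (by norm_num))
    ?_ fun φ => ?_
  · rw [locallyIntegrable_iff]
    intro k hk
    have h1 : MemLp (k.indicator fun _ => (1 : ℂ)) 2 (volume : Measure SpaceTime) :=
      memLp_indicator_const 2 hk.measurableSet 1 (Or.inr hk.measure_lt_top.ne)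
    have h2 := (integrable_mul_timeConv h1 hFL hFm hK).integral_prod_left
    rw [← integrable_indicator_iff hk.measurableSet]
    refine h2.congr (Filter.Eventually.of_forall fun ζ => ?_)
    simp only
    rw [← hcI]
    by_cases h : ζ ∈ k <;> simp [h]
  · have hint := integrable_mul_timeConv (φ.memLp 2 volume) hFL hFm hK
    have hfi : Integrable fun z => 𝓕 φ z * f z := integrable_schwartz_mul _ (Lp.memLp f)
    have hc : Continuous fun w : SpaceTime × ℝ =>
        ((Real.fourierChar (w.2 * w.1 2) : Circle) : ℂ) :=
      continuous_subtype_val.comp (Real.continuous_fourierChar.comp (by fun_prop))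
    have hint' : Integrable (fun w : SpaceTime × ℝ =>
        ((Real.fourierChar (w.2 * w.1 2) : Circle) : ℂ) * ((𝓕 φ w.1 * f w.1) * K w.2))
        (volume.prod volume) := by
      refine (hfi.mul_prod hK).mono (hc.aestronglyMeasurable.mul (hfi.mul_prod hK).1) ?_
      exact Filter.Eventually.of_forall fun w => by simp [Circle.norm_coe]
    calc ∫ ζ, φ ζ * (𝓕 g : L2SpaceTime) ζ = ∫ z, 𝓕 φ z * g z :=
          integral_schwartz_mul_fourier φ g
      _ = ∫ z, ∫ σ, ((Real.fourierChar (σ * z 2) : Circle) : ℂ) * ((𝓕 φ z * f z) * K σ) := by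
          refine integral_congr_ae ?_
          filter_upwards [hg] with z hz
          rw [hz, Real.fourierInv_eq, mul_left_comm, ← integral_mul_const]
          refine integral_congr_ae (Filter.Eventually.of_forall fun σ => ?_)
          simp only [Circle.smul_def, smul_eq_mul]
          have : inner ℝ σ (z 2) = σ * z 2 := by simp [mul_comm]
          rw [this]; ring
      _ = ∫ σ, ∫ z, ((Real.fourierChar (σ * z 2) : Circle) : ℂ) * ((𝓕 φ z * f z) * K σ) :=
          integral_integral_swap hint'
      _ = ∫ σ, ∫ ζ, φ ζ * (K σ * F (ζ - σ • eTime)) := by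
          refine integral_congr_ae (Filter.Eventually.of_forall fun σ => ?_)
          simp only
          have h1 := integral_schwartz_mul_fourier (φ.compSubConstCLM ℂ (-(σ • eTime))) f
          have h2 : ∫ ζ, φ ζ * (K σ * F (ζ - σ • eTime)) =
              K σ * ∫ ζ, φ ζ * F (ζ - σ • eTime) := by
            rw [← integral_const_mul]
            refine integral_congr_ae (Filter.Eventually.of_forall fun ζ => ?_)
            simp only; ring
          rw [h2, ← integral_add_right_eq_self (fun ζ => φ ζ * F (ζ - σ • eTime)) (σ • eTime)]
          simp only [add_sub_cancel_right]
          simp only [SchwartzMap.compSubConstCLM_apply, sub_neg_eq_add] at h1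
          rw [h1, ← integral_const_mul]
          refine integral_congr_ae (Filter.Eventually.of_forall fun z => ?_)
          have h3 : 𝓕 (φ.compSubConstCLM ℂ (-(σ • eTime))) z =
              ((Real.fourierChar (σ * z 2) : Circle) : ℂ) * 𝓕 φ z := by
            rw [SchwartzMap.fourier_coe, SchwartzMap.fourier_coe, Real.fourier_eq, Real.fourier_eq,
              ← integral_const_mul, ← integral_sub_right_eq_self _ (σ • eTime)]
            refine integral_congr_ae (Filter.Eventually.of_forall fun x => ?_)
            have : inner ℝ eTime z = z 2 := by rw [real_inner_comm, inner_eTime]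
            simp only [SchwartzMap.compSubConstCLM_apply, sub_neg_eq_add, sub_add_cancel,
              inner_sub_left, inner_smul_left, this, neg_sub, Circle.smul_def, smul_eq_mul]
            simp only [sub_eq_add_neg, AddChar.map_add_eq_mul, Circle.coe_mul]
            simp [mul_assoc]
          simp only [h3]
          ring
      _ = ∫ ζ, ∫ σ, φ ζ * (K σ * F (ζ - σ • eTime)) := (integral_integral_swap hint).symm
      _ = _ := by
          refine integral_congr_ae (Filter.Eventually.of_forall fun ζ => ?_)
          exact (hcI ζ φ).symm

/-! ### Time localization at scale `2^{-l}` in the spaces `X` -/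

/-- `ψ` is a bump function of size `A` around the time `2^{-l} m`, at scale `2^{-l}`. -/
structure TimeBump (l : ℕ) (m A : ℝ) (ψ : ℝ → ℝ) : Prop where
  contDiff : ContDiff ℝ 2 ψ
  eq_zero : ∀ t, 2 < |2 ^ l * t - m| → ψ t = 0
  abs_le : ∀ t, |ψ t| ≤ A
  abs_deriv_le : ∀ t, |deriv (deriv ψ) t| ≤ A * (2 ^ l) ^ 2

/-- The Fourier transform of a function of time. -/
def timeKernel (ψ : ℝ → ℝ) : ℝ → ℂ := 𝓕 fun t => (ψ t : ℂ)

theorem integrable_of_support {l : ℕ} {m : ℝ} {g : ℝ → ℝ} (hg : Continuous g)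
    (h0 : ∀ t, 2 < |2 ^ l * t - m| → g t = 0) : Integrable fun t => (g t : ℂ) := by
  have hp : (0 : ℝ) < 2 ^ l := by positivity
  refine Continuous.integrable_of_hasCompactSupport (by fun_prop) ?_
  refine HasCompactSupport.intro (isCompact_Icc (a := (m - 2) / 2 ^ l) (b := (m + 2) / 2 ^ l))
    fun t ht => ?_
  rw [h0 t, Complex.ofReal_zero]
  by_contra h
  push Not at h
  rw [abs_le] at h
  refine ht ⟨?_, ?_⟩
  · rw [div_le_iff₀ hp]; linarith
  · rw [le_div_iff₀ hp]; linarith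

theorem norm_fourier_le_of_support {l : ℕ} {m B : ℝ} {g : ℝ → ℝ}
    (h0 : ∀ t, 2 < |2 ^ l * t - m| → g t = 0) (hB : ∀ t, |g t| ≤ B) (s : ℝ) :
    ‖𝓕 (fun t => (g t : ℂ)) s‖ ≤ 4 * B / 2 ^ l := by
  have hp : (0 : ℝ) < 2 ^ l := by positivity
  set I : Set ℝ := Icc ((m - 2) / 2 ^ l) ((m + 2) / 2 ^ l) with hI
  have h1 : ∀ t, t ∉ I → ‖(g t : ℂ)‖ = 0 := by
    intro t ht
    rw [h0 t, Complex.ofReal_zero, norm_zero]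
    by_contra h
    push Not at h
    rw [abs_le] at h
    refine ht ⟨?_, ?_⟩
    · rw [div_le_iff₀ hp]; linarith
    · rw [le_div_iff₀ hp]; linarith
  calc ‖𝓕 (fun t => (g t : ℂ)) s‖ ≤ ∫ t, ‖(g t : ℂ)‖ :=
        VectorFourier.norm_fourierIntegral_le_integral_norm _ _ _ _ _
    _ = ∫ t in I, ‖(g t : ℂ)‖ := (setIntegral_eq_integral_of_forall_compl_eq_zero h1).symm
    _ ≤ ‖∫ t in I, ‖(g t : ℂ)‖‖ := le_abs_self _
    _ ≤ B * volume.real I := by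
        refine norm_setIntegral_le_of_norm_le_const (by rw [hI]; exact measure_Icc_lt_top)
          fun t _ => ?_
        rw [norm_norm, Complex.norm_real]
        exact hB t
    _ = 4 * B / 2 ^ l := by
        rw [hI, Real.volume_real_Icc_of_le (by gcongr; linarith)]
        field_simp
        ring

theorem deriv_eq_zero_of_support {l : ℕ} {m : ℝ} {g : ℝ → ℝ}
    (h0 : ∀ t, 2 < |2 ^ l * t - m| → g t = 0) (t : ℝ) (ht : 2 < |2 ^ l * t - m|) :
    deriv g t = 0 := by
  have hU : IsOpen {t : ℝ | 2 < |2 ^ l * t - m|} := isOpen_lt (by fun_prop) (by fun_prop)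
  have h1 : g =ᶠ[nhds t] fun _ => 0 := by
    filter_upwards [hU.mem_nhds ht] with x hx using h0 x hx
  rw [h1.deriv_eq, deriv_const]

theorem deriv_ofReal_comp {g : ℝ → ℝ} (hg : Differentiable ℝ g) :
    deriv (fun t => (g t : ℂ)) = fun t => ((deriv g t : ℝ) : ℂ) :=
  funext fun t => (hg t).hasDerivAt.ofReal_comp.deriv

section

variable {l : ℕ} {m A : ℝ} {ψ : ℝ → ℝ} (h : TimeBump l m A ψ)
include h

theorem TimeBump.nonneg : 0 ≤ A := (abs_nonneg _).trans (h.abs_le 0)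

theorem TimeBump.integrable : Integrable fun t => (ψ t : ℂ) :=
  integrable_of_support h.contDiff.continuous h.eq_zero

theorem TimeBump.fourier_deriv_deriv (s : ℝ) :
    𝓕 (fun t => ((deriv (deriv ψ) t : ℝ) : ℂ)) s =
      (2 * Real.pi * Complex.I * s) ^ 2 * timeKernel ψ s := by
  have hc := h.contDiff
  have hd : Differentiable ℝ ψ := hc.differentiable (by norm_num)
  have hc' : ContDiff ℝ 1 (deriv ψ) := by fun_prop
  have hd' : Differentiable ℝ (deriv ψ) := hc'.differentiable (by norm_num)
  have hz' := deriv_eq_zero_of_support h.eq_zero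
  have hz'' := deriv_eq_zero_of_support hz'
  have hi' : Integrable fun t => ((deriv ψ t : ℝ) : ℂ) := integrable_of_support hc'.continuous hz'
  have hi'' : Integrable fun t => ((deriv (deriv ψ) t : ℝ) : ℂ) :=
    integrable_of_support (by fun_prop) hz''
  have e1 := deriv_ofReal_comp hd
  have e2 := deriv_ofReal_comp hd'
  have hD : Differentiable ℝ fun t => (ψ t : ℂ) := fun t =>
    (hd t).hasDerivAt.ofReal_comp.differentiableAt
  have hD' : Differentiable ℝ fun t => ((deriv ψ t : ℝ) : ℂ) := fun t =>
    (hd' t).hasDerivAt.ofReal_comp.differentiableAt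
  have f1 := Real.fourier_deriv h.integrable hD (by rw [e1]; exact hi')
  have f2 := Real.fourier_deriv hi' hD' (by rw [e2]; exact hi'')
  rw [e1] at f1
  rw [e2] at f2
  rw [f2]
  simp only
  rw [f1]
  simp only [smul_eq_mul, timeKernel]
  ring

/-- The support has length 4/2^l, so the L¹ norms of ψ and ψ'' are at most 4A/2^l and 4A·2^l; the
second controls s² times the kernel. Adding the two bounds gives the Cauchy profile with constant 8
= 4 + 4. The argument s/(2π) converts to the normalization without 2π in the phase. -/
theorem TimeBump.norm_kernel_le (s : ℝ) :
    ‖timeKernel ψ (s / (2 * Real.pi))‖ ≤ 8 * A * ((2 ^ l)⁻¹ / (1 + (s / 2 ^ l) ^ 2)) := by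
  have hp : (0 : ℝ) < 2 ^ l := by positivity
  have hpi := Real.pi_pos
  have h1 := norm_fourier_le_of_support h.eq_zero h.abs_le (s / (2 * Real.pi))
  have h2 := norm_fourier_le_of_support
    (deriv_eq_zero_of_support (deriv_eq_zero_of_support h.eq_zero)) h.abs_deriv_le
    (s / (2 * Real.pi))
  rw [h.fourier_deriv_deriv, norm_mul, norm_pow] at h2
  have e : ‖(2 * Real.pi * Complex.I * ((s / (2 * Real.pi) : ℝ) : ℂ))‖ = |s| := by
    have : (2 * Real.pi * Complex.I * ((s / (2 * Real.pi) : ℝ) : ℂ)) = Complex.I * s := by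
      push_cast
      have : (Real.pi : ℂ) ≠ 0 := by exact_mod_cast hpi.ne'
      field_simp
    rw [this, norm_mul, Complex.norm_I, one_mul, Complex.norm_real, Real.norm_eq_abs]
  rw [e, sq_abs] at h2
  change ‖timeKernel ψ (s / (2 * Real.pi))‖ ≤ _ at h1
  set N := ‖timeKernel ψ (s / (2 * Real.pi))‖ with hN
  set a : ℝ := 2 ^ l with ha
  have e3 : 8 * A * (a⁻¹ / (1 + (s / a) ^ 2)) = 8 * A * a / (a ^ 2 + s ^ 2) := by
    field_simp
  rw [e3, le_div_iff₀ (by positivity)]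
  have h1' : N * a ≤ 4 * A := by rwa [le_div_iff₀ hp] at h1
  have h2' : s ^ 2 * N ≤ 4 * A * a := by
    refine h2.trans (le_of_eq ?_); field_simp
  nlinarith [mul_le_mul_of_nonneg_right h1' hp.le]

theorem TimeBump.continuous_kernel : Continuous (timeKernel ψ) :=
  VectorFourier.fourierIntegral_continuous Real.continuous_fourierChar continuous_inner h.integrable

theorem TimeBump.integrable_kernel : Integrable (timeKernel ψ) := by
  have hp : (0 : ℝ) < 2 ^ l := by positivity
  have hpi := Real.pi_pos
  have h1 : Integrable fun s : ℝ => 8 * A * ((2 ^ l)⁻¹ / (1 + (s / 2 ^ l) ^ 2)) := by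
    have := (integrable_inv_one_add_sq.comp_div hp.ne').const_mul (8 * A * (2 ^ l)⁻¹)
    refine this.congr (Filter.Eventually.of_forall fun s => ?_)
    simp only [div_eq_mul_inv]; ring
  have h2 : Integrable fun s : ℝ => timeKernel ψ (s / (2 * Real.pi)) :=
    h1.mono' (h.continuous_kernel.comp (by fun_prop)).aestronglyMeasurable
      (Filter.Eventually.of_forall h.norm_kernel_le)
  exact (integrable_comp_div_iff _ (by positivity)).1 h2

theorem TimeBump.fourierInv_kernel (t : ℝ) : 𝓕⁻ (timeKernel ψ) t = ψ t := by
  have hc : Continuous fun t => (ψ t : ℂ) := by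
    have := h.contDiff.continuous
    fun_prop
  have := hc.fourierInv_fourier_eq h.integrable h.integrable_kernel
  exact congrFun this t

end

theorem measurable_fourierST (f : L2SpaceTime) : Measurable (fourierST f) :=
  (Lp.stronglyMeasurable _).measurable.comp (by fun_prop)

theorem ae_fourierST {P : SpaceTime → Prop} (h : ∀ᵐ ζ, P ζ) :
    ∀ᵐ ζ : SpaceTime, P ((2 * Real.pi)⁻¹ • ζ) :=
  (Measure.quasiMeasurePreserving_smul volume (by positivity)).ae h

theorem lintegral_comp_div {c : ℝ} (hc : 0 < c) (F : ℝ → ℝ≥0∞) :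
    ∫⁻ s, F (s / c) = ENNReal.ofReal c * ∫⁻ s, F s := by
  have h := Real.smul_map_volume_mul_left hc.ne'
  have e : (c * ·) = (Homeomorph.mulLeft₀ c hc.ne').toMeasurableEquiv := rfl
  conv_lhs => rw [← h]
  rw [lintegral_smul_measure, e, lintegral_map_equiv, abs_of_pos hc]
  simp [hc.ne']

/-- The convolution formula is rescaled by 2π to the variables of `fourierST`. The Jacobian 2π ≥ 1
is simply dropped. -/
theorem enorm_fourierST_timeMul_le {l : ℕ} {m A : ℝ} {ψ : ℝ → ℝ} (h : TimeBump l m A ψ)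
    {f g : L2SpaceTime} (hg : ∀ᵐ z : SpaceTime, g z = ψ (z 2) * f z) :
    ∀ᵐ ζ, ‖fourierST g ζ‖ₑ ≤
      ENNReal.ofReal (8 * A) * cauchyAvg l (fun ζ => ‖fourierST f ζ‖ₑ) ζ := by
  have hpi := Real.pi_pos
  have hA := h.nonneg
  have h1 := fourier_timeMul_L2 (f := f) (g := g) h.integrable_kernel
    (by filter_upwards [hg] with z hz; rw [hz, h.fourierInv_kernel])
  filter_upwards [ae_fourierST h1] with ζ hζ
  have e1 : (∫⁻ σ, ‖timeKernel ψ σ * (𝓕 f : L2SpaceTime) ((2 * Real.pi)⁻¹ • ζ - σ • eTime)‖ₑ) ≤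
      ∫⁻ s, ‖timeKernel ψ (s / (2 * Real.pi))‖ₑ * ‖fourierST f (ζ - s • eTime)‖ₑ := by
    have e2 := lintegral_comp_div (c := 2 * Real.pi) (by positivity)
      fun σ => ‖timeKernel ψ σ * (𝓕 f : L2SpaceTime) ((2 * Real.pi)⁻¹ • ζ - σ • eTime)‖ₑ
    have e3 : (∫⁻ s, ‖timeKernel ψ (s / (2 * Real.pi))‖ₑ * ‖fourierST f (ζ - s • eTime)‖ₑ) =
        ENNReal.ofReal (2 * Real.pi) * ∫⁻ σ, ‖timeKernel ψ σ *
          (𝓕 f : L2SpaceTime) ((2 * Real.pi)⁻¹ • ζ - σ • eTime)‖ₑ := by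
      rw [← e2]
      refine lintegral_congr fun s => ?_
      rw [enorm_mul, fourierST, smul_sub, smul_smul, div_eq_inv_mul]
    rw [e3]
    refine le_mul_of_one_le_left zero_le ?_
    rw [ENNReal.one_le_ofReal]
    linarith [Real.pi_gt_three]
  have hfz : fourierST g ζ = ∫ σ, timeKernel ψ σ *
      (𝓕 f : L2SpaceTime) ((2 * Real.pi)⁻¹ • ζ - σ • eTime) := hζ
  rw [hfz]
  refine (enorm_integral_le_lintegral_enorm _).trans (e1.trans ?_)
  rw [cauchyAvg, ← lintegral_const_mul' _ _ ENNReal.ofReal_ne_top]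
  refine lintegral_mono fun s => ?_
  rw [← mul_assoc, ← ENNReal.ofReal_mul (by positivity), ← ofReal_norm]
  exact mul_le_mul_left (ENNReal.ofReal_le_ofReal (h.norm_kernel_le s)) _

/-- The constant in `yNorm_timeMul_le`. -/
def bumpConst : ℝ≥0∞ := 8 * (16 * geomConst (1 / 2) * geomConst 1) * 4

theorem bumpConst_ne_top : bumpConst ≠ ⊤ := by
  have h1 := geomConst_ne_top (x := 1 / 2) (by norm_num)
  have h2 := geomConst_ne_top (x := 1) (by norm_num)
  unfold bumpConst
  finiteness

/-- Localizing a function of `F_k` to a time interval of length `2^{-l}`, `l ≥ k + 2`. -/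
theorem yNorm_timeMul_le (η : Cutoff) {k l : ℕ} (hkl : k + 2 ≤ l) {m A : ℝ} {ψ : ℝ → ℝ}
    (h : TimeBump l m A ψ) {f g : L2SpaceTime} (hg : ∀ᵐ z : SpaceTime, g z = ψ (z 2) * f z) :
    yNorm l (fun ζ => ‖fourierST g ζ‖ₑ) ≤ bumpConst * ENNReal.ofReal A * fkNorm η k f := by
  have hA := h.nonneg
  set t₀ : ℝ := m / 2 ^ l with ht₀
  have hp : (0 : ℝ) < 2 ^ l := by positivity
  -- On the support of ψ one has |2^l t - m| ≤ 2, hence |2^k (t - t₀)| ≤ 2·2^{k-l} ≤ 1/2 and the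
  -- cutoff equals 1. Thus f may be replaced by the localized function that the F_k norm measures.
  have hg' : ∀ᵐ z : SpaceTime, g z = ψ (z 2) * timeCut η k t₀ f z := by
    filter_upwards [hg, (memLp_timeCut η k t₀ f).coeFn_toLp] with z hz hz'
    rw [hz, timeCut, hz']
    by_cases hb : 2 < |2 ^ l * z 2 - m|
    · rw [h.eq_zero _ hb]; simp
    · push Not at hb
      rw [η.eq_one' (r := 2 ^ k * (z 2 - t₀))]
      · simp
      · have e : 2 ^ k * (z 2 - t₀) = (2 ^ l * z 2 - m) * (2 ^ k / 2 ^ l) := by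
          rw [ht₀]; field_simp
        have e2 : (2 : ℝ) ^ k / 2 ^ l ≤ 1 / 4 := by
          rw [div_le_iff₀ hp]
          have : (2 : ℝ) ^ (k + 2) ≤ 2 ^ l := pow_le_pow_right₀ (by norm_num) hkl
          rw [pow_add] at this; linarith
        rw [e, abs_mul, abs_of_nonneg (by positivity : (0 : ℝ) ≤ 2 ^ k / 2 ^ l)]
        calc _ ≤ 2 * (1 / 4 : ℝ) := by gcongr
          _ ≤ _ := by norm_num
  have hm : Measurable fun ζ => ‖fourierST (timeCut η k t₀ f) ζ‖ₑ :=
    (measurable_fourierST _).enorm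
  calc yNorm l (fun ζ => ‖fourierST g ζ‖ₑ)
      ≤ yNorm l fun ζ => ENNReal.ofReal (8 * A) *
          cauchyAvg l (fun ζ => ‖fourierST (timeCut η k t₀ f) ζ‖ₑ) ζ :=
        yNorm_mono_ae (enorm_fourierST_timeMul_le h hg')
    _ = ENNReal.ofReal (8 * A) *
          yNorm l (cauchyAvg l fun ζ => ‖fourierST (timeCut η k t₀ f) ζ‖ₑ) :=
        yNorm_const_mul _ _ (measurable_cauchyAvg l hm)
    _ ≤ ENNReal.ofReal (8 * A) * (16 * geomConst (1 / 2) * geomConst 1 *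
          (4 * fkNorm η k f)) := by
        gcongr
        refine (yNorm_cauchyAvg_le l hm).trans ?_
        gcongr
        refine (yNorm_zero_le_xNorm η (measurable_fourierST _)).trans ?_
        gcongr
        exact le_iSup (fun t₀ => xNorm η (fourierST (timeCut η k t₀ f))) t₀
    _ = _ := by
        rw [bumpConst, ENNReal.ofReal_mul (by norm_num)]
        norm_num
        ring

/-! ### Bump functions of time -/

/-- `u` and its first two derivatives are bounded by `A`. -/
structure C2Bound (A : ℝ) (u : ℝ → ℝ) : Prop where
  contDiff : ContDiff ℝ 2 u
  abs_le : ∀ t, |u t| ≤ A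
  abs_deriv_le : ∀ t, |deriv u t| ≤ A
  abs_deriv_deriv_le : ∀ t, |deriv (deriv u) t| ≤ A

theorem C2Bound.mono {A B : ℝ} {u : ℝ → ℝ} (h : C2Bound A u) (hAB : A ≤ B) : C2Bound B u :=
  ⟨h.contDiff, fun t => (h.abs_le t).trans hAB, fun t => (h.abs_deriv_le t).trans hAB,
    fun t => (h.abs_deriv_deriv_le t).trans hAB⟩

theorem C2Bound.one : C2Bound 1 fun _ => 1 := by
  have : deriv (fun _ : ℝ => (1 : ℝ)) = fun _ => 0 := by simp
  exact ⟨contDiff_const, by simp, by simp, by simp⟩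

theorem C2Bound.exists_of_hasCompactSupport {u : ℝ → ℝ} (h : ContDiff ℝ 2 u)
    (hs : HasCompactSupport u) : ∃ A, C2Bound A u := by
  obtain ⟨A, hA⟩ := hs.exists_bound_of_continuous h.continuous
  obtain ⟨B, hB⟩ := hs.deriv.exists_bound_of_continuous (h.continuous_deriv (by norm_num))
  have h' : ContDiff ℝ 1 (deriv u) := h.deriv'
  obtain ⟨C, hC⟩ := hs.deriv.deriv.exists_bound_of_continuous (h'.continuous_deriv (by norm_num))
  exact ⟨max A (max B C), h, fun t => (hA t).trans (le_max_left _ _),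
    fun t => (hB t).trans ((le_max_left _ _).trans (le_max_right _ _)),
    fun t => (hC t).trans ((le_max_right _ _).trans (le_max_right _ _))⟩

theorem abs_mul_le_mul {x y X Y : ℝ} (hx : |x| ≤ X) (hy : |y| ≤ Y) : |x * y| ≤ X * Y := by
  rw [abs_mul]
  exact mul_le_mul hx hy (abs_nonneg _) ((abs_nonneg _).trans hx)

/-- A factor varying at a rate a ≤ 2^l does not spoil a bump at scale 2^{-l}: each of the four
Leibniz terms in the second derivative is at most A²(2^l)². -/
theorem C2Bound.timeBump {A a b m : ℝ} {l : ℕ} {u v : ℝ → ℝ} (hu : C2Bound A u)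
    (hv : C2Bound A v) (hv0 : ∀ x, 2 < |x| → v x = 0) (ha : 0 ≤ a) (hal : a ≤ 2 ^ l) :
    TimeBump l m (4 * A ^ 2) fun t => u (a * t + b) * v (2 ^ l * t - m) := by
  have hA : 0 ≤ A := (abs_nonneg _).trans (hu.abs_le 0)
  have huc := hu.contDiff
  have hvc := hv.contDiff
  set L : ℝ := 2 ^ l with hL
  have hLp : 0 < L := by positivity
  have haL : |a| ≤ L := by rwa [abs_of_nonneg ha]
  have hLL : |L| ≤ L := by rw [abs_of_pos hLp]
  have hLa (w : ℝ → ℝ) (hw : Differentiable ℝ w) (t : ℝ) :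
      HasDerivAt (fun t => w (a * t + b)) (deriv w (a * t + b) * a) t := by
    have h1 : HasDerivAt (fun t => a * t + b) a t := by
      simpa using ((hasDerivAt_id t).const_mul a).add_const b
    exact (hw _).hasDerivAt.comp t h1
  have hLm (w : ℝ → ℝ) (hw : Differentiable ℝ w) (t : ℝ) :
      HasDerivAt (fun t => w (L * t - m)) (deriv w (L * t - m) * L) t := by
    have h1 : HasDerivAt (fun t => L * t - m) L t := by
      simpa using ((hasDerivAt_id t).const_mul L).sub_const m
    exact (hw _).hasDerivAt.comp t h1
  have hud : Differentiable ℝ u := huc.differentiable (by norm_num)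
  have hvd : Differentiable ℝ v := hvc.differentiable (by norm_num)
  have huc' : ContDiff ℝ 1 (deriv u) := by fun_prop
  have hvc' : ContDiff ℝ 1 (deriv v) := by fun_prop
  have hud' : Differentiable ℝ (deriv u) := huc'.differentiable (by norm_num)
  have hvd' : Differentiable ℝ (deriv v) := hvc'.differentiable (by norm_num)
  have d1 : deriv (fun t => u (a * t + b) * v (L * t - m)) = fun t =>
      deriv u (a * t + b) * a * v (L * t - m) + u (a * t + b) * (deriv v (L * t - m) * L) :=
    funext fun t => ((hLa u hud t).mul (hLm v hvd t)).deriv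
  refine ⟨by fun_prop, fun t ht => ?_, fun t => ?_, fun t => ?_⟩
  · rw [hv0 _ ht, mul_zero]
  · have := abs_mul_le_mul (hu.abs_le (a * t + b)) (hv.abs_le (L * t - m))
    refine this.trans ?_
    nlinarith [sq_nonneg A]
  · have d2 : deriv (fun t => deriv u (a * t + b) * a * v (L * t - m) +
        u (a * t + b) * (deriv v (L * t - m) * L)) t =
        ((deriv (deriv u) (a * t + b) * a * a) * v (L * t - m) +
          deriv u (a * t + b) * a * (deriv v (L * t - m) * L)) +
        (deriv u (a * t + b) * a * (deriv v (L * t - m) * L) +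
          u (a * t + b) * (deriv (deriv v) (L * t - m) * L * L)) :=
      ((((hLa _ hud' t).mul_const a).mul (hLm v hvd t)).add
        ((hLa u hud t).mul ((hLm _ hvd' t).mul_const L))).deriv
    rw [d1, d2]
    have b1 := abs_mul_le_mul (abs_mul_le_mul (abs_mul_le_mul
      (hu.abs_deriv_deriv_le (a * t + b)) haL) haL) (hv.abs_le (L * t - m))
    have b2 := abs_mul_le_mul (abs_mul_le_mul
      (hu.abs_deriv_le (a * t + b)) haL) (abs_mul_le_mul (hv.abs_deriv_le (L * t - m)) hLL)
    have b3 := abs_mul_le_mul (hu.abs_le (a * t + b)) (abs_mul_le_mul (abs_mul_le_mul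
      (hv.abs_deriv_deriv_le (L * t - m)) hLL) hLL)
    refine (abs_add_le _ _).trans ((add_le_add (abs_add_le _ _) (abs_add_le _ _)).trans ?_)
    refine (add_le_add (add_le_add b1 b2) (add_le_add b2 b3)).trans (le_of_eq ?_)
    ring

/-- A bump function whose integer translates sum to `1`. -/
def unitBump (x : ℝ) : ℝ := Real.smoothTransition (x + 1) - Real.smoothTransition x

theorem unitBump_eq_zero {x : ℝ} (h : 1 < |x|) : unitBump x = 0 := by
  rcases lt_abs.1 h with h | h
  · rw [unitBump, Real.smoothTransition.one_of_one_le (by linarith),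
      Real.smoothTransition.one_of_one_le (by linarith), sub_self]
  · rw [unitBump, Real.smoothTransition.zero_of_nonpos (by linarith),
      Real.smoothTransition.zero_of_nonpos (by linarith), sub_self]

theorem contDiff_unitBump : ContDiff ℝ 2 unitBump := by
  have h : ContDiff ℝ 2 Real.smoothTransition := Real.smoothTransition.contDiff (n := 2)
  exact (h.comp (contDiff_id.add contDiff_const)).sub h

/-- A bump is a difference of two translates of one transition function, so the sum telescopes; |x|
≤ N puts the ends where the transition is 1 and 0. -/
theorem sum_unitBump (N : ℕ) {x : ℝ} (hx : |x| ≤ N) :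
    ∑ i ∈ Finset.range (2 * N + 1), unitBump (x - (i - N : ℝ)) = 1 := by
  have h1 : ∀ n : ℕ, ∑ i ∈ Finset.range n, unitBump (x - (i - N : ℝ)) =
      Real.smoothTransition (x + N + 1) - Real.smoothTransition (x + N + 1 - n) := by
    intro n
    induction n with
    | zero => simp
    | succ n ih =>
      rw [Finset.sum_range_succ, ih, unitBump]
      push_cast
      ring_nf
  rw [abs_le] at hx
  rw [h1, Real.smoothTransition.one_of_one_le (by linarith),
    Real.smoothTransition.zero_of_nonpos (by push_cast; linarith), sub_zero]

theorem Cutoff.exists_c2Bound (η : Cutoff) :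
    ∃ A : ℝ, 1 ≤ A ∧ C2Bound A η.toFun ∧ C2Bound A unitBump := by
  obtain ⟨A, hA⟩ := C2Bound.exists_of_hasCompactSupport (u := η.toFun)
    (η.smooth.of_le (by norm_cast))
    (HasCompactSupport.intro (isCompact_Icc (a := -2) (b := 2)) fun x hx =>
      η.eq_zero (by
        by_contra h
        push Not at h
        rw [abs_le] at h
        exact hx ⟨by linarith, by linarith⟩))
  obtain ⟨B, hB⟩ := C2Bound.exists_of_hasCompactSupport (u := unitBump) contDiff_unitBump
    (HasCompactSupport.intro (isCompact_Icc (a := -2) (b := 2)) fun x hx =>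
      unitBump_eq_zero (by
        by_contra h
        push Not at h
        rw [abs_le] at h
        exact hx ⟨by linarith, by linarith⟩))
  exact ⟨max 1 (max A B), le_max_left _ _,
    hA.mono ((le_max_left _ _).trans (le_max_right _ _)),
    hB.mono ((le_max_right _ _).trans (le_max_right _ _))⟩

/-- A uniform bound on the size of the bump functions in use. -/
def Cutoff.bumpSize (η : Cutoff) : ℝ := 4 * η.exists_c2Bound.choose ^ 2

theorem Cutoff.timeBump_cutoff (η : Cutoff) (l : ℕ) (m : ℝ) :
    TimeBump l m η.bumpSize fun t => η.toFun (2 ^ l * t - m) := by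
  obtain ⟨h1, h2, -⟩ := η.exists_c2Bound.choose_spec
  have := (C2Bound.one.mono h1).timeBump (a := 0) (b := 0) (m := m) (l := l) h2
    (fun x hx => η.eq_zero (by linarith)) le_rfl (by positivity)
  simpa [Cutoff.bumpSize] using this

theorem Cutoff.timeBump_unitBump (η : Cutoff) (l : ℕ) (m : ℝ) :
    TimeBump l m η.bumpSize fun t => unitBump (2 ^ l * t - m) := by
  obtain ⟨h1, -, h2⟩ := η.exists_c2Bound.choose_spec
  have := (C2Bound.one.mono h1).timeBump (a := 0) (b := 0) (m := m) (l := l) h2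
    (fun x hx => unitBump_eq_zero (by linarith)) le_rfl (by positivity)
  simpa [Cutoff.bumpSize] using this

theorem Cutoff.timeBump_mul (η : Cutoff) {k l : ℕ} (hkl : k ≤ l) (t₀ m : ℝ) :
    TimeBump l m η.bumpSize fun t => η.toFun (2 ^ k * (t - t₀)) * unitBump (2 ^ l * t - m) := by
  obtain ⟨-, h2, h3⟩ := η.exists_c2Bound.choose_spec
  have := h2.timeBump (a := 2 ^ k) (b := -(2 ^ k * t₀)) (m := m) (l := l) h3
    (fun x hx => unitBump_eq_zero (by linarith)) (by positivity)
    (pow_le_pow_right₀ (by norm_num) hkl)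
  simpa [Cutoff.bumpSize, mul_sub, sub_eq_add_neg, mul_add] using this

theorem Cutoff.timeBump_timeCut (η : Cutoff) (k : ℕ) (t₀ : ℝ) :
    TimeBump k (2 ^ k * t₀) η.bumpSize fun t => η.toFun (2 ^ k * (t - t₀)) := by
  simpa [mul_sub] using η.timeBump_cutoff k (2 ^ k * t₀)

theorem exists_timeMul {l : ℕ} {m A : ℝ} {ψ : ℝ → ℝ} (h : TimeBump l m A ψ) (f : L2SpaceTime) :
    ∃ g : L2SpaceTime, ∀ᵐ z : SpaceTime, g z = ψ (z 2) * f z := by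
  have hc : Continuous fun z : SpaceTime => (ψ (z 2) : ℂ) := by
    have := h.contDiff.continuous
    fun_prop
  have hm : MemLp (fun z : SpaceTime => (ψ (z 2) : ℂ) * f z) 2 := by
    refine MemLp.of_le_mul (c := A) (Lp.memLp f)
      (hc.aestronglyMeasurable.mul (Lp.aestronglyMeasurable f)) ?_
    refine Filter.Eventually.of_forall fun z => ?_
    rw [norm_mul, Complex.norm_real, Real.norm_eq_abs]
    gcongr
    exact h.abs_le _
  exact ⟨hm.toLp _, hm.coeFn_toLp⟩

/-! ### The operator `P_k ∂_x` from `L¹` to `L²` -/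

theorem measurableSet_freqSet (k : ℕ) : MeasurableSet (freqSet k) := by
  have h : Measurable fun x : ℝ => |x| := by fun_prop
  unfold freqSet
  split_ifs
  · exact measurableSet_lt h measurable_const
  · exact h measurableSet_Ico

theorem measurableSet_wideFreqSet (k : ℕ) : MeasurableSet (wideFreqSet k) := by
  have h : Measurable fun x : ℝ => |x| := by fun_prop
  unfold wideFreqSet
  split_ifs
  · exact measurableSet_le h measurable_const
  · exact h measurableSet_Icc

theorem abs_lt_of_mem_freqSet {k : ℕ} {x : ℝ} (h : x ∈ freqSet k) : |x| < 3 / 2 * 2 ^ k := by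
  unfold freqSet at h
  split_ifs at h with hk
  · simpa [hk] using h
  · exact h.2

theorem le_abs_of_mem_freqSet {k : ℕ} (hk : k ≠ 0) {x : ℝ} (h : x ∈ freqSet k) :
    3 / 4 * 2 ^ k ≤ |x| := by
  rw [freqSet, if_neg hk] at h
  exact h.1

theorem abs_le_of_mem_wideFreqSet {k : ℕ} {x : ℝ} (h : x ∈ wideFreqSet k) :
    |x| ≤ 2 ^ (k + 1) := by
  unfold wideFreqSet at h
  split_ifs at h with hk
  · simpa [hk] using h
  · exact_mod_cast h.2

theorem le_abs_of_mem_wideFreqSet {k : ℕ} (hk : k ≠ 0) {x : ℝ} (h : x ∈ wideFreqSet k) :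
    2 ^ k / 2 ≤ |x| := by
  rw [wideFreqSet, if_neg hk] at h
  have := h.1
  rwa [zpow_sub₀ (by norm_num), zpow_natCast, zpow_one] at this

theorem freqSet_subset_wideFreqSet (k : ℕ) : freqSet k ⊆ wideFreqSet k := by
  intro x hx
  have h1 := abs_lt_of_mem_freqSet hx
  by_cases hk : k = 0
  · subst hk
    simp only [wideFreqSet, if_true, mem_ofPred_eq]
    norm_num at h1
    linarith
  · have h2 := le_abs_of_mem_freqSet hk hx
    have hp : (0 : ℝ) < 2 ^ k := by positivity
    rw [wideFreqSet, if_neg hk]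
    refine ⟨?_, ?_⟩
    · rw [zpow_sub₀ (by norm_num), zpow_natCast, zpow_one]; linarith
    · rw [zpow_add₀ (by norm_num), zpow_natCast, zpow_one]; linarith

/-- The symbol of `P_k ∂_x`, as a function of the first frequency variable of Mathlib's Fourier
transform. -/
def dxSymbol (k : ℕ) (x : ℝ) : ℂ :=
  (freqSet k).indicator (fun ξ : ℝ => Complex.I * ξ) (2 * Real.pi * x)

theorem measurable_dxSymbol (k : ℕ) : Measurable (dxSymbol k) := by
  have h : Measurable ((freqSet k).indicator fun ξ : ℝ => Complex.I * (ξ : ℂ)) :=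
    Measurable.indicator (by fun_prop) (measurableSet_freqSet k)
  exact h.comp (by fun_prop)

theorem norm_dxSymbol_le (k : ℕ) (x : ℝ) : ‖dxSymbol k x‖ ≤ 2 ^ (k + 1) := by
  unfold dxSymbol
  by_cases h : 2 * Real.pi * x ∈ freqSet k
  · rw [indicator_of_mem h, norm_mul, Complex.norm_I, one_mul, Complex.norm_real,
      Real.norm_eq_abs]
    have h1 := abs_lt_of_mem_freqSet h
    have hp : (0 : ℝ) < 2 ^ k := by positivity
    rw [pow_succ]; linarith
  · rw [indicator_of_notMem h, norm_zero]; positivity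

/-- `O = P_k ∂_x p` for an integrable function `p` on space-time. -/
structure IsDx (k : ℕ) (p : SpaceTime → ℂ) (O : L2SpaceTime) : Prop where
  integrable : Integrable p
  fourier_eq : ∀ᵐ q : SpaceTime, (𝓕 O : L2SpaceTime) q = dxSymbol k (q 0) * 𝓕 p q

theorem fourier_injective_L2 {f g : L2SpaceTime} (h : (𝓕 f : L2SpaceTime) = 𝓕 g) : f = g := by
  have h1 : (𝓕⁻ (𝓕 f : L2SpaceTime) : L2SpaceTime) = f := FourierTransform.fourierInv_fourier_eq f
  have h2 : (𝓕⁻ (𝓕 g : L2SpaceTime) : L2SpaceTime) = g := FourierTransform.fourierInv_fourier_eq g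
  rw [← h1, h, h2]

section

variable {k : ℕ} {p p' : SpaceTime → ℂ} {O O' : L2SpaceTime}

theorem IsDx.congr (h : IsDx k p O) (hp : p =ᵐ[volume] p') : IsDx k p' O :=
  ⟨h.integrable.congr hp, by
    filter_upwards [h.fourier_eq] with q hq
    rw [hq, Real.fourier_congr_ae hp]⟩

theorem IsDx.unique (h : IsDx k p O) (h' : IsDx k p O') : O = O' := by
  refine fourier_injective_L2 (Lp.ext ?_)
  filter_upwards [h.fourier_eq, h'.fourier_eq] with q h1 h2
  rw [h1, h2]

theorem IsDx.zero (k : ℕ) : IsDx k (fun _ => 0) 0 := by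
  refine ⟨integrable_zero _ _ _, ?_⟩
  have : (𝓕 (0 : L2SpaceTime) : L2SpaceTime) = 0 := FourierTransform.fourier_zero
  rw [this]
  filter_upwards [Lp.coeFn_zero ℂ 2 (volume : Measure SpaceTime)] with q hq
  rw [hq, Real.fourier_eq]
  simp

theorem IsDx.add (h : IsDx k p O) (h' : IsDx k p' O') : IsDx k (fun z => p z + p' z) (O + O') := by
  refine ⟨h.integrable.add h'.integrable, ?_⟩
  have : (𝓕 (O + O') : L2SpaceTime) = 𝓕 O + 𝓕 O' := FourierTransform.fourier_add _ _
  rw [this]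
  filter_upwards [h.fourier_eq, h'.fourier_eq,
    Lp.coeFn_add (𝓕 O : L2SpaceTime) (𝓕 O')] with q h1 h2 h3
  rw [h3, Pi.add_apply, h1, h2, ← mul_add]
  congr 1
  have := VectorFourier.fourierIntegral_add (L := innerₗ SpaceTime) (μ := volume)
    Real.continuous_fourierChar continuous_inner h.integrable h'.integrable
  exact (congrFun this q).symm

theorem IsDx.sum {ι : Type*} (s : Finset ι) {p : ι → SpaceTime → ℂ} {O : ι → L2SpaceTime}
    (h : ∀ i ∈ s, IsDx k (p i) (O i)) : IsDx k (fun z => ∑ i ∈ s, p i z) (∑ i ∈ s, O i) := by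
  classical
  induction s using Finset.induction_on with
  | empty => simpa using IsDx.zero k
  | insert i s hi ih =>
    simp only [Finset.sum_insert hi]
    exact (h i (Finset.mem_insert_self _ _)).add
      (ih fun j hj => h j (Finset.mem_insert_of_mem hj))

/-- Multiplication by ψ(t) is a convolution in τ alone, and the symbol of P_k ∂_x depends only on ξ;
hence the two operations commute. -/
theorem IsDx.timeMul {l : ℕ} {m A : ℝ} {ψ : ℝ → ℝ} (hψ : TimeBump l m A ψ) (h : IsDx k p O)
    (hO : ∀ᵐ z : SpaceTime, O' z = ψ (z 2) * O z) : IsDx k (fun z => ψ (z 2) * p z) O' := by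
  have hK := hψ.integrable_kernel
  have hc : Continuous fun z : SpaceTime => (ψ (z 2) : ℂ) := by
    have := hψ.contDiff.continuous
    fun_prop
  have hp : Integrable fun z => (ψ (z 2) : ℂ) * p z := by
    refine h.integrable.bdd_mul hc.aestronglyMeasurable (c := A)
      (Filter.Eventually.of_forall fun z => ?_)
    rw [Complex.norm_real, Real.norm_eq_abs]
    exact hψ.abs_le _
  refine ⟨hp, ?_⟩
  have h1 := fourier_timeMul_L2 (f := O) (g := O') hK
    (by filter_upwards [hO] with z hz; rw [hz, hψ.fourierInv_kernel])
  -- The identity for 𝓕 O holds off a null set of space-time. Under the integral in σ it is needed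
  -- along lines in the τ direction; Fubini gives it on almost every such line.
  have h2 : ∀ᵐ q : SpaceTime, ∀ᵐ σ : ℝ, (𝓕 O : L2SpaceTime) (q - σ • eTime) =
      dxSymbol k (q 0) * 𝓕 p (q - σ • eTime) := by
    have hq : Measure.QuasiMeasurePreserving (fun w : SpaceTime × ℝ => w.1 - w.2 • eTime)
        (volume.prod volume) volume := by
      refine ⟨by fun_prop, Measure.AbsolutelyContinuous.mk fun s hs h0 => ?_⟩
      rw [Measure.map_apply (by fun_prop) hs,
        Measure.prod_apply_symm ((by fun_prop : Measurable fun w : SpaceTime × ℝ =>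
          w.1 - w.2 • eTime) hs)]
      simp only [preimage_preimage]
      refine (lintegral_congr fun σ => ?_).trans lintegral_zero
      have := (measurePreserving_sub_right (volume : Measure SpaceTime) (σ • eTime))
        |>.measure_preimage hs.nullMeasurableSet
      rw [h0] at this
      exact this
    have h3 := hq.ae h.fourier_eq
    have h4 := Measure.ae_ae_of_ae_prod h3
    filter_upwards [h4] with q hq
    filter_upwards [hq] with σ hσ
    rw [hσ, sub_smul_eTime_zero]
  filter_upwards [h1, h2] with q hq1 hq2
  have e : (fun z : SpaceTime => (ψ (z 2) : ℂ) * p z) =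
      fun z => 𝓕⁻ (timeKernel ψ) (z 2) * p z := by
    funext z; rw [hψ.fourierInv_kernel]
  rw [hq1, e, fourier_timeMul h.integrable hK, ← integral_const_mul]
  refine integral_congr_ae ?_
  filter_upwards [hq2] with σ hσ
  rw [hσ]; ring

theorem IsDx.freqSupported (h : IsDx k p O) : FreqSupported k O := by
  filter_upwards [ae_fourierST h.fourier_eq] with ζ hζ hnot
  have e : fourierST O ζ = _ := hζ
  rw [e, dxSymbol, indicator_of_notMem, zero_mul]
  have : 2 * Real.pi * ((2 * Real.pi)⁻¹ • ζ).ofLp 0 = ζ 0 := by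
    have := Real.pi_pos
    simp only [PiLp.smul_apply, smul_eq_mul]
    field_simp
  rw [this]
  exact fun h => hnot (freqSet_subset_wideFreqSet k h)

/-- The dilation has Jacobian (2π)³ ≥ 1, so passing between the two normalizations of the transform
costs nothing in this direction. -/
theorem lintegral_le_lintegral_comp_smul (F : SpaceTime → ℝ≥0∞) :
    ∫⁻ q, F q ≤ ∫⁻ ζ : SpaceTime, F ((2 * Real.pi)⁻¹ • ζ) := by
  have hr : (2 * Real.pi)⁻¹ ≠ 0 := by positivity
  have hm := Measure.map_addHaar_smul (volume : Measure SpaceTime) hr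
  have e : (fun x : SpaceTime => (2 * Real.pi)⁻¹ • x) =
      (Homeomorph.smulOfNeZero (2 * Real.pi)⁻¹ hr).toMeasurableEquiv := rfl
  have h2 : ∫⁻ ζ : SpaceTime, F ((2 * Real.pi)⁻¹ • ζ) =
      ∫⁻ q, F q ∂(Measure.map (fun x : SpaceTime => (2 * Real.pi)⁻¹ • x) volume) := by
    rw [e, lintegral_map_equiv]; rfl
  rw [h2, hm, lintegral_smul_measure, smul_eq_mul]
  refine le_mul_of_one_le_left zero_le ?_
  rw [ENNReal.one_le_ofReal, ← inv_pow, inv_inv, abs_of_pos (by positivity)]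
  exact one_le_pow₀ (by linarith [Real.pi_gt_three])

theorem enorm_dxSymbol_mul_fourier_le (k : ℕ) (f g : L2SpaceTime) (ζ : SpaceTime) :
    ‖dxSymbol k (((2 * Real.pi)⁻¹ • ζ) 0) * 𝓕 (fun z => f z * g z) ((2 * Real.pi)⁻¹ • ζ)‖ₑ ≤
      {ζ : SpaceTime | ζ 0 ∈ freqSet k}.indicator (fun ζ => ENNReal.ofReal |ζ 0| *
        conv (fun ζ => ‖fourierST f ζ‖ₑ) (fun ζ => ‖fourierST g ζ‖ₑ) ζ) ζ := by
  have e2 : 2 * Real.pi * ((2 * Real.pi)⁻¹ • ζ).ofLp 0 = ζ 0 := by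
    have := Real.pi_pos
    simp only [PiLp.smul_apply, smul_eq_mul]
    field_simp
  rw [dxSymbol, e2]
  by_cases hm : ζ 0 ∈ freqSet k
  · rw [indicator_of_mem hm, indicator_of_mem (by exact hm), enorm_mul]
    have e3 : ‖Complex.I * ((ζ 0 : ℝ) : ℂ)‖ₑ = ENNReal.ofReal |ζ 0| := by
      rw [← ofReal_norm, norm_mul, Complex.norm_I, one_mul, Complex.norm_real, Real.norm_eq_abs]
    rw [e3]
    gcongr
    rw [fourier_mul_L2]
    refine (enorm_integral_le_lintegral_enorm _).trans
      ((lintegral_le_lintegral_comp_smul _).trans (le_of_eq ?_))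
    rw [conv]
    refine lintegral_congr fun ζ' => ?_
    rw [enorm_mul, ← smul_sub]; rfl
  · rw [indicator_of_notMem hm, zero_mul, enorm_zero]; exact zero_le

/-- The Fourier transform of `P_k ∂_x (f g)` is controlled by a convolution. -/
theorem IsDx.enorm_fourierST_le {f g : L2SpaceTime} (h : IsDx k (fun z => f z * g z) O) :
    ∀ᵐ ζ, ‖fourierST O ζ‖ₑ ≤ {ζ : SpaceTime | ζ 0 ∈ freqSet k}.indicator (fun ζ =>
      ENNReal.ofReal |ζ 0| *
        conv (fun ζ => ‖fourierST f ζ‖ₑ) (fun ζ => ‖fourierST g ζ‖ₑ) ζ) ζ := by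
  filter_upwards [ae_fourierST h.fourier_eq] with ζ hζ
  have e : fourierST O ζ = _ := hζ
  rw [e]
  exact enorm_dxSymbol_mul_fourier_le k f g ζ

/-- The product f g is only in L¹, but finiteness of the convolution norm puts the prospective
Fourier transform into L², where it can be inverted. -/
theorem exists_isDx (k : ℕ) (f g : L2SpaceTime)
    (h : l2 ({ζ : SpaceTime | ζ 0 ∈ freqSet k}.indicator (fun ζ => ENNReal.ofReal |ζ 0| *
        conv (fun ζ => ‖fourierST f ζ‖ₑ) (fun ζ => ‖fourierST g ζ‖ₑ) ζ)) ≠ ⊤) :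
    ∃ O : L2SpaceTime, IsDx k (fun z => f z * g z) O := by
  set p : SpaceTime → ℂ := fun z => f z * g z with hpdef
  have hp : Integrable p := (Lp.memLp f).integrable_mul (Lp.memLp g)
  have hc : Continuous (𝓕 p) :=
    VectorFourier.fourierIntegral_continuous Real.continuous_fourierChar continuous_inner hp
  have hmeas : Measurable fun q : SpaceTime => dxSymbol k (q 0) * 𝓕 p q :=
    ((measurable_dxSymbol k).comp (by fun_prop)).mul hc.measurable
  have hm : MemLp (fun q : SpaceTime => dxSymbol k (q 0) * 𝓕 p q) 2 := by
    refine ⟨hmeas.aestronglyMeasurable, ?_⟩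
    rw [l2_eq_eLpNorm]
    refine lt_of_le_of_lt ?_ h.lt_top
    refine le_of_sq_le_sq ?_
    rw [l2_sq, l2_sq]
    refine (lintegral_le_lintegral_comp_smul _).trans (lintegral_mono fun ζ => ?_)
    exact pow_le_pow_left' (enorm_dxSymbol_mul_fourier_le k f g ζ) 2
  refine ⟨𝓕⁻ (hm.toLp _), hp, ?_⟩
  have e : (𝓕 (𝓕⁻ (hm.toLp _) : L2SpaceTime) : L2SpaceTime) = hm.toLp _ :=
    FourierTransform.fourier_fourierInv_eq _
  rw [e]
  exact hm.coeFn_toLp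

theorem enorm_le_l2_fourierST (O : L2SpaceTime) : ‖O‖ₑ ≤ l2 fun ζ => ‖fourierST O ζ‖ₑ := by
  have h1 : ‖O‖ₑ = ‖(𝓕 O : L2SpaceTime)‖ₑ := by
    rw [← ofReal_norm, ← ofReal_norm, Lp.norm_fourier_eq]
  rw [h1, Lp.enorm_def, l2_eq_eLpNorm]
  refine le_of_sq_le_sq ?_
  rw [l2_sq, l2_sq]
  exact lintegral_le_lintegral_comp_smul _

end

/-- Multiplication by functions of time preserves the support in `ξ`. -/
theorem FreqSupported.timeMul {k l : ℕ} {m A : ℝ} {ψ : ℝ → ℝ} (hψ : TimeBump l m A ψ)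
    {f g : L2SpaceTime} (hf : FreqSupported k f)
    (hg : ∀ᵐ z : SpaceTime, g z = ψ (z 2) * f z) : FreqSupported k g := by
  set S : Set SpaceTime := {ζ | ζ 0 ∈ wideFreqSet k}ᶜ with hS
  have hSm : MeasurableSet S :=
    ((by fun_prop : Measurable fun ζ : SpaceTime => ζ 0) (measurableSet_wideFreqSet k)).compl
  set F : SpaceTime → ℝ≥0∞ := fun ζ => ‖fourierST f ζ‖ₑ with hF
  have hFm : Measurable F := (measurable_fourierST f).enorm
  have hF0 : ∫⁻ ζ, S.indicator F ζ = 0 := by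
    rw [lintegral_eq_zero_iff (hFm.indicator hSm)]
    filter_upwards [hf] with ζ hζ
    by_cases h : ζ ∈ S
    · rw [indicator_of_mem h, hF]
      simp only [hζ h, enorm_zero]; rfl
    · rw [indicator_of_notMem h]; rfl
  -- The complement S of the band is invariant under shifts in τ, so averaging F, which vanishes
  -- almost everywhere on S, gives zero there again.
  have hc0 : ∫⁻ ζ, S.indicator (cauchyAvg l F) ζ = 0 := by
    have hmm : Measurable fun z : SpaceTime × ℝ =>
        ENNReal.ofReal (((2 : ℝ) ^ l)⁻¹ / (1 + (z.2 / 2 ^ l) ^ 2)) *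
          S.indicator F (z.1 - z.2 • eTime) :=
      (by fun_prop : Measurable fun z : SpaceTime × ℝ =>
        ENNReal.ofReal (((2 : ℝ) ^ l)⁻¹ / (1 + (z.2 / 2 ^ l) ^ 2))).mul
        (measurable_comp_sub_smul_eTime (hFm.indicator hSm))
    calc ∫⁻ ζ, S.indicator (cauchyAvg l F) ζ
        = ∫⁻ ζ, ∫⁻ s : ℝ, ENNReal.ofReal (((2 : ℝ) ^ l)⁻¹ / (1 + (s / 2 ^ l) ^ 2)) *
            S.indicator F (ζ - s • eTime) := by
          refine lintegral_congr fun ζ => ?_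
          have hmem (s : ℝ) : ζ - s • eTime ∈ S ↔ ζ ∈ S := by
            simp only [hS, mem_compl_iff, mem_ofPred_eq, sub_smul_eTime_zero]
          by_cases h : ζ ∈ S
          · rw [indicator_of_mem h, cauchyAvg]
            refine lintegral_congr fun s => ?_
            rw [indicator_of_mem ((hmem s).2 h)]
          · rw [indicator_of_notMem h]
            simp [hmem, h]
      _ = ∫⁻ s : ℝ, ∫⁻ ζ, ENNReal.ofReal (((2 : ℝ) ^ l)⁻¹ / (1 + (s / 2 ^ l) ^ 2)) *
            S.indicator F (ζ - s • eTime) := lintegral_lintegral_swap hmm.aemeasurable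
      _ = 0 := by
          refine (lintegral_congr fun s => ?_).trans lintegral_zero
          rw [lintegral_const_mul' _ _ ENNReal.ofReal_ne_top,
            lintegral_sub_right_eq_self (fun ζ => S.indicator F ζ) (s • eTime), hF0, mul_zero]
  rw [lintegral_eq_zero_iff ((measurable_cauchyAvg l hFm).indicator hSm)] at hc0
  filter_upwards [hc0, enorm_fourierST_timeMul_le hψ hg] with ζ h1 h2 h3
  have h4 : ζ ∈ S := h3
  rw [indicator_of_mem h4] at h1
  have h5 : cauchyAvg l F ζ = 0 := h1
  rw [← hF, h5, mul_zero] at h2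
  simpa using h2

/-! ### Dyadic pieces of the bilinear operator -/

theorem coeFn_timeCut (η : Cutoff) (k : ℕ) (t₀ : ℝ) (f : L2SpaceTime) :
    ∀ᵐ z : SpaceTime, timeCut η k t₀ f z = (η.toFun (2 ^ k * (z 2 - t₀)) : ℂ) * f z :=
  (memLp_timeCut η k t₀ f).coeFn_toLp

/-- Localization in time as a bounded operator. -/
def timeCutCLM (η : Cutoff) (k : ℕ) (t₀ : ℝ) : L2SpaceTime →L[ℂ] L2SpaceTime :=
  LinearMap.mkContinuous
    { toFun := timeCut η k t₀
      map_add' := fun f g => Lp.ext (by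
        filter_upwards [coeFn_timeCut η k t₀ f, coeFn_timeCut η k t₀ g,
          coeFn_timeCut η k t₀ (f + g), Lp.coeFn_add f g,
          Lp.coeFn_add (timeCut η k t₀ f) (timeCut η k t₀ g)] with z h1 h2 h3 h4 h5
        rw [h3, h5, h4, Pi.add_apply, Pi.add_apply, h1, h2, mul_add])
      map_smul' := fun c f => Lp.ext (by
        filter_upwards [coeFn_timeCut η k t₀ f, coeFn_timeCut η k t₀ (c • f), Lp.coeFn_smul c f,
          Lp.coeFn_smul c (timeCut η k t₀ f)] with z h1 h2 h3 h4
        simp only [RingHom.id_apply]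
        rw [h2, h4, h3, Pi.smul_apply, Pi.smul_apply, h1, smul_eq_mul, smul_eq_mul]
        ring) }
    1 fun f => by
      rw [one_mul]
      refine Lp.norm_le_norm_of_ae_le ?_
      filter_upwards [coeFn_timeCut η k t₀ f] with z hz
      have h := η.mem_Icc (2 ^ k * (z 2 - t₀))
      simp only [LinearMap.coe_mk, AddHom.coe_mk]
      rw [hz, norm_mul, Complex.norm_real, Real.norm_eq_abs, abs_of_nonneg h.1]
      exact mul_le_of_le_one_left (norm_nonneg _) h.2

theorem timeCutCLM_apply (η : Cutoff) (k : ℕ) (t₀ : ℝ) (f : L2SpaceTime) :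
    timeCutCLM η k t₀ f = timeCut η k t₀ f := rfl

theorem card_filter_abs_sub_le (s : Finset ℕ) (x : ℝ) {R : ℝ} (hR : 0 ≤ R) :
    ((s.filter fun i : ℕ => |(i : ℝ) - x| ≤ R).card : ℝ) ≤ 2 * R + 1 := by
  have h1 : (s.filter fun i : ℕ => |(i : ℝ) - x| ≤ R).card ≤
      (Finset.Icc ⌈x - R⌉ ⌊x + R⌋).card := by
    refine Finset.card_le_card_of_injOn (fun i => (i : ℤ)) (fun i hi => ?_)
      fun i _ j _ h => by simpa using h
    have h2 := (Finset.mem_filter.1 hi).2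
    rw [abs_le] at h2
    rw [Finset.coe_Icc]
    refine ⟨Int.ceil_le.2 ?_, Int.le_floor.2 ?_⟩ <;> push_cast <;> linarith
  have h3 : ((Finset.Icc ⌈x - R⌉ ⌊x + R⌋).card : ℝ) ≤ 2 * R + 1 := by
    rw [Int.card_Icc]
    have h4 : ((⌊x + R⌋ + 1 - ⌈x - R⌉).toNat : ℝ) =
        ((max (⌊x + R⌋ + 1 - ⌈x - R⌉) 0 : ℤ) : ℝ) := by
      rw [← Int.ofNat_toNat]; rfl
    rw [h4]
    push_cast
    refine max_le ?_ (by linarith)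
    linarith [Int.floor_le (x + R), Int.le_ceil (x - R)]
  exact (by exact_mod_cast h1 : _ ≤ _).trans h3

theorem sq_sum_le_of_card_le {ι : Type*} (s : Finset ι) (x : ι → ℝ≥0∞) {n : ℕ}
    (hn : s.card ≤ n) : (∑ i ∈ s, x i) ^ 2 ≤ n ^ 2 * ∑ i ∈ s, x i ^ 2 := by
  rcases s.eq_empty_or_nonempty with rfl | hs
  · simp
  obtain ⟨j, hj, hmax⟩ := s.exists_max_image x hs
  have h1 : ∑ i ∈ s, x i ≤ n * x j := by
    refine (Finset.sum_le_card_nsmul s x (x j) hmax).trans ?_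
    rw [nsmul_eq_mul]
    gcongr
  calc (∑ i ∈ s, x i) ^ 2 ≤ (n * x j) ^ 2 := by gcongr
    _ = n ^ 2 * x j ^ 2 := mul_pow _ _ _
    _ ≤ _ := by
      gcongr
      exact Finset.single_le_sum (f := fun i => x i ^ 2) (fun _ _ => zero_le) hj

/-- The bilinear estimate for convolutions of functions supported in the frequency bands `k₁`,
`k₂`, restricted to the band `k₃`. -/
def ConvBound (k₁ k₂ k₃ l : ℕ) (B : ℝ≥0∞) : Prop :=
  ∀ F₁ F₂ : SpaceTime → ℝ≥0∞, Measurable F₁ → Measurable F₂ →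
    (∀ ζ, F₁ ζ ≠ 0 → ζ 0 ∈ wideFreqSet k₁) → (∀ ζ, F₂ ζ ≠ 0 → ζ 0 ∈ wideFreqSet k₂) →
    zNorm k₃ ({ζ : SpaceTime | ζ 0 ∈ freqSet k₃}.indicator (conv F₁ F₂)) ≤
      B * yNorm l F₁ * yNorm l F₂

/-- The Fourier transform of `f`, cut off to its frequency band. -/
def bandFourier (k : ℕ) (f : L2SpaceTime) : SpaceTime → ℝ≥0∞ :=
  {ζ : SpaceTime | ζ 0 ∈ wideFreqSet k}.indicator fun ζ => ‖fourierST f ζ‖ₑ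

theorem measurableSet_coord {S : Set ℝ} (hS : MeasurableSet S) :
    MeasurableSet {ζ : SpaceTime | ζ 0 ∈ S} :=
  (by fun_prop : Measurable fun ζ : SpaceTime => ζ 0) hS

theorem measurable_bandFourier (k : ℕ) (f : L2SpaceTime) : Measurable (bandFourier k f) :=
  (measurable_fourierST f).enorm.indicator (measurableSet_coord (measurableSet_wideFreqSet k))

theorem mem_of_bandFourier_ne_zero {k : ℕ} {f : L2SpaceTime} {ζ : SpaceTime}
    (h : bandFourier k f ζ ≠ 0) : ζ 0 ∈ wideFreqSet k := by
  by_contra h1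
  exact h (indicator_of_notMem (by exact h1) _)

theorem FreqSupported.bandFourier_ae {k : ℕ} {f : L2SpaceTime} (h : FreqSupported k f) :
    (fun ζ => ‖fourierST f ζ‖ₑ) =ᵐ[volume] bandFourier k f := by
  filter_upwards [h] with ζ hζ
  by_cases h1 : ζ 0 ∈ wideFreqSet k
  · exact (indicator_of_mem (by exact h1) (fun ζ => ‖fourierST f ζ‖ₑ)).symm
  · rw [hζ h1, enorm_zero]
    exact (indicator_of_notMem (by exact h1) _).symm

theorem IsDx.enorm_fourierST_le_band {k k₁ k₂ : ℕ} {f g O : L2SpaceTime}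
    (h : IsDx k (fun z => f z * g z) O) (hf : FreqSupported k₁ f) (hg : FreqSupported k₂ g) :
    ∀ᵐ ζ, ‖fourierST O ζ‖ₑ ≤ {ζ : SpaceTime | ζ 0 ∈ freqSet k}.indicator (fun ζ =>
      ENNReal.ofReal |ζ 0| * conv (bandFourier k₁ f) (bandFourier k₂ g) ζ) ζ := by
  have := h.enorm_fourierST_le
  rwa [conv_congr_ae hf.bandFourier_ae hg.bandFourier_ae] at this

theorem l2_indicator_freqSet_le (k₁ k₂ k₃ : ℕ) (f g : L2SpaceTime) :
    l2 ({ζ : SpaceTime | ζ 0 ∈ freqSet k₃}.indicator fun ζ =>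
      ENNReal.ofReal |ζ 0| * conv (bandFourier k₁ f) (bandFourier k₂ g) ζ) ≤
      W (2 * k₃ + (max k₁ k₂ : ℕ) / 2 + 7) * yNorm (max k₁ k₂ + 2) (bandFourier k₁ f) *
        yNorm (max k₁ k₂ + 2) (bandFourier k₂ g) := by
  refine le_trans (l2_mono fun ζ => ?_) (l2_mul_conv_le_yNorm k₃ (max k₁ k₂)
    (measurable_bandFourier k₁ f) (measurable_bandFourier k₂ g) (fun ζ h => ?_) fun ζ h => ?_)
  · refine indicator_le_indicator_of_subset (fun ζ hζ => ?_) (fun _ => zero_le) ζ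
    exact abs_le_of_mem_wideFreqSet (freqSet_subset_wideFreqSet _ hζ)
  · refine (abs_le_of_mem_wideFreqSet (mem_of_bandFourier_ne_zero h)).trans ?_
    exact pow_le_pow_right₀ (by norm_num) (by omega)
  · refine (abs_le_of_mem_wideFreqSet (mem_of_bandFourier_ne_zero h)).trans ?_
    exact pow_le_pow_right₀ (by norm_num) (by omega)

theorem IsDx.zNorm_le {k₁ k₂ k₃ l : ℕ} {B : ℝ≥0∞} (hB : ConvBound k₁ k₂ k₃ l B)
    {f g O : L2SpaceTime} (h : IsDx k₃ (fun z => f z * g z) O) (hf : FreqSupported k₁ f)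
    (hg : FreqSupported k₂ g) :
    zNorm k₃ (fun ζ => ‖fourierST O ζ‖ₑ) ≤ 2 ^ (k₃ + 1) * B *
      yNorm l (fun ζ => ‖fourierST f ζ‖ₑ) * yNorm l (fun ζ => ‖fourierST g ζ‖ₑ) := by
  have h1 : ∀ᵐ ζ, ‖fourierST O ζ‖ₑ ≤ 2 ^ (k₃ + 1) * {ζ : SpaceTime | ζ 0 ∈ freqSet k₃}.indicator
      (conv (bandFourier k₁ f) (bandFourier k₂ g)) ζ := by
    filter_upwards [h.enorm_fourierST_le_band hf hg] with ζ hζ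
    refine hζ.trans ?_
    by_cases hm : ζ 0 ∈ freqSet k₃
    · rw [indicator_of_mem (by exact hm), indicator_of_mem (by exact hm)]
      gcongr
      refine ENNReal.ofReal_le_of_le_toReal ?_
      have := abs_le_of_mem_wideFreqSet (freqSet_subset_wideFreqSet _ hm)
      simpa using this
    · rw [indicator_of_notMem (by exact hm)]; exact zero_le
  have h2 : ∀ {k : ℕ} {f : L2SpaceTime}, FreqSupported k f →
      yNorm l (bandFourier k f) ≤ yNorm l (fun ζ => ‖fourierST f ζ‖ₑ) := fun {k f} hf =>
    yNorm_mono_ae (by filter_upwards [hf.bandFourier_ae] with ζ hζ; rw [← hζ])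
  refine (zNorm_mono_ae h1).trans ?_
  rw [zNorm_const_mul _ _ ((measurable_conv (measurable_bandFourier _ _)
    (measurable_bandFourier _ _)).indicator (measurableSet_coord (measurableSet_freqSet _)))]
  calc _ ≤ 2 ^ (k₃ + 1) * (B * yNorm l (bandFourier k₁ f) * yNorm l (bandFourier k₂ g)) := by
        gcongr
        exact hB _ _ (measurable_bandFourier _ _) (measurable_bandFourier _ _)
          (fun ζ h => mem_of_bandFourier_ne_zero h) fun ζ h => mem_of_bandFourier_ne_zero h
    _ ≤ 2 ^ (k₃ + 1) * (B * yNorm l (fun ζ => ‖fourierST f ζ‖ₑ) *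
          yNorm l (fun ζ => ‖fourierST g ζ‖ₑ)) := by
        gcongr
        exacts [h2 hf, h2 hg]
    _ = _ := by ring

theorem fourierST_sum {ι : Type*} (s : Finset ι) (O : ι → L2SpaceTime) :
    ∀ᵐ ζ, fourierST (∑ i ∈ s, O i) ζ = ∑ i ∈ s, fourierST (O i) ζ := by
  have h1 : (𝓕 (∑ i ∈ s, O i) : L2SpaceTime) = ∑ i ∈ s, (𝓕 (O i) : L2SpaceTime) :=
    map_sum (FourierTransform.fourierₗ ℂ L2SpaceTime) _ _
  have h2 := Lp.coeFn_finsetSum s fun i => (𝓕 (O i) : L2SpaceTime)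
  rw [← h1] at h2
  filter_upwards [ae_fourierST h2] with ζ hζ
  have e : fourierST (∑ i ∈ s, O i) ζ = _ := hζ
  rw [e, Finset.sum_apply]; rfl

theorem zNorm_fourierST_sum_le {ι : Type*} [Countable ι] [DecidableEq ι] (k : ℕ) (s : Finset ι)
    (O : ι → L2SpaceTime) : zNorm k (fun ζ => ‖fourierST (∑ i ∈ s, O i) ζ‖ₑ) ≤
      ∑ i ∈ s, zNorm k fun ζ => ‖fourierST (O i) ζ‖ₑ := by
  have h1 : ∀ᵐ ζ, ‖fourierST (∑ i ∈ s, O i) ζ‖ₑ ≤ ∑' i : s, ‖fourierST (O i) ζ‖ₑ := by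
    filter_upwards [fourierST_sum s O] with ζ hζ
    rw [hζ, tsum_fintype, Finset.sum_coe_sort s fun i => ‖fourierST (O i) ζ‖ₑ]
    exact enorm_sum_le _ _
  refine (zNorm_mono_ae h1).trans ((zNorm_tsum_le k fun i : s =>
    (measurable_fourierST (O i)).enorm).trans (le_of_eq ?_))
  rw [tsum_fintype, Finset.sum_coe_sort s fun i => zNorm k fun ζ => ‖fourierST (O i) ζ‖ₑ]

/-- The sum of the unit bumps at scale `2^{-l}` covering `[-1, 1]`. -/
def timePlateau (l : ℕ) (t : ℝ) : ℝ :=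
  ∑ i ∈ Finset.range (2 * 2 ^ l + 1), unitBump (2 ^ l * t - (i - 2 ^ l))

theorem timePlateau_eq_one {l : ℕ} {t : ℝ} (ht : |t| ≤ 1) : timePlateau l t = 1 := by
  have := sum_unitBump (2 ^ l) (x := 2 ^ l * t) (by
    rw [abs_mul, abs_of_pos (by positivity)]
    push_cast
    exact mul_le_of_le_one_right (by positivity) ht)
  simpa [timePlateau] using this

/-- The constant in the time localization estimates. -/
def Cutoff.timeConst (η : Cutoff) : ℝ≥0∞ := bumpConst * ENNReal.ofReal η.bumpSize

theorem Cutoff.timeConst_ne_top (η : Cutoff) : η.timeConst ≠ ⊤ :=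
  ENNReal.mul_ne_top bumpConst_ne_top ENNReal.ofReal_ne_top

/-- The bilinear operator localized to a time interval of length `2^{-l}`. -/
theorem exists_localPiece (η : Cutoff) {k₁ k₂ : ℕ} (k₃ : ℕ) {f g : L2SpaceTime}
    (hf : FreqSupported k₁ f) (hg : FreqSupported k₂ g) (hfa : fkNorm η k₁ f ≠ ⊤)
    (hgb : fkNorm η k₂ g ≠ ⊤) (m : ℝ) :
    ∃ f' g' O : L2SpaceTime, FreqSupported k₁ f' ∧ FreqSupported k₂ g' ∧
      (∀ᵐ z : SpaceTime, f' z * g' z = unitBump (2 ^ (max k₁ k₂ + 2) * z 2 - m) * (f z * g z)) ∧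
      IsDx k₃ (fun z => f' z * g' z) O ∧
      l2 (fun ζ => ‖fourierST O ζ‖ₑ) ≤ W (2 * k₃ + (max k₁ k₂ : ℕ) / 2 + 7) *
        (η.timeConst * fkNorm η k₁ f) * (η.timeConst * fkNorm η k₂ g) := by
  set l := max k₁ k₂ + 2 with hl
  have b1 := η.timeBump_unitBump l m
  -- The wider cutoff equals 1 where the unit bump lives (|x| ≤ 1 ≤ 5/4). So g can be localized as
  -- well without changing the localized product.
  have b2 := η.timeBump_cutoff l m
  obtain ⟨f', hf'⟩ := exists_timeMul b1 f
  obtain ⟨g', hg'⟩ := exists_timeMul b2 g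
  have s1 := hf.timeMul b1 hf'
  have s2 := hg.timeMul b2 hg'
  have y1 := yNorm_timeMul_le η (k := k₁) (by omega) b1 hf'
  have y2 := yNorm_timeMul_le η (k := k₂) (by omega) b2 hg'
  have hb := l2_indicator_freqSet_le k₁ k₂ k₃ f' g'
  have hb' : l2 ({ζ : SpaceTime | ζ 0 ∈ freqSet k₃}.indicator fun ζ =>
      ENNReal.ofReal |ζ 0| * conv (bandFourier k₁ f') (bandFourier k₂ g') ζ) ≤
      W (2 * k₃ + (max k₁ k₂ : ℕ) / 2 + 7) *
        (η.timeConst * fkNorm η k₁ f) * (η.timeConst * fkNorm η k₂ g) := by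
    refine hb.trans ?_
    refine mul_le_mul' (mul_le_mul' le_rfl ?_) ?_
    · exact (yNorm_mono_ae (by filter_upwards [s1.bandFourier_ae] with ζ hζ; rw [← hζ])).trans y1
    · exact (yNorm_mono_ae (by filter_upwards [s2.bandFourier_ae] with ζ hζ; rw [← hζ])).trans y2
  have htop : W (2 * k₃ + (max k₁ k₂ : ℕ) / 2 + 7) *
        (η.timeConst * fkNorm η k₁ f) * (η.timeConst * fkNorm η k₂ g) ≠ ⊤ := by
    have h1 := W_ne_top (2 * k₃ + (max k₁ k₂ : ℕ) / 2 + 7)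
    have h2 := η.timeConst_ne_top
    finiteness
  obtain ⟨O, hO⟩ := exists_isDx k₃ f' g' (by
    rw [conv_congr_ae s1.bandFourier_ae s2.bandFourier_ae]
    exact ne_top_of_le_ne_top htop hb')
  refine ⟨f', g', O, s1, s2, ?_, hO, (l2_mono_ae (hO.enorm_fourierST_le_band s1 s2)).trans hb'⟩
  filter_upwards [hf', hg'] with z h1 h2
  rw [h1, h2]
  by_cases hx : 1 < |2 ^ l * z 2 - m|
  · rw [unitBump_eq_zero hx]; simp
  · rw [η.eq_one' (by linarith)]
    push_cast; ring

/-- P_k ∂_x is local in time: it commutes with ψ(t), and an output is determined by its input. -/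
theorem isDx_eq_mul_of_mul_eq {k l : ℕ} {m A : ℝ} {ψ : ℝ → ℝ} (hψ : TimeBump l m A ψ)
    {p : SpaceTime → ℂ} {O : L2SpaceTime} (h : IsDx k p O)
    (hp : ∀ᵐ z : SpaceTime, ψ (z 2) * p z = p z) : ∀ᵐ z : SpaceTime, O z = ψ (z 2) * O z := by
  obtain ⟨O', hO'⟩ := exists_timeMul hψ O
  have h1 := (h.timeMul hψ hO').congr hp
  have h2 := h1.unique h
  rw [h2] at hO'
  exact hO'

/-- If the frequency bands do not interact, then the bilinear operator vanishes. -/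
theorem isDx_zero_of_conv_eq_zero (η : Cutoff) {k₁ k₂ k₃ : ℕ} {f g : L2SpaceTime}
    (hf : FreqSupported k₁ f) (hg : FreqSupported k₂ g) (hfa : fkNorm η k₁ f ≠ ⊤)
    (hgb : fkNorm η k₂ g ≠ ⊤)
    (h0 : ∀ ξ₁ ∈ wideFreqSet k₁, ∀ ξ₂ ∈ wideFreqSet k₂, ξ₁ + ξ₂ ∉ freqSet k₃) :
    IsDx k₃ (fun z => timePlateau (max k₁ k₂ + 2) (z 2) * (f z * g z)) 0 := by
  set l := max k₁ k₂ + 2 with hl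
  have key (i : ℕ) : IsDx k₃
      (fun z => (unitBump (2 ^ l * z 2 - (i - 2 ^ l)) : ℂ) * (f z * g z)) 0 := by
    obtain ⟨f', g', O, s1, s2, hp, hO, -⟩ := exists_localPiece η k₃ hf hg hfa hgb (i - 2 ^ l)
    have hO0 : O = 0 := by
      refine norm_eq_zero.1 (enorm_eq_zero.1 ?_)
      have h1 := enorm_le_l2_fourierST O
      have h2 : l2 (fun ζ => ‖fourierST O ζ‖ₑ) ≤ l2 fun _ : SpaceTime => 0 := by
        refine l2_mono_ae ?_
        filter_upwards [hO.enorm_fourierST_le_band s1 s2] with ζ hζ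
        refine hζ.trans (le_of_eq ?_)
        by_cases hm : ζ 0 ∈ freqSet k₃
        · rw [indicator_of_mem (by exact hm), conv]
          refine mul_eq_zero_of_right _ ((lintegral_congr fun ζ' => ?_).trans lintegral_zero)
          by_contra hne
          have hne' := mul_ne_zero_iff.1 hne
          refine h0 _ (mem_of_bandFourier_ne_zero hne'.1) _ (mem_of_bandFourier_ne_zero hne'.2) ?_
          simpa using hm
        · rw [indicator_of_notMem (by exact hm)]
      rw [l2_zero] at h2
      simpa using h1.trans h2
    rw [hO0] at hO
    exact hO.congr hp
  have h1 := IsDx.sum (Finset.range (2 * 2 ^ l + 1)) fun i _ => key i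
  simp only [Finset.sum_const_zero] at h1
  refine h1.congr (Filter.Eventually.of_forall fun z => ?_)
  simp only [timePlateau]
  rw [← Finset.sum_mul]
  push_cast
  rfl

/-- The output is the sum of about 2^l pieces, each living on a time interval of length about
2^{-l}. A window of length 2^{-k₃} meets at most about 2^{l-k₃} of them, and each costs 2^{k₃+1} B
because of the derivative, so the total 2^l B no longer contains k₃. In L²(ℝ³) the pieces overlap
boundedly in time, so only the square root of their number is lost. -/
theorem exists_piece (η : Cutoff) {k₁ k₂ k₃ : ℕ} (hk₃ : k₃ ≤ max k₁ k₂ + 2) {B : ℝ≥0∞}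
    (hB : ConvBound k₁ k₂ k₃ (max k₁ k₂ + 2) B) {f g : L2SpaceTime}
    (hf : FreqSupported k₁ f) (hg : FreqSupported k₂ g) (hfa : fkNorm η k₁ f ≠ ⊤)
    (hgb : fkNorm η k₂ g ≠ ⊤) :
    ∃ O : L2SpaceTime,
      IsDx k₃ (fun z => timePlateau (max k₁ k₂ + 2) (z 2) * (f z * g z)) O ∧
      (∀ t₀, zNorm k₃ (fun ζ => ‖fourierST (timeCut η k₃ t₀ O) ζ‖ₑ) ≤
        14 * 2 ^ (max k₁ k₂ + 2) * B * (η.timeConst * fkNorm η k₁ f) *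
          (η.timeConst * fkNorm η k₂ g)) ∧
      ‖O‖ₑ ≤ W (2 * k₃ + (max k₁ k₂ : ℕ) + 12) * (η.timeConst * fkNorm η k₁ f) *
        (η.timeConst * fkNorm η k₂ g) := by
  set l := max k₁ k₂ + 2 with hl
  set a := η.timeConst * fkNorm η k₁ f with ha
  set b := η.timeConst * fkNorm η k₂ g with hb
  choose f' g' O s1 s2 hp hO hO2 using fun i : ℕ =>
    exists_localPiece η k₃ hf hg hfa hgb (i - 2 ^ l)
  rw [← hl] at hp
  set I := Finset.range (2 * 2 ^ l + 1) with hI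
  have hOp (i : ℕ) := (hO i).congr (hp i)
  have hsum : IsDx k₃ (fun z => (timePlateau l (z 2) : ℂ) * (f z * g z)) (∑ i ∈ I, O i) := by
    refine (IsDx.sum I fun i _ => hOp i).congr (Filter.Eventually.of_forall fun z => ?_)
    simp only [timePlateau]
    rw [← Finset.sum_mul]
    push_cast
    rfl
  have hlp : (0 : ℝ) < 2 ^ l := by positivity
  refine ⟨∑ i ∈ I, O i, hsum, fun t₀ => ?_, ?_⟩
  · have hcut (i : ℕ) : IsDx k₃ (fun z => (η.toFun (2 ^ k₃ * (z 2 - t₀)) : ℂ) *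
        ((unitBump (2 ^ l * z 2 - (i - 2 ^ l)) : ℂ) * (f z * g z))) (timeCut η k₃ t₀ (O i)) :=
      (hOp i).timeMul (η.timeBump_timeCut k₃ t₀) (coeFn_timeCut η k₃ t₀ (O i))
    have hbound (i : ℕ) : zNorm k₃ (fun ζ => ‖fourierST (timeCut η k₃ t₀ (O i)) ζ‖ₑ) ≤
        2 ^ (k₃ + 1) * B * a * b := by
      -- As k₃ ≤ l, the window at scale 2^{-k₃} is attached to the unit bump on f, and the product
      -- is still a bump at scale 2^{-l} of the same size.
      have b1 := η.timeBump_mul hk₃ t₀ ((i : ℝ) - 2 ^ l)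
      have b2 := η.timeBump_cutoff l ((i : ℝ) - 2 ^ l)
      obtain ⟨f₁, hf₁⟩ := exists_timeMul b1 f
      obtain ⟨g₁, hg₁⟩ := exists_timeMul b2 g
      have h1 : IsDx k₃ (fun z => f₁ z * g₁ z) (timeCut η k₃ t₀ (O i)) := by
        refine (hcut i).congr ?_
        filter_upwards [hf₁, hg₁] with z h1 h2
        rw [h1, h2]
        by_cases hx : 1 < |2 ^ l * z 2 - (i - 2 ^ l)|
        · rw [unitBump_eq_zero hx]; simp
        · rw [η.eq_one' (r := 2 ^ l * z 2 - (i - 2 ^ l)) (by linarith)]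
          push_cast; ring
      refine (h1.zNorm_le hB (hf.timeMul b1 hf₁) (hg.timeMul b2 hg₁)).trans ?_
      refine mul_le_mul' (mul_le_mul' le_rfl ?_) ?_
      · exact yNorm_timeMul_le η (k := k₁) (by omega) b1 hf₁
      · exact yNorm_timeMul_le η (k := k₂) (by omega) b2 hg₁
    -- Radius in units of 2^{-l}: 1 for the unit bump and 8/5 for the window. The count 2R + 1 = 3 +
    -- (16/5)·2^{l-k₃} is at most 7·2^{l-k₃}.
    set R : ℝ := 1 + 8 / 5 * (2 ^ l / 2 ^ k₃) with hR
    have hzero (i : ℕ) (hi : R < |(i : ℝ) - (2 ^ l + 2 ^ l * t₀)|) :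
        timeCut η k₃ t₀ (O i) = 0 := by
      refine (hcut i).unique ((IsDx.zero k₃).congr (Filter.Eventually.of_forall fun z => ?_))
      symm
      by_cases hx : 1 < |2 ^ l * z 2 - (i - 2 ^ l)|
      · simp only [unitBump_eq_zero hx, Complex.ofReal_zero, zero_mul, mul_zero]
      · simp only
        rw [η.eq_zero (r := 2 ^ k₃ * (z 2 - t₀))]
        · simp only [Complex.ofReal_zero, zero_mul]
        · by_contra hcon
          push Not at hx hcon
          have e : (i : ℝ) - (2 ^ l + 2 ^ l * t₀) = -(2 ^ l * z 2 - (i - 2 ^ l)) +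
              2 ^ k₃ * (z 2 - t₀) * (2 ^ l / 2 ^ k₃) := by field_simp; ring
          have h1 : |(i : ℝ) - (2 ^ l + 2 ^ l * t₀)| ≤ R := by
            rw [e, hR]
            refine (abs_add_le _ _).trans (add_le_add (by rwa [abs_neg]) ?_)
            rw [abs_mul, abs_of_pos (by positivity : (0 : ℝ) < 2 ^ l / 2 ^ k₃)]
            gcongr
          linarith
    have hcard := card_filter_abs_sub_le I (2 ^ l + 2 ^ l * t₀) (R := R) (by positivity)
    set J := I.filter fun i : ℕ => |(i : ℝ) - (2 ^ l + 2 ^ l * t₀)| ≤ R with hJ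
    have e1 : timeCut η k₃ t₀ (∑ i ∈ I, O i) = ∑ i ∈ J, timeCut η k₃ t₀ (O i) := by
      rw [← timeCutCLM_apply, map_sum, hJ, Finset.sum_filter_of_ne]
      · rfl
      · intro i _ hne
        by_contra hcon
        exact hne (hzero i (not_le.1 hcon))
    rw [e1]
    refine (zNorm_fourierST_sum_le k₃ J fun i => timeCut η k₃ t₀ (O i)).trans ?_
    refine (Finset.sum_le_card_nsmul J _ _ fun i _ => hbound i).trans ?_
    rw [nsmul_eq_mul]
    have hc2 : (J.card : ℝ≥0∞) * 2 ^ (k₃ + 1) ≤ 14 * 2 ^ l := by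
      have h1 : (J.card : ℝ) * 2 ^ (k₃ + 1) ≤ 14 * 2 ^ l := by
        have h2 : (1 : ℝ) ≤ 2 ^ l / 2 ^ k₃ := by
          rw [one_le_div (by positivity)]
          exact pow_le_pow_right₀ (by norm_num) hk₃
        have h3 : (J.card : ℝ) ≤ 7 * (2 ^ l / 2 ^ k₃) := by
          refine hcard.trans ?_
          rw [hR]; linarith
        calc (J.card : ℝ) * 2 ^ (k₃ + 1) ≤ 7 * (2 ^ l / 2 ^ k₃) * 2 ^ (k₃ + 1) := by gcongr
          _ = 14 * 2 ^ l := by rw [pow_succ]; field_simp; ring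
      exact_mod_cast h1
    calc (J.card : ℝ≥0∞) * (2 ^ (k₃ + 1) * B * a * b)
        = (J.card : ℝ≥0∞) * 2 ^ (k₃ + 1) * B * a * b := by ring
      _ ≤ _ := by gcongr
  -- Each O i is itself supported in time where the cutoff is, by locality of P_k ∂_x. Hence at most
  -- 2·(8/5) + 1 < 5 pieces are nonzero at any given time.
  · have hOz (i : ℕ) : ∀ᵐ z : SpaceTime, O i z =
        (η.toFun (2 ^ l * z 2 - (i - 2 ^ l)) : ℂ) * O i z := by
      refine isDx_eq_mul_of_mul_eq (η.timeBump_cutoff l ((i : ℝ) - 2 ^ l)) (hOp i)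
        (Filter.Eventually.of_forall fun z => ?_)
      by_cases hx : 1 < |2 ^ l * z 2 - (i - 2 ^ l)|
      · rw [unitBump_eq_zero hx]; simp
      · rw [η.eq_one' (r := 2 ^ l * z 2 - (i - 2 ^ l)) (by linarith)]
        simp
    set M := W (2 * k₃ + (max k₁ k₂ : ℕ) / 2 + 7) * a * b with hM
    have hOM (i : ℕ) : l2 (fun z => ‖O i z‖ₑ) ≤ M := by
      have := (enorm_le_l2_fourierST (O i)).trans (hO2 i)
      rwa [Lp.enorm_def, l2_eq_eLpNorm] at this
    have hpt : ∀ᵐ z : SpaceTime, ‖(∑ i ∈ I, O i : L2SpaceTime) z‖ₑ ^ 2 ≤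
        5 ^ 2 * ∑ i ∈ I, ‖O i z‖ₑ ^ 2 := by
      filter_upwards [Lp.coeFn_finsetSum I O, ae_all_iff.2 hOz] with z h1 h2
      set J := I.filter fun i : ℕ => |(i : ℝ) - (2 ^ l + 2 ^ l * z 2)| ≤ 8 / 5 with hJ
      have hcard := card_filter_abs_sub_le I (2 ^ l + 2 ^ l * z 2) (R := 8 / 5) (by norm_num)
      rw [← hJ] at hcard
      have hcard' : J.card ≤ 5 := by
        have : (J.card : ℝ) ≤ 5 := hcard.trans (by norm_num)
        exact_mod_cast this
      have e : ∑ i ∈ I, O i z = ∑ i ∈ J, O i z := by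
        rw [hJ, Finset.sum_filter_of_ne]
        intro i _ hne
        by_contra hcon
        refine hne ?_
        rw [h2 i, η.eq_zero, Complex.ofReal_zero, zero_mul]
        rw [abs_sub_comm]
        have := not_le.1 hcon
        convert! this using 2
        ring
      rw [h1, Finset.sum_apply, e]
      calc ‖∑ i ∈ J, O i z‖ₑ ^ 2 ≤ (∑ i ∈ J, ‖O i z‖ₑ) ^ 2 := by
            gcongr; exact enorm_sum_le _ _
        _ ≤ (5 : ℕ) ^ 2 * ∑ i ∈ J, ‖O i z‖ₑ ^ 2 := sq_sum_le_of_card_le _ _ hcard'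
        _ ≤ 5 ^ 2 * ∑ i ∈ I, ‖O i z‖ₑ ^ 2 := by
            push_cast
            gcongr
            exact Finset.filter_subset _ _
    rw [Lp.enorm_def, l2_eq_eLpNorm]
    refine le_of_sq_le_sq ?_
    rw [l2_sq]
    have hmeas (i : ℕ) : Measurable fun z : SpaceTime => ‖O i z‖ₑ ^ 2 :=
      ((Lp.stronglyMeasurable (O i)).measurable.enorm).pow_const 2
    calc ∫⁻ z, ‖(∑ i ∈ I, O i : L2SpaceTime) z‖ₑ ^ 2
        ≤ ∫⁻ z, 5 ^ 2 * ∑ i ∈ I, ‖O i z‖ₑ ^ 2 := lintegral_mono_ae hpt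
      _ = 5 ^ 2 * ∑ i ∈ I, ∫⁻ z, ‖O i z‖ₑ ^ 2 := by
          rw [lintegral_const_mul' _ _ (by finiteness), lintegral_finsetSum _ fun i _ => hmeas i]
      _ ≤ 5 ^ 2 * ∑ i ∈ I, M ^ 2 := by
          gcongr with i
          rw [← l2_sq]
          exact pow_le_pow_left' (hOM i) 2
      _ = 5 ^ 2 * (2 * 2 ^ l + 1 : ℕ) * M ^ 2 := by
          rw [Finset.sum_const, hI, Finset.card_range, nsmul_eq_mul, mul_assoc]
      _ ≤ W ((max k₁ k₂ : ℕ) / 2 + 5) ^ 2 * M ^ 2 := by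
          gcongr
          have e1 : W ((max k₁ k₂ : ℕ) / 2 + 5) ^ 2 = 2 ^ (max k₁ k₂ + 10) := by
            rw [← W_mul_nat, ← W_one, ← W_mul_nat]
            congr 1; push_cast; ring
          have h1 : 1 ≤ 2 ^ (max k₁ k₂) := Nat.one_le_two_pow
          have h2 : 5 ^ 2 * (2 * 2 ^ l + 1) ≤ 2 ^ (max k₁ k₂ + 10) := by
            rw [hl, pow_add, pow_add]; omega
          rw [e1]
          exact_mod_cast h2
      _ = _ := by
          have e2 : W (2 * k₃ + (max k₁ k₂ : ℕ) + 12) =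
              W ((max k₁ k₂ : ℕ) / 2 + 5) * W (2 * k₃ + (max k₁ k₂ : ℕ) / 2 + 7) := by
            rw [← W_add]; congr 1; ring
          rw [← mul_pow, hM, e2]
          ring

/-! ### The interaction of the dyadic frequency bands -/

open Classical in
/-- The weight of the interaction of the high frequency `k₁` with the low frequency `k₂`. -/
def highLowWeight (k₁ k₂ k₃ : ℕ) : ℝ≥0∞ :=
  if k₂ + 4 ≤ k₁ ∧ k₁ ≤ k₃ + 2 ∧ k₃ ≤ k₁ + 2 then W ((k₂ : ℝ) / 2) else 0

open Classical in
/-- The weight of the interaction of comparable frequencies. -/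
def highHighWeight (k₁ k₂ k₃ : ℕ) : ℝ≥0∞ :=
  if k₁ ≤ k₂ + 3 ∧ k₂ ≤ k₁ + 3 ∧ k₃ ≤ max k₁ k₂ + 2 then W (((max k₁ k₂ : ℕ) + k₃ : ℝ) / 2)
  else 0

/-- The weight of the interaction of the frequencies `k₁` and `k₂` with output `k₃`. -/
def weight (k₁ k₂ k₃ : ℕ) : ℝ≥0∞ :=
  highLowWeight k₁ k₂ k₃ + highLowWeight k₂ k₁ k₃ + highHighWeight k₁ k₂ k₃

theorem zNorm_indicator_mono (l : ℕ) {S T : Set SpaceTime} (h : S ⊆ T) (F : SpaceTime → ℝ≥0∞) :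
    zNorm l (S.indicator F) ≤ zNorm l (T.indicator F) :=
  zNorm_mono_ae (Filter.Eventually.of_forall
    (indicator_le_indicator_of_subset h fun _ => zero_le))

theorem convBound_comm {k₁ k₂ k₃ l : ℕ} {B : ℝ≥0∞} (h : ConvBound k₁ k₂ k₃ l B) :
    ConvBound k₂ k₁ k₃ l B := fun F₁ F₂ m₁ m₂ s₁ s₂ => by
  have := h F₂ F₁ m₂ m₁ s₂ s₁
  rw [conv_comm, mul_right_comm] at this
  exact this

theorem convBound_highLow {k₁ k₂ k₃ : ℕ} (l : ℕ) (h₃ : k₃ ≠ 0) (hl : k₃ ≤ l) :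
    ConvBound k₁ k₂ k₃ l (geomConst (1 / 4) * W (k₂ / 2 - k₃ + 4)) := fun F₁ F₂ m₁ m₂ _ s₂ => by
  refine le_trans (zNorm_indicator_mono _ (fun ζ hζ => ?_) _)
    (zNorm_conv_high_low_le (k₂ := k₂) hl m₁ m₂ fun ζ h => abs_le_of_mem_wideFreqSet (s₂ ζ h))
  exact le_abs_of_mem_wideFreqSet h₃ (freqSet_subset_wideFreqSet _ hζ)

theorem convBound_highHigh (k₁ k₂ k₃ l : ℕ) :
    ConvBound k₁ k₂ k₃ l (geomConst (1 / 4) * W ((k₃ - l : ℝ) / 2 + 17 / 4)) :=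
  fun F₁ F₂ m₁ m₂ _ _ => by
    refine le_trans (zNorm_indicator_mono _ (fun ζ hζ => ?_) _) (zNorm_conv_low_le k₃ l m₁ m₂)
    exact abs_le_of_mem_wideFreqSet (freqSet_subset_wideFreqSet _ hζ)

theorem two_pow_mul_le {a b n : ℕ} (h : a + n ≤ b) : (2 : ℝ) ^ a * 2 ^ n ≤ 2 ^ b := by
  rw [← pow_add]; exact pow_le_pow_right₀ (by norm_num) h

theorem add_notMem_freqSet_of_highLow {k₁ k₂ k₃ : ℕ} (h : k₂ + 4 ≤ k₁)
    (h₃ : ¬(k₁ ≤ k₃ + 2 ∧ k₃ ≤ k₁ + 2)) {ξ₁ ξ₂ : ℝ} (h₁ : ξ₁ ∈ wideFreqSet k₁)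
    (h₂ : ξ₂ ∈ wideFreqSet k₂) : ξ₁ + ξ₂ ∉ freqSet k₃ := by
  intro hm
  have a1 := abs_le_of_mem_wideFreqSet h₁
  have a2 := le_abs_of_mem_wideFreqSet (by omega) h₁
  have a3 := abs_le_of_mem_wideFreqSet h₂
  have a4 := two_pow_mul_le h
  have a5 := abs_lt_of_mem_freqSet hm
  have b1 := abs_add_le ξ₁ ξ₂
  have b2 : |ξ₁| - |ξ₂| ≤ |ξ₁ + ξ₂| := by
    have := abs_sub_abs_le_abs_sub ξ₁ (-ξ₂)
    rwa [abs_neg, sub_neg_eq_add] at this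
  have hp : (0 : ℝ) < 2 ^ k₁ := by positivity
  rw [pow_succ] at a1 a3
  norm_num at a4
  by_cases hk : k₃ + 3 ≤ k₁
  · have := two_pow_mul_le hk
    norm_num at this
    linarith
  · have hk' : k₁ + 3 ≤ k₃ := by omega
    have a6 := le_abs_of_mem_freqSet (by omega) hm
    have := two_pow_mul_le hk'
    norm_num at this
    linarith

theorem add_notMem_freqSet_of_highHigh {k₁ k₂ k₃ : ℕ} (h₃ : max k₁ k₂ + 3 ≤ k₃) {ξ₁ ξ₂ : ℝ}
    (h₁ : ξ₁ ∈ wideFreqSet k₁) (h₂ : ξ₂ ∈ wideFreqSet k₂) : ξ₁ + ξ₂ ∉ freqSet k₃ := by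
  intro hm
  have a1 := abs_le_of_mem_wideFreqSet h₁
  have a3 := abs_le_of_mem_wideFreqSet h₂
  have a6 := le_abs_of_mem_freqSet (by omega) hm
  have b1 := abs_add_le ξ₁ ξ₂
  have c1 := two_pow_mul_le (a := k₁) (b := k₃) (n := 3) (by omega)
  have c2 := two_pow_mul_le (a := k₂) (b := k₃) (n := 3) (by omega)
  have hp : (0 : ℝ) < 2 ^ k₃ := by positivity
  rw [pow_succ] at a1 a3
  norm_num at c1 c2
  linarith

/-- The three cases of the weight exhaust all triples of bands whose frequencies can add up, so a
vanishing weight means that the bands do not interact. -/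
theorem add_notMem_freqSet_of_weight_eq_zero {k₁ k₂ k₃ : ℕ} (h : weight k₁ k₂ k₃ = 0)
    {ξ₁ ξ₂ : ℝ} (h₁ : ξ₁ ∈ wideFreqSet k₁) (h₂ : ξ₂ ∈ wideFreqSet k₂) :
    ξ₁ + ξ₂ ∉ freqSet k₃ := by
  simp only [weight, add_eq_zero, highLowWeight, highHighWeight, ite_eq_right_iff,
    (W_pos _).ne', imp_false] at h
  obtain ⟨⟨c1, c2⟩, c3⟩ := h
  by_cases hA : k₂ + 4 ≤ k₁
  · exact add_notMem_freqSet_of_highLow hA (fun hh => c1 ⟨hA, hh⟩) h₁ h₂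
  by_cases hB : k₁ + 4 ≤ k₂
  · rw [add_comm]
    exact add_notMem_freqSet_of_highLow hB (fun hh => c2 ⟨hB, hh⟩) h₂ h₁
  · exact add_notMem_freqSet_of_highHigh (by
      by_contra hcon
      exact c3 ⟨by omega, by omega, by omega⟩) h₁ h₂

/-- The constant in `exists_weighted_piece`. -/
def Cutoff.pieceConst (η : Cutoff) : ℝ≥0∞ := 14 * geomConst (1 / 4) * W 8 * η.timeConst ^ 2

theorem Cutoff.pieceConst_ne_top (η : Cutoff) : η.pieceConst ≠ ⊤ := by
  have h1 := geomConst_ne_top (x := 1 / 4) (by norm_num)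
  have h2 := η.timeConst_ne_top
  have h3 := W_ne_top 8
  unfold Cutoff.pieceConst
  finiteness

theorem two_pow_eq_W (n : ℕ) : (2 : ℝ≥0∞) ^ n = W n := by
  rw [← W_one, ← W_mul_nat, one_mul]

/-- The bilinear operator on dyadic pieces. -/
theorem exists_weighted_piece (η : Cutoff) (k₁ k₂ k₃ : ℕ) {f g : L2SpaceTime}
    (hf : FreqSupported k₁ f) (hg : FreqSupported k₂ g) (hfa : fkNorm η k₁ f ≠ ⊤)
    (hgb : fkNorm η k₂ g ≠ ⊤) :
    ∃ O : L2SpaceTime,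
      IsDx k₃ (fun z => timePlateau (max k₁ k₂ + 2) (z 2) * (f z * g z)) O ∧
      (∀ t₀, zNorm k₃ (fun ζ => ‖fourierST (timeCut η k₃ t₀ O) ζ‖ₑ) ≤
        η.pieceConst * weight k₁ k₂ k₃ * fkNorm η k₁ f * fkNorm η k₂ g) ∧
      (‖O‖ₑ ≤ W (2 * k₃ + (max k₁ k₂ : ℕ) + 12) * η.timeConst ^ 2 *
        fkNorm η k₁ f * fkNorm η k₂ g) ∧ (weight k₁ k₂ k₃ = 0 → O = 0) := by
  by_cases hw : weight k₁ k₂ k₃ = 0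
  · refine ⟨0, isDx_zero_of_conv_eq_zero η hf hg hfa hgb fun ξ₁ h₁ ξ₂ h₂ =>
      add_notMem_freqSet_of_weight_eq_zero hw h₁ h₂, fun t₀ => ?_, by simp, fun _ => rfl⟩
    rw [← timeCutCLM_apply, map_zero]
    have h0 := zNorm_fourierST_sum_le k₃ (∅ : Finset ℕ) fun _ => 0
    simp only [Finset.sum_empty] at h0
    exact h0.trans zero_le
  -- The weight is 2^l times the convolution bound. High-low: 2^{a+2}·2^{b/2-k₃+4} ≤ 2^{b/2+8}, as a
  -- ≤ k₃ + 2. Comparable inputs, m = max k₁ k₂: 2^{m+2}·2^{(k₃-m-2)/2+17/4} ≤ 2^{(m+k₃)/2+8}.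
  obtain ⟨B, hB, hk₃, hBw⟩ : ∃ B, ConvBound k₁ k₂ k₃ (max k₁ k₂ + 2) B ∧ k₃ ≤ max k₁ k₂ + 2 ∧
      2 ^ (max k₁ k₂ + 2) * B ≤ geomConst (1 / 4) * W 8 * weight k₁ k₂ k₃ := by
    have hHL : ∀ {a b : ℕ}, b + 4 ≤ a ∧ a ≤ k₃ + 2 ∧ k₃ ≤ a + 2 →
        2 ^ (max a b + 2) * (geomConst (1 / 4) * W (b / 2 - k₃ + 4)) ≤
          geomConst (1 / 4) * W 8 * W ((b : ℝ) / 2) := by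
      rintro a b ⟨c1, c2, c3⟩
      rw [max_eq_left (by omega), two_pow_eq_W, mul_left_comm, mul_assoc, ← W_add, ← W_add]
      gcongr
      refine W_mono ?_
      have : (a : ℝ) ≤ k₃ + 2 := by exact_mod_cast c2
      push_cast; linarith
    by_cases c1 : k₂ + 4 ≤ k₁ ∧ k₁ ≤ k₃ + 2 ∧ k₃ ≤ k₁ + 2
    · refine ⟨_, convBound_highLow (k₁ := k₁) (k₂ := k₂) (k₃ := k₃) _ (by omega) (by omega),
        by omega, ?_⟩
      refine (hHL c1).trans ?_
      rw [weight, highLowWeight, if_pos c1, add_assoc]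
      gcongr
      exact le_self_add
    by_cases c2 : k₁ + 4 ≤ k₂ ∧ k₂ ≤ k₃ + 2 ∧ k₃ ≤ k₂ + 2
    · refine ⟨_, convBound_comm
        (convBound_highLow (k₁ := k₂) (k₂ := k₁) (k₃ := k₃) _ (by omega) (by omega)),
        by omega, ?_⟩
      rw [max_comm]
      refine (hHL c2).trans ?_
      rw [weight]
      gcongr
      rw [highLowWeight, highLowWeight, if_pos c2, add_comm _ (W _), add_assoc]
      exact le_self_add
    · have c3 : k₁ ≤ k₂ + 3 ∧ k₂ ≤ k₁ + 3 ∧ k₃ ≤ max k₁ k₂ + 2 := by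
        by_contra c3
        refine hw ?_
        rw [weight, highLowWeight, highLowWeight, highHighWeight, if_neg c1, if_neg c2, if_neg c3]
        simp
      refine ⟨_, convBound_highHigh k₁ k₂ k₃ _, c3.2.2, ?_⟩
      have e : weight k₁ k₂ k₃ = W (((max k₁ k₂ : ℕ) + k₃ : ℝ) / 2) := by
        rw [weight, highLowWeight, highLowWeight, highHighWeight, if_neg c1, if_neg c2, if_pos c3]
        simp
      rw [e, two_pow_eq_W, mul_left_comm, mul_assoc, ← W_add, ← W_add]
      gcongr
      refine W_mono ?_
      push_cast; linarith
  obtain ⟨O, h1, h2, h3⟩ := exists_piece η hk₃ hB hf hg hfa hgb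
  refine ⟨O, h1, fun t₀ => (h2 t₀).trans ?_, h3.trans (le_of_eq (by ring)), fun h => absurd h hw⟩
  calc 14 * 2 ^ (max k₁ k₂ + 2) * B * (η.timeConst * fkNorm η k₁ f) *
        (η.timeConst * fkNorm η k₂ g)
      = 14 * (2 ^ (max k₁ k₂ + 2) * B) * η.timeConst ^ 2 * fkNorm η k₁ f * fkNorm η k₂ g := by
        ring
    _ ≤ 14 * (geomConst (1 / 4) * W 8 * weight k₁ k₂ k₃) * η.timeConst ^ 2 * fkNorm η k₁ f *
          fkNorm η k₂ g := by gcongr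
    _ = _ := by rw [Cutoff.pieceConst]; ring

/-! ### Restriction to fixed times -/

theorem measurePreserving_stMk :
    MeasurePreserving stMk ((volume : Measure Plane).prod (volume : Measure ℝ)) volume :=
  measurePreserving_stEquiv

theorem measurable_stMk : Measurable stMk := measurePreserving_stMk.measurable

theorem integral_stMk (F : SpaceTime → ℂ) :
    ∫ z, F (stMk z) ∂((volume : Measure Plane).prod (volume : Measure ℝ)) = ∫ ζ, F ζ :=
  measurePreserving_stEquiv.integral_comp' F

theorem integrable_stMk {F : SpaceTime → ℂ} (hF : Integrable F) :
    Integrable (fun z => F (stMk z)) ((volume : Measure Plane).prod (volume : Measure ℝ)) :=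
  measurePreserving_stMk.integrable_comp_of_integrable hF

/-- The product of a function of the plane variables and a function of the time variable. -/
def tensor (a : Plane → ℂ) (b : ℝ → ℂ) (ζ : SpaceTime) : ℂ := a !₂[ζ 0, ζ 1] * b (ζ 2)

theorem tensor_stMk (a : Plane → ℂ) (b : ℝ → ℂ) (z : Plane × ℝ) :
    tensor a b (stMk z) = a z.1 * b z.2 := by
  have : (!₂[z.1 0, z.1 1] : Plane) = z.1 := by ext i; fin_cases i <;> rfl
  rw [tensor, stMk_zero, stMk_one, stMk_two, this]

theorem tensor_eq_comp (a : Plane → ℂ) (b : ℝ → ℂ) :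
    tensor a b = (fun z : Plane × ℝ => a z.1 * b z.2) ∘ stEquiv.symm := rfl

theorem integrable_tensor {a : Plane → ℂ} {b : ℝ → ℂ} (ha : Integrable a) (hb : Integrable b) :
    Integrable (tensor a b) := by
  rw [tensor_eq_comp]
  exact (measurePreserving_stEquiv.symm _).integrable_comp_of_integrable (ha.mul_prod hb)

theorem memLp_two_prod {a : Plane → ℂ} {b : ℝ → ℂ} (ha : MemLp a 2) (hb : MemLp b 2) :
    MemLp (fun z : Plane × ℝ => a z.1 * b z.2) 2 (volume.prod volume) := by
  have hm : AEStronglyMeasurable (fun z : Plane × ℝ => a z.1 * b z.2) (volume.prod volume) :=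
    ha.1.comp_fst.mul hb.1.comp_snd
  rw [memLp_two_iff_integrable_sq_norm hm]
  have h1 := (memLp_two_iff_integrable_sq_norm ha.1).1 ha
  have h2 := (memLp_two_iff_integrable_sq_norm hb.1).1 hb
  refine (h1.mul_prod h2).congr (Filter.Eventually.of_forall fun z => ?_)
  simp only [norm_mul, mul_pow]

theorem memLp_tensor {a : Plane → ℂ} {b : ℝ → ℂ} (ha : MemLp a 2) (hb : MemLp b 2) :
    MemLp (tensor a b) 2 := by
  rw [tensor_eq_comp]
  exact (memLp_two_prod ha hb).comp_measurePreserving (measurePreserving_stEquiv.symm _)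

theorem inner_stMk (z w : Plane × ℝ) :
    inner ℝ (stMk z) (stMk w) = inner ℝ z.1 w.1 + z.2 * w.2 := by
  simp only [PiLp.inner_apply, Fin.sum_univ_three, Fin.sum_univ_two, stMk_zero, stMk_one,
    stMk_two]
  simp [mul_comm]

theorem fourier_tensor (a : Plane → ℂ) (b : ℝ → ℂ) :
    𝓕 (tensor a b) = tensor (𝓕 a) (𝓕 b) := by
  funext ζ
  obtain ⟨w, rfl⟩ : ∃ w, stMk w = ζ := ⟨stEquiv.symm ζ, stEquiv.apply_symm_apply ζ⟩
  rw [tensor_stMk, Real.fourier_eq, Real.fourier_eq, Real.fourier_eq, ← integral_stMk,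
    ← integral_prod_mul]
  refine integral_congr_ae (Filter.Eventually.of_forall fun z => ?_)
  have : inner ℝ z.2 w.2 = z.2 * w.2 := by simp [mul_comm]
  simp only [tensor_stMk, inner_stMk, neg_add, AddChar.map_add_eq_mul, Circle.smul_def,
    Circle.coe_mul, smul_eq_mul, this]
  ring

theorem ae_memLp_slice (O : L2SpaceTime) :
    ∀ᵐ t : ℝ, MemLp (fun x : Plane => O (stMk (x, t))) 2 := by
  have hs : StronglyMeasurable (O : SpaceTime → ℂ) := Lp.stronglyMeasurable O
  have h1 := (memLp_two_iff_integrable_sq_norm hs.aestronglyMeasurable).1 (Lp.memLp O)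
  have h2 := measurePreserving_stMk.integrable_comp_of_integrable h1
  filter_upwards [h2.prod_left_ae] with t ht
  have hm : StronglyMeasurable fun x : Plane => O (stMk (x, t)) :=
    hs.comp_measurable (measurable_stMk.comp (by fun_prop))
  exact (memLp_two_iff_integrable_sq_norm hm.aestronglyMeasurable).2 ht

theorem ae_integrable_slice {p : SpaceTime → ℂ} (hp : Integrable p) :
    ∀ᵐ t : ℝ, Integrable (fun x : Plane => p (stMk (x, t))) :=
  (integrable_stMk hp).prod_left_ae

theorem integrable_dxSymbol_mul (k : ℕ) {φ : Plane → ℂ} (hφ : Integrable φ) :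
    Integrable fun q : Plane => dxSymbol k (q 0) * φ q :=
  hφ.bdd_mul ((measurable_dxSymbol k).comp (by fun_prop)).aestronglyMeasurable
    (Filter.Eventually.of_forall fun q => norm_dxSymbol_le k (q 0))

theorem continuous_fourier {V : Type*} [NormedAddCommGroup V] [InnerProductSpace ℝ V]
    [FiniteDimensional ℝ V] [MeasurableSpace V] [BorelSpace V] {f : V → ℂ} (hf : Integrable f) :
    Continuous (𝓕 f) :=
  VectorFourier.fourierIntegral_continuous Real.continuous_fourierChar continuous_inner hf

theorem norm_fourier_le {V : Type*} [NormedAddCommGroup V] [InnerProductSpace ℝ V]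
    [FiniteDimensional ℝ V] [MeasurableSpace V] [BorelSpace V] (f : V → ℂ) (q : V) :
    ‖𝓕 f q‖ ≤ ∫ x, ‖f x‖ :=
  VectorFourier.norm_fourierIntegral_le_integral_norm _ _ _ _ _

theorem memLp_fourier {V : Type*} [NormedAddCommGroup V] [InnerProductSpace ℝ V]
    [FiniteDimensional ℝ V] [MeasurableSpace V] [BorelSpace V] {f : V → ℂ} (hf : Integrable f)
    (hf₂ : MemLp f 2) : MemLp (𝓕 f) 2 :=
  (memLp_congr_ae (coeFn_fourier_toLp hf hf₂)).1 (Lp.memLp _)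

theorem integral_fourier_mul_eq_of_memLp {V : Type*} [NormedAddCommGroup V]
    [InnerProductSpace ℝ V] [FiniteDimensional ℝ V] [MeasurableSpace V] [BorelSpace V]
    (f : Lp ℂ 2 (volume : Measure V)) {g : V → ℂ} (hg : Integrable g) (hg₂ : MemLp g 2) :
    ∫ x, (𝓕 f : Lp ℂ 2 (volume : Measure V)) x * g x = ∫ x, f x * 𝓕 g x := by
  have h := integral_fourier_mul_eq_L2 f (hg₂.toLp g)
  calc _ = ∫ x, (𝓕 f : Lp ℂ 2 (volume : Measure V)) x * hg₂.toLp g x := by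
        refine integral_congr_ae ?_
        filter_upwards [hg₂.coeFn_toLp] with x hx
        rw [hx]
    _ = _ := by
        rw [h]
        refine integral_congr_ae ?_
        filter_upwards [coeFn_fourier_toLp hg hg₂] with x hx
        rw [hx]

/-- The defining relation of `P_k ∂_x`, tested against a function of the plane variables. -/
theorem IsDx.ae_integral_slice {k : ℕ} {p : SpaceTime → ℂ} {O : L2SpaceTime} (h : IsDx k p O)
    {φ : Plane → ℂ} (hφ : Integrable φ) (hφ₂ : MemLp φ 2) :
    ∀ᵐ t : ℝ, ∫ x : Plane, O (stMk (x, t)) * 𝓕 φ x =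
      ∫ x : Plane, p (stMk (x, t)) * 𝓕 (fun q : Plane => dxSymbol k (q 0) * φ q) x := by
  set ψ : Plane → ℂ := fun q => dxSymbol k (q 0) * φ q with hψ
  have hψi : Integrable ψ := integrable_dxSymbol_mul k hφ
  have hΦ : MemLp (𝓕 φ) 2 := memLp_fourier hφ hφ₂
  have hO₂ : MemLp (fun z => O (stMk z)) 2
      ((volume : Measure Plane).prod (volume : Measure ℝ)) :=
    (Lp.memLp O).comp_measurePreserving measurePreserving_stMk
  have hp₂ : Integrable (fun z : Plane × ℝ => p (stMk z) * 𝓕 ψ z.1)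
      ((volume : Measure Plane).prod (volume : Measure ℝ)) := by
    have h1 := (integrable_stMk h.integrable).bdd_mul (c := ∫ x, ‖ψ x‖)
      (f := fun z : Plane × ℝ => 𝓕 ψ z.1)
      ((continuous_fourier hψi).comp continuous_fst).aestronglyMeasurable
      (Filter.Eventually.of_forall fun z => norm_fourier_le ψ z.1)
    exact h1.congr (Filter.Eventually.of_forall fun z => mul_comm _ _)
  have hOθ {θ : ℝ → ℂ} (hθ : MemLp θ 2) :
      Integrable (fun z : Plane × ℝ => O (stMk z) * (𝓕 φ z.1 * θ z.2))
        ((volume : Measure Plane).prod (volume : Measure ℝ)) :=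
    hO₂.integrable_mul (memLp_two_prod hΦ hθ)
  refine ae_eq_of_integral_schwartz_mul_eq ?_ hp₂.integral_prod_right.locallyIntegrable
    fun θ' => ?_
  · rw [locallyIntegrable_iff]
    intro K hK
    have h1 : MemLp (K.indicator fun _ => (1 : ℂ)) 2 (volume : Measure ℝ) :=
      memLp_indicator_const 2 hK.measurableSet 1 (Or.inr hK.measure_lt_top.ne)
    have h2 := (hOθ h1).integral_prod_right
    rw [← integrable_indicator_iff hK.measurableSet]
    refine h2.congr (Filter.Eventually.of_forall fun t => ?_)
    by_cases ht : t ∈ K <;> simp [ht]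
  -- An arbitrary test function θ' of time is written as a transform. The space-time identity tested
  -- on φ ⊗ θ then yields the desired identity integrated against θ'.
  · set θ : 𝓢(ℝ, ℂ) := 𝓕⁻ θ' with hθ
    have hθF : (𝓕 (θ : ℝ → ℂ) : ℝ → ℂ) = θ' := by
      rw [← SchwartzMap.fourier_coe, hθ, FourierTransform.fourier_fourierInv_eq]
    have i1 := integrable_tensor hφ (b := θ) θ.integrable
    have i2 := memLp_tensor hφ₂ (θ.memLp 2 volume)
    have i3 := integrable_tensor hψi (b := θ) θ.integrable
    have e1 := integral_fourier_mul_eq_of_memLp O i1 i2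
    have e2 := integral_fourier_mul_eq h.integrable i3
    rw [fourier_tensor, hθF] at e1 e2
    have e3 : ∫ ζ, (𝓕 O : L2SpaceTime) ζ * tensor φ θ ζ = ∫ ζ, 𝓕 p ζ * tensor ψ θ ζ := by
      refine integral_congr_ae ?_
      filter_upwards [h.fourier_eq] with ζ hζ
      rw [hζ]
      simp only [tensor, hψ]
      have : (![ζ 0, ζ 1] : Fin 2 → ℝ) 0 = ζ 0 := rfl
      rw [this]; ring
    rw [e1, e2, ← integral_stMk, ← integral_stMk] at e3
    simp only [tensor_stMk] at e3
    rw [integral_prod_symm _ (hOθ (θ'.memLp 2 volume)), integral_prod_symm] at e3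
    · calc _ = _ := integral_congr_ae (Filter.Eventually.of_forall fun t => ?_)
        _ = _ := e3
        _ = _ := integral_congr_ae (Filter.Eventually.of_forall fun t => ?_)
      · simp only
        rw [← integral_const_mul]
        refine integral_congr_ae (Filter.Eventually.of_forall fun x => ?_)
        simp only; ring
      · simp only
        rw [← integral_const_mul]
        refine integral_congr_ae (Filter.Eventually.of_forall fun x => ?_)
        simp only; ring
    · obtain ⟨C, hC⟩ : ∃ C, ∀ t, ‖θ' t‖ ≤ C :=
        ⟨SchwartzMap.seminorm ℝ 0 0 θ', SchwartzMap.norm_le_seminorm ℝ θ'⟩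
      have := hp₂.bdd_mul (c := C) (f := fun z : Plane × ℝ => θ' z.2)
        (θ'.continuous.comp continuous_snd).aestronglyMeasurable
        (Filter.Eventually.of_forall fun z => hC z.2)
      refine this.congr (Filter.Eventually.of_forall fun z => ?_)
      simp only; ring

theorem eq_zero_of_pairing₂_eq_zero {V : Type*} [NormedAddCommGroup V] [InnerProductSpace ℝ V]
    [FiniteDimensional ℝ V] [MeasurableSpace V] [BorelSpace V] {g : Lp ℂ 2 (volume : Measure V)}
    {D : Set (Lp ℂ 2 (volume : Measure V))} (hD : Dense D) (h : ∀ φ ∈ D, pairing₂ g φ = 0) :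
    g = 0 := by
  have h1 : (fun φ => pairing₂ g φ) = fun _ => 0 :=
    Continuous.ext_on hD (by fun_prop) continuous_const h
  refine Lp.ext ?_
  have h2 : (g : V → ℂ) =ᵐ[volume] fun _ => 0 := by
    refine ae_eq_of_integral_schwartz_mul_eq ((Lp.memLp g).locallyIntegrable (by norm_num))
      (locallyIntegrable_zero) fun φ => ?_
    have h3 := congrFun h1 (φ.toLp 2)
    simp only [pairing₂_apply] at h3
    simp only [mul_zero, integral_zero]
    rw [← h3]
    refine integral_congr_ae ?_
    filter_upwards [φ.coeFn_toLp 2 volume] with x hx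
    rw [hx, mul_comm]
  filter_upwards [h2, Lp.coeFn_zero ℂ 2 (volume : Measure V)] with x hx hx'
  rw [hx, hx']; rfl

/-- The relation `O = P_k ∂_x p` at almost every fixed time. -/
theorem IsDx.ae_slice {k : ℕ} {p : SpaceTime → ℂ} {O : L2SpaceTime} (h : IsDx k p O) :
    ∀ᵐ t : ℝ, Integrable (fun x : Plane => p (stMk (x, t))) ∧
      ∀ o : L2Plane, (∀ᵐ x : Plane, o x = O (stMk (x, t))) →
        ∀ᵐ q : Plane, (𝓕 o : L2Plane) q =
          dxSymbol k (q 0) * 𝓕 (fun x : Plane => p (stMk (x, t))) q := by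
  have : Fact ((2 : ℝ≥0∞) ≠ ⊤) := ⟨by simp⟩
  -- The tested identity holds off a null set of times depending on the test function. A countable
  -- dense family, truncated to balls of integer radius to be integrable, leaves a single
  -- exceptional null set.
  obtain ⟨D, hDc, hD⟩ := TopologicalSpace.exists_countable_dense L2Plane
  set φ : L2Plane → ℕ → Plane → ℂ := fun d R => (Metric.ball (0 : Plane) R).indicator d with hφ
  have hfin (R : ℕ) : IsFiniteMeasure (volume.restrict (Metric.ball (0 : Plane) R)) :=
    ⟨by rw [Measure.restrict_apply_univ]; exact measure_ball_lt_top⟩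
  have hφ₂ (d : L2Plane) (R : ℕ) : MemLp (φ d R) 2 :=
    (Lp.memLp d).indicator measurableSet_ball
  have hφ₁ (d : L2Plane) (R : ℕ) : Integrable (φ d R) := by
    rw [hφ, integrable_indicator_iff measurableSet_ball]
    exact MemLp.integrable (q := 2) (by norm_num) ((Lp.memLp d).restrict _)
  have key : ∀ᵐ t : ℝ, ∀ d ∈ D, ∀ R : ℕ, ∫ x : Plane, O (stMk (x, t)) * 𝓕 (φ d R) x =
      ∫ x : Plane, p (stMk (x, t)) * 𝓕 (fun q : Plane => dxSymbol k (q 0) * φ d R q) x := by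
    rw [ae_ball_iff hDc]
    intro d _
    rw [ae_all_iff]
    exact fun R => h.ae_integral_slice (hφ₁ d R) (hφ₂ d R)
  filter_upwards [key, ae_integrable_slice h.integrable] with t ht hpt
  refine ⟨hpt, fun o ho => ?_⟩
  set P : Plane → ℂ := 𝓕 fun x : Plane => p (stMk (x, t)) with hP
  have hPc : Continuous P := continuous_fourier hpt
  set G : Plane → ℂ := fun q => (𝓕 o : L2Plane) q - dxSymbol k (q 0) * P q with hG
  have hmP : Measurable fun q : Plane => dxSymbol k (q 0) * P q :=
    ((measurable_dxSymbol k).comp (by fun_prop)).mul hPc.measurable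
  have hball (R : ℕ) : ∀ᵐ q : Plane, (Metric.ball (0 : Plane) R).indicator G q = 0 := by
    have hm1 : MemLp ((Metric.ball (0 : Plane) R).indicator (𝓕 o : L2Plane)) 2 :=
      (Lp.memLp _).indicator measurableSet_ball
    have hm2 : MemLp ((Metric.ball (0 : Plane) R).indicator fun q : Plane =>
        dxSymbol k (q 0) * P q) 2 := by
      rw [memLp_indicator_iff_restrict measurableSet_ball]
      refine MemLp.of_bound hmP.aestronglyMeasurable
        (2 ^ (k + 1) * ∫ x : Plane, ‖p (stMk (x, t))‖) (Filter.Eventually.of_forall fun q => ?_)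
      rw [norm_mul]
      exact mul_le_mul (norm_dxSymbol_le k _) (norm_fourier_le _ q) (norm_nonneg _)
        (by positivity)
    have hmG : MemLp ((Metric.ball (0 : Plane) R).indicator G) 2 := by
      have e : (Metric.ball (0 : Plane) R).indicator G =
          (Metric.ball (0 : Plane) R).indicator (𝓕 o : L2Plane) -
            (Metric.ball (0 : Plane) R).indicator fun q : Plane => dxSymbol k (q 0) * P q := by
        funext q
        by_cases hb : q ∈ Metric.ball (0 : Plane) R
        · simp only [Pi.sub_apply, indicator_of_mem hb, hG]
        · simp only [Pi.sub_apply, indicator_of_notMem hb, sub_zero]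
      rw [e]
      exact hm1.sub hm2
    have hz : hmG.toLp _ = 0 := by
      refine eq_zero_of_pairing₂_eq_zero hD fun d hd => ?_
      have e0 := ht d hd R
      have e1 := integral_fourier_mul_eq_of_memLp o (hφ₁ d R) (hφ₂ d R)
      have e2 := integral_fourier_mul_eq hpt (integrable_dxSymbol_mul k (hφ₁ d R))
      have e3 : ∫ x, o x * 𝓕 (φ d R) x = ∫ x : Plane, O (stMk (x, t)) * 𝓕 (φ d R) x :=
        integral_congr_ae (by filter_upwards [ho] with x hx; rw [hx])
      have e4 : ∫ q, (𝓕 o : L2Plane) q * φ d R q =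
          ∫ q, P q * (dxSymbol k (q 0) * φ d R q) := by
        rw [e1, e3, e0, e2]
      rw [pairing₂_apply]
      have i1 : Integrable fun q => (𝓕 o : L2Plane) q * φ d R q :=
        (Lp.memLp _).integrable_mul (hφ₂ d R)
      have i2 : Integrable fun q => P q * (dxSymbol k (q 0) * φ d R q) := by
        refine (integrable_dxSymbol_mul k (hφ₁ d R)).bdd_mul hPc.aestronglyMeasurable
          (c := ∫ x : Plane, ‖p (stMk (x, t))‖)
          (Filter.Eventually.of_forall fun q => norm_fourier_le _ q)
      rw [← sub_eq_zero, ← integral_sub i1 i2] at e4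
      rw [← e4]
      refine integral_congr_ae ?_
      filter_upwards [hmG.coeFn_toLp] with q hq
      rw [hq, hφ]
      by_cases hb : q ∈ Metric.ball (0 : Plane) R
      · simp only [indicator_of_mem hb, hG]; ring
      · simp only [indicator_of_notMem hb]; ring
    have := hmG.coeFn_toLp
    rw [hz] at this
    filter_upwards [this, Lp.coeFn_zero ℂ 2 (volume : Measure Plane)] with q h1 h2
    rw [← h1, h2]; rfl
  filter_upwards [ae_all_iff.2 hball] with q hq
  obtain ⟨R, hR⟩ := exists_nat_gt ‖q‖
  have hq' := hq R
  rw [indicator_of_mem (by simpa using hR)] at hq'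
  exact sub_eq_zero.1 hq'

/-! ### Littlewood-Paley pieces on the plane -/

open Filter Topology in
/-- The Fourier transform of products, along convergent sums in `L²`. -/
theorem tendsto_fourier_mul_sum {V : Type*} [NormedAddCommGroup V] [InnerProductSpace ℝ V]
    [FiniteDimensional ℝ V] [MeasurableSpace V] [BorelSpace V]
    {f g : ℕ → Lp ℂ 2 (volume : Measure V)} {u v : Lp ℂ 2 (volume : Measure V)}
    (hf : Tendsto (fun N => ∑ i ∈ Finset.range N, f i) atTop (𝓝 u))
    (hg : Tendsto (fun N => ∑ i ∈ Finset.range N, g i) atTop (𝓝 v)) (q : V) :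
    Tendsto (fun N => ∑ i ∈ Finset.range N ×ˢ Finset.range N,
      𝓕 (fun x => f i.1 x * g i.2 x) q) atTop (𝓝 (𝓕 (fun x => u x * v x) q)) := by
  set H := (ContinuousLinearMap.mul ℂ ℂ).holderL (volume : Measure V) 2 2 1 with hH
  have hL (f g : Lp ℂ 2 (volume : Measure V)) : 𝓕 (fun z => f z * g z) q =
      Real.Lp.fourierTransformCLM V ℂ (H f g) q := by
    rw [Real.Lp.fourierTransformCLM_apply, Real.Lp.fourierTransform_apply]
    refine Real.fourier_congr_ae ?_ _
    filter_upwards [(ContinuousLinearMap.mul ℂ ℂ).coeFn_holder (r := 1) f g] with x hx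
    exact hx.symm
  have hev : Continuous fun h : BoundedContinuousFunction V ℂ => h q := continuous_eval_const q
  have hc : Continuous fun w : Lp ℂ 2 (volume : Measure V) × Lp ℂ 2 (volume : Measure V) =>
      Real.Lp.fourierTransformCLM V ℂ (H w.1 w.2) q := hev.comp (by fun_prop)
  have h1 := (hc.tendsto (u, v)).comp (hf.prodMk_nhds hg)
  simp only [hL]
  refine h1.congr fun N => ?_
  simp only [Function.comp_apply, map_sum, sum_apply,
    BoundedContinuousFunction.sum_apply]
  rw [Finset.sum_product, Finset.sum_comm]

/-- The sharp bands tile the line: the lower end (3/4)·2^{N+1} of each band is the upper end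
(3/2)·2^N of the preceding one. -/
theorem sum_indicator_freqSet (N : ℕ) (x : ℝ) (c : ℂ) :
    ∑ k ∈ Finset.range (N + 1), (freqSet k).indicator (fun _ => c) x =
      {x : ℝ | |x| < 3 / 2 * 2 ^ N}.indicator (fun _ => c) x := by
  induction N with
  | zero => simp [freqSet]
  | succ N ih =>
    rw [Finset.sum_range_succ, ih]
    have hp : (0 : ℝ) < 2 ^ N := by positivity
    have e1 : x ∈ freqSet (N + 1) ↔ 3 / 2 * 2 ^ N ≤ |x| ∧ |x| < 3 / 2 * 2 ^ (N + 1) := by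
      rw [freqSet, if_neg (by omega), mem_ofPred_eq, mem_Ico, pow_succ]
      constructor <;> rintro ⟨h1, h2⟩ <;> constructor <;> linarith
    by_cases h1 : |x| < 3 / 2 * 2 ^ N
    · have h2 : |x| < 3 / 2 * 2 ^ (N + 1) := by rw [pow_succ]; linarith
      have h3 : x ∉ freqSet (N + 1) := fun h => by have := (e1.1 h).1; linarith
      rw [indicator_of_notMem h3, add_zero, indicator_of_mem (by exact h1),
        indicator_of_mem (by exact h2)]
    · rw [indicator_of_notMem (by exact h1), zero_add]
      push Not at h1
      by_cases h2 : |x| < 3 / 2 * 2 ^ (N + 1)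
      · rw [indicator_of_mem (e1.2 ⟨h1, h2⟩)]
        exact (indicator_of_mem (by exact h2) (fun _ => c)).symm
      · rw [indicator_of_notMem (fun h => h2 (e1.1 h).2)]
        exact (indicator_of_notMem (by exact h2) (fun _ => c)).symm

open Filter Topology in
/-- The Littlewood-Paley decomposition converges in `L²`. -/
theorem tendsto_sum_pieces {u : L2Plane} {h : ℕ → L2Plane}
    (hh : ∀ k, ∀ᵐ q : Plane, (𝓕 (h k) : L2Plane) q =
      indicator {q : Plane | 2 * Real.pi * q 0 ∈ freqSet k} (𝓕 u : L2Plane) q) :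
    Tendsto (fun N => ∑ k ∈ Finset.range N, h k) atTop (𝓝 u) := by
  rw [← tendsto_add_atTop_iff_nat 1]
  set S : ℕ → L2Plane := fun N => ∑ k ∈ Finset.range (N + 1), h k with hS
  have hFS (N : ℕ) : ∀ᵐ q : Plane, (𝓕 u - 𝓕 (S N) : L2Plane) q =
      {q : Plane | 3 / 2 * 2 ^ N ≤ |2 * Real.pi * q 0|}.indicator (𝓕 u : L2Plane) q := by
    have e : (𝓕 (S N) : L2Plane) = ∑ k ∈ Finset.range (N + 1), 𝓕 (h k) :=
      map_sum (FourierTransform.fourierₗ ℂ L2Plane) _ _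
    rw [e]
    filter_upwards [Lp.coeFn_sub (𝓕 u : L2Plane) (∑ k ∈ Finset.range (N + 1), 𝓕 (h k)),
      Lp.coeFn_fun_finsetSum (Finset.range (N + 1)) fun k => (𝓕 (h k) : L2Plane),
      ae_all_iff.2 hh] with q h1 h2 h3
    rw [h1, Pi.sub_apply, h2]
    simp only [h3]
    have h4 : ∀ k, indicator {q : Plane | 2 * Real.pi * q 0 ∈ freqSet k} (𝓕 u : L2Plane) q =
        (freqSet k).indicator (fun _ => (𝓕 u : L2Plane) q) (2 * Real.pi * q 0) := fun k => rfl
    simp only [h4]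
    rw [sum_indicator_freqSet]
    by_cases hq : |2 * Real.pi * q 0| < 3 / 2 * 2 ^ N
    · rw [indicator_of_mem (by exact hq), indicator_of_notMem (by simpa using hq), sub_self]
    · rw [indicator_of_notMem (by exact hq), indicator_of_mem (by simpa using hq), sub_zero]
  have hnorm (N : ℕ) : ENNReal.ofReal ‖S N - u‖ ^ 2 =
      ∫⁻ q : Plane, ({q : Plane | 3 / 2 * 2 ^ N ≤ |2 * Real.pi * q 0|}.indicator
        (fun q => ‖(𝓕 u : L2Plane) q‖ₑ ^ 2) q) := by
    have e1 : ‖S N - u‖ = ‖(𝓕 u - 𝓕 (S N) : L2Plane)‖ := by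
      have e : (𝓕 (u - S N) : L2Plane) = 𝓕 u - 𝓕 (S N) :=
        map_sub (FourierTransform.fourierₗ ℂ L2Plane) _ _
      rw [← e, Lp.norm_fourier_eq, norm_sub_rev]
    rw [e1, ofReal_norm, Lp.enorm_def, l2_eq_eLpNorm, l2_sq]
    refine lintegral_congr_ae ?_
    filter_upwards [hFS N] with q hq
    rw [hq]
    by_cases hm : 3 / 2 * 2 ^ N ≤ |2 * Real.pi * q 0|
    · rw [indicator_of_mem (by exact hm), indicator_of_mem (by exact hm)]
    · rw [indicator_of_notMem (by exact hm), indicator_of_notMem (by exact hm)]; simp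
  have hlim : Tendsto (fun N : ℕ => ENNReal.ofReal ‖S N - u‖ ^ 2) atTop (𝓝 0) := by
    simp only [hnorm]
    have hmeas : Measurable fun q : Plane => ‖(𝓕 u : L2Plane) q‖ₑ ^ 2 :=
      ((Lp.stronglyMeasurable (𝓕 u : L2Plane)).measurable.enorm).pow_const 2
    have h0 := tendsto_lintegral_of_dominated_convergence (μ := (volume : Measure Plane))
      (F := fun N : ℕ => {q : Plane | 3 / 2 * 2 ^ N ≤ |2 * Real.pi * q 0|}.indicator
        (fun q => ‖(𝓕 u : L2Plane) q‖ₑ ^ 2)) (f := fun _ => 0)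
      (fun q => ‖(𝓕 u : L2Plane) q‖ₑ ^ 2)
      (fun N => hmeas.indicator (measurableSet_le measurable_const (by fun_prop)))
      (fun N => Filter.Eventually.of_forall fun q => indicator_le_self _ _ _) ?_
      (Filter.Eventually.of_forall fun q => ?_)
    · simpa using h0
    · rw [← l2_sq, ← l2_eq_eLpNorm, ← Lp.enorm_def]
      simp
    · refine tendsto_const_nhds.congr' ?_
      have h2 : Tendsto (fun N : ℕ => (3 / 2 * 2 ^ N : ℝ)) atTop atTop :=
        (tendsto_pow_atTop_atTop_of_one_lt (by norm_num)).const_mul_atTop (by norm_num)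
      filter_upwards [h2.eventually_gt_atTop |2 * Real.pi * q 0|] with N hN
      rw [indicator_of_notMem (by simpa using hN)]
  rw [tendsto_iff_norm_sub_tendsto_zero]
  have h3 : Tendsto (fun N : ℕ => (‖S N - u‖) ^ 2) atTop (𝓝 0) := by
    have := (ENNReal.tendsto_toReal ENNReal.zero_ne_top).comp hlim
    simpa [Function.comp_def] using this
  have h4 := h3.sqrt
  simpa using h4

/-- The Littlewood-Paley pieces of an `L²` function. -/
theorem IsPiece.ae_fourier_eq {k : ℕ} {u h : L2Plane} (hp : IsPiece k (u : 𝓢'(Plane, ℂ)) h) :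
    ∀ᵐ q : Plane, (𝓕 h : L2Plane) q =
      indicator {q : Plane | 2 * Real.pi * q 0 ∈ freqSet k} (𝓕 u : L2Plane) q := by
  obtain ⟨g, hg, hφ, hh⟩ := hp
  -- The function g witnessing the piece is determined by its pairings with Schwartz functions, so
  -- it can only be the L² transform of u.
  have hgu : g =ᵐ[volume] (𝓕 u : L2Plane) := by
    refine ae_eq_of_integral_schwartz_mul_eq hg
      ((Lp.memLp _).locallyIntegrable (by norm_num)) fun φ => ?_
    rw [← (hφ φ).2, Lp.fourier_toTemperedDistribution_eq, Lp.toTemperedDistribution_apply]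
    simp only [smul_eq_mul]
  filter_upwards [hh, hgu] with q h1 h2
  rw [h1]
  by_cases hq : q ∈ {q : Plane | 2 * Real.pi * q 0 ∈ freqSet k}
  · rw [indicator_of_mem hq, indicator_of_mem hq, h2]
  · rw [indicator_of_notMem hq, indicator_of_notMem hq]

/-- The Littlewood-Paley pieces of `∂_x (u v)`. -/
theorem isPiece_dx_mul {k : ℕ} {u v o : L2Plane}
    (ho : ∀ᵐ q : Plane, (𝓕 o : L2Plane) q =
      dxSymbol k (q 0) * 𝓕 (fun x : Plane => u x * v x) q) :
    IsPiece k (∂_{(EuclideanSpace.single 0 1 : Plane)}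
      (((u • v : Lp ℂ 1 (volume : Measure Plane))) : 𝓢'(Plane, ℂ))) o := by
  have hp : Integrable (fun x : Plane => u x * v x) := (Lp.memLp u).integrable_mul (Lp.memLp v)
  set P := 𝓕 (fun x : Plane => u x * v x) with hP
  have hPc : Continuous P := continuous_fourier hp
  have ht : Function.HasTemperateGrowth
      (fun x : Plane => inner ℝ x (EuclideanSpace.single 0 1 : Plane)) :=
    ((innerSL ℝ).flip (EuclideanSpace.single 0 1 : Plane)).hasTemperateGrowth
  have hin (q : Plane) : inner ℝ q (EuclideanSpace.single 0 1 : Plane) = q 0 := by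
    simp [EuclideanSpace.inner_single_right]
  refine ⟨fun q => (2 * Real.pi * Complex.I) * q 0 * P q, ?_, fun φ => ?_, ?_⟩
  · exact Continuous.locallyIntegrable (by fun_prop)
  · set ψ : 𝓢(Plane, ℂ) := SchwartzMap.smulLeftCLM ℂ
      (fun x : Plane => inner ℝ x (EuclideanSpace.single 0 1 : Plane)) φ with hψ
    have hψa (q : Plane) : ψ q = q 0 * φ q := by
      rw [hψ, SchwartzMap.smulLeftCLM_apply_apply ht, hin]
      simp
    have e0 (q : Plane) : φ q * ((2 * Real.pi * Complex.I) * q 0 * P q) =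
        (2 * Real.pi * Complex.I) * (ψ q * P q) := by rw [hψa]; ring
    simp only [e0]
    refine ⟨Integrable.const_mul ?_ _, ?_⟩
    · exact (ψ.integrable.mul_bdd (c := ∫ x, ‖u x * v x‖) hPc.aestronglyMeasurable
        (Filter.Eventually.of_forall fun q => norm_fourier_le _ q))
    · rw [TemperedDistribution.fourier_apply, TemperedDistribution.lineDerivOp_apply_apply,
        SchwartzMap.lineDerivOp_fourier_eq, ← hψ, Lp.toTemperedDistribution_apply,
        integral_const_mul]
      have e1 : (-(𝓕 (-(2 * (Real.pi : ℂ) * Complex.I) • ψ) : 𝓢(Plane, ℂ))) =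
          (2 * (Real.pi : ℂ) * Complex.I) • (𝓕 ψ : 𝓢(Plane, ℂ)) := by
        rw [FourierTransform.fourier_smul, neg_smul, neg_neg]
      rw [e1]
      have e2 := integral_fourier_mul_eq ψ.integrable hp
      rw [← hP] at e2
      rw [← e2, ← integral_const_mul]
      refine integral_congr_ae ?_
      filter_upwards [Lp.coeFn_lpSMul (r := 1) u v] with x hx
      rw [hx, smul_apply, SchwartzMap.fourier_coe]
      simp only [Pi.smul_apply', smul_eq_mul]
      ring
  · filter_upwards [ho] with q hq
    rw [hq, dxSymbol]
    by_cases hm : 2 * Real.pi * q 0 ∈ freqSet k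
    · rw [indicator_of_mem hm, indicator_of_mem (by exact hm)]
      push_cast; ring
    · rw [indicator_of_notMem hm, indicator_of_notMem (by exact hm), zero_mul]

/-! ### Sums of dyadic pieces -/

section Sums

variable {ι : Type*} [Countable ι] {O : ι → L2SpaceTime}

theorem ae_hasSum_fourierST_timeCut (η : Cutoff) (k : ℕ) (t₀ : ℝ) (hO : ∑' i, ‖O i‖ₑ ≠ ⊤) :
    ∀ᵐ ζ, HasSum (fun i => fourierST (timeCut η k t₀ (O i)) ζ)
      (fourierST (timeCut η k t₀ (∑' i, O i)) ζ) := by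
  set L : L2SpaceTime →L[ℂ] L2SpaceTime :=
    (Lp.fourierTransformₗᵢ SpaceTime ℂ).toContinuousLinearEquiv.toContinuousLinearMap ∘L
      timeCutCLM η k t₀ with hL
  have hLa (f : L2SpaceTime) : L f = (𝓕 (timeCut η k t₀ f) : L2SpaceTime) := rfl
  have hLn (f : L2SpaceTime) : ‖L f‖ₑ ≤ ‖f‖ₑ := by
    rw [hLa, ← ofReal_norm, ← ofReal_norm, Lp.norm_fourier_eq]
    refine ENNReal.ofReal_le_ofReal (Lp.norm_le_norm_of_ae_le ?_)
    filter_upwards [coeFn_timeCut η k t₀ f] with z hz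
    have h := η.mem_Icc (2 ^ k * (z 2 - t₀))
    rw [hz, norm_mul, Complex.norm_real, Real.norm_eq_abs, abs_of_nonneg h.1]
    exact mul_le_of_le_one_left (norm_nonneg _) h.2
  have h1 : ∑' i, ‖L (O i)‖ₑ ≠ ⊤ :=
    ne_top_of_le_ne_top hO (ENNReal.tsum_le_tsum fun i => hLn (O i))
  have h2 := Lp.hasSum_coeFn_tsum h1
  rw [← L.map_tsum (Summable.of_enorm hO)] at h2
  exact ae_fourierST h2

theorem zNorm_fourierST_tsum_le (η : Cutoff) (k : ℕ) (t₀ : ℝ) (hO : ∑' i, ‖O i‖ₑ ≠ ⊤) :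
    zNorm k (fun ζ => ‖fourierST (timeCut η k t₀ (∑' i, O i)) ζ‖ₑ) ≤
      ∑' i, zNorm k (fun ζ => ‖fourierST (timeCut η k t₀ (O i)) ζ‖ₑ) := by
  refine (zNorm_mono_ae ?_).trans (zNorm_tsum_le k fun i => (measurable_fourierST _).enorm)
  filter_upwards [ae_hasSum_fourierST_timeCut η k t₀ hO] with ζ hζ
  rw [← hζ.tsum_eq]
  exact enorm_tsum_le_tsum_enorm

theorem freqSupported_tsum {k : ℕ} (hO : ∑' i, ‖O i‖ₑ ≠ ⊤) (h : ∀ i, FreqSupported k (O i)) :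
    FreqSupported k (∑' i, O i) := by
  have h1 : ∑' i, ‖(𝓕 (O i) : L2SpaceTime)‖ₑ ≠ ⊤ := by
    refine ne_top_of_le_ne_top hO (ENNReal.tsum_le_tsum fun i => le_of_eq ?_)
    rw [← ofReal_norm, ← ofReal_norm, Lp.norm_fourier_eq]
  have h2 := Lp.hasSum_coeFn_tsum h1
  have h3 : (𝓕 (∑' i, O i) : L2SpaceTime) = ∑' i, (𝓕 (O i) : L2SpaceTime) :=
    (Lp.fourierTransformₗᵢ SpaceTime ℂ).toContinuousLinearEquiv.toContinuousLinearMap.map_tsum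
      (Summable.of_enorm hO)
  rw [← h3] at h2
  filter_upwards [ae_fourierST h2, ae_all_iff.2 h] with ζ h4 h5 h6
  have h7 : HasSum (fun i => fourierST (O i) ζ) (fourierST (∑' i, O i) ζ) := h4
  simp only [h5 _ h6] at h7
  exact h7.unique hasSum_zero

/-- Convergent sums in `L²(ℝ³)`, at almost every fixed time. -/
theorem ae_slice_tsum (hO : ∑' i, ‖O i‖ₑ ≠ ⊤) :
    ∀ᵐ t : ℝ, ∃ o : ι → L2Plane, (∀ i, ∀ᵐ x : Plane, o i x = O i (stMk (x, t))) ∧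
      ∑' i, ‖o i‖ₑ ≠ ⊤ ∧ ∀ᵐ x : Plane, (∑' i, o i) x = (∑' i, O i) (stMk (x, t)) := by
  have hm (i : ι) : Measurable fun z : Plane × ℝ => ‖O i (stMk z)‖ₑ :=
    (Lp.stronglyMeasurable (O i)).measurable.enorm.comp measurable_stMk
  set n : ι → ℝ → ℝ≥0∞ := fun i t => l2 fun x : Plane => ‖O i (stMk (x, t))‖ₑ with hn
  have hnm (i : ι) : Measurable (n i) :=
    (Measurable.lintegral_prod_left ((hm i).pow_const 2)).pow_const _
  have hnl (i : ι) : l2 (n i) = ‖O i‖ₑ := by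
    rw [Lp.enorm_def, l2_eq_eLpNorm, l2, l2]
    congr 1
    simp only [hn, l2_sq]
    rw [← lintegral_prod_symm' _ ((hm i).pow_const 2)]
    exact measurePreserving_stEquiv.lintegral_comp_emb stEquiv.measurableEmbedding
      (fun ζ => ‖O i ζ‖ₑ ^ 2)
  -- Minkowski in t bounds the L²_t norm of the sum of the slice norms by ∑ ‖O i‖. That sum is
  -- therefore finite for almost every t, and the slices converge absolutely in L²(ℝ²).
  have hfin : ∀ᵐ t : ℝ, ∑' i, n i t < ⊤ := by
    have h1 : ∫⁻ t : ℝ, (∑' i, n i t) ^ 2 ≠ ⊤ := by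
      rw [← l2_sq]
      have := (l2_tsum_le hnm).trans_lt (by simpa only [hnl] using hO.lt_top)
      finiteness
    filter_upwards [ae_lt_top ((Measurable.tsum hnm).pow_const 2) h1] with t ht
    by_contra h
    rw [not_lt, top_le_iff] at h
    simp [h] at ht
  have hsum : ∀ᵐ t : ℝ, ∀ᵐ x : Plane,
      HasSum (fun i => O i (stMk (x, t))) ((∑' i, O i) (stMk (x, t))) := by
    have h1 := measurePreserving_stMk.quasiMeasurePreserving.ae (Lp.hasSum_coeFn_tsum hO)
    have h2 := Measure.measurePreserving_swap (μ := (volume : Measure ℝ))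
      (ν := (volume : Measure Plane)) |>.quasiMeasurePreserving.ae h1
    exact Measure.ae_ae_of_ae_prod h2
  filter_upwards [hfin, hsum, ae_all_iff.2 fun i => ae_memLp_slice (O i)] with t h1 h2 h3
  have h4 (i : ι) := (h3 i).coeFn_toLp
  have h5 : ∑' i, ‖(h3 i).toLp _‖ₑ ≠ ⊤ := by
    refine ne_top_of_le_ne_top h1.ne (ENNReal.tsum_le_tsum fun i => le_of_eq ?_)
    rw [Lp.enorm_toLp, l2_eq_eLpNorm]
  refine ⟨fun i => (h3 i).toLp _, h4, h5, ?_⟩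
  filter_upwards [h2, Lp.hasSum_coeFn_tsum h5, ae_all_iff.2 h4] with x h6 h7 h8
  simp only [h8] at h7
  exact h7.unique h6

end Sums

open Filter Topology in
/-- The Littlewood-Paley pieces of `∂_x (u v)` as sums over the pieces of `u` and `v`. -/
theorem isPiece_dx_mul_tsum {k : ℕ} {u v : L2Plane} {h h' : ℕ → L2Plane}
    (hu : ∀ i, IsPiece i (u : 𝓢'(Plane, ℂ)) (h i))
    (hv : ∀ i, IsPiece i (v : 𝓢'(Plane, ℂ)) (h' i))
    {o : ℕ × ℕ → L2Plane} (hofin : ∑' i, ‖o i‖ₑ ≠ ⊤)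
    (ho : ∀ i, ∀ᵐ q : Plane, (𝓕 (o i) : L2Plane) q =
      dxSymbol k (q 0) * 𝓕 (fun x : Plane => h i.1 x * h' i.2 x) q) :
    IsPiece k (∂_{(EuclideanSpace.single 0 1 : Plane)}
      (((u • v : Lp ℂ 1 (volume : Measure Plane))) : 𝓢'(Plane, ℂ))) (∑' i, o i) := by
  refine isPiece_dx_mul ?_
  have hu' := tendsto_sum_pieces (u := u) (h := h) fun i => (hu i).ae_fourier_eq
  have hv' := tendsto_sum_pieces (u := v) (h := h') fun i => (hv i).ae_fourier_eq
  have h1 : ∑' i, ‖(𝓕 (o i) : L2Plane)‖ₑ ≠ ⊤ := by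
    refine ne_top_of_le_ne_top hofin (ENNReal.tsum_le_tsum fun i => le_of_eq ?_)
    rw [← ofReal_norm, ← ofReal_norm, Lp.norm_fourier_eq]
  have h2 := Lp.hasSum_coeFn_tsum h1
  have h3 : (𝓕 (∑' i, o i) : L2Plane) = ∑' i, (𝓕 (o i) : L2Plane) :=
    (Lp.fourierTransformₗᵢ Plane ℂ).toContinuousLinearEquiv.toContinuousLinearMap.map_tsum
      (Summable.of_enorm hofin)
  rw [← h3] at h2
  filter_upwards [h2, ae_all_iff.2 ho] with q hq1 hq2
  simp only [hq2] at hq1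
  -- The double series converges unconditionally, so it may be summed along squares. Its partial
  -- sums are then products of partial Littlewood-Paley sums of u and v.
  have h5 : Tendsto (fun N : ℕ => Finset.range N ×ˢ Finset.range N) atTop atTop := by
    have h := tendsto_finset_range.prodMk tendsto_finset_range
    rw [prod_atTop_atTop_eq] at h
    exact tendsto_finsetProd_atTop.comp h
  have h6 := (tendsto_fourier_mul_sum hu' hv' q).const_mul (dxSymbol k (q 0))
  rw [HasSum, SummationFilter.unconditional_filter] at hq1
  have h7 := hq1.comp h5
  refine tendsto_nhds_unique h7 (h6.congr fun N => ?_)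
  rw [Finset.mul_sum, Function.comp_apply]

/-- The sum of the dyadic pieces of `P_k ∂_x (u v)` is an extension of `P_k ∂_x (u v)`. -/
theorem extendsPiece_dxMul {T : ℝ} (hT : T ≤ 1) {k : ℕ} {u v : ℝ → L2Plane}
    {f g : ℕ → L2SpaceTime} (hf : ∀ i, ExtendsPiece T i (fun t => (u t : 𝓢'(Plane, ℂ))) (f i))
    (hg : ∀ i, ExtendsPiece T i (fun t => (v t : 𝓢'(Plane, ℂ))) (g i))
    {l : ℕ × ℕ → ℕ} {O : ℕ × ℕ → L2SpaceTime} (hO : ∑' i, ‖O i‖ₑ ≠ ⊤)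
    (hd : ∀ i, IsDx k (fun z => timePlateau (l i) (z 2) * (f i.1 z * g i.2 z)) (O i)) :
    ExtendsPiece T k (dxMul u v) (∑' i, O i) := by
  have hIcc : ∀ᵐ t ∂(volume.restrict (Icc (-T) T)), t ∈ Icc (-T) T :=
    ae_restrict_mem measurableSet_Icc
  have hsl := ae_restrict_of_ae (s := Icc (-T) T) (ae_slice_tsum hO)
  have hdt := ae_restrict_of_ae (s := Icc (-T) T) (ae_all_iff.2 fun i => (hd i).ae_slice)
  filter_upwards [hIcc, ae_all_iff.2 hf, ae_all_iff.2 hg, hsl, hdt] with t ht hft hgt hsl hdt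
  -- This is where T ≤ 1 enters: the plateau used in the time decomposition equals 1 on [-1, 1].
  have htl (i) : (timePlateau (l i) t : ℂ) = 1 := by
    rw [timePlateau_eq_one (abs_le.2 ⟨by linarith [ht.1], by linarith [ht.2]⟩)]; simp
  choose hu hu1 hu2 using hft
  choose hv hv1 hv2 using hgt
  obtain ⟨o, ho, hofin, hosum⟩ := hsl
  refine ⟨∑' i, o i, hosum, isPiece_dx_mul_tsum hu2 hv2 hofin fun i => ?_⟩
  filter_upwards [(hdt i).2 (o i) (ho i)] with q hq
  rw [hq]
  congr 1
  refine Real.fourier_congr_ae ?_ _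
  filter_upwards [hu1 i.1, hv1 i.2] with x hx1 hx2
  have e : stMk (x, t) = !₂[x 0, x 1, t] := rfl
  rw [hx1, hx2, ← e, stMk_two, htl, one_mul]

/-- The bilinear estimate for `P_k ∂_x (u v)`, in terms of extensions of the pieces of `u`
and `v`. -/
theorem nkTNorm_dxMul_le (η : Cutoff) {T : ℝ} (hT : T ≤ 1) (k : ℕ) {u v : ℝ → L2Plane}
    {f g : ℕ → L2SpaceTime} (hfs : ∀ i, FreqSupported i (f i))
    (hgs : ∀ i, FreqSupported i (g i))
    (hf : ∀ i, ExtendsPiece T i (fun t => (u t : 𝓢'(Plane, ℂ))) (f i))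
    (hg : ∀ i, ExtendsPiece T i (fun t => (v t : 𝓢'(Plane, ℂ))) (g i))
    (hfa : ∀ i, fkNorm η i (f i) ≠ ⊤) (hga : ∀ i, fkNorm η i (g i) ≠ ⊤)
    (hsum : ∑' i : ℕ × ℕ, (if weight i.1 i.2 k = 0 then 0 else
      W (max i.1 i.2 : ℕ) * fkNorm η i.1 (f i.1) * fkNorm η i.2 (g i.2)) ≠ ⊤) :
    nkTNorm η T k (dxMul u v) ≤ (3 * geomConst (1 / 2) + 6) * (η.pieceConst *
      ∑' i : ℕ × ℕ, weight i.1 i.2 k * fkNorm η i.1 (f i.1) * fkNorm η i.2 (g i.2)) := by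
  choose O hd hz hn h0 using fun i : ℕ × ℕ =>
    exists_weighted_piece η i.1 i.2 k (hfs i.1) (hgs i.2) (hfa i.1) (hga i.2)
  -- Only finiteness matters at this point: k is fixed, so factors growing with k are harmless, and
  -- non-interacting pairs contribute zero.
  have hO : ∑' i, ‖O i‖ₑ ≠ ⊤ := by
    refine ne_top_of_le_ne_top (b := W (2 * k + 12) * η.timeConst ^ 2 * _)
      (ENNReal.mul_ne_top (ENNReal.mul_ne_top (W_ne_top _)
        (ENNReal.pow_ne_top η.timeConst_ne_top)) hsum) ?_
    rw [← ENNReal.tsum_mul_left]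
    refine ENNReal.tsum_le_tsum fun i => ?_
    by_cases hw : weight i.1 i.2 k = 0
    · rw [h0 i hw]; simp
    · rw [if_neg hw]
      refine (hn i).trans (le_of_eq ?_)
      rw [show (2 * k + (max i.1 i.2 : ℕ) + 12 : ℝ) = (2 * k + 12) + (max i.1 i.2 : ℕ) by ring,
        W_add]
      ring
  refine iInf_le_of_le (∑' i, O i) (iInf_le_of_le (freqSupported_tsum hO fun i =>
    (hd i).freqSupported) (iInf_le_of_le (extendsPiece_dxMul hT hf hg hO hd) ?_))
  refine iSup_le fun t₀ => ?_
  refine (xNorm_inv_modulation_le η k (measurable_fourierST _)).trans ?_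
  gcongr
  refine (zNorm_fourierST_tsum_le η k t₀ hO).trans ?_
  rw [← ENNReal.tsum_mul_left]
  refine ENNReal.tsum_le_tsum fun i => (hz i t₀).trans (le_of_eq ?_)
  ring

/-! ### Summation over the frequency bands -/

/-- The exponentially decaying kernel on pairs of frequency bands. -/
def bandKernel (i j : ℕ) : ℝ≥0∞ := W (-|(i : ℝ) - j| / 2)

theorem bandKernel_comm (i j : ℕ) : bandKernel i j = bandKernel j i := by
  rw [bandKernel, bandKernel, abs_sub_comm]

theorem tsum_bandKernel_le (i : ℕ) : ∑' j, bandKernel i j ≤ 2 * geomConst (1 / 2) := by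
  rw [← Summable.sum_add_tsum_nat_add' (k := i) ENNReal.summable, two_mul]
  refine add_le_add ?_ (le_of_eq ?_)
  · rw [← Finset.sum_range_reflect]
    refine le_trans (Finset.sum_le_sum fun j hj => ?_) (ENNReal.sum_le_tsum (Finset.range i))
    have hj' := Finset.mem_range.1 hj
    have e : (i : ℝ) - ((i - 1 - j : ℕ) : ℝ) = j + 1 := by
      rw [Nat.sub_sub, Nat.cast_sub (by omega)]; push_cast; ring
    rw [bandKernel, e]
    refine W_mono ?_
    rw [abs_of_nonneg (by positivity)]
    linarith
  · rw [geomConst]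
    refine tsum_congr fun n => ?_
    rw [bandKernel]
    congr 1
    push_cast
    rw [show (i : ℝ) - (n + i) = -n by ring, abs_neg, abs_of_nonneg (by positivity)]
    ring

theorem mul_le_sq_add_sq (x y : ℝ≥0∞) : x * y ≤ x ^ 2 + y ^ 2 := by
  rcases le_total x y with h | h
  · exact (mul_le_mul' h le_rfl).trans ((sq y).symm.le.trans le_add_self)
  · exact (mul_le_mul' le_rfl h).trans ((sq x).symm.le.trans le_self_add)

/-- Cauchy-Schwarz with a lost factor 2: the square is expanded into a double sum and xy ≤ x² + y²
is applied to each term. -/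
theorem sq_tsum_mul_le {ι : Type*} (κ x : ι → ℝ≥0∞) :
    (∑' j, κ j * x j) ^ 2 ≤ 2 * ((∑' j, κ j) * ∑' j, κ j * x j ^ 2) := by
  calc (∑' j, κ j * x j) ^ 2 = ∑' j, ∑' l, (κ j * x j) * (κ l * x l) := by
        rw [sq, ← ENNReal.tsum_mul_right]
        simp_rw [ENNReal.tsum_mul_left]
    _ ≤ ∑' j, ∑' l, (κ l * (κ j * x j ^ 2) + κ j * (κ l * x l ^ 2)) := by
        refine ENNReal.tsum_le_tsum fun j => ENNReal.tsum_le_tsum fun l => ?_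
        calc (κ j * x j) * (κ l * x l) = (κ j * κ l) * (x j * x l) := by ring
          _ ≤ (κ j * κ l) * (x j ^ 2 + x l ^ 2) := by gcongr; exact mul_le_sq_add_sq _ _
          _ = _ := by ring
    _ = _ := by
        simp_rw [ENNReal.tsum_add, ENNReal.tsum_mul_left, ENNReal.tsum_mul_right,
          ENNReal.tsum_mul_left]
        ring

/-- Schur's test. -/
theorem tsum_sq_bandKernel_le (x : ℕ → ℝ≥0∞) :
    ∑' k, (∑' i, bandKernel k i * x i) ^ 2 ≤ 2 * (2 * geomConst (1 / 2)) ^ 2 * ∑' i, x i ^ 2 := by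
  set M := 2 * geomConst (1 / 2) with hM
  calc ∑' k, (∑' i, bandKernel k i * x i) ^ 2
      ≤ ∑' k, 2 * (M * ∑' i, bandKernel k i * x i ^ 2) := by
        refine ENNReal.tsum_le_tsum fun k => (sq_tsum_mul_le _ _).trans ?_
        gcongr
        exact tsum_bandKernel_le k
    _ = 2 * (M * ∑' i, ∑' k, bandKernel k i * x i ^ 2) := by
        rw [ENNReal.tsum_mul_left, ENNReal.tsum_mul_left, ENNReal.tsum_comm]
    _ ≤ 2 * (M * ∑' i, M * x i ^ 2) := by
        gcongr with i
        rw [ENNReal.tsum_mul_right]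
        gcongr
        simp_rw [bandKernel_comm _ i]
        exact tsum_bandKernel_le i
    _ = _ := by rw [ENNReal.tsum_mul_left]; ring

theorem tsum_bandKernel_mul_le (x y : ℕ → ℝ≥0∞) :
    ∑' i : ℕ × ℕ, bandKernel i.1 i.2 * (x i.1 * y i.2) ≤
      2 * geomConst (1 / 2) * (∑' i, x i ^ 2 + ∑' i, y i ^ 2) := by
  set M := 2 * geomConst (1 / 2) with hM
  rw [ENNReal.tsum_prod' (f := fun i : ℕ × ℕ => bandKernel i.1 i.2 * (x i.1 * y i.2)), mul_add]
  calc ∑' i, ∑' j, bandKernel i j * (x i * y j)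
      ≤ ∑' i, ∑' j, (bandKernel i j * x i ^ 2 + bandKernel i j * y j ^ 2) := by
        refine ENNReal.tsum_le_tsum fun i => ENNReal.tsum_le_tsum fun j => ?_
        rw [← mul_add]
        gcongr
        exact mul_le_sq_add_sq _ _
    _ = ∑' i, (∑' j, bandKernel i j) * x i ^ 2 + ∑' j, (∑' i, bandKernel i j) * y j ^ 2 := by
        simp_rw [ENNReal.tsum_add, ENNReal.tsum_mul_right]
        congr 1
        rw [ENNReal.tsum_comm]
        simp_rw [ENNReal.tsum_mul_right]
    _ ≤ _ := by
        rw [← ENNReal.tsum_mul_left, ← ENNReal.tsum_mul_left]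
        gcongr with i j
        · exact tsum_bandKernel_le i
        · simp_rw [bandKernel_comm _ j]
          exact tsum_bandKernel_le j

/-- A sum over pairs of frequency bands dominated by the kernel. -/
theorem tsum_sq_tsum_le {t : ℕ → ℕ → ℕ → ℝ≥0∞} {x y : ℕ → ℝ≥0∞} {ρ : ℕ → ℕ → ℕ → ℝ≥0∞}
    {C M Y : ℝ≥0∞}
    (ht : ∀ k i j, t k i j ≤ C * (bandKernel k i * x i) * (ρ k i j * y j))
    (hρ : ∀ k i, ∑' j, ρ k i j ≤ M) (hY : ∀ j, y j ≤ Y) :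
    ∑' k, (∑' i : ℕ × ℕ, t k i.1 i.2) ^ 2 ≤
      2 * (2 * geomConst (1 / 2) * C * M) ^ 2 * (Y ^ 2 * ∑' i, x i ^ 2) := by
  have h1 (k : ℕ) : ∑' i : ℕ × ℕ, t k i.1 i.2 ≤ C * M * Y * ∑' i, bandKernel k i * x i := by
    rw [ENNReal.tsum_prod' (f := fun i : ℕ × ℕ => t k i.1 i.2), ← ENNReal.tsum_mul_left]
    refine ENNReal.tsum_le_tsum fun i => ?_
    calc ∑' j, t k i j ≤ ∑' j, C * (bandKernel k i * x i) * (ρ k i j * Y) := by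
          refine ENNReal.tsum_le_tsum fun j => (ht k i j).trans ?_
          gcongr
          exact hY j
      _ = C * (bandKernel k i * x i) * ((∑' j, ρ k i j) * Y) := by
          rw [ENNReal.tsum_mul_left, ENNReal.tsum_mul_right]
      _ ≤ C * (bandKernel k i * x i) * (M * Y) := by gcongr; exact hρ k i
      _ = _ := by ring
  calc _ ≤ ∑' k, (C * M * Y * ∑' i, bandKernel k i * x i) ^ 2 :=
        ENNReal.tsum_le_tsum fun k => pow_le_pow_left' (h1 k) 2
    _ = (C * M * Y) ^ 2 * ∑' k, (∑' i, bandKernel k i * x i) ^ 2 := by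
        simp_rw [mul_pow, ENNReal.tsum_mul_left]
    _ ≤ (C * M * Y) ^ 2 * (2 * (2 * geomConst (1 / 2)) ^ 2 * ∑' i, x i ^ 2) := by
        gcongr; exact tsum_sq_bandKernel_le x
    _ = _ := by ring

section Weights

variable {s : ℝ} (k i j : ℕ) (a b : ℝ≥0∞)

/-- Here |k - i| ≤ 2, so 2^{sk} costs 2^{2s} against 2^{si}. The weight 2^{j/2} is absorbed by the
full derivative 2^j on the low factor, leaving the summable 2^{-j/2}. -/
theorem W_mul_highLowWeight_le (hs : 0 ≤ s) :
    W (s * k) * (highLowWeight i j k * a * b) ≤ W (2 * s + 1) *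
      (bandKernel k i * (W (s * i) * a)) * (W (-(1 / 2) * j) * (W (1 * j) * b)) := by
  by_cases h : j + 4 ≤ i ∧ i ≤ k + 2 ∧ k ≤ i + 2
  · rw [highLowWeight, if_pos h]
    obtain ⟨-, h1, h2⟩ := h
    have h1' : (i : ℝ) ≤ k + 2 := by exact_mod_cast h1
    have h2' : (k : ℝ) ≤ i + 2 := by exact_mod_cast h2
    have h3 : s * (k - i) ≤ s * 2 := mul_le_mul_of_nonneg_left (by linarith) hs
    have h4 : |(k : ℝ) - i| ≤ 2 := abs_le.2 ⟨by linarith, by linarith⟩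
    calc _ = W (s * k + j / 2) * (a * b) := by rw [W_add]; ring
      _ ≤ W (2 * s + 1 + -|(k : ℝ) - i| / 2 + s * i + -(1 / 2) * j + 1 * j) * (a * b) := by
        gcongr
        exact W_mono (by linarith)
      _ = _ := by rw [W_add, W_add, W_add, W_add, bandKernel]; ring
  · rw [highLowWeight, if_neg h]; simp

/-- The weight 2^{(max(i,j)+k)/2} is compared with 2^j, where i ~ j: what remains is about
2^{-(i-k)/2}, the decay that sums over outputs far below the inputs. Since k ≤ i + 5 and s ≥ 0, the
factor 2^{sk} can be moved onto the first factor. -/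
theorem W_mul_highHighWeight_le (hs : 0 ≤ s) :
    W (s * k) * (highHighWeight i j k * a * b) ≤ W (5 * s + 10) *
      (bandKernel k i * (W (s * i) * a)) * (bandKernel i j * (W (1 * j) * b)) := by
  by_cases h : i ≤ j + 3 ∧ j ≤ i + 3 ∧ k ≤ max i j + 2
  · rw [highHighWeight, if_pos h]
    obtain ⟨h0, h1, h2⟩ := h
    have h0' : (i : ℝ) ≤ j + 3 := by exact_mod_cast h0
    have h1' : (j : ℝ) ≤ i + 3 := by exact_mod_cast h1
    have h5 : (max i j : ℕ) ≤ (j + 3 : ℝ) := by exact_mod_cast max_le h0 (by omega)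
    have h6 : (k : ℝ) ≤ i + 5 := by
      have : k ≤ i + 5 := h2.trans (by omega)
      exact_mod_cast this
    have h3 : s * (k - i) ≤ s * 5 := mul_le_mul_of_nonneg_left (by linarith) hs
    have h4 : |(i : ℝ) - j| ≤ 3 := abs_le.2 ⟨by linarith, by linarith⟩
    calc _ = W (s * k + ((max i j : ℕ) + k : ℝ) / 2) * (a * b) := by rw [W_add]; ring
      _ ≤ W (5 * s + 10 + -|(k : ℝ) - i| / 2 + s * i + -|(i : ℝ) - j| / 2 + 1 * j) *
          (a * b) := by
        gcongr
        refine W_mono ?_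
        rcases abs_cases ((k : ℝ) - i) with ⟨h7, -⟩ | ⟨h7, -⟩ <;> rw [h7] <;> linarith
      _ = _ := by rw [W_add, W_add, W_add, W_add, bandKernel, bandKernel]; ring
  · rw [highHighWeight, if_neg h]; simp

/-- Special to s = 0, for part (b): the derivative stays on the high factor j ~ k, and 2^{i/2 - j}
provides decay in k - i, which permits an unweighted low factor. -/
theorem W_mul_lowHighWeight_le :
    W (0 * k) * (highLowWeight j i k * a * b) ≤ W 10 *
      (bandKernel k i * (W (0 * i) * a)) * (bandKernel k j * (W (1 * j) * b)) := by
  by_cases h : i + 4 ≤ j ∧ j ≤ k + 2 ∧ k ≤ j + 2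
  · rw [highLowWeight, if_pos h]
    obtain ⟨h0, h1, h2⟩ := h
    have h0' : (i : ℝ) + 4 ≤ j := by exact_mod_cast h0
    have h1' : (j : ℝ) ≤ k + 2 := by exact_mod_cast h1
    have h2' : (k : ℝ) ≤ j + 2 := by exact_mod_cast h2
    have h3 : |(k : ℝ) - j| ≤ 2 := abs_le.2 ⟨by linarith, by linarith⟩
    have h4 : |(k : ℝ) - i| = k - i := abs_of_nonneg (by linarith)
    have h5 : (0 : ℝ) ≤ j := by positivity
    calc _ = W (0 * k + i / 2) * (a * b) := by rw [W_add]; ring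
      _ ≤ W (10 + -|(k : ℝ) - i| / 2 + 0 * i + -|(k : ℝ) - j| / 2 + 1 * j) * (a * b) := by
        gcongr
        refine W_mono ?_
        rw [h4]; linarith
      _ = _ := by rw [W_add, W_add, W_add, W_add, bandKernel, bandKernel]; ring
  · rw [highLowWeight, if_neg h]; simp

/-- Serves only the absolute convergence in L² for a fixed output band: in each interacting
configuration max(i, j) is at most j - |i - j|/2 up to 2k + 10. -/
theorem W_max_mul_le : (if weight i j k = 0 then 0 else W (max i j : ℕ) * a * b) ≤
    W (2 * k + 10) * (bandKernel i j * (a * (W (1 * j) * b))) := by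
  by_cases hw : weight i j k = 0
  · rw [if_pos hw]; exact zero_le
  rw [if_neg hw]
  have key : ((max i j : ℕ) : ℝ) ≤ 2 * k + 10 + -|(i : ℝ) - j| / 2 + 1 * j := by
    have hk : (0 : ℝ) ≤ k := by positivity
    by_cases c1 : j + 4 ≤ i ∧ i ≤ k + 2 ∧ k ≤ i + 2
    · obtain ⟨h0, h1, -⟩ := c1
      rw [max_eq_left (by omega)]
      have h0' : (j : ℝ) + 4 ≤ i := by exact_mod_cast h0
      have h1' : (i : ℝ) ≤ k + 2 := by exact_mod_cast h1
      have h5 : (0 : ℝ) ≤ j := by positivity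
      rw [abs_of_nonneg (by linarith)]
      linarith
    by_cases c2 : i + 4 ≤ j ∧ j ≤ k + 2 ∧ k ≤ j + 2
    · obtain ⟨h0, h1, -⟩ := c2
      rw [max_eq_right (by omega)]
      have h0' : (i : ℝ) + 4 ≤ j := by exact_mod_cast h0
      have h1' : (j : ℝ) ≤ k + 2 := by exact_mod_cast h1
      have h5 : (0 : ℝ) ≤ i := by positivity
      rw [abs_of_nonpos (by linarith)]
      linarith
    by_cases c3 : i ≤ j + 3 ∧ j ≤ i + 3 ∧ k ≤ max i j + 2
    · obtain ⟨h0, h1, -⟩ := c3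
      have h0' : (i : ℝ) ≤ j + 3 := by exact_mod_cast h0
      have h1' : (j : ℝ) ≤ i + 3 := by exact_mod_cast h1
      have h5 : (max i j : ℕ) ≤ (j + 3 : ℝ) := by exact_mod_cast max_le h0 (by omega)
      have h4 : |(i : ℝ) - j| ≤ 3 := abs_le.2 ⟨by linarith, by linarith⟩
      linarith
    · exact absurd (by rw [weight, highLowWeight, highLowWeight, highHighWeight, if_neg c1,
        if_neg c2, if_neg c3]; simp) hw
  calc _ ≤ W (2 * k + 10 + -|(i : ℝ) - j| / 2 + 1 * j) * a * b := by
        gcongr; exact W_mono key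
    _ = _ := by rw [W_add, W_add, bandKernel]; ring

end Weights

/-- The weighted `ℓ²` norm of a sequence indexed by the frequency bands. -/
def bandNorm (s : ℝ) (a : ℕ → ℝ≥0∞) : ℝ≥0∞ := (∑' k : ℕ, (W (s * k) * a k) ^ 2) ^ (1 / 2 : ℝ)

theorem bandNorm_sq (s : ℝ) (a : ℕ → ℝ≥0∞) :
    bandNorm s a ^ 2 = ∑' k : ℕ, (W (s * k) * a k) ^ 2 := rpow_half_sq _

theorem le_bandNorm (s : ℝ) (a : ℕ → ℝ≥0∞) (k : ℕ) : W (s * k) * a k ≤ bandNorm s a :=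
  le_of_sq_le_sq (by rw [bandNorm_sq]; exact ENNReal.le_tsum k)

theorem bandNorm_mono {s s' : ℝ} (hs : s ≤ s') {a a' : ℕ → ℝ≥0∞} (h : ∀ k, a k ≤ a' k) :
    bandNorm s a ≤ bandNorm s' a' := by
  refine le_of_sq_le_sq ?_
  rw [bandNorm_sq, bandNorm_sq]
  gcongr with k
  · exact W_mono (by gcongr)
  · exact h k

theorem sq_add_le (x y : ℝ≥0∞) : (x + y) ^ 2 ≤ 4 * (x ^ 2 + y ^ 2) := by
  calc (x + y) ^ 2 = x ^ 2 + y ^ 2 + 2 * (x * y) := by ring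
    _ ≤ x ^ 2 + y ^ 2 + 2 * (x ^ 2 + y ^ 2) := by gcongr; exact mul_le_sq_add_sq _ _
    _ = 3 * (x ^ 2 + y ^ 2) := by ring
    _ ≤ _ := by gcongr; norm_num

theorem bandNorm_add_le (s : ℝ) (a b : ℕ → ℝ≥0∞) :
    bandNorm s (fun k => a k + b k) ≤ 2 * (bandNorm s a + bandNorm s b) := by
  refine le_of_sq_le_sq ?_
  have h : bandNorm s a ^ 2 + bandNorm s b ^ 2 ≤ (bandNorm s a + bandNorm s b) ^ 2 := by
    rw [add_sq]
    exact add_le_add (le_self_add) le_rfl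
  rw [mul_pow]
  calc _ ≤ 4 * (bandNorm s a ^ 2 + bandNorm s b ^ 2) := by
        rw [bandNorm_sq, bandNorm_sq, bandNorm_sq, ← ENNReal.tsum_add, ← ENNReal.tsum_mul_left]
        refine ENNReal.tsum_le_tsum fun k => ?_
        rw [mul_add]
        exact sq_add_le _ _
    _ ≤ _ := by
        refine mul_le_mul' (by norm_num) h

/-! ### The bilinear estimate -/

/-- The sum of all interactions with output frequency `k`. -/
def weightSum (a b : ℕ → ℝ≥0∞) (k : ℕ) : ℝ≥0∞ :=
  ∑' i : ℕ × ℕ, weight i.1 i.2 k * a i.1 * b i.2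

/-- The constant in the summation over the frequency bands. -/
def bandConst (s : ℝ) : ℝ≥0∞ :=
  2 * (2 * geomConst (1 / 2) * W (2 * s + 1) * geomConst (1 / 2)) ^ 2 +
    2 * (2 * geomConst (1 / 2) * W (5 * s + 10) * (2 * geomConst (1 / 2))) ^ 2

theorem bandConst_ne_top (s : ℝ) : bandConst s ≠ ⊤ := by
  have h1 := geomConst_ne_top (x := 1 / 2) (by norm_num)
  have h2 := W_ne_top (2 * s + 1)
  have h3 := W_ne_top (5 * s + 10)
  unfold bandConst
  finiteness

theorem tsum_sq_highLow_le {s : ℝ} (hs : 0 ≤ s) (a b : ℕ → ℝ≥0∞) :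
    ∑' k : ℕ, (∑' i : ℕ × ℕ, W (s * k) * (highLowWeight i.1 i.2 k * a i.1 * b i.2)) ^ 2 ≤
      bandConst s * (bandNorm s a * bandNorm 1 b) ^ 2 := by
  refine (tsum_sq_tsum_le (fun k i j => W_mul_highLowWeight_le k i j (a i) (b j) hs)
    (ρ := fun _ _ j => W (-(1 / 2) * j)) (M := geomConst (1 / 2)) (fun _ _ => le_rfl)
    (le_bandNorm 1 b)).trans ?_
  refine mul_le_mul' ?_ (le_of_eq (by rw [← bandNorm_sq]; ring))
  exact le_self_add

theorem tsum_sq_highHigh_le {s : ℝ} (hs : 0 ≤ s) (a b : ℕ → ℝ≥0∞) :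
    ∑' k : ℕ, (∑' i : ℕ × ℕ, W (s * k) * (highHighWeight i.1 i.2 k * a i.1 * b i.2)) ^ 2 ≤
      bandConst s * (bandNorm s a * bandNorm 1 b) ^ 2 := by
  refine (tsum_sq_tsum_le (fun k i j => W_mul_highHighWeight_le k i j (a i) (b j) hs)
    (ρ := fun _ i j => bandKernel i j) (fun _ i => tsum_bandKernel_le i)
    (le_bandNorm 1 b)).trans ?_
  refine mul_le_mul' ?_ (le_of_eq (by rw [← bandNorm_sq]; ring))
  exact le_add_self

theorem tsum_sq_lowHigh_le (a b : ℕ → ℝ≥0∞) :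
    ∑' k : ℕ, (∑' i : ℕ × ℕ, W (0 * k) * (highLowWeight i.2 i.1 k * a i.1 * b i.2)) ^ 2 ≤
      bandConst 0 * (bandNorm 0 a * bandNorm 1 b) ^ 2 := by
  refine (tsum_sq_tsum_le (fun k i j => W_mul_lowHighWeight_le k i j (a i) (b j))
    (ρ := fun k _ j => bandKernel k j) (fun k _ => tsum_bandKernel_le k)
    (le_bandNorm 1 b)).trans ?_
  refine mul_le_mul' ?_ (le_of_eq (by rw [← bandNorm_sq]; ring))
  refine le_trans (le_of_eq ?_) le_add_self
  norm_num

/-- The mirror image of the high-low sum. It puts s derivatives on the second factor, which is why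
part (a) has two terms on its right-hand side. -/
theorem tsum_sq_lowHigh_le' {s : ℝ} (hs : 0 ≤ s) (a b : ℕ → ℝ≥0∞) :
    ∑' k : ℕ, (∑' i : ℕ × ℕ, W (s * k) * (highLowWeight i.2 i.1 k * a i.1 * b i.2)) ^ 2 ≤
      bandConst s * (bandNorm 1 a * bandNorm s b) ^ 2 := by
  rw [mul_comm (bandNorm 1 a)]
  refine le_trans (le_of_eq ?_) (tsum_sq_highLow_le hs b a)
  refine tsum_congr fun k => ?_
  congr 1
  rw [← (Equiv.prodComm ℕ ℕ).tsum_eq]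
  refine tsum_congr fun i => ?_
  simp only [Equiv.prodComm_apply, Prod.fst_swap, Prod.snd_swap]
  ring

theorem tsum_sq_weightSum_le (s : ℝ) (a b : ℕ → ℝ≥0∞) :
    ∑' k : ℕ, (W (s * k) * weightSum a b k) ^ 2 ≤ 16 *
      (∑' k : ℕ, (∑' i : ℕ × ℕ, W (s * k) * (highLowWeight i.1 i.2 k * a i.1 * b i.2)) ^ 2 +
        ∑' k : ℕ, (∑' i : ℕ × ℕ, W (s * k) * (highLowWeight i.2 i.1 k * a i.1 * b i.2)) ^ 2 +
        ∑' k : ℕ, (∑' i : ℕ × ℕ, W (s * k) * (highHighWeight i.1 i.2 k * a i.1 * b i.2)) ^ 2) := by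
  rw [← ENNReal.tsum_add, ← ENNReal.tsum_add, ← ENNReal.tsum_mul_left]
  refine ENNReal.tsum_le_tsum fun k => ?_
  have h : ∀ x y z : ℝ≥0∞, (x + y + z) ^ 2 ≤ 16 * (x ^ 2 + y ^ 2 + z ^ 2) := fun x y z =>
    calc (x + y + z) ^ 2 ≤ 4 * ((x + y) ^ 2 + z ^ 2) := sq_add_le _ _
      _ ≤ 4 * (4 * (x ^ 2 + y ^ 2) + 4 * z ^ 2) := by
        gcongr
        · exact sq_add_le _ _
        · exact le_mul_of_one_le_left zero_le (by norm_num)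
      _ = _ := by ring
  refine le_trans (le_of_eq ?_) (h _ _ _)
  rw [weightSum, ← ENNReal.tsum_mul_left, ← ENNReal.tsum_add, ← ENNReal.tsum_add]
  congr 1
  refine tsum_congr fun i => ?_
  rw [weight]
  ring

theorem tsum_sq_weightSum_le_symm {s : ℝ} (hs : 0 ≤ s) (a b : ℕ → ℝ≥0∞) :
    ∑' k : ℕ, (W (s * k) * weightSum a b k) ^ 2 ≤ 48 * bandConst s *
      (bandNorm s a * bandNorm 1 b + bandNorm 1 a * bandNorm s b) ^ 2 := by
  have h1 := tsum_sq_highLow_le hs a b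
  have h2 := tsum_sq_lowHigh_le' hs a b
  have h3 := tsum_sq_highHigh_le hs a b
  set X := bandNorm s a * bandNorm 1 b
  set Y := bandNorm 1 a * bandNorm s b
  have hX : X ≤ X + Y := le_self_add
  have hY : Y ≤ X + Y := le_add_self
  calc _ ≤ 16 * (bandConst s * X ^ 2 + bandConst s * Y ^ 2 + bandConst s * X ^ 2) :=
        (tsum_sq_weightSum_le s a b).trans (by gcongr)
    _ ≤ 16 * (bandConst s * (X + Y) ^ 2 + bandConst s * (X + Y) ^ 2 +
        bandConst s * (X + Y) ^ 2) := by gcongr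
    _ = _ := by ring

theorem tsum_sq_weightSum_zero_le (a b : ℕ → ℝ≥0∞) :
    ∑' k : ℕ, (W (0 * k) * weightSum a b k) ^ 2 ≤ 48 * bandConst 0 *
      (bandNorm 0 a * bandNorm 1 b) ^ 2 := by
  have h1 := tsum_sq_highLow_le le_rfl a b
  have h2 := tsum_sq_lowHigh_le a b
  have h3 := tsum_sq_highHigh_le le_rfl a b
  calc _ ≤ 16 * (bandConst 0 * (bandNorm 0 a * bandNorm 1 b) ^ 2 +
        bandConst 0 * (bandNorm 0 a * bandNorm 1 b) ^ 2 +
        bandConst 0 * (bandNorm 0 a * bandNorm 1 b) ^ 2) :=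
        (tsum_sq_weightSum_le 0 a b).trans (by gcongr)
    _ = _ := by ring

theorem ofReal_two_rpow_eq (s : ℝ) (k : ℕ) : ENNReal.ofReal ((2 : ℝ) ^ (2 * s * k)) =
    W (s * k) ^ 2 := by
  rw [sq, ← W_add, W]
  congr 2
  ring

theorem fNorm_eq_bandNorm (η : Cutoff) (s T : ℝ) (u : ℝ → L2Plane) :
    fNorm η s T u = bandNorm s fun k => fkTNorm η T k (fun t => (u t : 𝓢'(Plane, ℂ))) := by
  simp only [fNorm, bandNorm, ofReal_two_rpow_eq, mul_pow]

theorem nNorm_eq_bandNorm (η : Cutoff) (s T : ℝ) (w : ℝ → 𝓢'(Plane, ℂ)) :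
    nNorm η s T w = bandNorm s fun k => nkTNorm η T k w := by
  simp only [nNorm, bandNorm, ofReal_two_rpow_eq, mul_pow]

theorem ne_top_of_bandNorm_ne_top {s : ℝ} {a : ℕ → ℝ≥0∞} (h : bandNorm s a ≠ ⊤) (k : ℕ) :
    a k ≠ ⊤ := by
  intro hk
  have := le_bandNorm s a k
  rw [hk, ENNReal.mul_top (W_pos _).ne', top_le_iff] at this
  exact h this

/-- The constant in the bilinear estimate for dyadic pieces. -/
def Cutoff.dxConst (η : Cutoff) : ℝ≥0∞ := (3 * geomConst (1 / 2) + 6) * η.pieceConst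

theorem Cutoff.dxConst_ne_top (η : Cutoff) : η.dxConst ≠ ⊤ := by
  have h1 := geomConst_ne_top (x := 1 / 2) (by norm_num)
  have h2 := η.pieceConst_ne_top
  unfold Cutoff.dxConst
  finiteness

/-- The bilinear estimate in terms of extensions of the dyadic pieces. -/
theorem nNorm_dxMul_sq_le (η : Cutoff) (s : ℝ) {T : ℝ} (hT : T ≤ 1) {u v : ℝ → L2Plane}
    {f g : ℕ → L2SpaceTime} (hfs : ∀ i, FreqSupported i (f i))
    (hgs : ∀ i, FreqSupported i (g i))
    (hf : ∀ i, ExtendsPiece T i (fun t => (u t : 𝓢'(Plane, ℂ))) (f i))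
    (hg : ∀ i, ExtendsPiece T i (fun t => (v t : 𝓢'(Plane, ℂ))) (g i))
    (hfa : bandNorm 0 (fun i => fkNorm η i (f i)) ≠ ⊤)
    (hga : bandNorm 1 (fun i => fkNorm η i (g i)) ≠ ⊤) :
    nNorm η s T (dxMul u v) ^ 2 ≤ η.dxConst ^ 2 *
      ∑' k : ℕ, (W (s * k) *
        weightSum (fun i => fkNorm η i (f i)) (fun i => fkNorm η i (g i)) k) ^ 2 := by
  rw [nNorm_eq_bandNorm, bandNorm_sq, ← ENNReal.tsum_mul_left]
  refine ENNReal.tsum_le_tsum fun k => ?_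
  rw [← mul_pow, mul_left_comm]
  gcongr
  rw [Cutoff.dxConst, mul_assoc]
  refine nkTNorm_dxMul_le η hT k hfs hgs hf hg (ne_top_of_bandNorm_ne_top hfa)
    (ne_top_of_bandNorm_ne_top hga) ?_
  refine ne_top_of_le_ne_top ?_ (ENNReal.tsum_le_tsum fun i : ℕ × ℕ => W_max_mul_le k i.1 i.2
    (fkNorm η i.1 (f i.1)) (fkNorm η i.2 (g i.2)))
  rw [ENNReal.tsum_mul_left]
  refine ENNReal.mul_ne_top (W_ne_top _) (ne_top_of_le_ne_top ?_ (tsum_bandKernel_mul_le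
    (fun i => fkNorm η i (f i)) fun j => W (1 * j) * fkNorm η j (g j)))
  rw [← bandNorm_sq 1 fun j => fkNorm η j (g j)]
  have e : ∑' i, fkNorm η i (f i) ^ 2 = bandNorm 0 (fun i => fkNorm η i (f i)) ^ 2 := by
    rw [bandNorm_sq]
    simp only [zero_mul, W_zero, one_mul]
  rw [e]
  have h1 := geomConst_ne_top (x := 1 / 2) (by norm_num)
  finiteness

/-- Almost optimal extensions of the dyadic pieces. -/
theorem exists_extensions (η : Cutoff) {s T : ℝ} {u : ℝ → L2Plane}
    (hu : fNorm η s T u < ⊤) (r : ℝ) {ε : ℝ≥0∞} (hε : 0 < ε) :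
    ∃ f : ℕ → L2SpaceTime, (∀ i, FreqSupported i (f i)) ∧
      (∀ i, ExtendsPiece T i (fun t => (u t : 𝓢'(Plane, ℂ))) (f i)) ∧
      ∀ t ≤ r, bandNorm t (fun i => fkNorm η i (f i)) ≤
        2 * (fNorm η t T u + ε * geomConst 2 ^ (1 / 2 : ℝ)) := by
  set A : ℕ → ℝ≥0∞ := fun k => fkTNorm η T k (fun t => (u t : 𝓢'(Plane, ℂ))) with hA
  -- The errors decay faster than 2^{-rk}, so a single choice of extensions is nearly optimal for
  -- all exponents t ≤ r at once. Part (a) needs the exponents 0, 1 and s for the same extensions.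
  set δ : ℕ → ℝ≥0∞ := fun k => ε * W (-(r + 1) * k) with hδ
  have hδ0 (k : ℕ) : δ k ≠ 0 := (ENNReal.mul_pos hε.ne' (W_pos _).ne').ne'
  have h1 (k : ℕ) : ∃ f, FreqSupported k f ∧
      ExtendsPiece T k (fun t => (u t : 𝓢'(Plane, ℂ))) f ∧ fkNorm η k f ≤ A k + δ k := by
    rw [fNorm_eq_bandNorm] at hu
    have h2 : A k < A k + δ k :=
      ENNReal.lt_add_right (ne_top_of_bandNorm_ne_top hu.ne k) (hδ0 k)
    have h3 : fkTNorm η T k (fun t => (u t : 𝓢'(Plane, ℂ))) < A k + δ k := h2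
    unfold fkTNorm at h3
    simp only [iInf_lt_iff] at h3
    obtain ⟨f, hf1, hf2, hf3⟩ := h3
    exact ⟨f, hf1, hf2, hf3.le⟩
  choose f hf1 hf2 hf3 using h1
  refine ⟨f, hf1, hf2, fun t ht => (bandNorm_mono le_rfl hf3).trans
    ((bandNorm_add_le t A δ).trans ?_)⟩
  rw [fNorm_eq_bandNorm]
  gcongr
  refine le_of_sq_le_sq ?_
  rw [bandNorm_sq, mul_pow, rpow_half_sq, geomConst, ← ENNReal.tsum_mul_left]
  refine ENNReal.tsum_le_tsum fun k => ?_
  rw [hδ, mul_left_comm, mul_pow, ← W_add, sq (W _), ← W_add]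
  gcongr
  refine W_mono ?_
  have : t * (k : ℝ) ≤ r * k := by gcongr
  linarith

open Filter Topology in
theorem tendsto_add_mul_add {X Y G : ℝ≥0∞} (hX : X ≠ ⊤) (hY : Y ≠ ⊤) (hG : G ≠ ⊤) :
    Tendsto (fun ε : ℝ≥0∞ => (2 * (X + ε * G)) * (2 * (Y + ε * G))) (𝓝[>] 0)
      (𝓝 (4 * (X * Y))) := by
  have h (X : ℝ≥0∞) (hX : X ≠ ⊤) :
      Tendsto (fun ε : ℝ≥0∞ => 2 * (X + ε * G)) (𝓝[>] 0) (𝓝 (2 * X)) := by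
    have h1 : Tendsto (fun ε : ℝ≥0∞ => ε * G) (𝓝[>] 0) (𝓝 (0 * G)) :=
      ENNReal.Tendsto.mul_const (tendsto_id.mono_left nhdsWithin_le_nhds) (Or.inr hG)
    have h2 := ENNReal.Tendsto.const_mul (a := 2) (h1.const_add X) (Or.inr (by simp))
    simpa using h2
  have h3 := ENNReal.Tendsto.mul (h X hX) (Or.inr (by finiteness)) (h Y hY)
    (Or.inr (by finiteness))
  rwa [show 2 * X * (2 * Y) = 4 * (X * Y) by ring] at h3

theorem fNorm_mono (η : Cutoff) {s s' : ℝ} (h : s ≤ s') (T : ℝ) (u : ℝ → L2Plane) :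
    fNorm η s T u ≤ fNorm η s' T u := by
  rw [fNorm_eq_bandNorm, fNorm_eq_bandNorm]
  exact bandNorm_mono h fun _ => le_rfl

/-- The added 1 makes the constant positive and at least 1, so K ≤ K² and no square root has to be
taken. -/
theorem Cutoff.exists_const (η : Cutoff) (s : ℝ) : ∃ C : ℝ, 0 < C ∧
    ∀ N Z : ℝ≥0∞, N ^ 2 ≤ η.dxConst ^ 2 * (48 * bandConst s * Z ^ 2) →
      N ≤ ENNReal.ofReal C * Z := by
  have h1 := η.dxConst_ne_top
  have h2 := bandConst_ne_top s
  set K : ℝ≥0∞ := η.dxConst ^ 2 * (48 * bandConst s) + 1 with hK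
  have hKt : K ≠ ⊤ := by finiteness
  refine ⟨K.toReal, ENNReal.toReal_pos (by simp [hK]) hKt, fun N Z h => le_of_sq_le_sq ?_⟩
  rw [ENNReal.ofReal_toReal hKt, mul_pow]
  refine h.trans ?_
  rw [← mul_assoc]
  gcongr
  calc η.dxConst ^ 2 * (48 * bandConst s) ≤ K := le_self_add
    _ = K * 1 := (mul_one K).symm
    _ ≤ K * K := by gcongr; exact le_add_self
    _ = K ^ 2 := (sq K).symm

open Filter Topology in
theorem nNorm_dxMul_le (η : Cutoff) {s : ℝ} (hs : 1 ≤ s) : ∃ C : ℝ, 0 < C ∧ ∀ T ≤ (1 : ℝ),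
    ∀ u v : ℝ → L2Plane, fNorm η s T u < ⊤ → fNorm η s T v < ⊤ → nNorm η s T (dxMul u v) ≤
      ENNReal.ofReal C * (fNorm η s T u * fNorm η 1 T v + fNorm η 1 T u * fNorm η s T v) := by
  obtain ⟨C, hC, hCN⟩ := η.exists_const s
  -- The 4 is the product of the two factors 2 lost in `exists_extensions`; the errors proportional
  -- to ε disappear in the limit ε → 0.
  refine ⟨C * 4, by positivity, fun T hT u v hu hv => ?_⟩
  have hu1 := (fNorm_mono η hs T u).trans_lt hu
  have hv1 := (fNorm_mono η hs T v).trans_lt hv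
  set G := geomConst 2 ^ (1 / 2 : ℝ) with hGdef
  have hG : G ≠ ⊤ := ENNReal.rpow_ne_top_of_nonneg (by norm_num) (geomConst_ne_top (by norm_num))
  have hlim := ENNReal.Tendsto.const_mul (a := ENNReal.ofReal C)
    ((tendsto_add_mul_add hu.ne hv1.ne hG).add (tendsto_add_mul_add hu1.ne hv.ne hG))
    (Or.inr ENNReal.ofReal_ne_top)
  rw [ENNReal.ofReal_mul hC.le, mul_assoc,
    show ENNReal.ofReal (4 : ℝ) = 4 by norm_num, mul_add]
  refine ge_of_tendsto hlim ?_
  filter_upwards [Ioo_mem_nhdsGT (zero_lt_one (α := ℝ≥0∞))] with ε hε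
  have hεt : ε ≠ ⊤ := (hε.2.trans ENNReal.one_lt_top).ne
  obtain ⟨f, hf1, hf2, hf3⟩ := exists_extensions η hu s hε.1
  obtain ⟨g, hg1, hg2, hg3⟩ := exists_extensions η hv s hε.1
  have hfin {t : ℝ} {w : ℝ → L2Plane} (h : fNorm η t T w < ⊤) :
      2 * (fNorm η t T w + ε * G) ≠ ⊤ := by finiteness
  have hu0 := (fNorm_mono η zero_le_one T u).trans_lt hu1
  refine hCN _ _ ((nNorm_dxMul_sq_le η s hT hf1 hg1 hf2 hg2
    (ne_top_of_le_ne_top (hfin hu0) (hf3 0 (zero_le_one.trans hs)))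
    (ne_top_of_le_ne_top (hfin hv1) (hg3 1 hs))).trans ?_)
  gcongr
  refine (tsum_sq_weightSum_le_symm (zero_le_one.trans hs) _ _).trans ?_
  gcongr
  · exact hf3 s le_rfl
  · exact hg3 1 hs
  · exact hf3 1 hs
  · exact hg3 s le_rfl

open Filter Topology in
theorem nNorm_zero_dxMul_le (η : Cutoff) : ∃ C : ℝ, 0 < C ∧ ∀ T ≤ (1 : ℝ),
    ∀ u v : ℝ → L2Plane, fNorm η 0 T u < ⊤ → fNorm η 1 T v < ⊤ → nNorm η 0 T (dxMul u v) ≤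
      ENNReal.ofReal C * (fNorm η 0 T u * fNorm η 1 T v) := by
  obtain ⟨C, hC, hCN⟩ := η.exists_const 0
  refine ⟨C * 4, by positivity, fun T hT u v hu hv => ?_⟩
  set G := geomConst 2 ^ (1 / 2 : ℝ) with hGdef
  have hG : G ≠ ⊤ := ENNReal.rpow_ne_top_of_nonneg (by norm_num) (geomConst_ne_top (by norm_num))
  have hlim := ENNReal.Tendsto.const_mul (a := ENNReal.ofReal C)
    (tendsto_add_mul_add hu.ne hv.ne hG) (Or.inr ENNReal.ofReal_ne_top)
  rw [ENNReal.ofReal_mul hC.le, mul_assoc, show ENNReal.ofReal (4 : ℝ) = 4 by norm_num]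
  refine ge_of_tendsto hlim ?_
  filter_upwards [Ioo_mem_nhdsGT (zero_lt_one (α := ℝ≥0∞))] with ε hε
  have hεt : ε ≠ ⊤ := (hε.2.trans ENNReal.one_lt_top).ne
  obtain ⟨f, hf1, hf2, hf3⟩ := exists_extensions η hu 0 hε.1
  obtain ⟨g, hg1, hg2, hg3⟩ := exists_extensions η hv 1 hε.1
  refine hCN _ _ ((nNorm_dxMul_sq_le η 0 hT hf1 hg1 hf2 hg2
    (ne_top_of_le_ne_top (by finiteness) (hf3 0 le_rfl))
    (ne_top_of_le_ne_top (by finiteness) (hg3 1 le_rfl))).trans ?_)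
  gcongr
  refine (tsum_sq_weightSum_zero_le _ _).trans ?_
  gcongr
  · exact hf3 0 le_rfl
  · exact hg3 1 le_rfl

end KPI

end

/-! ### The proposition -/

theorem proposition4p5 (η : KPI.Cutoff) :
    (∀ s : ℝ, 1 ≤ s → ∃ C : ℝ, 0 < C ∧ ∀ T ∈ Set.Ioc (0 : ℝ) 1,
      ∀ u ∈ KPI.FSpace η s T, ∀ v ∈ KPI.FSpace η s T,
        KPI.nNorm η s T (KPI.dxMul u v) ≤
          ENNReal.ofReal C *
            (KPI.fNorm η s T u * KPI.fNorm η 1 T v + KPI.fNorm η 1 T u * KPI.fNorm η s T v)) ∧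
    (∃ C : ℝ, 0 < C ∧ ∀ T ∈ Set.Ioc (0 : ℝ) 1,
      ∀ u ∈ KPI.FSpace η 0 T, ∀ v ∈ KPI.FSpace η 1 T,
        KPI.nNorm η 0 T (KPI.dxMul u v) ≤
          ENNReal.ofReal C * (KPI.fNorm η 0 T u * KPI.fNorm η 1 T v)) := by
  refine ⟨fun s hs => ?_, ?_⟩
  · obtain ⟨C, hC, h⟩ := KPI.nNorm_dxMul_le η hs
    exact ⟨C, hC, fun T hT u hu v hv => h T hT.2 u v hu.2 hv.2⟩
  · obtain ⟨C, hC, h⟩ := KPI.nNorm_zero_dxMul_le η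
    exact ⟨C, hC, fun T hT u hu v hv => h T hT.2 u v hu.2 hv.2⟩
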